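/- Let $k$ be a field of characteristic $0$ and let $\mathbf{Vect}$ be the category of finite-dimensional $k$-vector spaces. **Polynomial functors.** For a $k$-linear category $\mathcal A$, a functor $F:\mathcal A\to\mathbf{Vect}$ is *polynomial* (of finite degree) if for some $d$ all maps $F:\mathrm{Hom}(V,W)\to\mathrm{Hom}(FV,FW)$ are polynomial maps of degree $\le d$, and *homogeneous of degree $n$* if all of them are homogeneous polynomial maps of degree $n$. For a finite set $S$ let $\mathrm{Sh}(S)$ be the category of sheaves of finite-dimensional vector spaces on the discrete set $S$ (families $(V_s)_{s\in S}$), and for $\varphi:S\to T$ let $\varphi^*:\mathrm{Sh}(T)\to\mathrm{Sh}(S)$, $(\varphi^*V)_s=V_{\varphi(s)}$, and $\varphi_*:\mathrm{Sh}(S)\to\mathrm{Sh}(T)$, $(\varphi_*V)_t=\prod_{\varphi(s)=t}V_s$. Let $\mathcal P(\mathrm{Sh}(S))$ be the category of polynomial functors $\mathrm{Sh}(S)\to\mathbf{Vect}$, graded by degree, and $\mathcal P=\mathcal P(\mathbf{Vect})$. **The target.** A *2-vector space* is a $k$-linear category equivalent to a finite sum of copies of $\mathbf{Vect}$; a *graded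 2-vector space* is a sequence, indexed by $n\ge 0$, of 2-vector spaces (equivalently its total category with its subcategories of homogeneous objects). Fix a submonoid $A\subseteq\mathbb Z$ of allowed degrees (for instance $A=\mathbb Z$ or $A=\mathbb Z_{\ge 0}$). Write $\mathrm{FinSet}_*$ for the category of finite pointed sets, whose morphisms $I\to J$ are viewed as partially defined maps between the complements of the base points. Let $\mathbf{2Vect}_{gr}^{\otimes}\to\mathrm{FinSet}_*$ be the bicategory of finite families $(\mathcal C_i)_{i\in I}$ of graded 2-vector spaces. A 1-morphism $(\mathcal C_i)\to(\mathcal D_j)$ over $\varphi:I\to J$ is a collection of $k$-linear multi-exact functors $\prod_{\varphi(i)=j}\mathcal C_i\to\mathcal D_j$ (an object of $\mathcal D_j$, if the product is empty), each *bounded*: there is a finite set $D\subseteq A$ such that objects of degrees $n_i$ are sent to direct sums of objects of degrees in $\sum n_i+D$. It has *degree zero* if objects of degrees $n_i$ are sent to objects of degree $\sum n_i$. The 2-morphisms, between 1-morphisms over the same $\varphi$, are families of natural transformations. Let $\mathrm{FinSet}^{\sqcup}\to\mathrm{FinSet}_*$ be the category of finite families $(S_i)_{i\in I}$ of finite sets;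 a morphism $(S_i)\to(T_j)$ over $\varphi:I\to J$ is a collection of maps $S_i\to T_{\varphi(i)}$, for the $i$ where $\varphi$ is defined. **Conditions.** For $p:\mathcal B\to E$ from a bicategory to a category, a 1-morphism $F:X\to Y$ is *coCartesian* if for every $Z$ the square formed by $-\circ F:\mathcal B(Y,Z)\to\mathcal B(X,Z)$ and $-\circ p(F):E(pY,pZ)\to E(pX,pZ)$ is a pseudo-pullback of categories. A square of 1-morphisms $g:a\to b$, $f:a\to c$, $h:b\to d$, $i:c\to d$ with a 2-cell $\alpha:hg\Rightarrow if$ is *Beck–Chevalley* if $f,h$ have right adjoints and the mate $g f_R\Rightarrow h_R i$ is invertible, and $g,i$ have left adjoints and the mate $i_L h\Rightarrow f g_L$ is invertible. An *SSH structure* is a pseudofunctor $\mathcal H:\mathrm{FinSet}^{\sqcup}\to\mathbf{2Vect}_{gr}^{\otimes}$ over $\mathrm{FinSet}_*$ such that (1) all $\mathcal H(f)$ have degree zero; (2) $\mathcal H$ sends coCartesian morphisms to coCartesian 1-morphisms; (3) Cartesian squares of finite sets (families indexed by a one-element set) go to Beck–Chevalley squares. It is an SSH structure *on* the graded 2-vector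 space $\mathcal H(\{1\})$. **Proposition.** Every $\mathcal P(\mathrm{Sh}(S))$, $S$ a finite set, is a graded 2-vector space, and for every submonoid $A\subseteq\mathbb Z$ the following data form an SSH structure on $\mathcal P$: * a family $(S_i)$ goes to the family $(\mathcal P(\mathrm{Sh}(S_i)))$; * a morphism $(\varphi_i):(S_i)\to(T_j)$ over $\varphi$ goes to the functors $m_{(\varphi_i)}:\prod_{\varphi(i)=j}\mathcal P(\mathrm{Sh}(S_i))\to\mathcal P(\mathrm{Sh}(T_j))$, $m_{(\varphi_i)}(F_i)(V)=\bigotimes_i F_i(\varphi_i^*V)$; * the structure isomorphisms come from the canonical isomorphisms $\varphi^*\psi^*\cong(\psi\varphi)^*$. Moreover, for a single map $\varphi:S\to T$ the functor $m_\varphi$ is (isomorphic to) $F\mapsto F\circ\varphi^*$, and the functor $\Delta_\varphi:\mathcal P(\mathrm{Sh}(T))\to\mathcal P(\mathrm{Sh}(S))$, $\Delta_\varphi(\Phi)=\Phi\circ\varphi_*$, is a 1-morphism that is both left and right adjoint to $m_\varphi$; and composition with the stalk functor $\mathrm{Sh}(\{1\})\to\mathbf{Vect}$ is an equivalence $\mathcal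 P\simeq\mathcal P(\mathrm{Sh}(\{1\}))$ under which a functor is homogeneous of degree $n$ if and only if its image is. -/

import Mathlib

open CategoryTheory CategoryTheory.Limits
open scoped TensorProduct

universe u v w w'

set_option linter.unusedVariables false

namespace SSH

noncomputable section

/-! ### Linear algebra -/

section LinearAlgebra

variable {k : Type u} [Field k]

/-- Substitution of multilinear maps `F j` (in the variables of the block `fib j`) into a
multilinear map `G`; the blocks partition the set of all variables `ι`. -/
def multilinearSubst {ι κ : Type*} {fib : κ → Type*} (e : ∀ j, fib j → ι)
    (he : Function.Bijective fun p : Σ j, fib j => e p.1 p.2) {M : ι → Type*} [∀ i, AddCommGroup (M i)] [∀ i, Module k (M i)]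
    {N : κ → Type*} [∀ j, AddCommGroup (N j)] [∀ j, Module k (N j)]
    {P : Type*} [AddCommGroup P] [Module k P]
    (G : MultilinearMap k N P)
    (F : ∀ j, MultilinearMap k (fun i : fib j => M (e j i)) (N j)) :
    MultilinearMap k M P where
  toFun x := G fun j => F j fun i => x (e j i)
  map_update_add' := by
    classical
    intro _ x i0 a b
    obtain ⟨⟨j0, i0⟩, rfl⟩ := he.2 i0
    have key : ∀ c, (fun j => F j fun i => Function.update x (e j0 i0) c (e j i)) =
        Function.update (fun j => F j fun i => x (e j i)) j0
          (F j0 (Function.update (fun i => x (e j0 i)) i0 c)) := by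
      intro c
      funext j
      by_cases hj : j = j0
      · subst hj
        rw [Function.update_self]
        congr 1
        funext i
        by_cases hi : i = i0
        · subst hi
          simp [Function.update_self]
        · rw [Function.update_of_ne hi, Function.update_of_ne]
          intro h
          have := @he.1 ⟨_, _⟩ ⟨_, _⟩ h
          simp only [Sigma.mk.injEq, heq_eq_eq, true_and] at this
          exact hi this
      · rw [Function.update_of_ne hj]
        congr 1
        funext i
        rw [Function.update_of_ne]
        intro h
        have := @he.1 ⟨_, _⟩ ⟨_, _⟩ h
        simp only [Sigma.mk.injEq] at this
        exact hj this.1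
    convert_to G (fun j => F j fun i => Function.update x (e j0 i0) (a + b) (e j i)) =
      G (fun j => F j fun i => Function.update x (e j0 i0) a (e j i)) +
      G (fun j => F j fun i => Function.update x (e j0 i0) b (e j i))
    rw [key, key, key, MultilinearMap.map_update_add, MultilinearMap.map_update_add]
  map_update_smul' := by
    classical
    intro _ x i0 r a
    obtain ⟨⟨j0, i0⟩, rfl⟩ := he.2 i0
    have key : ∀ c, (fun j => F j fun i => Function.update x (e j0 i0) c (e j i)) =
        Function.update (fun j => F j fun i => x (e j i)) j0
          (F j0 (Function.update (fun i => x (e j0 i)) i0 c)) := by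
      intro c
      funext j
      by_cases hj : j = j0
      · subst hj
        rw [Function.update_self]
        congr 1
        funext i
        by_cases hi : i = i0
        · subst hi
          simp [Function.update_self]
        · rw [Function.update_of_ne hi, Function.update_of_ne]
          intro h
          have := @he.1 ⟨_, _⟩ ⟨_, _⟩ h
          simp only [Sigma.mk.injEq, heq_eq_eq, true_and] at this
          exact hi this
      · rw [Function.update_of_ne hj]
        congr 1
        funext i
        rw [Function.update_of_ne]
        intro h
        have := @he.1 ⟨_, _⟩ ⟨_, _⟩ h
        simp only [Sigma.mk.injEq] at this
        exact hj this.1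
    convert_to G (fun j => F j fun i => Function.update x (e j0 i0) (r • a) (e j i)) =
      r • G (fun j => F j fun i => Function.update x (e j0 i0) a (e j i))
    rw [key, key, MultilinearMap.map_update_smul, MultilinearMap.map_update_smul]

/-- The canonical map `⨂ i, M i → ⨂ j, ⨂ i ∈ fib j, M i` sending a pure tensor `⊗ x i` to
`⊗ j, ⊗ i ∈ fib j, x i`. -/
def nestTensor {ι κ : Type*} {fib : κ → Type*} (e : ∀ j, fib j → ι)
    (he : Function.Bijective fun p : Σ j, fib j => e p.1 p.2) (M : ι → Type*) [∀ i, AddCommGroup (M i)] [∀ i, Module k (M i)] :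
    (⨂[k] i, M i) →ₗ[k] ⨂[k] j, ⨂[k] i : fib j, M (e j i) :=
  PiTensorProduct.lift (multilinearSubst e he (PiTensorProduct.tprod k)
    fun _ => PiTensorProduct.tprod k)

theorem nestTensor_tprod {ι κ : Type*} {fib : κ → Type*} (e : ∀ j, fib j → ι)
    (he : Function.Bijective fun p : Σ j, fib j => e p.1 p.2) (M : ι → Type*) [∀ i, AddCommGroup (M i)] [∀ i, Module k (M i)] (x : ∀ i, M i) :
    nestTensor e he M (PiTensorProduct.tprod k x) =
      PiTensorProduct.tprod k fun j => PiTensorProduct.tprod k fun i => x (e j i) := by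
  simp [nestTensor]
  rfl

theorem nestTensor_bijective {ι κ : Type*} [Finite ι] [Finite κ] {fib : κ → Type*}
    [∀ j, Finite (fib j)] (e : ∀ j, fib j → ι)
    (he : Function.Bijective fun p : Σ j, fib j => e p.1 p.2) (M : ι → Type*) [∀ i, AddCommGroup (M i)] [∀ i, Module k (M i)] :
    Function.Bijective (nestTensor (k := k) e he M) := by
  let b := fun i => Module.Basis.ofVectorSpace k (M i)
  let B₁ := Basis.piTensorProduct b
  let B₂ := Basis.piTensorProduct fun j => Basis.piTensorProduct fun i : fib j => b (e j i)
  let ε : (∀ i, Module.Basis.ofVectorSpaceIndex k (M i)) ≃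
      ∀ j, ∀ i : fib j, Module.Basis.ofVectorSpaceIndex k (M (e j i)) :=
    (Equiv.piCongrLeft _ (Equiv.ofBijective _ he)).symm.trans (Equiv.piCurry fun j (i : fib j) => ↥(Module.Basis.ofVectorSpaceIndex k (M (e j i))))
  have : nestTensor (k := k) e he M = (B₁.equiv B₂ ε).toLinearMap := by
    apply B₁.ext
    intro p
    simp only [LinearEquiv.coe_coe, Module.Basis.equiv_apply]
    simp only [B₁, B₂, Basis.piTensorProduct_apply, nestTensor_tprod]
    rfl
  rw [this]
  exact (B₁.equiv B₂ ε).bijective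

variable (k)
variable {U W : Type*} [AddCommGroup U] [Module k U] [AddCommGroup W] [Module k W]

/-- `f : U → W` is a homogeneous polynomial map of degree `n`: the restriction to the diagonal of
an `n`-linear map. -/
def IsHomogeneousMap (n : ℕ) (f : U → W) : Prop :=
  ∃ M : MultilinearMap k (fun _ : Fin n => U) W, ∀ x, f x = M fun _ => x

/-- `f : U → W` is a polynomial map of degree at most `d`: a sum of homogeneous polynomial maps of
degrees `0, …, d`. -/
def IsPolynomialMap (d : ℕ) (f : U → W) : Prop :=
  ∃ p : Fin (d + 1) → U → W, (∀ n : Fin (d + 1), IsHomogeneousMap k (n : ℕ) (p n)) ∧ ∀ x, f x = ∑ n, p n x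

variable {k}

theorem IsHomogeneousMap.of_multilinear {ι : Type*} [Finite ι] {n : ℕ} (hn : Nat.card ι = n)
    {f : U → W} (M : MultilinearMap k (fun _ : ι => U) W) (h : ∀ x, f x = M fun _ => x) :
    IsHomogeneousMap k n f := by
  subst hn
  exact ⟨M.domDomCongr (Finite.equivFin ι), fun x => by simp [h]⟩

theorem IsHomogeneousMap.zero (n : ℕ) : IsHomogeneousMap k n (fun _ : U => (0 : W)) :=
  ⟨0, fun _ => rfl⟩

theorem IsHomogeneousMap.add {n : ℕ} {f g : U → W} (hf : IsHomogeneousMap k n f)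
    (hg : IsHomogeneousMap k n g) : IsHomogeneousMap k n (fun x => f x + g x) := by
  obtain ⟨M, hM⟩ := hf
  obtain ⟨N, hN⟩ := hg
  exact ⟨M + N, fun x => by simp [hM, hN]⟩

theorem IsHomogeneousMap.comp_linear {n : ℕ} {f : U → W} (hf : IsHomogeneousMap k n f)
    {U' : Type*} [AddCommGroup U'] [Module k U'] (L : U' →ₗ[k] U) :
    IsHomogeneousMap k n (fun x => f (L x)) := by
  obtain ⟨M, hM⟩ := hf
  exact ⟨M.compLinearMap fun _ => L, fun x => by simp [hM]⟩

theorem IsPolynomialMap.comp_linear {d : ℕ} {f : U → W} (hf : IsPolynomialMap k d f)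
    {U' : Type*} [AddCommGroup U'] [Module k U'] (L : U' →ₗ[k] U) :
    IsPolynomialMap k d (fun x => f (L x)) := by
  obtain ⟨p, hp, h⟩ := hf
  exact ⟨fun n x => p n (L x), fun n => (hp n).comp_linear L, fun x => h _⟩

theorem IsHomogeneousMap.isPolynomialMap {n d : ℕ} (hnd : n ≤ d) {f : U → W}
    (hf : IsHomogeneousMap k n f) : IsPolynomialMap k d f := by
  classical
  refine ⟨fun m => if m = ⟨n, by omega⟩ then f else fun _ => 0, fun m => ?_, fun x => ?_⟩
  · by_cases h : m = ⟨n, by omega⟩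
    · simpa [h] using hf
    · simpa [h] using IsHomogeneousMap.zero _
  · rw [Finset.sum_eq_single_of_mem ⟨n, by omega⟩ (Finset.mem_univ _)]
    · simp
    · intro m _ hm
      simp [hm]

theorem IsPolynomialMap.add {d : ℕ} {f g : U → W} (hf : IsPolynomialMap k d f)
    (hg : IsPolynomialMap k d g) : IsPolynomialMap k d (fun x => f x + g x) := by
  obtain ⟨p, hp, h⟩ := hf
  obtain ⟨q, hq, h'⟩ := hg
  exact ⟨fun n x => p n x + q n x, fun n => (hp n).add (hq n), fun x => by
    simp [h, h', Finset.sum_add_distrib]⟩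

theorem IsPolynomialMap.sum {d : ℕ} {α : Type*} (s : Finset α) {f : α → U → W}
    (hf : ∀ a ∈ s, IsPolynomialMap k d (f a)) : IsPolynomialMap k d (fun x => ∑ a ∈ s, f a x) := by
  classical
  induction s using Finset.induction_on with
  | empty => simpa using (IsHomogeneousMap.zero 0).isPolynomialMap (Nat.zero_le d)
  | insert a s ha ih =>
    simp only [Finset.sum_insert ha]
    exact (hf a (Finset.mem_insert_self a s)).add
      (ih fun b hb => hf b (Finset.mem_insert_of_mem hb))

/-- A multilinear expression in homogeneous polynomial maps is homogeneous. -/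
theorem IsHomogeneousMap.multilinear {ι : Type*} [Finite ι] {N : ι → Type*}
    [∀ i, AddCommGroup (N i)] [∀ i, Module k (N i)] (G : MultilinearMap k N W)
    (n : ι → ℕ) {f : ∀ i, U → N i} (hf : ∀ i, IsHomogeneousMap k (n i) (f i)) :
    IsHomogeneousMap k (∑ᶠ i, n i) (fun x => G fun i => f i x) := by
  choose M hM using hf
  have := Fintype.ofFinite ι
  refine IsHomogeneousMap.of_multilinear (ι := Σ i, Fin (n i)) ?_
    (multilinearSubst (fun i a => ⟨i, a⟩) Function.bijective_id G M) fun x => ?_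
  · rw [Nat.card_sigma, finsum_eq_sum_of_fintype]
    simp
  · simp only [hM]
    rfl

/-- A multilinear expression in polynomial maps is polynomial. -/
theorem IsPolynomialMap.multilinear {ι : Type*} [Finite ι] {N : ι → Type*}
    [∀ i, AddCommGroup (N i)] [∀ i, Module k (N i)] (G : MultilinearMap k N W)
    (d : ι → ℕ) {f : ∀ i, U → N i} (hf : ∀ i, IsPolynomialMap k (d i) (f i)) :
    IsPolynomialMap k (∑ᶠ i, d i) (fun x => G fun i => f i x) := by
  classical
  have := Fintype.ofFinite ι
  choose p hp h using hf
  have : (fun x => G fun i => f i x) =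
      fun x => ∑ r : ∀ i, Fin (d i + 1), G fun i => p i (r i) x := by
    funext x
    simp only [h]
    exact G.map_sum fun i n => p i n x
  rw [this]
  refine IsPolynomialMap.sum _ fun r _ => ?_
  refine (IsHomogeneousMap.multilinear G (fun i => (r i : ℕ)) fun i => hp i (r i)).isPolynomialMap ?_
  rw [finsum_eq_sum_of_fintype, finsum_eq_sum_of_fintype]
  exact Finset.sum_le_sum fun i _ => Nat.lt_succ_iff.mp (r i).2

end LinearAlgebra

/-! ### Linear categories and multilinear functors -/

/-- The product of a family of preadditive categories. -/
instance piPreadditive {J : Type w} (C : J → Type v) [∀ j, Category.{w'} (C j)]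
    [∀ j, Preadditive (C j)] : Preadditive (∀ j, C j) where
  homGroup X Y := inferInstanceAs (AddCommGroup (∀ j, X j ⟶ Y j))
  add_comp _ _ _ f f' g := by
    funext j
    exact Preadditive.add_comp _ _ _ (f j) (f' j) (g j)
  comp_add _ _ _ f g g' := by
    funext j
    exact Preadditive.comp_add _ _ _ (f j) (g j) (g' j)

/-- The product of a family of `k`-linear categories. -/
instance piLinear (k : Type u) [Field k] {J : Type w} (C : J → Type v)
    [∀ j, Category.{w'} (C j)] [∀ j, Preadditive (C j)] [∀ j, Linear k (C j)] :
    Linear k (∀ j, C j) where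
  homModule X Y := inferInstanceAs (Module k (∀ j, X j ⟶ Y j))
  smul_comp _ _ _ r f g := by
    funext j
    exact Linear.smul_comp _ _ _ r (f j) (g j)
  comp_smul _ _ _ f r g := by
    funext j
    exact Linear.comp_smul _ _ _ (f j) r (g j)

/-- A functor `F` on a product of `k`-linear categories is multilinear if its action on morphisms
is `k`-multilinear. On an empty product (the one-object, one-morphism category) this says nothing,
and a functor is just an object of the target. Since additive functors between semisimple abelian
categories are exact, for such categories these are the `k`-linear multi-exact functors. -/
def IsMultilinearFunctor (k : Type u) [Field k] {J : Type w} {C : J → Type v}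
    [∀ j, Category.{w'} (C j)] [∀ j, Preadditive (C j)] [∀ j, Linear k (C j)]
    {D : Type v} [Category.{w'} D] [Preadditive D] [Linear k D] (F : (∀ j, C j) ⥤ D) : Prop :=
  ∀ X Y : ∀ j, C j, ∃ M : MultilinearMap k (fun j => X j ⟶ Y j) (F.obj X ⟶ F.obj Y),
    ∀ f : X ⟶ Y, M f = F.map f

/-! ### Graded 2-vector spaces -/

section Grading

variable {C : Type v} [Category.{w'} C] [Preadditive C]

/-- `X` is a finite direct sum of objects, each homogeneous of some degree in `D`. -/
def IsSumOfDegrees (deg : ℕ → ObjectProperty C) (D : Set ℕ) (X : C) : Prop :=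
  ∃ (J : Type) (_ : Finite J) (Y : J → C) (b : Bicone Y),
    Nonempty b.IsBilimit ∧ Nonempty (X ≅ b.pt) ∧ ∀ a, ∃ n ∈ D, deg n (Y a)

/-- `X` is the direct sum of the `Y a`, in terms of projections and inclusions. -/
def IsDirectSum {J : Type} [Fintype J] (X : C) (Y : J → C) : Prop :=
  ∃ (π : ∀ a, X ⟶ Y a) (ι : ∀ a, Y a ⟶ X), (∀ a, ι a ≫ π a = 𝟙 _) ∧
    (∀ a b, a ≠ b → ι a ≫ π b = 0) ∧ ∑ a, π a ≫ ι a = 𝟙 X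

theorem isSumOfDegrees_iff (deg : ℕ → ObjectProperty C) (D : Set ℕ) (X : C) :
    IsSumOfDegrees deg D X ↔ ∃ (J : Type) (_ : Fintype J) (Y : J → C),
      IsDirectSum X Y ∧ ∀ a, ∃ n ∈ D, deg n (Y a) := by
  classical
  constructor
  · rintro ⟨J, _, Y, b, ⟨hb⟩, ⟨e⟩, h⟩
    have := Fintype.ofFinite J
    refine ⟨J, this, Y, ⟨fun a => e.hom ≫ b.π a, fun a => b.ι a ≫ e.inv, fun a => by simp,
      fun a a' haa' => by simp [b.ι_π, haa'], ?_⟩, h⟩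
    have ht := IsBilimit.total hb
    calc ∑ a, (e.hom ≫ b.π a) ≫ b.ι a ≫ e.inv = e.hom ≫ (∑ a, b.π a ≫ b.ι a) ≫ e.inv := by
          simp only [Preadditive.sum_comp, Preadditive.comp_sum, Category.assoc]
      _ = 𝟙 X := by simp [ht]
  · rintro ⟨J, _, Y, ⟨π, ι, h1, h2, h3⟩, h⟩
    let b : Bicone Y :=
      { pt := X, π := π, ι := ι
        ι_π := by
          intro a a'
          by_cases haa' : a = a'
          · subst haa'
            simp [h1]
          · simp [haa', h2 a a' haa'] }
    exact ⟨J, inferInstance, Y, b, ⟨isBilimitOfTotal b h3⟩, ⟨Iso.refl _⟩, h⟩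

theorem IsSumOfDegrees.single {deg : ℕ → ObjectProperty C} {D : Set ℕ} {X : C} {n : ℕ}
    (hn : n ∈ D) (hX : deg n X) : IsSumOfDegrees deg D X := by
  rw [isSumOfDegrees_iff]
  exact ⟨Unit, inferInstance, fun _ => X, ⟨fun _ => 𝟙 X, fun _ => 𝟙 X, by simp,
    fun a b h => (h rfl).elim, by simp⟩, fun _ => ⟨n, hn, hX⟩⟩

theorem IsSumOfDegrees.trans {deg : ℕ → ObjectProperty C} {D : Set ℕ} {X : C} {J : Type}
    [Fintype J] {Y : J → C} (hX : IsDirectSum X Y) (hY : ∀ a, IsSumOfDegrees deg D (Y a)) :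
    IsSumOfDegrees deg D X := by
  classical
  simp only [isSumOfDegrees_iff] at hY
  choose K fK Z hZ hd using hY
  rw [isSumOfDegrees_iff]
  obtain ⟨π, ι, h1, h2, h3⟩ := hX
  choose π' ι' h1' h2' h3' using hZ
  refine ⟨Σ a, K a, inferInstance, fun p => Z p.1 p.2, ⟨fun p => π p.1 ≫ π' p.1 p.2,
    fun p => ι' p.1 p.2 ≫ ι p.1, ?_, ?_, ?_⟩, fun p => hd p.1 p.2⟩
  · rintro ⟨a, b⟩
    simp only [Category.assoc]
    rw [reassoc_of% (h1 a), h1']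
  · rintro ⟨a, b⟩ ⟨a', b'⟩ hne
    simp only [Category.assoc]
    by_cases haa' : a = a'
    · subst haa'
      rw [reassoc_of% (h1 a), h2']
      rintro rfl
      exact hne rfl
    · rw [reassoc_of% (h2 a a' haa')]
      simp
  · rw [Fintype.sum_sigma, ← h3]
    refine Finset.sum_congr rfl fun a _ => ?_
    calc ∑ b, (π a ≫ π' a b) ≫ ι' a b ≫ ι a = π a ≫ (∑ b, π' a b ≫ ι' a b) ≫ ι a := by
          simp only [Preadditive.sum_comp, Preadditive.comp_sum, Category.assoc]
      _ = π a ≫ ι a := by rw [h3']; simp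

end Grading

theorem IsDirectSum.map {k : Type u} [Field k] {J : Type} [Finite J] {C : J → Type v}
    [∀ j, Category.{w'} (C j)] [∀ j, Preadditive (C j)] [∀ j, Linear k (C j)]
    {D : Type v} [Category.{w'} D] [Preadditive D] [Linear k D] {F : (∀ j, C j) ⥤ D}
    (hF : IsMultilinearFunctor k F) {X : ∀ j, C j} {K : J → Type} [∀ j, Fintype (K j)]
    [Fintype (∀ j, K j)]
    {Y : ∀ j, K j → C j} (h : ∀ j, IsDirectSum (X j) (Y j)) :
    IsDirectSum (F.obj X) fun p : ∀ j, K j => F.obj fun j => Y j (p j) := by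
  classical
  choose π ι h1 h2 h3 using h
  refine ⟨fun p => F.map fun j => π j (p j), fun p => F.map fun j => ι j (p j), fun p => ?_,
    fun p q hpq => ?_, ?_⟩
  · rw [← F.map_comp, ← F.map_id]
    congr 1
    funext j
    exact h1 j (p j)
  · obtain ⟨j, hj⟩ := Function.ne_iff.mp hpq
    rw [← F.map_comp]
    obtain ⟨M, hM⟩ := hF (fun j => Y j (p j)) (fun j => Y j (q j))
    rw [← hM]
    exact M.map_coord_zero j (h2 j _ _ hj)
  · obtain ⟨M, hM⟩ := hF X X
    have := Fintype.ofFinite J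
    have key := M.map_sum (fun j a => π j a ≫ ι j a)
    simp only [← F.map_comp]
    rw [← F.map_id, ← hM]
    have e1 : (fun j => ∑ a, π j a ≫ ι j a) = (𝟙 X : ∀ j, X j ⟶ X j) := by
      funext j
      exact h3 j
    rw [← e1, key]
    refine Finset.sum_congr (by ext; simp) fun p _ => ?_
    exact (hM (fun j => π j (p j) ≫ ι j (p j))).symm

/-- `C`, with the subcategories `deg n` of homogeneous objects of degree `n`, is the direct sum of
a sequence (indexed by `n : ℕ`) of 2-vector spaces over `k`, that is, of `k`-linear categories
equivalent to finite sums of copies of the category `FGModuleCat k` of finite-dimensional vector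
spaces. -/
structure IsGradedTwoVect (k : Type u) [Field k] (C : Type (u + 1)) [Category.{u + 1} C]
    [Preadditive C] [Linear k C] (deg : ℕ → ObjectProperty C) : Prop where
  closed_iso : ∀ n, (deg n).IsClosedUnderIsomorphisms
  twoVect : ∀ n, ∃ (m : ℕ) (e : (deg n).FullSubcategory ≌ (Fin m → FGModuleCat.{u} k)),
    e.functor.Additive ∧ e.functor.Linear k
  orthogonal : ∀ m n, m ≠ n → ∀ X Y : C, deg m X → deg n Y → ∀ f : X ⟶ Y, f = 0
  biproducts : HasFiniteBiproducts C
  decomposition : ∀ X : C, IsSumOfDegrees deg Set.univ X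

/-- Graded 2-vector spaces over `k`: a sequence of 2-vector spaces, recorded as its total category
together with the subcategories of homogeneous objects. -/
structure GradedTwoVect (k : Type u) [Field k] where
  carrier : Type (u + 1)
  [category : Category.{u + 1} carrier]
  [preadditive : Preadditive carrier]
  [linear : Linear k carrier]
  deg : ℕ → ObjectProperty carrier
  isGradedTwoVect : IsGradedTwoVect k carrier deg

instance (k : Type u) [Field k] : CoeSort (GradedTwoVect k) (Type (u + 1)) :=
  ⟨GradedTwoVect.carrier⟩

attribute [instance] GradedTwoVect.category GradedTwoVect.preadditive GradedTwoVect.linear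

section Multifunctors

variable {k : Type u} [Field k] {J : Type} {C : J → GradedTwoVect k} {D : GradedTwoVect k}

/-- `F` is a finite sum of functors whose degrees belong to `A`: there is a finite set `S` of
elements of `A` such that `F` sends objects `X i` of degrees `n i` to a direct sum of objects whose
degrees belong to `∑ i, n i + S`. -/
def IsBounded (A : AddSubmonoid ℤ) (F : (∀ i, C i) ⥤ D) : Prop :=
  ∃ S : Finset ℤ, (∀ d ∈ S, d ∈ A) ∧ ∀ (X : ∀ i, C i) (n : J → ℕ), (∀ i, (C i).deg (n i) (X i)) →
    IsSumOfDegrees D.deg {m : ℕ | ∃ d ∈ S, (m : ℤ) = ((∑ᶠ i, n i : ℕ) : ℤ) + d} (F.obj X)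

/-- `F` is homogeneous of degree zero: it sends objects of degrees `n i` to an object of degree
`∑ i, n i`. -/
def IsDegreeZero (F : (∀ i, C i) ⥤ D) : Prop :=
  ∀ (X : ∀ i, C i) (n : J → ℕ), (∀ i, (C i).deg (n i) (X i)) → D.deg (∑ᶠ i, n i) (F.obj X)

theorem IsDegreeZero.isBounded (A : AddSubmonoid ℤ) {F : (∀ i, C i) ⥤ D} (h : IsDegreeZero F) :
    IsBounded A F :=
  ⟨{0}, by simp [A.zero_mem], fun X n hX => IsSumOfDegrees.single (by simp) (h X n hX)⟩

/-- Composition of multivariable functors: the variables `I` of the composite are partitioned into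
the blocks `fib j` of variables of the functors `F j`. -/
def composeFunctor {I : Type} {fib : J → Type} (e : ∀ j, fib j → I)
    {B : I → GradedTwoVect k}
    (F : ∀ j, (∀ i : fib j, B (e j i)) ⥤ C j) (G : (∀ j, C j) ⥤ D) : (∀ i, B i) ⥤ D where
  obj X := G.obj fun j => (F j).obj fun i => X (e j i)
  map f := G.map fun j => (F j).map fun i => f (e j i)
  map_id X := by
    rw [← G.map_id]
    congr 1
    funext j
    exact (F j).map_id _
  map_comp f g := by
    rw [← G.map_comp]
    congr 1
    funext j
    exact (F j).map_comp _ _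

theorem composeFunctor_multilinear {I : Type} {fib : J → Type} (e : ∀ j, fib j → I)
    (he : Function.Bijective fun p : Σ j, fib j => e p.1 p.2)
    {B : I → GradedTwoVect k} {F : ∀ j, (∀ i : fib j, B (e j i)) ⥤ C j} {G : (∀ j, C j) ⥤ D}
    (hF : ∀ j, IsMultilinearFunctor k (F j)) (hG : IsMultilinearFunctor k G) :
    IsMultilinearFunctor k (composeFunctor e F G) := by
  intro X Y
  have hF' := fun j => hF j (fun i => X (e j i)) (fun i => Y (e j i))
  choose MF hMF using hF'
  obtain ⟨MG, hMG⟩ := hG (fun j => (F j).obj fun i => X (e j i))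
    (fun j => (F j).obj fun i => Y (e j i))
  refine ⟨multilinearSubst e he MG MF, fun f => ?_⟩
  change MG (fun j => MF j fun i => f (e j i)) = G.map fun j => (F j).map fun i => f (e j i)
  rw [← hMG]
  congr 1
  funext j
  exact hMF j _

theorem composeFunctor_bounded [Finite J] {A : AddSubmonoid ℤ} {I : Type} [Finite I]
    {fib : J → Type} (e : ∀ j, fib j → I)
    (he : Function.Bijective fun p : Σ j, fib j => e p.1 p.2)
    {B : I → GradedTwoVect k} {F : ∀ j, (∀ i : fib j, B (e j i)) ⥤ C j} {G : (∀ j, C j) ⥤ D}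
    (hF : ∀ j, IsBounded A (F j)) (hGm : IsMultilinearFunctor k G) (hG : IsBounded A G) :
    IsBounded A (composeFunctor e F G) := by
  classical
  have := Fintype.ofFinite J
  choose SF hSF hF using hF
  obtain ⟨SG, hSG, hG⟩ := hG
  refine ⟨Finset.image (fun p : (∀ j, ℤ) × ℤ => (∑ j, p.1 j) + p.2)
    (Fintype.piFinset SF ×ˢ SG), ?_, fun X n hX => ?_⟩
  · intro d hd
    simp only [Finset.mem_image, Finset.mem_product, Fintype.mem_piFinset] at hd
    obtain ⟨p, ⟨h1, h2⟩, rfl⟩ := hd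
    exact A.add_mem (A.sum_mem fun j _ => hSF j _ (h1 j)) (hSG _ h2)
  · have h1 := fun j => hF j (fun i => X (e j i)) (fun i => n (e j i))
      (fun i => hX (e j i))
    simp only [isSumOfDegrees_iff] at h1
    choose K fK Y hY hd using h1
    choose m hm hdeg using hd
    refine IsSumOfDegrees.trans (IsDirectSum.map hGm hY) fun p => ?_
    have h2 := hG (fun j => Y j (p j)) (fun j => m j (p j)) (fun j => hdeg j (p j))
    obtain ⟨K', fK', Y', b, hb, hi, hdd⟩ := h2
    refine ⟨K', fK', Y', b, hb, hi, fun a => ?_⟩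
    obtain ⟨r, ⟨d, hdS, hr⟩, hYr⟩ := hdd a
    refine ⟨r, ?_, hYr⟩
    have hm' := fun j => hm j (p j)
    simp only [Set.mem_ofPred_eq] at hm'
    choose d' hd' hmd using hm'
    refine ⟨∑ j, d' j + d, Finset.mem_image.mpr ⟨(d', d), by simp [hd', hdS], rfl⟩, ?_⟩
    have hfib : ∀ j, Finite (fib j) := fun j =>
      Finite.of_injective (fun i => e j i) fun a b hab => by
        simpa using @he.1 ⟨_, a⟩ ⟨_, b⟩ hab
    have := fun j => Fintype.ofFinite (fib j)
    have hsum : (∑ᶠ i, n i) = ∑ j, ∑ᶠ i : fib j, n (e j i) := by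
      rw [← finsum_comp_equiv (Equiv.ofBijective _ he), finsum_eq_sum_of_fintype, Fintype.sum_sigma]
      simp only [finsum_eq_sum_of_fintype]
      rfl
    rw [hr, hsum, finsum_eq_sum_of_fintype]
    push_cast
    simp only [hmd, Finset.sum_add_distrib]
    push_cast
    ring

end Multifunctors

/-! ### Pointed finite sets -/

/-- Finite pointed sets, each given by the complement `carrier` of its base point. -/
structure FinPtd where
  carrier : Type
  [finite : Finite carrier]

attribute [instance] FinPtd.finite

/-- A morphism of pointed sets is a partially defined map between the complements of the base
points; `none` is the base point. -/
instance : Category FinPtd where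
  Hom I J := I.carrier → Option J.carrier
  id _ := some
  comp f g := fun i => (f i).bind g
  id_comp f := by
    funext i
    rfl
  comp_id f := by
    funext i
    exact Option.bind_fun_some _
  assoc f g h := by
    funext i
    exact Option.bind_assoc _ _ _

/-- For composable partial maps `f`, `g`, the fibre of the composite over `c` is partitioned into
the fibres of `f` over the elements of the fibre of `g` over `c`. -/
theorem fiber_bijective {I J K : Type} (f : I → Option J) (g : J → Option K) (c : K) :
    Function.Bijective fun p : (Σ j : {j // g j = some c}, {i // f i = some j.1}) =>
      (⟨p.2.1, by rw [p.2.2]; exact p.1.2⟩ : {i // (f i).bind g = some c}) := by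
  constructor
  · rintro ⟨⟨j, hj⟩, ⟨i, hi⟩⟩ ⟨⟨j', hj'⟩, ⟨i', hi'⟩⟩ h
    obtain rfl : i = i' := congrArg Subtype.val h
    obtain rfl : j = j' := Option.some.inj (hi.symm.trans hi')
    rfl
  · rintro ⟨i, hi⟩
    obtain ⟨j, hj, hj'⟩ := Option.bind_eq_some_iff.mp hi
    exact ⟨⟨⟨j, hj'⟩, ⟨i, hj⟩⟩, rfl⟩

/-! ### The bicategory of finite families of graded 2-vector spaces -/

/-- Finite families of graded 2-vector spaces (the component at the base point, which is the zero
category, is omitted). `A` is the set of degrees allowed for 1-morphisms: `⊤` for all integers,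
or the submonoid of non-negative integers. -/
structure TwoVectTensor (k : Type u) [Field k] (A : AddSubmonoid ℤ) where
  I : Type
  [finite : Finite I]
  C : I → GradedTwoVect k

attribute [instance] TwoVectTensor.finite

namespace TwoVectTensor

variable {k : Type u} [Field k] {A : AddSubmonoid ℤ}

/-- A 1-morphism over the map `base` of pointed sets: for each `j` a multi-exact bounded functor
`∏_{base i = j} C i ⥤ D j`. -/
structure Cell1 (X Y : TwoVectTensor k A) where
  base : X.I → Option Y.I
  func : ∀ j, (∀ i : {i // base i = some j}, X.C i.1) ⥤ Y.C j
  multilinear : ∀ j, IsMultilinearFunctor k (func j)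
  bounded : ∀ j, IsBounded A (func j)

/-- The identification of `∏_{a i = j} C i` and `∏_{b i = j} C i` for equal maps `a` and `b`. -/
def reindex (X : TwoVectTensor k A) {J : Type} {a b : X.I → Option J} (h : a = b) (j : J) :
    (∀ i : {i // a i = some j}, X.C i.1) ⥤ (∀ i : {i // b i = some j}, X.C i.1) where
  obj V i := V ⟨i.1, by rw [h]; exact i.2⟩
  map f i := f ⟨i.1, by rw [h]; exact i.2⟩

/-- A 2-morphism between 1-morphisms over the same map of pointed sets: a family of natural
transformations. -/
@[ext]
structure Cell2 {X Y : TwoVectTensor k A} (F G : Cell1 X Y) where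
  base_eq : F.base = G.base
  app : ∀ j, F.func j ⟶ X.reindex base_eq j ⋙ G.func j

instance homCategory (X Y : TwoVectTensor k A) : Category (Cell1 X Y) where
  Hom F G := Cell2 F G
  id F := { base_eq := rfl, app := fun j => 𝟙 (F.func j) }
  comp η θ :=
    { base_eq := η.base_eq.trans θ.base_eq
      app := fun j => η.app j ≫ Functor.whiskerLeft (X.reindex η.base_eq j) (θ.app j) }
  id_comp η := by
    refine Cell2.ext (funext fun j => ?_)
    ext V
    exact Category.id_comp _
  comp_id η := by
    refine Cell2.ext (funext fun j => ?_)
    ext V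
    exact Category.comp_id _
  assoc η θ ζ := by
    refine Cell2.ext (funext fun j => ?_)
    ext V
    exact Category.assoc _ _ _

theorem cell2_ext {X Y : TwoVectTensor k A} {F G : Cell1 X Y} {η θ : F ⟶ G}
    (h : ∀ j V, (Cell2.app η j).app V = (Cell2.app θ j).app V) : η = θ :=
  Cell2.ext (funext fun j => NatTrans.ext (funext fun V => h j V))

def Cell1.id (X : TwoVectTensor k A) : Cell1 X X where
  base := some
  func j := Pi.eval (fun i : {i // some i = some j} => X.C i.1) ⟨j, rfl⟩
  multilinear j V W :=
    ⟨{  toFun := fun f => f ⟨j, rfl⟩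
        map_update_add' := by
          intro _ f i a b
          obtain ⟨i, hi⟩ := i
          obtain rfl := Option.some.inj hi
          simp only [Function.update_self]
          rfl
        map_update_smul' := by
          intro _ f i a b
          obtain ⟨i, hi⟩ := i
          obtain rfl := Option.some.inj hi
          simp only [Function.update_self]
          rfl }, fun _ => rfl⟩
  bounded j := IsDegreeZero.isBounded A fun V n h => by
    have : (∑ᶠ i : {i // some i = some j}, n i) = n ⟨j, rfl⟩ := by
      rw [finsum_eq_single _ ⟨j, rfl⟩]
      rintro ⟨i, hi⟩ hne
      obtain rfl := Option.some.inj hi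
      exact (hne rfl).elim
    rw [this]
    exact h ⟨j, rfl⟩

theorem comp_mem_fiber {X Y Z : TwoVectTensor k A} (F : Cell1 X Y) (G : Cell1 Y Z) {c : Z.I}
    (j : {j // G.base j = some c}) (i : {i // F.base i = some j.1}) :
    (F.base i.1).bind G.base = some c := by
  rw [i.2]
  exact j.2

def Cell1.comp {X Y Z : TwoVectTensor k A} (F : Cell1 X Y) (G : Cell1 Y Z) : Cell1 X Z where
  base i := (F.base i).bind G.base
  func c := composeFunctor (B := fun i : {i // (F.base i).bind G.base = some c} => X.C i.1)
    (C := fun j : {j // G.base j = some c} => Y.C j.1)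
    (fun j (i : {i // F.base i = some j.1}) => ⟨i.1, comp_mem_fiber F G j i⟩)
    (fun j => F.func j.1) (G.func c)
  multilinear c := composeFunctor_multilinear
    (B := fun i : {i // (F.base i).bind G.base = some c} => X.C i.1)
    (C := fun j : {j // G.base j = some c} => Y.C j.1)
    (fun j (i : {i // F.base i = some j.1}) => ⟨i.1, comp_mem_fiber F G j i⟩)
    (fiber_bijective F.base G.base c)
    (fun j => F.multilinear j.1) (G.multilinear c)
  bounded c := composeFunctor_bounded
    (B := fun i : {i // (F.base i).bind G.base = some c} => X.C i.1)
    (C := fun j : {j // G.base j = some c} => Y.C j.1)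
    (fun j (i : {i // F.base i = some j.1}) => ⟨i.1, comp_mem_fiber F G j i⟩)
    (fiber_bijective F.base G.base c)
    (fun j => F.bounded j.1) (G.multilinear c) (G.bounded c)

def whiskerL {X Y Z : TwoVectTensor k A} (F : Cell1 X Y) {G H : Cell1 Y Z} (η : Cell2 G H) :
    Cell2 (F.comp G) (F.comp H) where
  base_eq := congrArg (fun b => fun i => (F.base i).bind b) η.base_eq
  app c :=
    { app := fun V => (η.app c).app fun j => (F.func j.1).obj fun i =>
        V ⟨i.1, comp_mem_fiber F G j i⟩
      naturality := fun _ _ f => (η.app c).naturality fun j => (F.func j.1).map fun i =>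
        f ⟨i.1, comp_mem_fiber F G j i⟩ }

def whiskerR {X Y Z : TwoVectTensor k A} {F G : Cell1 X Y} (η : Cell2 F G) (H : Cell1 Y Z) :
    Cell2 (F.comp H) (G.comp H) where
  base_eq := congrArg (fun b => fun i => (b i).bind H.base) η.base_eq
  app c :=
    { app := fun V => (H.func c).map fun j => (η.app j.1).app fun i =>
        V ⟨i.1, comp_mem_fiber F H j i⟩
      naturality := fun V W f => by
        refine ((H.func c).map_comp _ _).symm.trans (Eq.trans ?_ ((H.func c).map_comp _ _))
        congr 1
        funext j
        exact (η.app j.1).naturality fun i => f ⟨i.1, comp_mem_fiber F H j i⟩ }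

def assocIso {X Y Z T : TwoVectTensor k A} (F : Cell1 X Y) (G : Cell1 Y Z) (H : Cell1 Z T) :
    (F.comp G).comp H ≅ F.comp (G.comp H) where
  hom :=
    { base_eq := funext fun _ => Option.bind_assoc _ _ _
      app := fun c =>
        { app := fun V => 𝟙 (((F.comp G).comp H).func c |>.obj V)
          naturality := fun _ _ _ => (Category.comp_id _).trans (Category.id_comp _).symm } }
  inv :=
    { base_eq := funext fun _ => (Option.bind_assoc _ _ _).symm
      app := fun c =>
        { app := fun V => 𝟙 ((F.comp (G.comp H)).func c |>.obj V)
          naturality := fun _ _ _ => (Category.comp_id _).trans (Category.id_comp _).symm } }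
  hom_inv_id := cell2_ext fun _ _ => Category.comp_id _
  inv_hom_id := cell2_ext fun _ _ => Category.comp_id _

def leftIso {X Y : TwoVectTensor k A} (F : Cell1 X Y) : (Cell1.id X).comp F ≅ F where
  hom :=
    { base_eq := rfl
      app := fun c =>
        { app := fun V => 𝟙 (((Cell1.id X).comp F).func c |>.obj V)
          naturality := fun _ _ _ => (Category.comp_id _).trans (Category.id_comp _).symm } }
  inv :=
    { base_eq := rfl
      app := fun c =>
        { app := fun V => 𝟙 (F.func c |>.obj V)
          naturality := fun _ _ _ => (Category.comp_id _).trans (Category.id_comp _).symm } }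
  hom_inv_id := cell2_ext fun _ _ => Category.comp_id _
  inv_hom_id := cell2_ext fun _ _ => Category.comp_id _

def rightIso {X Y : TwoVectTensor k A} (F : Cell1 X Y) : F.comp (Cell1.id Y) ≅ F where
  hom :=
    { base_eq := funext fun _ => Option.bind_fun_some _
      app := fun c =>
        { app := fun V => 𝟙 ((F.comp (Cell1.id Y)).func c |>.obj V)
          naturality := fun _ _ _ => (Category.comp_id _).trans (Category.id_comp _).symm } }
  inv :=
    { base_eq := funext fun _ => (Option.bind_fun_some _).symm
      app := fun c =>
        { app := fun V => 𝟙 (F.func c |>.obj V)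
          naturality := fun _ _ _ => (Category.comp_id _).trans (Category.id_comp _).symm } }
  hom_inv_id := cell2_ext fun _ _ => Category.comp_id _
  inv_hom_id := cell2_ext fun _ _ => Category.comp_id _

instance : Bicategory (TwoVectTensor k A) where
  Hom X Y := Cell1 X Y
  id X := Cell1.id X
  comp F G := Cell1.comp F G
  homCategory X Y := homCategory X Y
  whiskerLeft F _ _ η := whiskerL F η
  whiskerRight η H := whiskerR η H
  associator F G H := assocIso F G H
  leftUnitor F := leftIso F
  rightUnitor F := rightIso F
  whiskerLeft_id _ _ := cell2_ext fun _ _ => rfl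
  whiskerLeft_comp := by
    intros
    exact cell2_ext fun _ _ => rfl
  id_whiskerLeft _ := cell2_ext fun _ _ =>
    ((Category.id_comp _).trans (Category.comp_id _)).symm
  comp_whiskerLeft := by
    intros
    exact cell2_ext fun _ _ => ((Category.id_comp _).trans (Category.comp_id _)).symm
  id_whiskerRight _ G := cell2_ext fun _ _ => (Cell1.func G _).map_id _
  comp_whiskerRight _ _ G := cell2_ext fun _ _ => (Cell1.func G _).map_comp _ _
  whiskerRight_id _ := cell2_ext fun _ _ =>
    ((Category.id_comp _).trans (Category.comp_id _)).symm
  whiskerRight_comp _ _ _ := cell2_ext fun _ _ =>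
    ((Category.id_comp _).trans (Category.comp_id _)).symm
  whisker_assoc := by
    intros
    exact cell2_ext fun _ _ => ((Category.id_comp _).trans (Category.comp_id _)).symm
  whisker_exchange {_ _ _ F _ G _} η θ := cell2_ext fun c V =>
    ((Cell2.app θ c).naturality fun j => (Cell2.app η j.1).app fun i =>
      V ⟨i.1, comp_mem_fiber F G j i⟩).symm
  pentagon F G H K := cell2_ext fun c V => by
    refine Eq.trans ?_ (Category.id_comp _).symm
    refine Eq.trans (congrArg₂ _ ((K.func c).map_id _) (Category.id_comp _)) ?_
    exact Category.id_comp _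
  triangle F G := cell2_ext fun c V => by
    refine Eq.trans (Category.id_comp _) ?_
    exact ((G.func c).map_id _).symm

/-- The projection to finite pointed sets. -/
def proj (k : Type u) [Field k] (A : AddSubmonoid ℤ) : TwoVectTensor k A ⥤q FinPtd where
  obj X := ⟨X.I⟩
  map F := Cell1.base F

end TwoVectTensor

/-! ### The category of finite families of finite sets -/

/-- Finite families of finite sets (the component at the base point, a one-point set, is
omitted). -/
structure FinSetSqcup where
  I : Type
  [finite : Finite I]
  S : I → FintypeCat.{0}

attribute [instance] FinSetSqcup.finite

namespace FinSetSqcup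

/-- A morphism over the map `base` of pointed sets: a map `S i → T j` for each `i` with
`base i = j`. -/
structure Hom (X Y : FinSetSqcup) where
  base : X.I → Option Y.I
  fn : ∀ i j, base i = some j → X.S i → Y.S j

theorem Hom.ext' {X Y : FinSetSqcup} {f g : Hom X Y} (h : f.base = g.base)
    (h' : ∀ i j (hf : f.base i = some j) (hg : g.base i = some j) s, f.fn i j hf s = g.fn i j hg s) :
    f = g := by
  obtain ⟨b, f⟩ := f
  obtain ⟨b', g⟩ := g
  obtain rfl : b = b' := h
  congr
  funext i j hj s
  exact h' i j hj hj s

def Hom.id (X : FinSetSqcup) : Hom X X where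
  base := some
  fn i j h s := cast (by rw [Option.some.inj h]) s

/-- The intermediate index in a composite. -/
def mid {I J K : Type} (f : I → Option J) (g : J → Option K) {i : I} {c : K}
    (h : (f i).bind g = some c) : J :=
  (f i).get (by
    cases hf : f i with
    | none => rw [hf] at h; simp at h
    | some j => rfl)

theorem base_mid {I J K : Type} (f : I → Option J) (g : J → Option K) {i : I} {c : K}
    (h : (f i).bind g = some c) : f i = some (mid f g h) := by
  simp [mid]

theorem mid_base {I J K : Type} (f : I → Option J) (g : J → Option K) {i : I} {c : K}
    (h : (f i).bind g = some c) : g (mid f g h) = some c := by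
  rw [base_mid f g h] at h
  exact h

def Hom.comp {X Y Z : FinSetSqcup} (f : Hom X Y) (g : Hom Y Z) : Hom X Z where
  base i := (f.base i).bind g.base
  fn i c h s := g.fn _ c (mid_base f.base g.base h) (f.fn i _ (base_mid f.base g.base h) s)

theorem Hom.comp_fn {X Y Z : FinSetSqcup} (f : Hom X Y) (g : Hom Y Z) {i : X.I} {j : Y.I} {c : Z.I}
    (hi : f.base i = some j) (hj : g.base j = some c) (h : (f.comp g).base i = some c) (s : X.S i) :
    (f.comp g).fn i c h s = g.fn j c hj (f.fn i j hi s) := by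
  have e : mid f.base g.base h = j :=
    Option.some.inj ((base_mid f.base g.base h).symm.trans hi)
  subst e
  rfl

instance : Category FinSetSqcup where
  Hom X Y := Hom X Y
  id X := Hom.id X
  comp f g := Hom.comp f g
  id_comp {X Y} f := by
    refine Hom.ext' rfl fun i j hf hg s => ?_
    exact Hom.comp_fn (Hom.id X) f rfl hg _ s
  comp_id {X Y} f := by
    refine Hom.ext' (funext fun i => Option.bind_fun_some _) fun i j hf hg s => ?_
    exact Hom.comp_fn f (Hom.id Y) hg rfl _ s
  assoc {X Y Z W} f g h := by
    refine Hom.ext' (funext fun i => Option.bind_assoc _ _ _) fun i d hf hg s => ?_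
    obtain ⟨c, hc, hd⟩ := Option.bind_eq_some_iff.mp hf
    obtain ⟨j, hj, hjc⟩ := Option.bind_eq_some_iff.mp hc
    have hjd : (g.comp h).base j = some d := (congrArg (fun o => Option.bind o h.base) hjc).trans hd
    exact (Hom.comp_fn (f.comp g) h hc hd hf s).trans
      ((congrArg (h.fn c d hd) (Hom.comp_fn f g hj hjc hc s)).trans
        ((Hom.comp_fn g h hjc hd hjd _).symm.trans (Hom.comp_fn f (g.comp h) hj hjd hg s).symm))

/-- The projection to finite pointed sets. -/
def proj : LocallyDiscrete FinSetSqcup ⥤q FinPtd where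
  obj X := ⟨X.as.I⟩
  map f := Hom.base f.as

/-- A finite set, as a family over the one-element index set: the fibre over `{*, 1}`. -/
def single (S : FintypeCat.{0}) : FinSetSqcup where
  I := PUnit
  S _ := S

/-- A map of finite sets, as a morphism of one-element families. -/
def singleMap {S T : FintypeCat.{0}} (φ : S ⟶ T) : single S ⟶ single T :=
  (⟨some, fun _ _ _ => φ⟩ : Hom (single S) (single T))

theorem singleMap_comp {S T U : FintypeCat.{0}} (φ : S ⟶ T) (ψ : T ⟶ U) :
    singleMap (φ ≫ ψ) = singleMap φ ≫ singleMap ψ :=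
  rfl

end FinSetSqcup

/-! ### CoCartesian arrows and the Beck–Chevalley condition -/

section Bicategories

open Bicategory

variable {B : Type*} [Bicategory B]

/-- The 1-morphism `F : X ⟶ Y` is coCartesian for `p : B → E`, where `E` is a category: for every
`Z` the square formed by precomposition with `F`, from `B(Y, Z)` to `B(X, Z)`, over precomposition
with `p F`, from `E(p Y, p Z)` to `E(p X, p Z)`, is a pseudo-pullback of categories. As the sets
`E(-, -)` are discrete categories this says that the functor from `B(Y, Z)` to the category of pairs
`(g, G)` with `p G = p F ≫ g` is essentially surjective and fully faithful. -/
structure IsCoCartesian {E : Type*} [Category E] (p : B ⥤q E) {X Y : B} (F : X ⟶ Y) : Prop where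
  exists_lift : ∀ (Z : B) (g : p.obj Y ⟶ p.obj Z) (G : X ⟶ Z), p.map G = p.map F ≫ g →
    ∃ G' : Y ⟶ Z, p.map G' = g ∧ Nonempty (F ≫ G' ≅ G)
  bijective : ∀ (Z : B) (G G' : Y ⟶ Z), p.map G = p.map G' →
    Function.Bijective fun η : G ⟶ G' => F ◁ η

variable {a b c d : B} {g : a ⟶ b} {f : a ⟶ c} {h : b ⟶ d} {i : c ⟶ d}

/-- The right Beck–Chevalley condition for a square `α : h ∘ g ⟶ i ∘ f`: the verticals `f`, `h` have
right adjoints and the right mate `g ∘ f_R ⟶ h_R ∘ i` is invertible. (The choice of the adjunctions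
does not matter.) -/
def RightBeckChevalley (α : g ≫ h ⟶ f ≫ i) : Prop :=
  ∃ (fR : c ⟶ a) (hR : d ⟶ b) (adjf : f ⊣ fR) (adjh : h ⊣ hR), IsIso (mateEquiv adjf adjh α)

/-- The left Beck–Chevalley condition for a square `α : h ∘ g ⟶ i ∘ f`: the horizontals `g`, `i`
have left adjoints and the left mate `i_L ∘ h ⟶ f ∘ g_L` is invertible. -/
def LeftBeckChevalley (α : g ≫ h ⟶ f ≫ i) : Prop :=
  ∃ (gL : b ⟶ a) (iL : d ⟶ c) (adjg : gL ⊣ g) (adji : iL ⊣ i),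
    IsIso ((mateEquiv adjg adji).symm α)

def BeckChevalley (α : g ≫ h ⟶ f ≫ i) : Prop :=
  RightBeckChevalley α ∧ LeftBeckChevalley α

/-- The image of a commutative square under a pseudofunctor. -/
def imageSquare {E : Type*} [Category E] (H : LocallyDiscrete E ⥤ᵖ B) {s t r u : E} {a : s ⟶ t}
    {c : s ⟶ r} {b : t ⟶ u} {d : r ⟶ u} (w : a ≫ b = c ≫ d) :
    H.map a.toLoc ≫ H.map b.toLoc ≅ H.map c.toLoc ≫ H.map d.toLoc :=
  (H.mapComp a.toLoc b.toLoc).symm ≪≫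
    H.map₂Iso (eqToIso (congrArg Quiver.Hom.toLoc w)) ≪≫ H.mapComp c.toLoc d.toLoc

end Bicategories

/-! ### Symmetric self-adjoint Hopf structures -/

open Bicategory in
/-- `H` is a symmetric self-adjoint Hopf (SSH) structure: a morphism of fibrations over finite
pointed sets, taking values in degree zero 1-morphisms, preserving coCartesian arrows, and sending
Cartesian squares of finite sets to squares satisfying the Beck–Chevalley condition. -/
structure IsSSH {k : Type u} [Field k] {A : AddSubmonoid ℤ}
    (H : LocallyDiscrete FinSetSqcup ⥤ᵖ TwoVectTensor k A) : Prop where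
  base : H.toPrefunctor ⋙q TwoVectTensor.proj k A = FinSetSqcup.proj
  degreeZero : ∀ {X Y : LocallyDiscrete FinSetSqcup} (f : X ⟶ Y) (j : (H.obj Y).I),
    IsDegreeZero (TwoVectTensor.Cell1.func (H.map f) j)
  coCartesian : ∀ {X Y : LocallyDiscrete FinSetSqcup} (f : X ⟶ Y),
    IsCoCartesian FinSetSqcup.proj f → IsCoCartesian (TwoVectTensor.proj k A) (H.map f)
  beckChevalley : ∀ {S T R U : FintypeCat.{0}} {a : S ⟶ T} {c : S ⟶ R} {b : T ⟶ U} {d : R ⟶ U}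
    (sq : IsPullback a c b d),
    BeckChevalley (imageSquare H (s := FinSetSqcup.single S) (a := FinSetSqcup.singleMap a)
      (c := FinSetSqcup.singleMap c) (b := FinSetSqcup.singleMap b) (d := FinSetSqcup.singleMap d)
      (congrArg FinSetSqcup.singleMap sq.w)).hom

/-! ### Polynomial functors -/

section PolynomialFunctors

variable (k : Type u) [Field k]

section

variable {A : Type v} [Category.{w'} A] [Preadditive A] [Linear k A]

/-- `F` is a polynomial functor (of finite degree): its action on morphism spaces is given by
polynomial maps of bounded degree. -/
def IsPolynomialFunctor : ObjectProperty (A ⥤ FGModuleCat.{u} k) := fun F =>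
  ∃ d : ℕ, ∀ V W : A, IsPolynomialMap k d fun f : V ⟶ W => F.map f

/-- `F` is homogeneous of degree `n`: its action on morphism spaces is given by homogeneous
polynomial maps of degree `n`. -/
def IsHomogeneousFunctor (n : ℕ) (F : A ⥤ FGModuleCat.{u} k) : Prop :=
  ∀ V W : A, IsHomogeneousMap k n fun f : V ⟶ W => F.map f

variable (A)

/-- The category of polynomial functors from `A` to finite-dimensional vector spaces. -/
abbrev Poly := (IsPolynomialFunctor k (A := A)).FullSubcategory

/-- The grading of the category of polynomial functors by degree. -/
def polyDeg (n : ℕ) : ObjectProperty (Poly k A) := fun F => IsHomogeneousFunctor k n F.obj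

end

/-- Sheaves of finite-dimensional vector spaces on the finite discrete set `S`, given by their
stalks. -/
abbrev Sh (S : Type) := S → FGModuleCat.{u} k

/-- The inverse image functor `φ^*`. -/
def shPull {S T : Type} (φ : S → T) : Sh k T ⥤ Sh k S where
  obj V s := V (φ s)
  map f s := f (φ s)

/-- The direct image functor `φ_*`: the stalk of `φ_* V` at `t` is the product of the `V s` with
`φ s = t`. -/
def shPush {S T : Type} [Finite S] (φ : S → T) : Sh k S ⥤ Sh k T where
  obj V t := FGModuleCat.of k (∀ s : {s // φ s = t}, V s.1)
  map f t := FGModuleCat.ofHom (LinearMap.pi fun s => (f s.1).hom.hom ∘ₗ LinearMap.proj s)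

variable {k}

/-- Morphisms of vector spaces as linear maps. -/
def fgHom (V W : FGModuleCat.{u} k) : (V ⟶ W) ≃ₗ[k] (V →ₗ[k] W) :=
  InducedCategory.homLinearEquiv.trans ModuleCat.homLinearEquiv

section

variable {A : Type v} [Category.{w'} A] {ι : Type} [Finite ι]

/-- The pointwise tensor product of a finite family of functors. -/
def tensorFunctor (G : ι → A ⥤ FGModuleCat.{u} k) : A ⥤ FGModuleCat.{u} k where
  obj V := FGModuleCat.of k (⨂[k] i, (G i).obj V)
  map f := FGModuleCat.ofHom (PiTensorProduct.map fun i => ((G i).map f).hom.hom)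
  map_id V := by
    ext : 1
    refine Eq.trans ?_ PiTensorProduct.map_id
    change PiTensorProduct.map _ = _
    congr 1
    funext i
    rw [(G i).map_id]
    rfl
  map_comp f g := by
    ext : 1
    refine Eq.trans ?_ (PiTensorProduct.map_comp _ _)
    change PiTensorProduct.map _ = _
    congr 1
    funext i
    rw [(G i).map_comp]
    rfl

/-- The tensor product of a family of natural transformations. -/
def tensorNat {G G' : ι → A ⥤ FGModuleCat.{u} k} (τ : ∀ i, G i ⟶ G' i) :
    tensorFunctor G ⟶ tensorFunctor G' where
  app V := FGModuleCat.ofHom (PiTensorProduct.map fun i => ((τ i).app V).hom.hom)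
  naturality V W f := by
    ext : 1
    refine (PiTensorProduct.map_comp _ _).symm.trans (Eq.trans ?_ (PiTensorProduct.map_comp _ _))
    congr 1
    funext i
    exact congrArg (fun g => g.hom.hom) ((τ i).naturality f)

/-- The tensor product of morphisms of vector spaces, as a multilinear map. -/
def tensorHom (V W : ι → FGModuleCat.{u} k) :
    MultilinearMap k (fun i => V i ⟶ W i)
      (FGModuleCat.of k (⨂[k] i, V i) ⟶ FGModuleCat.of k (⨂[k] i, W i)) :=
  (fgHom _ _).symm.toLinearMap.compMultilinearMap
    ((PiTensorProduct.mapMultilinear k (fun i => V i) fun i => W i).compLinearMap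
      fun i => (fgHom (V i) (W i)).toLinearMap)

theorem tensorHom_apply (V W : ι → FGModuleCat.{u} k) (f : ∀ i, V i ⟶ W i) :
    tensorHom V W f = FGModuleCat.ofHom (PiTensorProduct.map fun i => (f i).hom.hom) :=
  rfl

variable [Preadditive A] [Linear k A]

theorem tensorFunctor_homogeneous {G : ι → A ⥤ FGModuleCat.{u} k} {n : ι → ℕ}
    (h : ∀ i, IsHomogeneousFunctor k (n i) (G i)) :
    IsHomogeneousFunctor k (∑ᶠ i, n i) (tensorFunctor G) := fun V W =>
  IsHomogeneousMap.multilinear (tensorHom (fun i => (G i).obj V) fun i => (G i).obj W) n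
    fun i => h i V W

theorem tensorFunctor_polynomial {G : ι → A ⥤ FGModuleCat.{u} k}
    (h : ∀ i, IsPolynomialFunctor k (G i)) : IsPolynomialFunctor k (tensorFunctor G) := by
  choose d hd using h
  exact ⟨∑ᶠ i, d i, fun V W =>
    IsPolynomialMap.multilinear (tensorHom (fun i => (G i).obj V) fun i => (G i).obj W) d
      fun i => hd i V W⟩

variable {B : Type*} [Category B] [Preadditive B] [Linear k B] {L : B ⥤ A}

theorem IsHomogeneousFunctor.precomp {n : ℕ} {F : A ⥤ FGModuleCat.{u} k}
    (hF : IsHomogeneousFunctor k n F) (hL : L.Additive) (hL' : L.Linear k) :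
    IsHomogeneousFunctor k n (L ⋙ F) := fun V W =>
  (hF (L.obj V) (L.obj W)).comp_linear (L.mapLinearMap k)

theorem IsPolynomialFunctor.precomp {F : A ⥤ FGModuleCat.{u} k}
    (hF : IsPolynomialFunctor k F) (hL : L.Additive) (hL' : L.Linear k) :
    IsPolynomialFunctor k (L ⋙ F) := by
  obtain ⟨d, hd⟩ := hF
  exact ⟨d, fun V W => (hd (L.obj V) (L.obj W)).comp_linear (L.mapLinearMap k)⟩

end

instance shPull_additive {S T : Type} (φ : S → T) : (shPull k φ).Additive where
  map_add := rfl

instance shPull_linear {S T : Type} (φ : S → T) : (shPull k φ).Linear k where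
  map_smul _ _ := rfl

instance shPush_additive {S T : Type} [Finite S] (φ : S → T) : (shPush k φ).Additive where
  map_add := rfl

instance shPush_linear {S T : Type} [Finite S] (φ : S → T) : (shPush k φ).Linear k where
  map_smul _ _ := rfl

/-- Precomposition with a linear functor, on categories of polynomial functors. -/
def precomp {A : Type v} [Category.{w'} A] [Preadditive A] [Linear k A]
    {B : Type v} [Category.{w'} B] [Preadditive B] [Linear k B] (L : B ⥤ A)
    [hL : L.Additive] [hL' : L.Linear k] : Poly k A ⥤ Poly k B where
  obj F := ⟨L ⋙ F.obj, F.property.precomp hL hL'⟩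
  map τ := ObjectProperty.homMk (Functor.whiskerLeft L τ.hom)

/-- The functor `(F i) ↦ (V ↦ ⨂ F i (φ_i^* V))`. -/
def mTensor {ι : Type} [Finite ι] {S : ι → Type} {T : Type} (φ : ∀ i, S i → T) :
    (∀ i, Poly k (Sh k (S i))) ⥤ Poly k (Sh k T) where
  obj F := ⟨tensorFunctor fun i => shPull k (φ i) ⋙ (F i).obj, tensorFunctor_polynomial fun i =>
    (F i).property.precomp inferInstance inferInstance⟩
  map τ := ObjectProperty.homMk
    (tensorNat fun i => Functor.whiskerLeft (shPull k (φ i)) (τ i).hom)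
  map_id F := by
    apply ObjectProperty.hom_ext
    ext V : 3
    exact PiTensorProduct.map_id
  map_comp τ σ := by
    apply ObjectProperty.hom_ext
    ext V : 3
    exact PiTensorProduct.map_comp _ _

theorem mTensor_map_update {ι : Type} [Finite ι] [DecidableEq ι] {S : ι → Type} {T : Type}
    (φ : ∀ i, S i → T) {F G : ∀ i, Poly k (Sh k (S i))} (τ : F ⟶ G) (i : ι) (c : F i ⟶ G i)
    (V : Sh k T) :
    tensorHom (fun i => (F i).obj.obj ((shPull k (φ i)).obj V))
      (fun i => (G i).obj.obj ((shPull k (φ i)).obj V))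
      (Function.update (fun i => (τ i).hom.app ((shPull k (φ i)).obj V)) i
        (c.hom.app ((shPull k (φ i)).obj V))) =
      ((mTensor φ).map (Function.update τ i c : ∀ i, F i ⟶ G i)).hom.app V := by
  refine Eq.trans (congrArg _ (funext fun j => (Function.apply_update
    (fun i (c : F i ⟶ G i) => c.hom.app ((shPull k (φ i)).obj V)) τ i c j).symm)) ?_
  rfl

theorem mTensor_multilinear {ι : Type} [Finite ι] {S : ι → Type} {T : Type} (φ : ∀ i, S i → T) :
    IsMultilinearFunctor k (mTensor (k := k) φ) := by
  intro F G
  refine ⟨{ toFun := fun τ => (mTensor φ).map τ, map_update_add' := ?_, map_update_smul' := ?_ },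
    fun τ => rfl⟩
  · intro _ τ i a b
    apply ObjectProperty.hom_ext
    ext V : 2
    refine (mTensor_map_update φ τ i _ V).symm.trans (Eq.trans
      (MultilinearMap.map_update_add _ _ _ _ _)
      (congrArg₂ (· + ·) (mTensor_map_update φ τ i a V) (mTensor_map_update φ τ i b V)))
  · intro _ τ i r a
    apply ObjectProperty.hom_ext
    ext V : 2
    refine (mTensor_map_update φ τ i _ V).symm.trans (Eq.trans
      (MultilinearMap.map_update_smul _ _ _ _ _)
      (congrArg (r • ·) (mTensor_map_update φ τ i a V)))

variable (k) in
/-- `P(Sh(S))` is a graded 2-vector space for every finite set `S`. -/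
def PolyIsGradedTwoVect : Prop :=
  ∀ S : FintypeCat.{0}, IsGradedTwoVect k (Poly k (Sh k S)) (polyDeg k (Sh k S))

/-- The graded category `P(Sh(S))`, as a graded 2-vector space. -/
def polySh (hk : PolyIsGradedTwoVect k) (S : FintypeCat.{0}) : GradedTwoVect k where
  carrier := Poly k (Sh k S)
  deg := polyDeg k (Sh k S)
  isGradedTwoVect := hk S

end PolynomialFunctors

/-! ### The SSH structure on polynomial functors -/

section PolyH

variable {k : Type u} [Field k]

/-- The canonical map `φ^* V ⟶ ψ^* V` for equal maps `φ` and `ψ`. -/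
def pullCongr {S T : Type} {φ ψ : S → T} (h : ∀ s, φ s = ψ s) (V : Sh k T) :
    (shPull k φ).obj V ⟶ (shPull k ψ).obj V :=
  fun s => eqToHom (congrArg V (h s))

theorem pullCongr_bijective {S T : Type} {φ ψ : S → T} (h : ∀ s, φ s = ψ s) (V : Sh k T)
    (F : Sh k S ⥤ FGModuleCat.{u} k) :
    Function.Bijective (F.map (pullCongr h V)).hom.hom := by
  obtain rfl : φ = ψ := funext h
  have : pullCongr h V = 𝟙 _ := rfl
  rw [this, F.map_id]
  exact Function.bijective_id

theorem pullCongr_naturality {S T : Type} {φ ψ : S → T} (h : ∀ s, φ s = ψ s) {V W : Sh k T}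
    (f : V ⟶ W) :
    pullCongr h V ≫ (shPull k ψ).map f = (shPull k φ).map f ≫ pullCongr h W := by
  obtain rfl : φ = ψ := funext h
  exact (Category.id_comp _).trans (Category.comp_id _).symm

variable (A : AddSubmonoid ℤ) (hk : PolyIsGradedTwoVect k)

/-- The family `(P(Sh(S_i)))` of a family `(S_i)` of finite sets. -/
def polyObj (X : FinSetSqcup) : TwoVectTensor k A where
  I := X.I
  C i := polySh hk (X.S i)

theorem mTensor_degreeZero {J : Type} [Finite J] {S : J → FintypeCat.{0}} {T : FintypeCat.{0}}
    (φ : ∀ i, S i → T) :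
    IsDegreeZero (C := fun i => polySh hk (S i)) (D := polySh hk T) (mTensor φ) := fun F n hF =>
  tensorFunctor_homogeneous fun i =>
    IsHomogeneousFunctor.precomp (hF i) inferInstance inferInstance

/-- The functors `m_(φ_i) : ∏_{base i = j} P(Sh(S_i)) ⥤ P(Sh(T_j))`, `(F_i) ↦ ⨂ F_i ∘ φ_i^*`,
of a morphism `(S_i) ⟶ (T_j)` of families of finite sets. -/
def polyMap {X Y : FinSetSqcup} (f : X ⟶ Y) : polyObj A hk X ⟶ polyObj A hk Y :=
  ({  base := FinSetSqcup.Hom.base f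
      func := fun j => mTensor fun i : {i // FinSetSqcup.Hom.base f i = some j} =>
        FinSetSqcup.Hom.fn f i.1 j i.2
      multilinear := fun j => mTensor_multilinear _
      bounded := fun j => IsDegreeZero.isBounded A (mTensor_degreeZero hk
        (S := fun i : {i // FinSetSqcup.Hom.base f i = some j} => X.S i.1) (T := Y.S j) _) } :
    TwoVectTensor.Cell1 (polyObj A hk X) (polyObj A hk Y))

variable {A hk}

section Components

variable {X : TwoVectTensor k A} {Y : FinSetSqcup} {F G : TwoVectTensor.Cell1 X (polyObj A hk Y)}

/-- The components of a 2-morphism, as linear maps. -/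
def cellLin (η : F ⟶ G) (j : Y.I)
    (P : ∀ i : {i // F.base i = some j}, X.C i.1) (V : Sh k (Y.S j)) :
    (((F.func j).obj P : Poly k (Sh k (Y.S j))).obj.obj V) →ₗ[k]
      (((X.reindex (TwoVectTensor.Cell2.base_eq η) j ⋙ G.func j).obj P :
        Poly k (Sh k (Y.S j))).obj.obj V) :=
  (((TwoVectTensor.Cell2.app η j).app P :
    ((F.func j).obj P : Poly k (Sh k (Y.S j))) ⟶ _).hom.app V).hom.hom

theorem cellLin_ext {η θ : F ⟶ G} (h : ∀ j P V, cellLin η j P V = cellLin θ j P V) : η = θ := by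
  apply TwoVectTensor.cell2_ext
  intro j P
  apply ObjectProperty.hom_ext
  apply NatTrans.ext
  funext V
  apply FGModuleCat.hom_ext
  exact h j P V

/-- A 2-morphism with bijective components is invertible. -/
theorem cell_isIso (η : F ⟶ G) (h : ∀ j P V, Function.Bijective (cellLin η j P V)) : IsIso η := by
  have h1 : ∀ j P, IsIso ((TwoVectTensor.Cell2.app η j).app P) := by
    intro j P
    let τ : ((F.func j).obj P : Poly k (Sh k (Y.S j))) ⟶
      ((X.reindex (TwoVectTensor.Cell2.base_eq η) j ⋙ G.func j).obj P : Poly k (Sh k (Y.S j))) :=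
      (TwoVectTensor.Cell2.app η j).app P
    have h2 : ∀ V, IsIso (τ.hom.app V) := by
      intro V
      let e := (LinearEquiv.ofBijective (cellLin η j P V) (h j P V)).toFGModuleCatIso
      exact inferInstanceAs (IsIso e.hom)
    have h3 : IsIso τ.hom := NatIso.isIso_of_isIso_app _
    refine ⟨⟨ObjectProperty.homMk (inv τ.hom), ?_, ?_⟩⟩
    · apply ObjectProperty.hom_ext
      exact IsIso.hom_inv_id τ.hom
    · apply ObjectProperty.hom_ext
      exact IsIso.inv_hom_id τ.hom
  have h4 : ∀ j, IsIso (TwoVectTensor.Cell2.app η j) := fun j => NatIso.isIso_of_isIso_app _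
  let θ : G ⟶ F :=
    { base_eq := (TwoVectTensor.Cell2.base_eq η).symm
      app := fun j => Functor.whiskerLeft (X.reindex (TwoVectTensor.Cell2.base_eq η).symm j)
        (inv (TwoVectTensor.Cell2.app η j)) }
  refine ⟨⟨θ, ?_, ?_⟩⟩
  · apply TwoVectTensor.cell2_ext
    intro j V
    exact congrArg (fun (t : F.func j ⟶ F.func j) => t.app V) (IsIso.hom_inv_id (TwoVectTensor.Cell2.app η j))
  · apply TwoVectTensor.cell2_ext
    intro j V
    exact congrArg (fun (t : X.reindex (TwoVectTensor.Cell2.base_eq η) j ⋙ G.func j ⟶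
      X.reindex (TwoVectTensor.Cell2.base_eq η) j ⋙ G.func j) =>
      t.app ((X.reindex (TwoVectTensor.Cell2.base_eq η).symm j).obj V))
      (IsIso.inv_hom_id (TwoVectTensor.Cell2.app η j))

end Components

instance subsingleton_fiber {I : Type} (j : I) : Subsingleton {i // some i = some j} :=
  ⟨fun a b => Subtype.ext (Option.some.inj (a.2.trans b.2.symm))⟩

theorem subsingletonEquiv_map {ι : Type*} [Subsingleton ι] (i : ι) {M N : ι → Type*}
    [∀ i, AddCommGroup (M i)] [∀ i, Module k (M i)] [∀ i, AddCommGroup (N i)]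
    [∀ i, Module k (N i)] (L : ∀ i, M i →ₗ[k] N i) (x : ∀ i, M i) :
    PiTensorProduct.subsingletonEquiv i (PiTensorProduct.map L (PiTensorProduct.tprod k x)) =
      L i (PiTensorProduct.subsingletonEquiv i (PiTensorProduct.tprod k x)) := by
  simp

/-- The canonical identification of the one-fold tensor product `⨂ F_j ∘ id^*` with `F_j`. -/
def mTensorId (X : FinSetSqcup) (j : X.I)
    (F : ∀ i : {i // some i = some j}, Poly k (Sh k (X.S i.1))) :
    (mTensor fun i : {i // some i = some j} => (FinSetSqcup.Hom.id X).fn i.1 j i.2).obj F ⟶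
      F ⟨j, rfl⟩ :=
  ObjectProperty.homMk
    { app := fun V => FGModuleCat.ofHom (PiTensorProduct.subsingletonEquiv
        (s := fun i : {i // some i = some j} => (F i).obj.obj
          ((shPull k ((FinSetSqcup.Hom.id X).fn i.1 j i.2)).obj V))
        (⟨j, rfl⟩ : {i // some i = some j})).toLinearMap
      naturality := fun V W f => by
        ext : 1
        apply PiTensorProduct.ext
        ext x
        exact subsingletonEquiv_map (⟨j, rfl⟩ : {i // some i = some j})
          (fun i => ((F i).obj.map ((shPull k ((FinSetSqcup.Hom.id X).fn i.1 j i.2)).map f)).hom.hom)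
          x }

/-- The isomorphism `m_id ≅ id`, in one direction. -/
def polyMapId (X : FinSetSqcup) : polyMap A hk (𝟙 X) ⟶ 𝟙 (polyObj A hk X) :=
  ({  base_eq := rfl
      app := fun j =>
        { app := fun F => mTensorId X j F
          naturality := fun F G τ => by
            apply ObjectProperty.hom_ext
            ext V : 3
            apply PiTensorProduct.ext
            ext x
            exact subsingletonEquiv_map (⟨j, rfl⟩ : {i // some i = some j})
              (fun i => ((τ i).hom.app ((shPull k ((FinSetSqcup.Hom.id X).fn i.1 j i.2)).obj V)).hom.hom)
              x } } :
    TwoVectTensor.Cell2 (polyMap A hk (𝟙 X)) (TwoVectTensor.Cell1.id (polyObj A hk X)))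

instance polyMapId_isIso (X : FinSetSqcup) : IsIso (polyMapId (A := A) (hk := hk) X) :=
  cell_isIso (X := polyObj A hk X) (Y := X) _ fun j P V =>
    (PiTensorProduct.subsingletonEquiv (R := k)
      (s := fun i : {i // some i = some j} => (P i : Poly k (Sh k (X.S i.1))).obj.obj
          ((shPull k ((FinSetSqcup.Hom.id X).fn i.1 j i.2)).obj V))
      (⟨j, rfl⟩ : {i // some i = some j})).bijective

section Composition

variable {X Y Z : FinSetSqcup} (f : X ⟶ Y) (g : Y ⟶ Z) (c : Z.I)

theorem comp_mem (j : {j // FinSetSqcup.Hom.base g j = some c})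
    (i : {i // FinSetSqcup.Hom.base f i = some j.1}) :
    (FinSetSqcup.Hom.base f i.1).bind (FinSetSqcup.Hom.base g) = some c := by
  rw [i.2]
  exact j.2

/-- The canonical map
`⨂ F_i ((g f)_i^* V) ⟶ ⨂_j ⨂_{f i = j} F_i (f_i^* g_j^* V)`, for a multi-index `i` in the fibre of
the composite over `c`, and `j` in the fibre of `g` over `c`. -/
def compLin (F : ∀ i : {i // (FinSetSqcup.Hom.base f i).bind (FinSetSqcup.Hom.base g) = some c},
      Poly k (Sh k (X.S i.1))) (V : Sh k (Z.S c)) :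
    (⨂[k] i : {i // (FinSetSqcup.Hom.base f i).bind (FinSetSqcup.Hom.base g) = some c},
      (F i).obj.obj ((shPull k ((FinSetSqcup.Hom.comp f g).fn i.1 c i.2)).obj V)) →ₗ[k]
    ⨂[k] j : {j // FinSetSqcup.Hom.base g j = some c},
      ⨂[k] i : {i // FinSetSqcup.Hom.base f i = some j.1},
        (F ⟨i.1, comp_mem f g c j i⟩).obj.obj ((shPull k (FinSetSqcup.Hom.fn f i.1 j.1 i.2)).obj
          ((shPull k (FinSetSqcup.Hom.fn g j.1 c j.2)).obj V)) :=
  (PiTensorProduct.map fun j => PiTensorProduct.map fun i =>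
    ((F ⟨i.1, comp_mem f g c j i⟩).obj.map (pullCongr (fun s => FinSetSqcup.Hom.comp_fn f g i.2 j.2 _ s)
      V)).hom.hom) ∘ₗ
  nestTensor (fun (j : {j // FinSetSqcup.Hom.base g j = some c})
    (i : {i // FinSetSqcup.Hom.base f i = some j.1}) => ⟨i.1, comp_mem f g c j i⟩)
    (fiber_bijective (FinSetSqcup.Hom.base f) (FinSetSqcup.Hom.base g) c)
    (fun i => (F i).obj.obj ((shPull k ((FinSetSqcup.Hom.comp f g).fn i.1 c i.2)).obj V))

theorem compLin_tprod (F : ∀ i : {i // (FinSetSqcup.Hom.base f i).bind (FinSetSqcup.Hom.base g) =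
      some c}, Poly k (Sh k (X.S i.1))) (V : Sh k (Z.S c))
    (x : ∀ i : {i // (FinSetSqcup.Hom.base f i).bind (FinSetSqcup.Hom.base g) = some c},
      (F i).obj.obj ((shPull k ((FinSetSqcup.Hom.comp f g).fn i.1 c i.2)).obj V)) :
    compLin f g c F V (PiTensorProduct.tprod k x) =
      PiTensorProduct.tprod k fun j : {j // FinSetSqcup.Hom.base g j = some c} =>
        PiTensorProduct.tprod k fun i : {i // FinSetSqcup.Hom.base f i = some j.1} =>
          ((F ⟨i.1, comp_mem f g c j i⟩).obj.map
            (pullCongr (fun s => FinSetSqcup.Hom.comp_fn f g i.2 j.2 _ s) V)).hom.hom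
            (x ⟨i.1, comp_mem f g c j i⟩) := by
  unfold compLin
  rw [LinearMap.comp_apply, nestTensor_tprod]
  refine (PiTensorProduct.map_tprod _ _).trans ?_
  congr 1
  funext j
  exact PiTensorProduct.map_tprod _ _

theorem map_bijective {ι : Type*} {M N : ι → Type*} [∀ i, AddCommGroup (M i)]
    [∀ i, Module k (M i)] [∀ i, AddCommGroup (N i)] [∀ i, Module k (N i)]
    (L : ∀ i, M i →ₗ[k] N i) (h : ∀ i, Function.Bijective (L i)) :
    Function.Bijective (PiTensorProduct.map L) :=
  (PiTensorProduct.congr fun i => LinearEquiv.ofBijective (L i) (h i)).bijective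

theorem compLin_bijective (F : ∀ i : {i // (FinSetSqcup.Hom.base f i).bind
      (FinSetSqcup.Hom.base g) = some c}, Poly k (Sh k (X.S i.1))) (V : Sh k (Z.S c)) :
    Function.Bijective (compLin f g c F V) := by
  unfold compLin
  rw [LinearMap.coe_comp]
  exact (map_bijective _ fun j => map_bijective _ fun i => pullCongr_bijective _ _ _).comp
    (nestTensor_bijective _ _ _)

/-- The tensor functor `(F_i) ↦ ⨂ F_i ∘ φ_i^*` of a morphism of families, at the index `j`. -/
abbrev mAt {X Y : FinSetSqcup} (f : X ⟶ Y) (j : Y.I) :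
    (∀ i : {i // FinSetSqcup.Hom.base f i = some j}, Poly k (Sh k (X.S i.1))) ⥤
      Poly k (Sh k (Y.S j)) :=
  mTensor fun i : {i // FinSetSqcup.Hom.base f i = some j} => FinSetSqcup.Hom.fn f i.1 j i.2

/-- The restriction of a family of functors, indexed by the fibre of a composite, to a block. -/
abbrev block (F : ∀ i : {i // FinSetSqcup.Hom.base (f ≫ g) i = some c}, Poly k (Sh k (X.S i.1)))
    (j : {j // FinSetSqcup.Hom.base g j = some c}) :
    ∀ i : {i // FinSetSqcup.Hom.base f i = some j.1}, Poly k (Sh k (X.S i.1)) :=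
  fun i => F ⟨i.1, comp_mem f g c j i⟩

/-- The isomorphism `m_(g f) ≅ m_g m_f`, in one direction and at one index and object. -/
def compNat (F : ∀ i : {i // FinSetSqcup.Hom.base (f ≫ g) i = some c}, Poly k (Sh k (X.S i.1))) :
    (mAt (f ≫ g) c).obj F ⟶ (mAt g c).obj fun j => (mAt f j.1).obj (block f g c F j) :=
  ObjectProperty.homMk
    { app := fun V => FGModuleCat.ofHom (compLin f g c F V)
      naturality := fun V W φ => by
        apply FGModuleCat.hom_ext
        apply PiTensorProduct.ext
        ext x
        refine (congrArg (compLin f g c F W) (PiTensorProduct.map_tprod _ x)).trans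
          ((compLin_tprod f g c F W _).trans (Eq.trans ?_ ((congrArg _
            (compLin_tprod f g c F V x)).trans (PiTensorProduct.map_tprod _ _)).symm))
        congr 1
        funext j
        refine Eq.trans ?_ (PiTensorProduct.map_tprod _ _).symm
        congr 1
        funext i
        have h := pullCongr_naturality
          (fun s => FinSetSqcup.Hom.comp_fn f g i.2 j.2 (comp_mem f g c j i) s) φ
        have h2 := congrArg (F ⟨i.1, comp_mem f g c j i⟩).obj.map h
        rw [Functor.map_comp, Functor.map_comp] at h2
        exact (LinearMap.congr_fun (congrArg (fun t => t.hom.hom) h2) _).symm }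

theorem compNat_naturality {F G : ∀ i : {i // FinSetSqcup.Hom.base (f ≫ g) i = some c},
      Poly k (Sh k (X.S i.1))} (τ : F ⟶ G) :
    (mAt (f ≫ g) c).map τ ≫ compNat f g c G = compNat f g c F ≫
      (mAt g c).map fun j => (mAt f j.1).map fun i => τ ⟨i.1, comp_mem f g c j i⟩ := by
  apply ObjectProperty.hom_ext
  apply NatTrans.ext
  funext V
  apply FGModuleCat.hom_ext
  apply PiTensorProduct.ext
  ext x
  refine (congrArg (compLin f g c G V) (PiTensorProduct.map_tprod _ x)).trans
    ((compLin_tprod f g c G V _).trans (Eq.trans ?_ ((congrArg _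
      (compLin_tprod f g c F V x)).trans (PiTensorProduct.map_tprod _ _)).symm))
  congr 1
  funext j
  refine Eq.trans ?_ (PiTensorProduct.map_tprod _ _).symm
  congr 1
  funext i
  have h2 := (τ ⟨i.1, comp_mem f g c j i⟩).hom.naturality
    (pullCongr (fun s => FinSetSqcup.Hom.comp_fn f g i.2 j.2 (comp_mem f g c j i) s) V)
  exact (LinearMap.congr_fun (congrArg (fun t => t.hom.hom) h2) _).symm

/-- The isomorphism `m_(g f) ≅ m_g m_f`, in one direction. -/
def polyMapComp : polyMap A hk (f ≫ g) ⟶ polyMap A hk f ≫ polyMap A hk g :=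
  ({  base_eq := rfl
      app := fun c =>
        { app := fun F => compNat f g c F
          naturality := fun F G τ => compNat_naturality f g c τ } } :
    TwoVectTensor.Cell2 (polyMap A hk (f ≫ g)) ((polyMap A hk f).comp (polyMap A hk g)))

instance polyMapComp_isIso : IsIso (polyMapComp (A := A) (hk := hk) f g) :=
  cell_isIso (X := polyObj A hk X) (Y := Z) _ fun c P V => compLin_bijective f g c P V

end Composition

section Coherence

theorem hom_base_eq {X Y : FinSetSqcup} {f f' : X ⟶ Y} (h : f = f') {i : X.I} {j : Y.I}
    (hi : FinSetSqcup.Hom.base f' i = some j) : FinSetSqcup.Hom.base f i = some j := by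
  rw [h]
  exact hi

theorem hom_fn_eq {X Y : FinSetSqcup} {f f' : X ⟶ Y} (h : f = f') {i : X.I} {j : Y.I}
    (hi : FinSetSqcup.Hom.base f' i = some j) (s : X.S i) :
    FinSetSqcup.Hom.fn f i j (hom_base_eq h hi) s = FinSetSqcup.Hom.fn f' i j hi s := by
  subst h
  rfl

/-- The canonical map `m_f ⟶ m_f'` for equal morphisms `f` and `f'`. -/
def eqNat {X Y : FinSetSqcup} {f f' : X ⟶ Y} (h : f = f') (j : Y.I)
    (P : ∀ i : {i // FinSetSqcup.Hom.base f i = some j}, Poly k (Sh k (X.S i.1))) :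
    (mAt f j).obj P ⟶ (mAt f' j).obj fun i => P ⟨i.1, hom_base_eq h i.2⟩ :=
  eqToHom (by subst h; rfl)

theorem eqNat_tprod {X Y : FinSetSqcup} {f f' : X ⟶ Y} (h : f = f') (j : Y.I)
    (P : ∀ i : {i // FinSetSqcup.Hom.base f i = some j}, Poly k (Sh k (X.S i.1)))
    (V : Sh k (Y.S j)) (x : ∀ i, (P i).obj.obj ((shPull k (f.fn i.1 j i.2)).obj V)) :
    ((eqNat h j P).hom.app V).hom.hom (PiTensorProduct.tprod k x) =
      PiTensorProduct.tprod k fun i : {i // FinSetSqcup.Hom.base f' i = some j} =>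
        ((P ⟨i.1, hom_base_eq h i.2⟩).obj.map (pullCongr (hom_fn_eq h i.2) V)).hom.hom
          (x ⟨i.1, hom_base_eq h i.2⟩) := by
  subst h
  refine Eq.trans (b := PiTensorProduct.tprod k x) rfl (congrArg _ (funext fun i => ?_))
  have : pullCongr (hom_fn_eq (f := f) rfl i.2) V = 𝟙 _ := rfl
  refine Eq.symm (Eq.trans (congrArg (fun t => ((P i).obj.map t).hom.hom (x i)) this) ?_)
  rw [CategoryTheory.Functor.map_id]
  rfl

theorem app_eqToHom {X Y : FinSetSqcup} {f f' : X ⟶ Y} (h : f = f')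
    (e : polyMap A hk f = polyMap A hk f') (j : Y.I)
    (P : ∀ i : {i // FinSetSqcup.Hom.base f i = some j}, Poly k (Sh k (X.S i.1))) :
    (TwoVectTensor.Cell2.app (eqToHom e) j).app P = eqNat h j P := by
  subst h
  rfl

theorem left_unitor_nat {X Y : FinSetSqcup} (f : X ⟶ Y) (j : Y.I)
    (P : ∀ i : {i // FinSetSqcup.Hom.base (𝟙 X ≫ f) i = some j}, Poly k (Sh k (X.S i.1))) :
    compNat (𝟙 X) f j P ≫ ((mAt f j).map fun i => mTensorId X i.1 (block (𝟙 X) f j P i)) =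
      eqNat (Category.id_comp f) j P := by
  apply ObjectProperty.hom_ext
  apply NatTrans.ext
  funext V
  apply FGModuleCat.hom_ext
  apply PiTensorProduct.ext
  ext x
  refine Eq.trans ?_ (eqNat_tprod (Category.id_comp f) j P V x).symm
  refine Eq.trans (congrArg (PiTensorProduct.map _) (compLin_tprod (𝟙 X) f j P V x)) ?_
  refine (PiTensorProduct.map_tprod _ _).trans ?_
  congr 1
  funext i
  exact PiTensorProduct.subsingletonEquiv_apply_tprod _ _

theorem right_unitor_nat {X Y : FinSetSqcup} (f : X ⟶ Y) (j : Y.I)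
    (P : ∀ i : {i // FinSetSqcup.Hom.base (f ≫ 𝟙 Y) i = some j}, Poly k (Sh k (X.S i.1))) :
    compNat f (𝟙 Y) j P ≫ mTensorId Y j (fun i => (mAt f i.1).obj (block f (𝟙 Y) j P i)) =
      eqNat (Category.comp_id f) j P := by
  apply ObjectProperty.hom_ext
  apply NatTrans.ext
  funext V
  apply FGModuleCat.hom_ext
  apply PiTensorProduct.ext
  ext x
  refine Eq.trans ?_ (eqNat_tprod (Category.comp_id f) j P V x).symm
  refine Eq.trans (congrArg (PiTensorProduct.subsingletonEquiv
    (⟨j, rfl⟩ : {i : Y.I // some i = some j})) (compLin_tprod f (𝟙 Y) j P V x)) ?_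
  exact PiTensorProduct.subsingletonEquiv_apply_tprod
    (⟨j, rfl⟩ : {i : Y.I // some i = some j}) _

theorem map_coherence {B : Type*} [Category B] (F : B ⥤ FGModuleCat.{u} k)
    {V₁ V₂ V₃ V₄ W : B} (a : V₁ ⟶ V₂) (b : V₂ ⟶ V₃) (c : V₃ ⟶ V₄) (a' : V₁ ⟶ W) (b' : W ⟶ V₄)
    (h : a ≫ b ≫ c = a' ≫ b') (x : F.obj V₁) :
    (F.map c).hom.hom ((F.map b).hom.hom ((F.map a).hom.hom x)) =
      (F.map b').hom.hom ((F.map a').hom.hom x) := by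
  have h' := congrArg F.map h
  rw [F.map_comp, F.map_comp, F.map_comp] at h'
  exact LinearMap.congr_fun (congrArg (fun t => t.hom.hom) h') x

theorem eqToHom_coherence {B : Type*} [Category B] {V₁ V₂ V₃ V₄ W : B} (a : V₁ = V₂) (b : V₂ = V₃)
    (c : V₃ = V₄) (a' : V₁ = W) (b' : W = V₄) :
    eqToHom a ≫ eqToHom b ≫ eqToHom c = eqToHom a' ≫ eqToHom b' := by
  simp

section Associator

variable {X Y Z W : FinSetSqcup} (f : X ⟶ Y) (g : Y ⟶ Z) (h : Z ⟶ W) (d : W.I)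
  (P : ∀ i : {i // FinSetSqcup.Hom.base ((f ≫ g) ≫ h) i = some d}, Poly k (Sh k (X.S i.1)))

/-- The family `P`, indexed by the fibre of the reassociated composite. -/
abbrev reassoc : ∀ i : {i // FinSetSqcup.Hom.base (f ≫ g ≫ h) i = some d},
    Poly k (Sh k (X.S i.1)) :=
  fun i => P ⟨i.1, hom_base_eq (Category.assoc f g h) i.2⟩

theorem associator_nat :
    eqNat (Category.assoc f g h) d P ≫ compNat f (g ≫ h) d (reassoc f g h d P) ≫
        compNat g h d (fun j => (mAt f j.1).obj (block f (g ≫ h) d (reassoc f g h d P) j)) =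
      compNat (f ≫ g) h d P ≫
        (mAt h d).map fun c => compNat f g c.1 (block (f ≫ g) h d P c) := by
  apply ObjectProperty.hom_ext
  apply NatTrans.ext
  funext V
  apply FGModuleCat.hom_ext
  apply PiTensorProduct.ext
  ext x
  have h1 := eqNat_tprod (Category.assoc f g h) d P V x
  have h2 := (congrArg (compLin f (g ≫ h) d (reassoc f g h d P) V) h1).trans
    (compLin_tprod f (g ≫ h) d _ V _)
  have h3 := (congrArg (compLin g h d (fun j => (mAt f j.1).obj
    (block f (g ≫ h) d (reassoc f g h d P) j)) V) h2).trans (compLin_tprod g h d _ V _)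
  refine Eq.trans h3 ?_
  have h4 := (congrArg (PiTensorProduct.map fun c : {c // FinSetSqcup.Hom.base h c = some d} =>
    compLin f g c.1 (block (f ≫ g) h d P c) ((shPull k (FinSetSqcup.Hom.fn h c.1 d c.2)).obj V))
      (compLin_tprod (f ≫ g) h d P V x)).trans (PiTensorProduct.map_tprod _ _)
  refine Eq.trans ?_ h4.symm
  congr 1
  funext c
  refine Eq.trans ?_ (compLin_tprod f g c.1 (block (f ≫ g) h d P c)
    ((shPull k (FinSetSqcup.Hom.fn h c.1 d c.2)).obj V) _).symm
  congr 1
  funext j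
  refine (PiTensorProduct.map_tprod _ _).trans ?_
  congr 1
  funext i
  refine map_coherence (P ⟨i.1, comp_mem (f ≫ g) h d c ⟨i.1, comp_mem f g c.1 j i⟩⟩).obj
    _ _ _ _ _ ?_ _
  funext s
  exact eqToHom_coherence (B := FGModuleCat.{u} k) _ _
    (congrArg V (FinSetSqcup.Hom.comp_fn g h j.2 c.2 (comp_mem g h d c j) _)) _ _

end Associator

theorem polyMap_left_unitor {X Y : FinSetSqcup} (f : X ⟶ Y)
    (e : polyMap A hk (𝟙 X ≫ f) = polyMap A hk f) :
    polyMapComp (𝟙 X) f ≫ Bicategory.whiskerRight (polyMapId X) (polyMap A hk f) ≫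
      (Bicategory.leftUnitor (polyMap A hk f)).hom = eqToHom e :=
  TwoVectTensor.cell2_ext fun j P =>
    (congrArg (compNat (𝟙 X) f j P ≫ ·) (Category.comp_id _)).trans
      ((left_unitor_nat f j P).trans (app_eqToHom (Category.id_comp f) e j P).symm)

theorem polyMap_right_unitor {X Y : FinSetSqcup} (f : X ⟶ Y)
    (e : polyMap A hk (f ≫ 𝟙 Y) = polyMap A hk f) :
    polyMapComp f (𝟙 Y) ≫ Bicategory.whiskerLeft (polyMap A hk f) (polyMapId Y) ≫
      (Bicategory.rightUnitor (polyMap A hk f)).hom = eqToHom e :=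
  TwoVectTensor.cell2_ext fun j P =>
    (congrArg (compNat f (𝟙 Y) j P ≫ ·) (Category.comp_id _)).trans
      ((right_unitor_nat f j P).trans (app_eqToHom (Category.comp_id f) e j P).symm)

theorem polyMap_associator {X Y Z W : FinSetSqcup} (f : X ⟶ Y) (g : Y ⟶ Z) (h : Z ⟶ W)
    (e : polyMap A hk ((f ≫ g) ≫ h) = polyMap A hk (f ≫ g ≫ h)) :
    eqToHom e ≫ polyMapComp f (g ≫ h) ≫
        Bicategory.whiskerLeft (polyMap A hk f) (polyMapComp g h) =
      polyMapComp (f ≫ g) h ≫ Bicategory.whiskerRight (polyMapComp f g) (polyMap A hk h) ≫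
        (Bicategory.associator (polyMap A hk f) (polyMap A hk g) (polyMap A hk h)).hom :=
  TwoVectTensor.cell2_ext fun d P =>
    (congrArg (· ≫ compNat f (g ≫ h) d (reassoc f g h d P) ≫
      compNat g h d (fun j => (mAt f j.1).obj (block f (g ≫ h) d (reassoc f g h d P) j)))
      (app_eqToHom (Category.assoc f g h) e d P)).trans
      ((associator_nat f g h d P).trans
        (congrArg (compNat (f ≫ g) h d P ≫ ·) (Category.comp_id _).symm))

end Coherence

/-- An oplax functor on a category `E`, from its values on objects and morphisms. -/
def mkOplax {E : Type*} [Category E] {B : Type*} [Bicategory B] (obj : E → B)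
    (map : ∀ {X Y : E}, (X ⟶ Y) → (obj X ⟶ obj Y)) (mapId : ∀ X : E, map (𝟙 X) ⟶ 𝟙 (obj X))
    (mapComp : ∀ {X Y Z : E} (f : X ⟶ Y) (g : Y ⟶ Z), map (f ≫ g) ⟶ map f ≫ map g)
    (assoc : ∀ {X Y Z W : E} (f : X ⟶ Y) (g : Y ⟶ Z) (h : Z ⟶ W)
      (e : map ((f ≫ g) ≫ h) = map (f ≫ g ≫ h)),
      eqToHom e ≫ mapComp f (g ≫ h) ≫ Bicategory.whiskerLeft (map f) (mapComp g h) =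
        mapComp (f ≫ g) h ≫ Bicategory.whiskerRight (mapComp f g) (map h) ≫
          (Bicategory.associator (map f) (map g) (map h)).hom)
    (left : ∀ {X Y : E} (f : X ⟶ Y) (e : map (𝟙 X ≫ f) = map f),
      mapComp (𝟙 X) f ≫ Bicategory.whiskerRight (mapId X) (map f) ≫
        (Bicategory.leftUnitor (map f)).hom = eqToHom e)
    (right : ∀ {X Y : E} (f : X ⟶ Y) (e : map (f ≫ 𝟙 Y) = map f),
      mapComp f (𝟙 Y) ≫ Bicategory.whiskerLeft (map f) (mapId Y) ≫
        (Bicategory.rightUnitor (map f)).hom = eqToHom e) :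
    OplaxFunctor (LocallyDiscrete E) B :=
  oplaxFunctorOfIsLocallyDiscrete (fun X => obj X.as) (fun f => map f.as)
    (fun X => mapId X.as) (fun f g => mapComp f.as g.as)
    (fun f g h => assoc f.as g.as h.as _) (fun f => left f.as _) (fun f => right f.as _)

/-- The morphism of fibrations `S ↦ P(Sh(S))`, as an oplax functor. -/
def polyOplax (A : AddSubmonoid ℤ) (hk : PolyIsGradedTwoVect k) :
    OplaxFunctor (LocallyDiscrete FinSetSqcup) (TwoVectTensor k A) :=
  mkOplax (polyObj A hk) (polyMap A hk) polyMapId polyMapComp polyMap_associator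
    polyMap_left_unitor polyMap_right_unitor

instance polyOplax_mapId_isIso (X : LocallyDiscrete FinSetSqcup) :
    IsIso ((polyOplax A hk).mapId X) :=
  polyMapId_isIso X.as

instance polyOplax_mapComp_isIso {X Y Z : LocallyDiscrete FinSetSqcup} (f : X ⟶ Y) (g : Y ⟶ Z) :
    IsIso ((polyOplax A hk).mapComp f g) :=
  polyMapComp_isIso f.as g.as

/-- The assignment `S ↦ P(Sh(S))`, with the functors `m_(φ_i) : (F_i) ↦ ⨂ F_i ∘ φ_i^*`. On 2-cells it
is given by the canonical isomorphisms `(ψ φ)^* ≅ φ^* ψ^*`. -/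
def polyH (A : AddSubmonoid ℤ) (hk : PolyIsGradedTwoVect k) :
    Pseudofunctor (LocallyDiscrete FinSetSqcup) (TwoVectTensor k A) :=
  Pseudofunctor.mkOfOplax' (polyOplax A hk)

section OneVariable

variable {S T : Type} (L : Sh k T ⥤ Sh k S) [L.Additive] [L.Linear k]

/-- Precomposition with a linear functor `L : Sh(T) ⥤ Sh(S)`, as a functor of one variable. -/
def precompUnary (j : PUnit) :
    (∀ i : {i : PUnit // some i = some j}, Poly k (Sh k S)) ⥤ Poly k (Sh k T) :=
  Pi.eval (fun i : {i : PUnit // some i = some j} => Poly k (Sh k S)) ⟨j, rfl⟩ ⋙ precomp L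

theorem precompUnary_multilinear (j : PUnit) :
    IsMultilinearFunctor k (precompUnary (k := k) L j) := fun V W =>
  ⟨{  toFun := fun f => (precomp L).map (f ⟨j, rfl⟩)
      map_update_add' := by
        intro _ f i a b
        obtain rfl := Subsingleton.elim ⟨j, rfl⟩ i
        simp only [Function.update_self]
        rfl
      map_update_smul' := by
        intro _ f i a b
        obtain rfl := Subsingleton.elim ⟨j, rfl⟩ i
        simp only [Function.update_self]
        rfl }, fun _ => rfl⟩

end OneVariable

theorem precompUnary_degreeZero {S T : FintypeCat.{0}} (L : Sh k T ⥤ Sh k S) [hL : L.Additive]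
    [hL' : L.Linear k] (j : PUnit) :
    IsDegreeZero (C := fun i : {i : PUnit // some i = some j} => polySh hk S) (D := polySh hk T)
      (precompUnary L j) := fun V n h => by
  have e : (∑ᶠ i : {i : PUnit // some i = some j}, n i) = n ⟨j, rfl⟩ := by
    rw [finsum_eq_single _ ⟨j, rfl⟩]
    exact fun i hne => (hne (Subsingleton.elim _ _)).elim
  rw [e]
  exact IsHomogeneousFunctor.precomp (h ⟨j, rfl⟩) hL hL'

/-- A one-variable 1-morphism `P(Sh(S)) ⟶ P(Sh(T))`, over the identity of the index set, given by
precomposition with a linear functor `L : Sh(T) ⥤ Sh(S)`. -/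
def precompCell (A : AddSubmonoid ℤ) (hk : PolyIsGradedTwoVect k) {S T : FintypeCat.{0}}
    (L : Sh k T ⥤ Sh k S) [hL : L.Additive] [hL' : L.Linear k] :
    polyObj A hk (FinSetSqcup.single S) ⟶ polyObj A hk (FinSetSqcup.single T) :=
  ({  base := some
      func := fun j => precompUnary L j
      multilinear := fun j => precompUnary_multilinear L j
      bounded := fun j => IsDegreeZero.isBounded A (precompUnary_degreeZero (hk := hk) L j) } :
    TwoVectTensor.Cell1 (polyObj A hk (FinSetSqcup.single S))
      (polyObj A hk (FinSetSqcup.single T)))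

/-- The functor `m_φ(F) = F ∘ φ^*`. -/
def mCell (A : AddSubmonoid ℤ) (hk : PolyIsGradedTwoVect k) {S T : FintypeCat.{0}} (φ : S → T) :
    polyObj A hk (FinSetSqcup.single S) ⟶ polyObj A hk (FinSetSqcup.single T) :=
  precompCell A hk (shPull k φ)

/-- The functor `Δ_φ(F) = F ∘ φ_*`. -/
def deltaCell (A : AddSubmonoid ℤ) (hk : PolyIsGradedTwoVect k) {S T : FintypeCat.{0}}
    (φ : S → T) : polyObj A hk (FinSetSqcup.single T) ⟶ polyObj A hk (FinSetSqcup.single S) :=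
  precompCell A hk (shPush k φ)

/-- The stalk functor `Sh({1}) ⥤ Vect`. -/
def stalk (k : Type u) [Field k] : Sh k PUnit ⥤ FGModuleCat.{u} k :=
  Pi.eval _ PUnit.unit

instance : (stalk k).Additive where
  map_add := rfl

instance : (stalk k).Linear k where
  map_smul _ _ := rfl

/-- The functor from the category `P` of polynomial functors `Vect ⥤ Vect` to `P(Sh({1}))`, given
by composition with the stalk functor. -/
def fromP (k : Type u) [Field k] : Poly k (FGModuleCat.{u} k) ⥤ Poly k (Sh k PUnit) :=
  precomp (stalk k)

end PolyH

end

end SSH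

namespace SSH

noncomputable section

/-! ### Polynomial identities -/

section Coefficients

variable {k : Type u} [Field k] [Infinite k]

/-! The statement has a formal half and a representation-theoretic half.

The formal half is the pair of adjunctions and the Beck–Chevalley condition. On finite discrete sets
products are also sums, so `φ_*` is both right and left adjoint to `φ^*` (`pullPush`, `pushPull`).
Precomposition reverses an adjunction (`precompAdj`), so `F ↦ F ∘ φ^*` and `F ↦ F ∘ φ_*` are adjoint
to each other on both sides. For a Cartesian square the two mates are obtained by applying a
polynomial functor to the base change maps `c_* a^* ⟶ d^* b_*` and `b^* d_* ⟶ a_* c^*`, which are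
invertible because the upper left corner is the fibre product (`baseChangeRight_isIso`,
`baseChangeLeft_isIso`). The structure is built from one-fold tensor products instead of plain
composition, and the condition is transported along `singleIso`.

The other half needs bases: families of mutually orthogonal objects with scalar endomorphisms, of
which every object is a finite direct sum (`IsBasis`). A polynomial functor splits by degree,
according to the coefficients of `F.map (c • f)` as a polynomial in `c`. For `F` homogeneous of
degree `n`, the full polarization of its action is compatible with composition, and it writes `n! •
𝟙 (F V)` as a sum of maps through `F (k^n)` (`sum_polar_comp_polar`). Averaging with it turns a
linear map between values at `k^n` into a natural transformation, so each natural transformation has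
a quasi-inverse (`exists_quasiInverse`). This is semisimplicity. By the same formula every nonzero
functor of degree `n` receives a nonzero map from the `n`-th tensor power, so the indecomposable
functors of degree `n` are summands of it, finitely many up to isomorphism.

That their endomorphisms are scalars, although `k` need not be algebraically closed, is proved by a
lowest weight argument, by induction on the degree (`IsIndec.end_scalar`). Scaling `V` grades the
functor `V ↦ L (k ⊕ V)`, and its lowest weight part `X` has degree less than `n`. Factoring block
matrices into lower, diagonal and upper triangular ones shows that compressing `L.map g` to `X`
gives nothing outside the span of the maps `X.map f`. Hence `X` is again indecomposable. By
induction an endomorphism of `L` acts on `X` by a scalar, so it has an eigenvector, and by Schur's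
lemma it is that scalar.

In several variables, `F (V, -)` is decomposed along the basis of the last variable. The
multiplicity spaces are polynomial in `V`, so tensor products of basis members form a basis
(`IsBasis.box`). By induction on `S`, external tensor products form a basis of `P(Sh(S))`, finite in
each degree (`isBasis_ext`). This makes `P(Sh(S))` a graded 2-vector space.

A coCartesian morphism of families of finite sets has bijective blocks, and then `m` takes
combinations of basis members to a basis. Multilinear functors and their transformations can be
prescribed freely on bases (`IsMultiBasis.exists_functor`, `IsMultiBasis.exists_nat`), so they
factor through `m` essentially uniquely. This is the coCartesian property
(`TwoVectTensor.Cell1.isCoCartesian`). -/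

theorem coeff_eq_zero {W : Type*} [AddCommGroup W] [Module k W] (s : Finset ℕ) (w : ℕ → W)
    (h : ∀ c : k, ∑ n ∈ s, c ^ n • w n = 0) : ∀ n ∈ s, w n = 0 := by
  intro n hn
  rw [← Module.forall_dual_apply_eq_zero_iff k]
  intro ξ
  -- Functionals separate vectors, and each functional turns the hypothesis into a scalar polynomial
  -- vanishing on an infinite field.
  have h0 : (∑ m ∈ s, Polynomial.monomial m (ξ (w m)) : Polynomial k) = 0 := by
    apply Polynomial.funext
    intro c
    have := congrArg ξ (h c)
    simp only [map_sum, map_smul, map_zero, smul_eq_mul] at this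
    simp only [Polynomial.eval_finsetSum, Polynomial.eval_monomial, Polynomial.eval_zero]
    rw [← this]
    exact Finset.sum_congr rfl fun m _ => mul_comm _ _
  have h1 := congrArg (fun p => Polynomial.coeff p n) h0
  simp only [Polynomial.finsetSum_coeff, Polynomial.coeff_monomial, Polynomial.coeff_zero] at h1
  rw [Finset.sum_eq_single_of_mem n hn (fun m _ hm => if_neg hm), if_pos rfl] at h1
  exact h1

theorem coeff_unique {W : Type*} [AddCommGroup W] [Module k W] (s : Finset ℕ) (w w' : ℕ → W)
    (h : ∀ c : k, ∑ n ∈ s, c ^ n • w n = ∑ n ∈ s, c ^ n • w' n) : ∀ n ∈ s, w n = w' n := by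
  intro n hn
  rw [← sub_eq_zero]
  refine coeff_eq_zero (k := k) s (fun n => w n - w' n) (fun c => ?_) n hn
  simp only [smul_sub, Finset.sum_sub_distrib, h c, sub_self]

end Coefficients

/-! ### Closure properties of homogeneous and polynomial maps. -/

section PolynomialMaps

variable {k : Type u} [Field k] {U W : Type*} [AddCommGroup U] [Module k U] [AddCommGroup W]
  [Module k W]

theorem IsHomogeneousMap.map_smul {n : ℕ} {f : U → W} (hf : IsHomogeneousMap k n f) (c : k)
    (x : U) : f (c • x) = c ^ n • f x := by
  obtain ⟨M, hM⟩ := hf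
  rw [hM, hM, M.map_smul_univ (fun _ => c) (fun _ => x)]
  simp

theorem IsHomogeneousMap.linear_comp {n : ℕ} {f : U → W} (hf : IsHomogeneousMap k n f)
    {W' : Type*} [AddCommGroup W'] [Module k W'] (L : W →ₗ[k] W') :
    IsHomogeneousMap k n (fun x => L (f x)) := by
  obtain ⟨M, hM⟩ := hf
  exact ⟨L.compMultilinearMap M, fun x => by simp [hM]⟩

theorem IsPolynomialMap.linear_comp {d : ℕ} {f : U → W} (hf : IsPolynomialMap k d f)
    {W' : Type*} [AddCommGroup W'] [Module k W'] (L : W →ₗ[k] W') :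
    IsPolynomialMap k d (fun x => L (f x)) := by
  obtain ⟨p, hp, h⟩ := hf
  exact ⟨fun n x => L (p n x), fun n => (hp n).linear_comp L, fun x => by simp [h]⟩

/-- Extending the components by zero beyond `d` allows maps with different degree bounds to be
compared index by index. -/
theorem IsPolynomialMap.exists_components {d : ℕ} {f : U → W} (hf : IsPolynomialMap k d f) :
    ∃ p : ℕ → U → W, (∀ n, IsHomogeneousMap k n (p n)) ∧ (∀ n, d < n → p n = 0) ∧
      ∀ x, f x = ∑ n ∈ Finset.range (d + 1), p n x := by
  obtain ⟨p, hp, h⟩ := hf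
  refine ⟨fun n => if hn : n < d + 1 then p ⟨n, hn⟩ else fun _ => 0, fun n => ?_, fun n hn => ?_,
    fun x => ?_⟩
  · by_cases hn : n < d + 1
    · simpa [hn] using hp ⟨n, hn⟩
    · simpa [hn] using IsHomogeneousMap.zero n
  · have : ¬n < d + 1 := by omega
    simp only [this, dif_neg, not_false_eq_true]
    rfl
  · rw [h, Finset.sum_range]
    exact Finset.sum_congr rfl fun n _ => by simp only [n.2, dif_pos, Fin.eta]

theorem IsPolynomialMap.mono {d e : ℕ} (hde : d ≤ e) {f : U → W} (hf : IsPolynomialMap k d f) :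
    IsPolynomialMap k e f := by
  obtain ⟨p, hp, h⟩ := hf
  have := IsPolynomialMap.sum (k := k) (d := e) Finset.univ (f := p) fun n _ =>
    (hp n).isPolynomialMap (by omega)
  convert this using 1
  exact funext h

theorem IsPolynomialMap.const (d : ℕ) (w : W) : IsPolynomialMap k d (fun _ : U => w) :=
  IsHomogeneousMap.isPolynomialMap (n := 0) (Nat.zero_le d)
    ⟨MultilinearMap.constOfIsEmpty k _ w, fun _ => rfl⟩

theorem IsHomogeneousMap.linear (L : U →ₗ[k] W) : IsHomogeneousMap k 1 (fun x => L x) :=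
  IsHomogeneousMap.of_multilinear (ι := Unit) (by simp)
    (LinearMap.compMultilinearMap L (MultilinearMap.ofSubsingleton k U U () LinearMap.id))
    fun _ => rfl

/-- Each degree `n` form, expanded at `c + L x`, spreads over the degrees `0, …, n`: homogeneity is
lost, but the bound `d` survives. -/
theorem IsPolynomialMap.comp_affine {d : ℕ} {f : U → W} (hf : IsPolynomialMap k d f)
    {U' : Type*} [AddCommGroup U'] [Module k U'] (L : U' →ₗ[k] U) (c : U) :
    IsPolynomialMap k d (fun x => f (c + L x)) := by
  obtain ⟨p, hp, h⟩ := hf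
  have h1 : ∀ n, IsPolynomialMap k d (fun x => p n (c + L x)) := by
    intro n
    obtain ⟨M, hM⟩ := hp n
    have := IsPolynomialMap.multilinear M (fun _ => 1) (f := fun _ x => c + L x) fun _ =>
      (IsPolynomialMap.const 1 c).add ((IsHomogeneousMap.linear L).isPolynomialMap le_rfl)
    rw [finsum_eq_sum_of_fintype] at this
    simp only [hM]
    exact this.mono (by simp; omega)
  have := IsPolynomialMap.sum (k := k) (d := d) Finset.univ fun n _ => h1 n
  convert this using 1
  exact funext fun x => h _

end PolynomialMaps

/-! ### Components of polynomial functors -/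

section Components

variable {k : Type u} [Field k] {A : Type v} [Category.{w'} A] [Preadditive A] [Linear k A]

/-- `p n f` are the homogeneous components of the maps `F.map f`. -/
structure IsComponents (F : A ⥤ FGModuleCat.{u} k) (d : ℕ)
    (p : ℕ → ∀ {V W : A}, (V ⟶ W) → (F.obj V ⟶ F.obj W)) : Prop where
  homogeneous : ∀ n (V W : A), IsHomogeneousMap k n fun f : V ⟶ W => p n f
  vanish : ∀ n, d < n → ∀ {V W : A} (f : V ⟶ W), p n f = 0
  map_eq : ∀ {V W : A} (f : V ⟶ W), F.map f = ∑ n ∈ Finset.range (d + 1), p n f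

theorem IsPolynomialFunctor.exists_components {F : A ⥤ FGModuleCat.{u} k} {d : ℕ}
    (hF : ∀ V W : A, IsPolynomialMap k d fun f : V ⟶ W => F.map f) :
    ∃ p : ℕ → ∀ {V W : A}, (V ⟶ W) → (F.obj V ⟶ F.obj W), IsComponents F d p := by
  choose p hp h0 h using fun V W => (hF V W).exists_components
  exact ⟨fun n V W f => p V W n f, fun n V W => hp V W n,
    fun n hn V W f => by rw [h0 V W n hn]; rfl, fun {V W} f => h V W f⟩

namespace IsComponents

variable {F : A ⥤ FGModuleCat.{u} k} {d : ℕ}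
  {p : ℕ → ∀ {V W : A}, (V ⟶ W) → (F.obj V ⟶ F.obj W)} (hp : IsComponents F d p)

include hp

theorem smul (n : ℕ) {V W : A} (c : k) (f : V ⟶ W) : p n (c • f) = c ^ n • p n f :=
  (hp.homogeneous n V W).map_smul c f

theorem map_smul {V W : A} (c : k) (f : V ⟶ W) :
    F.map (c • f) = ∑ n ∈ Finset.range (d + 1), c ^ n • p n f := by
  rw [hp.map_eq]
  exact Finset.sum_congr rfl fun n _ => hp.smul n c f

variable [Infinite k]

/-- Both sides are the coefficient of `c ^ n` in `F.map (c • (f ≫ g))`, and over an infinite field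
coefficients are determined by values. -/
theorem comp_map (n : ℕ) {V W X : A} (f : V ⟶ W) (g : W ⟶ X) :
    p n f ≫ F.map g = p n (f ≫ g) := by
  by_cases hn : n ∈ Finset.range (d + 1)
  · refine coeff_unique (k := k) _ (fun n => p n f ≫ F.map g) (fun n => p n (f ≫ g))
      (fun c => ?_) n hn
    simp only [← Linear.smul_comp, ← Preadditive.sum_comp]
    rw [← hp.map_smul, ← hp.map_smul, ← F.map_comp, Linear.smul_comp]
  · simp only [Finset.mem_range, not_lt] at hn
    rw [hp.vanish n (by omega), hp.vanish n (by omega), Limits.zero_comp]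

theorem map_comp (n : ℕ) {V W X : A} (f : V ⟶ W) (g : W ⟶ X) :
    F.map f ≫ p n g = p n (f ≫ g) := by
  by_cases hn : n ∈ Finset.range (d + 1)
  · refine coeff_unique (k := k) _ (fun n => F.map f ≫ p n g) (fun n => p n (f ≫ g))
      (fun c => ?_) n hn
    simp only [← Linear.comp_smul, ← Preadditive.comp_sum]
    rw [← hp.map_smul, ← hp.map_smul, ← F.map_comp, Linear.comp_smul]
  · simp only [Finset.mem_range, not_lt] at hn
    rw [hp.vanish n (by omega), hp.vanish n (by omega), Limits.comp_zero]

/-- By `comp_map`, `p m f ≫ F.map (c • g)` is the single monomial `c ^ m • p m (f ≫ g)`, so only `n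
= m` contributes. In particular the maps `p n (𝟙 V)` are orthogonal idempotents, natural in `V` by
the two preceding lemmas. -/
theorem comp (m n : ℕ) {V W X : A} (f : V ⟶ W) (g : W ⟶ X) :
    p m f ≫ p n g = if m = n then p m (f ≫ g) else 0 := by
  by_cases hn : n ∈ Finset.range (d + 1)
  · refine coeff_unique (k := k) (Finset.range (d + 1)) (fun n => p m f ≫ p n g)
      (fun n => if m = n then p m (f ≫ g) else 0) (fun c => ?_) n hn
    simp only [← Linear.comp_smul, ← Preadditive.comp_sum]
    rw [← hp.map_smul, hp.comp_map, Linear.comp_smul, hp.smul]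
    simp only [smul_ite, smul_zero, Finset.sum_ite_eq]
    split_ifs with h
    · rfl
    · simp only [Finset.mem_range, not_lt] at h
      rw [hp.vanish m (by omega), smul_zero]
  · simp only [Finset.mem_range, not_lt] at hn
    rw [hp.vanish n (by omega), Limits.comp_zero]
    split_ifs with h
    · rw [hp.vanish m (by omega)]
    · rfl

/-- Compares coefficients in the naturality square of `τ` at `c • f`. Both sums are extended by
zeros to the common bound `max d e`. -/
theorem naturality {G : A ⥤ FGModuleCat.{u} k} {q : ℕ → ∀ {V W : A}, (V ⟶ W) → (G.obj V ⟶ G.obj W)}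
    {e : ℕ} (hq : IsComponents G e q) (τ : F ⟶ G) (n : ℕ) {V W : A} (f : V ⟶ W) :
    p n f ≫ τ.app W = τ.app V ≫ q n f := by
  have key : ∀ c : k, ∑ n ∈ Finset.range (max d e + 1), c ^ n • (p n f ≫ τ.app W) =
      ∑ n ∈ Finset.range (max d e + 1), c ^ n • (τ.app V ≫ q n f) := by
    intro c
    have h1 : ∑ n ∈ Finset.range (max d e + 1), c ^ n • p n f = F.map (c • f) := by
      rw [hp.map_smul]
      refine (Finset.sum_subset (Finset.range_mono (by omega)) fun n _ hn => ?_).symm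
      simp only [Finset.mem_range, not_lt] at hn
      rw [hp.vanish n (by omega), smul_zero]
    have h2 : ∑ n ∈ Finset.range (max d e + 1), c ^ n • q n f = G.map (c • f) := by
      rw [hq.map_smul]
      refine (Finset.sum_subset (Finset.range_mono (by omega)) fun n _ hn => ?_).symm
      simp only [Finset.mem_range, not_lt] at hn
      rw [hq.vanish n (by omega), smul_zero]
    have h3 := τ.naturality (c • f)
    rw [← h1, ← h2] at h3
    simpa only [Preadditive.sum_comp, Preadditive.comp_sum, Linear.smul_comp, Linear.comp_smul]
      using h3
  by_cases hn : n ∈ Finset.range (max d e + 1)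
  · exact coeff_unique (k := k) _ _ _ key n hn
  · simp only [Finset.mem_range, not_lt] at hn
    rw [hp.vanish n (by omega), hq.vanish n (by omega), Limits.comp_zero, Limits.zero_comp]

end IsComponents

end Components

/-! ### Subfunctors, idempotents and retracts -/

section Subfunctors

variable {k : Type u} [Field k] {A : Type v} [Category.{w'} A]

/-- The subfunctor of `F` given by a stable family of subspaces. -/
def subFunctor (F : A ⥤ FGModuleCat.{u} k) (N : ∀ V, Submodule k (F.obj V))
    (h : ∀ {V W : A} (f : V ⟶ W), N V ≤ (N W).comap (F.map f).hom.hom) :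
    A ⥤ FGModuleCat.{u} k where
  obj V := FGModuleCat.of k (N V)
  map f := FGModuleCat.ofHom ((F.map f).hom.hom.restrict (h f))
  map_id V := by
    ext x
    change (F.map (𝟙 V)).hom.hom x.1 = x.1
    rw [F.map_id]
    rfl
  map_comp f g := by
    ext x
    change (F.map (f ≫ g)).hom.hom x.1 = (F.map g).hom.hom ((F.map f).hom.hom x.1)
    rw [F.map_comp]
    rfl

/-- The inclusion of a subfunctor. -/
def subFunctorι (F : A ⥤ FGModuleCat.{u} k) (N : ∀ V, Submodule k (F.obj V))
    (h : ∀ {V W : A} (f : V ⟶ W), N V ≤ (N W).comap (F.map f).hom.hom) :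
    subFunctor F N h ⟶ F where
  app V := FGModuleCat.ofHom (N V).subtype

/-- The linear retraction of `F.obj W` onto `N W` need not be natural. It only has to express the
restricted action as a linear function of `F.map f`, which is enough to inherit polynomiality and
homogeneity. -/
theorem subFunctor_map_eq (F : A ⥤ FGModuleCat.{u} k) (N : ∀ V, Submodule k (F.obj V))
    (h : ∀ {V W : A} (f : V ⟶ W), N V ≤ (N W).comap (F.map f).hom.hom) (V W : A) :
    ∃ L : (F.obj V ⟶ F.obj W) →ₗ[k] ((subFunctor F N h).obj V ⟶ (subFunctor F N h).obj W),
      ∀ f : V ⟶ W, (subFunctor F N h).map f = L (F.map f) := by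
  obtain ⟨r, hr⟩ := (N W).subtype.exists_leftInverse_of_injective (N W).ker_subtype
  let R : F.obj W ⟶ FGModuleCat.of k (N W) := FGModuleCat.ofHom r
  let I : FGModuleCat.of k (N V) ⟶ F.obj V := FGModuleCat.ofHom (N V).subtype
  refine ⟨Linear.leftComp k _ I ∘ₗ Linear.rightComp k _ R, fun f => ?_⟩
  ext x
  exact (LinearMap.congr_fun hr ⟨(F.map f).hom.hom x.1, h f x.2⟩).symm

variable [Preadditive A] [Linear k A]

theorem subFunctor_polynomial {F : A ⥤ FGModuleCat.{u} k} (hF : IsPolynomialFunctor k F)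
    (N : ∀ V, Submodule k (F.obj V))
    (h : ∀ {V W : A} (f : V ⟶ W), N V ≤ (N W).comap (F.map f).hom.hom) :
    IsPolynomialFunctor k (subFunctor F N h) := by
  obtain ⟨d, hd⟩ := hF
  refine ⟨d, fun V W => ?_⟩
  obtain ⟨L, hL⟩ := subFunctor_map_eq F N h V W
  simp only [hL]
  exact (hd V W).linear_comp L

theorem subFunctor_homogeneous {n : ℕ} {F : A ⥤ FGModuleCat.{u} k}
    (hF : IsHomogeneousFunctor k n F) (N : ∀ V, Submodule k (F.obj V))
    (h : ∀ {V W : A} (f : V ⟶ W), N V ≤ (N W).comap (F.map f).hom.hom) :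
    IsHomogeneousFunctor k n (subFunctor F N h) := by
  intro V W
  obtain ⟨L, hL⟩ := subFunctor_map_eq F N h V W
  simp only [hL]
  exact (hF V W).linear_comp L

theorem IsHomogeneousFunctor.of_retract {n : ℕ} {F G : A ⥤ FGModuleCat.{u} k}
    (hF : IsHomogeneousFunctor k n F) (ι : G ⟶ F) (π : F ⟶ G) (h : ι ≫ π = 𝟙 G) :
    IsHomogeneousFunctor k n G := by
  intro V W
  have : ∀ f : V ⟶ W, G.map f =
      (Linear.leftComp k _ (ι.app V) ∘ₗ Linear.rightComp k _ (π.app W)) (F.map f) := by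
    intro f
    change _ = ι.app V ≫ F.map f ≫ π.app W
    rw [π.naturality, ← Category.assoc, ← NatTrans.comp_app, h]
    simp
  simp only [this]
  exact (hF V W).linear_comp _

theorem IsPolynomialMap.of_retract {d : ℕ} {F G : A ⥤ FGModuleCat.{u} k}
    (ι : G ⟶ F) (π : F ⟶ G) (h : ι ≫ π = 𝟙 G) {V W : A}
    (hF : IsPolynomialMap k d fun f : V ⟶ W => F.map f) :
    IsPolynomialMap k d fun f : V ⟶ W => G.map f := by
  have : ∀ f : V ⟶ W, G.map f =
      (Linear.leftComp k _ (ι.app V) ∘ₗ Linear.rightComp k _ (π.app W)) (F.map f) := by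
    intro f
    change _ = ι.app V ≫ F.map f ≫ π.app W
    rw [π.naturality, ← Category.assoc, ← NatTrans.comp_app, h]
    simp
  simp only [this]
  exact hF.linear_comp _

/-- The subfunctor of a polynomial functor given by a stable family of subspaces, as a polynomial
functor. -/
def polySub (F : Poly k A) (N : ∀ V, Submodule k (F.obj.obj V))
    (h : ∀ {V W : A} (f : V ⟶ W), N V ≤ (N W).comap (F.obj.map f).hom.hom) : Poly k A :=
  ⟨subFunctor F.obj N h, subFunctor_polynomial F.property N h⟩

def polySubι (F : Poly k A) (N : ∀ V, Submodule k (F.obj.obj V))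
    (h : ∀ {V W : A} (f : V ⟶ W), N V ≤ (N W).comap (F.obj.map f).hom.hom) :
    polySub F N h ⟶ F :=
  ObjectProperty.homMk (subFunctorι F.obj N h)

/-- Idempotents split in the category of polynomial functors. -/
theorem exists_splitting (F : Poly k A) (ε : F ⟶ F) (h : ε ≫ ε = ε) :
    ∃ (X : Poly k A) (ι : X ⟶ F) (π : F ⟶ X), ι ≫ π = 𝟙 X ∧ π ≫ ι = ε := by
  have hε : ∀ V x, (ε.hom.app V).hom.hom ((ε.hom.app V).hom.hom x) = (ε.hom.app V).hom.hom x :=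
    fun V x => LinearMap.congr_fun (congrArg (fun t : F ⟶ F => (t.hom.app V).hom.hom) h) x
  have hnat : ∀ {V W : A} (f : V ⟶ W) x, (ε.hom.app W).hom.hom ((F.obj.map f).hom.hom x) =
      (F.obj.map f).hom.hom ((ε.hom.app V).hom.hom x) := fun {V W} f x =>
    LinearMap.congr_fun (congrArg (fun t => t.hom.hom) (ε.hom.naturality f)) x
  let N : ∀ V, Submodule k (F.obj.obj V) := fun V => LinearMap.range (ε.hom.app V).hom.hom
  have hN : ∀ {V W : A} (f : V ⟶ W), N V ≤ (N W).comap (F.obj.map f).hom.hom := by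
    rintro V W f _ ⟨x, rfl⟩
    exact ⟨(F.obj.map f).hom.hom x, hnat f x⟩
  let π : F.obj ⟶ subFunctor F.obj N hN :=
    { app := fun V => FGModuleCat.ofHom (ε.hom.app V).hom.hom.rangeRestrict
      naturality := fun V W f => by
        ext x
        apply Subtype.ext
        exact hnat f x }
  refine ⟨polySub F N hN, polySubι F N hN, ObjectProperty.homMk π, ?_, ?_⟩
  · apply ObjectProperty.hom_ext
    ext V ⟨_, x, rfl⟩
    apply Subtype.ext
    exact hε V x
  · apply ObjectProperty.hom_ext
    ext V x
    rfl

end Subfunctors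

/-! ### Polarization -/

section Polarization

variable {k : Type u} [Field k] {U W : Type*} [AddCommGroup U] [Module k U] [AddCommGroup W]
  [Module k W]

/-- The full polarization of a map of degree `n`. -/
def polarize (n : ℕ) (f : U → W) (g : Fin n → U) : W :=
  ∑ C : Finset (Fin n), (-1 : ℤ) ^ C.card • f (∑ i ∈ Cᶜ, g i)

/-- Inclusion–exclusion. After multilinear expansion the term of `r : Fin n → Fin n` occurs once for
each `C` disjoint from the image of `r`; the signs cancel unless `r` is surjective, that is, a
permutation. -/
theorem polarize_eq_sum_perm {n : ℕ} (M : MultilinearMap k (fun _ : Fin n => U) W) {f : U → W}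
    (h : ∀ x, f x = M fun _ => x) (g : Fin n → U) :
    polarize n f g = ∑ σ : Equiv.Perm (Fin n), M fun i => g (σ i) := by
  classical
  have h1 : ∀ C : Finset (Fin n), f (∑ i ∈ Cᶜ, g i) =
      ∑ r : Fin n → Fin n, if C ⊆ (Finset.univ.image r)ᶜ then M (fun i => g (r i)) else 0 := by
    intro C
    rw [h, M.map_sum_finset (fun _ j => g j) (fun _ => Cᶜ), ← Finset.sum_filter]
    refine Finset.sum_congr ?_ fun _ _ => rfl
    ext r
    simp only [Fintype.mem_piFinset, Finset.mem_compl, Finset.mem_filter, Finset.mem_univ, true_and]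
    constructor
    · intro hr c hc
      simp only [Finset.mem_compl, Finset.mem_image, Finset.mem_univ, true_and, not_exists]
      rintro a rfl
      exact hr a hc
    · intro hr a ha
      have := hr ha
      simp at this
  have h2 : ∀ r : Fin n → Fin n, (∑ C : Finset (Fin n), (-1 : ℤ) ^ C.card •
      (if C ⊆ (Finset.univ.image r)ᶜ then M (fun i => g (r i)) else 0)) =
      if Function.Surjective r then M (fun i => g (r i)) else 0 := by
    intro r
    have h3 : (∑ C : Finset (Fin n), (-1 : ℤ) ^ C.card •
      (if C ⊆ (Finset.univ.image r)ᶜ then M (fun i => g (r i)) else 0)) =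
      (∑ C ∈ ((Finset.univ.image r)ᶜ).powerset, (-1 : ℤ) ^ C.card) • M (fun i => g (r i)) := by
      simp only [smul_ite, smul_zero]
      rw [← Finset.sum_filter, Finset.sum_smul]
      refine Finset.sum_congr ?_ fun _ _ => rfl
      ext C
      simp
    rw [h3, Finset.sum_powerset_neg_one_pow_card]
    have h4 : (Finset.univ.image r)ᶜ = ∅ ↔ Function.Surjective r := by
      rw [Finset.compl_eq_empty_iff, Finset.eq_univ_iff_forall]
      simp [Function.Surjective]
    simp only [h4]
    split_ifs <;> simp
  unfold polarize
  simp only [h1, Finset.smul_sum]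
  rw [Finset.sum_comm]
  simp only [h2]
  rw [← Finset.sum_filter]
  refine (Finset.sum_bij (fun (σ : Equiv.Perm (Fin n)) _ => (σ : Fin n → Fin n)) ?_ ?_ ?_ ?_).symm
  · intro σ _
    simp [σ.surjective]
  · intro σ _ τ _ h
    exact DFunLike.coe_injective h
  · intro r hr
    simp only [Finset.mem_filter, Finset.mem_univ, true_and] at hr
    exact ⟨Equiv.ofBijective r (Finite.injective_iff_bijective.mp
      (Finite.injective_iff_surjective.mpr hr)), Finset.mem_univ _, rfl⟩
  · intro σ _
    rfl

/-- Polarization has two descriptions: an alternating sum of values of `f`, which is compatible with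
functoriality, and a multilinear map `Q`. The arguments below use both. The factor `n!` counts the
permutations. -/
theorem IsHomogeneousMap.exists_polarize {n : ℕ} {f : U → W} (hf : IsHomogeneousMap k n f) :
    ∃ Q : MultilinearMap k (fun _ : Fin n => U) W, (∀ g, polarize n f g = Q g) ∧
      ∀ x, Q (fun _ => x) = (n.factorial : k) • f x := by
  obtain ⟨M, hM⟩ := hf
  refine ⟨∑ σ : Equiv.Perm (Fin n), M.domDomCongr σ, fun g => ?_, fun x => ?_⟩
  · rw [polarize_eq_sum_perm M hM, sum_apply]
    rfl
  · rw [sum_apply]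
    simp only [MultilinearMap.domDomCongr_apply, ← hM, Finset.sum_const, Finset.card_univ,
      Fintype.card_perm, Fintype.card_fin]
    exact (Nat.cast_smul_eq_nsmul k _ _).symm

end Polarization

/-! ### Polarization of homogeneous functors -/

section PolarizedFunctors

variable {k : Type u} [Field k] {A : Type v} [Category.{w'} A] [Preadditive A] [Linear k A]

/-- The polarization of the action of a functor on morphisms. -/
def polar (F : A ⥤ FGModuleCat.{u} k) (n : ℕ) {V W : A} (g : Fin n → (V ⟶ W)) :
    F.obj V ⟶ F.obj W :=
  polarize n (fun f : V ⟶ W => F.map f) g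

section

variable (F : A ⥤ FGModuleCat.{u} k) (n : ℕ) {V W X : A}

omit [Linear k A] in
-- The polarization is an integral combination of maps `F.map` at sums, so functoriality and
-- biadditivity of composition suffice; the same holds for the next two lemmas.
theorem map_comp_polar (f : V ⟶ W) (g : Fin n → (W ⟶ X)) :
    F.map f ≫ polar F n g = polar F n fun i => f ≫ g i := by
  simp only [polar, polarize, Preadditive.comp_sum, Preadditive.comp_zsmul]
  simp only [← F.map_comp, Preadditive.comp_sum]

omit [Linear k A] in
theorem polar_comp_map (g : Fin n → (V ⟶ W)) (f : W ⟶ X) :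
    polar F n g ≫ F.map f = polar F n fun i => g i ≫ f := by
  simp only [polar, polarize, Preadditive.sum_comp, Preadditive.zsmul_comp]
  simp only [← F.map_comp, Preadditive.sum_comp]

omit [Linear k A] in
theorem polar_naturality {F G : A ⥤ FGModuleCat.{u} k} (τ : F ⟶ G) (g : Fin n → (V ⟶ W)) :
    polar F n g ≫ τ.app W = τ.app V ≫ polar G n g := by
  simp only [polar, polarize, Preadditive.sum_comp, Preadditive.zsmul_comp, Preadditive.comp_sum,
    Preadditive.comp_zsmul, τ.naturality]

end

variable {F : A ⥤ FGModuleCat.{u} k} {n : ℕ} (hF : IsHomogeneousFunctor k n F)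

include hF

/-- The map `x ↦ F.map x ≫ polar F n g` is the diagonal of the multilinear map `x ↦ Q (x i ≫ g i)`,
by `map_comp_polar`. Polarizing it in the two ways gives the two sides. -/
theorem polar_comp_polar {V W X : A} (f : Fin n → (V ⟶ W)) (g : Fin n → (W ⟶ X)) :
    polar F n f ≫ polar F n g =
      ∑ σ : Equiv.Perm (Fin n), polar F n fun i => f (σ i) ≫ g i := by
  obtain ⟨Q, hQ, -⟩ := (hF V X).exists_polarize
  have := polarize_eq_sum_perm (f := fun x : V ⟶ W => polar F n fun i => x ≫ g i)
    (Q.compLinearMap fun i => Linear.rightComp k V (g i)) (fun x => hQ _) f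
  refine Eq.trans ?_ (this.trans (Finset.sum_congr rfl fun σ _ => (hQ _).symm))
  simp only [polarize, ← map_comp_polar]
  simp only [← Preadditive.sum_comp, ← Preadditive.zsmul_comp]
  rfl

variable {K X V : A} {m : ℕ} (ι : Fin n → (K ⟶ X)) (pr : Fin n → (X ⟶ K))

/-- Up to the factor `n!`, this makes `F V` a retract of a finite power of `F X`, where `X` contains
`n` orthogonal copies of `K`. Orthogonality of the copies kills every permutation but the identity,
and the sum over `b` rebuilds `𝟙 V` in each of the `n` arguments of `Q`. -/
theorem sum_polar_comp_polar (h1 : ∀ i, ι i ≫ pr i = 𝟙 K) (h2 : ∀ i j, i ≠ j → ι i ≫ pr j = 0)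
    (a : Fin m → (K ⟶ V)) (c : Fin m → (V ⟶ K)) (h : ∑ j, c j ≫ a j = 𝟙 V) :
    ∑ b : Fin n → Fin m, polar F n (fun i => c (b i) ≫ ι i) ≫ polar F n (fun i => pr i ≫ a (b i)) =
      (n.factorial : k) • 𝟙 (F.obj V) := by
  classical
  obtain ⟨Q, hQ, hQ'⟩ := (hF V V).exists_polarize
  have key : ∀ b : Fin n → Fin m,
      polar F n (fun i => c (b i) ≫ ι i) ≫ polar F n (fun i => pr i ≫ a (b i)) =
        Q fun i => c (b i) ≫ a (b i) := by
    intro b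
    rw [polar_comp_polar hF, Finset.sum_eq_single_of_mem 1 (Finset.mem_univ _)]
    · refine (hQ _).trans (congrArg Q (funext fun i => ?_))
      simp only [Equiv.Perm.coe_one, id, Category.assoc]
      rw [reassoc_of% (h1 i)]
    · intro σ _ hσ
      obtain ⟨i, hi⟩ : ∃ i, σ i ≠ i := by
        by_contra! hc
        exact hσ (Equiv.ext hc)
      refine (hQ _).trans (Q.map_coord_zero i ?_)
      simp only [Category.assoc]
      rw [reassoc_of% (h2 _ _ hi)]
      simp
  simp only [key]
  rw [← Q.map_sum (fun _ j => c j ≫ a j)]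
  simp only [h, hQ', F.map_id]

end PolarizedFunctors

/-! ### Semisimplicity of the category of homogeneous functors -/

section Semisimplicity

variable {k : Type u} [Field k]

/-- The standard vector space of dimension `n`. -/
abbrev std (k : Type u) [Field k] (n : ℕ) : FGModuleCat.{u} k := FGModuleCat.of k (Fin n → k)

abbrev line (k : Type u) [Field k] : FGModuleCat.{u} k := FGModuleCat.of k k

def stdι (n : ℕ) (i : Fin n) : line k ⟶ std k n :=
  FGModuleCat.ofHom (LinearMap.single k (fun _ => k) i)

def stdπ (n : ℕ) (i : Fin n) : std k n ⟶ line k :=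
  FGModuleCat.ofHom (LinearMap.proj i)

theorem stdι_stdπ (n : ℕ) (i : Fin n) : stdι (k := k) n i ≫ stdπ n i = 𝟙 _ := by
  apply FGModuleCat.hom_ext
  ext
  exact Pi.single_eq_same (M := fun _ => k) i (1 : k)

theorem stdι_stdπ_ne (n : ℕ) (i j : Fin n) (h : i ≠ j) : stdι (k := k) n i ≫ stdπ n j = 0 := by
  apply FGModuleCat.hom_ext
  ext
  exact Pi.single_eq_of_ne (M := fun _ => k) h.symm (1 : k)

theorem exists_coordinates (V : FGModuleCat.{u} k) : ∃ (m : ℕ) (a : Fin m → (line k ⟶ V))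
    (c : Fin m → (V ⟶ line k)), ∑ j, c j ≫ a j = 𝟙 V := by
  let B := Module.finBasis k V
  refine ⟨_, fun j => (fgHom _ _).symm (LinearMap.toSpanSingleton k V (B j)),
    fun j => (fgHom _ _).symm (B.coord j), ?_⟩
  apply (fgHom V V).injective
  rw [map_sum]
  ext x
  rw [LinearMap.sum_apply]
  exact B.sum_repr x

theorem end_line (φ : line k ⟶ line k) : ∃ a : k, φ = a • 𝟙 _ := by
  refine ⟨φ.hom.hom (1 : k), ?_⟩
  apply FGModuleCat.hom_ext
  ext
  exact (mul_one _).symm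

variable {n : ℕ} {F G : FGModuleCat.{u} k ⥤ FGModuleCat.{u} k} (hF : IsHomogeneousFunctor k n F)
  (hG : IsHomogeneousFunctor k n G)

include hF in
-- Multilinear expansion in the coordinates of `W`: composition with `f` acts by the `n`-th tensor
-- power of its matrix `s`. In `map_polar_change` the same coefficients appear transposed.
theorem polar_change {V W : FGModuleCat.{u} k} {m m' : ℕ}
    {a : Fin m → (line k ⟶ V)} {c : Fin m → (V ⟶ line k)} (h : ∑ j, c j ≫ a j = 𝟙 V)
    {a' : Fin m' → (line k ⟶ W)} {c' : Fin m' → (W ⟶ line k)} (h' : ∑ j, c' j ≫ a' j = 𝟙 W)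
    (f : V ⟶ W) (s : Fin m → Fin m' → k) (hs : ∀ j j', a j ≫ f ≫ c' j' = s j j' • 𝟙 _)
    (b : Fin n → Fin m) : polar F n (fun i => stdπ n i ≫ a (b i)) ≫ F.map f =
      ∑ b' : Fin n → Fin m', (∏ i, s (b i) (b' i)) • polar F n (fun i => stdπ n i ≫ a' (b' i)) := by
  classical
  obtain ⟨Q, hQ, -⟩ := (hF (std k n) W).exists_polarize
  have h1 : ∀ j, a j ≫ f = ∑ j', s j j' • a' j' := by
    intro j
    calc a j ≫ f = (a j ≫ f) ≫ ∑ j', c' j' ≫ a' j' := by rw [h', Category.comp_id]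
      _ = ∑ j', (a j ≫ f ≫ c' j') ≫ a' j' := by
        simp only [Preadditive.comp_sum, Category.assoc]
      _ = _ := by simp only [hs, Linear.smul_comp, Category.id_comp]
  rw [polar_comp_map]
  refine (hQ _).trans ?_
  simp only [Category.assoc, h1, Preadditive.comp_sum, Linear.comp_smul]
  rw [Q.map_sum (fun i j' => s (b i) j' • stdπ n i ≫ a' j')]
  refine Finset.sum_congr rfl fun b' _ => ?_
  rw [Q.map_smul_univ (fun i => s (b i) (b' i)) (fun i => stdπ n i ≫ a' (b' i)), ← hQ]
  rfl

include hF in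
theorem map_polar_change {V W : FGModuleCat.{u} k} {m m' : ℕ}
    {a : Fin m → (line k ⟶ V)} {c : Fin m → (V ⟶ line k)} (h : ∑ j, c j ≫ a j = 𝟙 V)
    {a' : Fin m' → (line k ⟶ W)} {c' : Fin m' → (W ⟶ line k)} (h' : ∑ j, c' j ≫ a' j = 𝟙 W)
    (f : V ⟶ W) (s : Fin m → Fin m' → k) (hs : ∀ j j', a j ≫ f ≫ c' j' = s j j' • 𝟙 _)
    (b' : Fin n → Fin m') : F.map f ≫ polar F n (fun i => c' (b' i) ≫ stdι n i) =
      ∑ b : Fin n → Fin m, (∏ i, s (b i) (b' i)) • polar F n (fun i => c (b i) ≫ stdι n i) := by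
  classical
  obtain ⟨Q, hQ, -⟩ := (hF V (std k n)).exists_polarize
  have h1 : ∀ j', f ≫ c' j' = ∑ j, s j j' • c j := by
    intro j'
    calc f ≫ c' j' = (∑ j, c j ≫ a j) ≫ f ≫ c' j' := by rw [h, Category.id_comp]
      _ = ∑ j, c j ≫ (a j ≫ f ≫ c' j') := by
        simp only [Preadditive.sum_comp, Category.assoc]
      _ = _ := by simp only [hs, Linear.comp_smul, Category.comp_id]
  rw [map_comp_polar]
  refine (hQ _).trans ?_
  simp only [← Category.assoc, h1, Preadditive.sum_comp, Linear.smul_comp]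
  rw [Q.map_sum (fun i j => s j (b' i) • c j ≫ stdι n i)]
  refine Finset.sum_congr rfl fun b _ => ?_
  rw [Q.map_smul_univ (fun i => s (b i) (b' i)) (fun i => c (b i) ≫ stdι n i), ← hQ]
  rfl

include hF hG in
/-- The natural transformation of homogeneous functors of degree `n` obtained by averaging a linear
map between their values at a vector space of dimension `n`. -/
theorem exists_average (x : F.obj (std k n) ⟶ G.obj (std k n)) : ∃ σ : F ⟶ G,
    ∀ (V : FGModuleCat.{u} k), ∃ (m : ℕ) (a : Fin m → (line k ⟶ V))
    (c : Fin m → (V ⟶ line k)) (h : ∑ j, c j ≫ a j = 𝟙 V), σ.app V = ∑ b : Fin n → Fin m,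
      polar F n (fun i => c (b i) ≫ stdι n i) ≫ x ≫ polar G n (fun i => stdπ n i ≫ a (b i)) := by
  choose m a c h using exists_coordinates (k := k)
  refine ⟨{ app := fun V => (∑ b : Fin n → Fin (m V), polar F n (fun i => c V (b i) ≫ stdι n i) ≫
      x ≫ polar G n (fun i => stdπ n i ≫ a V (b i)))
            naturality := fun V W f => ?_ },
    fun V => ⟨m V, a V, c V, h V, rfl⟩⟩
  -- The coordinates of the spaces are chosen independently of each other. Naturality holds
  -- nevertheless: both sides become the same double sum over `b` and `b'`, weighted by the matrix
  -- entries of `f`.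
  choose s hs using fun j j' => end_line (a V j ≫ f ≫ c W j')
  simp only [Preadditive.comp_sum, Preadditive.sum_comp, Category.assoc,
    polar_change hG (h V) (h W) f s hs]
  simp only [← Category.assoc, map_polar_change hF (h V) (h W) f s hs]
  simp only [Preadditive.sum_comp, Linear.smul_comp, Linear.comp_smul]
  rw [Finset.sum_comm]

variable [CharZero k]

include hF in
-- By `sum_polar_comp_polar` and naturality of polarization, `n! • τ.app V` is a sum of maps that
-- factor through `τ` at `k^n`.
theorem eq_zero_of_app_std {τ : F ⟶ G} (h : τ.app (std k n) = 0) : τ = 0 := by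
  ext V : 2
  obtain ⟨m, a, c, hac⟩ := exists_coordinates V
  have := congrArg (· ≫ τ.app V) (sum_polar_comp_polar hF (stdι n) (stdπ n) (stdι_stdπ n)
    (stdι_stdπ_ne n) a c hac)
  simp only [Preadditive.sum_comp, Category.assoc, polar_naturality, Linear.smul_comp,
    Category.id_comp] at this
  rw [h] at this
  simp only [zero_comp, comp_zero, Finset.sum_const_zero] at this
  exact ((smul_eq_zero_iff_right (Nat.cast_ne_zero.mpr n.factorial_ne_zero)).mp this.symm)

include hF hG in
/-- The category of homogeneous functors of degree `n` is von Neumann regular. -/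
theorem exists_quasiInverse (τ : F ⟶ G) : ∃ σ : G ⟶ F, τ ≫ σ ≫ τ = τ := by
  -- A linear map always has a quasi-inverse: project onto the range, then apply a section of the
  -- map onto its range.
  obtain ⟨x, hx⟩ : ∃ x : G.obj (std k n) ⟶ F.obj (std k n),
      τ.app (std k n) ≫ x ≫ τ.app (std k n) = τ.app (std k n) := by
    let t := (τ.app (std k n)).hom.hom
    obtain ⟨r, hr⟩ := t.rangeRestrict.exists_rightInverse_of_surjective
      (LinearMap.range_eq_top.mpr t.surjective_rangeRestrict)
    obtain ⟨p, hp⟩ := (LinearMap.range t).subtype.exists_leftInverse_of_injective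
      (Submodule.ker_subtype _)
    refine ⟨(fgHom _ _).symm (r ∘ₗ p), ?_⟩
    ext y
    change t (r (p (t y))) = t y
    have h1 : p (t y) = t.rangeRestrict y := LinearMap.congr_fun hp (t.rangeRestrict y)
    rw [h1]
    exact congrArg Subtype.val (LinearMap.congr_fun hr (t.rangeRestrict y))
  -- Averaging commutes with composing by `τ` on both sides, so `τ ≫ σ ≫ τ` is the average of `τ ≫ x
  -- ≫ τ = τ` at `k^n`, which is `n! • τ`.
  obtain ⟨σ, hσ⟩ := exists_average hG hF x
  refine ⟨(n.factorial : k)⁻¹ • σ, ?_⟩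
  ext V : 2
  obtain ⟨m, a, c, hac, e⟩ := hσ V
  have h0 := sum_polar_comp_polar hF (stdι n) (stdπ n) (stdι_stdπ n) (stdι_stdπ_ne n) a c hac
  have h1 := congrArg (· ≫ τ.app V) h0
  have h2 : τ.app V ≫ σ.app V ≫ τ.app V = (n.factorial : k) • τ.app V := by
    rw [e]
    simp only [Preadditive.sum_comp, Preadditive.comp_sum, Category.assoc, polar_naturality,
      Linear.smul_comp, Category.id_comp] at h1 ⊢
    rw [← h1]
    refine Finset.sum_congr rfl fun b _ => ?_
    rw [← Category.assoc, ← polar_naturality, Category.assoc, reassoc_of% hx]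
  have h3 : (n.factorial : k) ≠ 0 := Nat.cast_ne_zero.mpr n.factorial_ne_zero
  change τ.app V ≫ ((n.factorial : k)⁻¹ • σ.app V) ≫ τ.app V = _
  rw [Linear.smul_comp, Linear.comp_smul, h2, smul_smul, inv_mul_cancel₀ h3, one_smul]

end Semisimplicity

/-! ### Indecomposable objects -/

section Indecomposable

variable {C : Type v} [Category.{w'} C] [Preadditive C]

/-- An object is indecomposable if it is nonzero and has no nontrivial idempotents. -/
def IsIndec (X : C) : Prop :=
  𝟙 X ≠ 0 ∧ ∀ ε : X ⟶ X, ε ≫ ε = ε → ε = 0 ∨ ε = 𝟙 X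

/-- Schur's lemma, with a quasi-inverse in place of kernels and images: `f ≫ g` and `g ≫ f` are
idempotents, nonzero since `f ≠ 0`, hence identities. -/
theorem IsIndec.isIso {X Y : C} (hX : IsIndec X) (hY : IsIndec Y) {f : X ⟶ Y} (hf : f ≠ 0)
    {g : Y ⟶ X} (h : f ≫ g ≫ f = f) : IsIso f := by
  have h1 : f ≫ g = 𝟙 X := by
    refine (hX.2 (f ≫ g) ?_).resolve_left fun h0 => hf ?_
    · rw [Category.assoc, reassoc_of% h]
    · rw [← h, ← Category.assoc, h0, zero_comp]
  have h2 : g ≫ f = 𝟙 Y := by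
    refine (hY.2 (g ≫ f) ?_).resolve_left fun h0 => hf ?_
    · rw [Category.assoc, h]
    · rw [← h, h0, comp_zero]
  exact ⟨g, h1, h2⟩

end Indecomposable

/-! ### Polynomials in one variable with values in a vector space -/

section OneVariablePolynomials

variable {k : Type u} [Field k] [Infinite k] {W : Type*} [AddCommGroup W] [Module k W]

omit [Infinite k] in
theorem IsPolynomialMap.exists_coeff {d : ℕ} {y : k → W} (hy : IsPolynomialMap k d y) :
    ∃ w : ℕ → W, ∀ c, y c = ∑ n ∈ Finset.range (d + 1), c ^ n • w n := by
  obtain ⟨p, hp, -, h⟩ := hy.exists_components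
  refine ⟨fun n => p n 1, fun c => ?_⟩
  rw [h]
  refine Finset.sum_congr rfl fun n _ => ?_
  rw [← (hp n).map_smul, smul_eq_mul, mul_one]

/-- Compares coefficients of `c ^ a`: the right side has no terms below degree `b`, and its term of
degree `b` is `y 0`. -/
theorem IsPolynomialMap.shift {d : ℕ} {y : k → W} (hy : IsPolynomialMap k d y) {x : W} {a b : ℕ}
    (hab : a ≤ b) (h : ∀ c : k, c ^ a • x = c ^ b • y c) : x = if a = b then y 0 else 0 := by
  obtain ⟨w, hw⟩ := hy.exists_coeff
  have key := coeff_unique (k := k) (Finset.range (b + (d + 1))) (fun n => if n = a then x else 0)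
    (fun n => if b ≤ n then w (n - b) else 0) (fun c => ?_) a (Finset.mem_range.mpr (by omega))
  · simp only [if_true] at key
    rw [key]
    by_cases hb : a = b
    · subst hb
      simp only [le_refl, if_true, Nat.sub_self, hw]
      rw [Finset.sum_eq_single_of_mem 0 (Finset.mem_range.mpr (by omega))]
      · simp
      · intro n _ hn
        simp [hn]
    · rw [if_neg (by omega), if_neg hb]
  · simp only [smul_ite, smul_zero, Finset.sum_ite_eq', Finset.mem_range]
    have hz : (∑ n ∈ Finset.range b, if b ≤ n then c ^ n • w (n - b) else 0) = 0 :=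
      Finset.sum_eq_zero fun n hn => if_neg (by simp only [Finset.mem_range] at hn; omega)
    rw [if_pos (by omega), h, hw, Finset.sum_range_add _ b (d + 1), hz, zero_add, Finset.smul_sum]
    refine Finset.sum_congr rfl fun n _ => ?_
    rw [if_pos (by omega), smul_smul, pow_add, Nat.add_sub_cancel_left]

/-- A substitute for letting `c` tend to `0`. After multiplication by `c` the vanishing holds at
every `c`, and `shift` removes the factor again. -/
theorem IsPolynomialMap.eq_zero_of_ne {d : ℕ} {y : k → W} (hy : IsPolynomialMap k d y)
    (h : ∀ c : k, c ≠ 0 → y c = 0) : y 0 = 0 := by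
  have := hy.shift (x := 0) (a := 1) (b := 1) le_rfl fun c => by
    by_cases hc : c = 0
    · simp [hc]
    · simp [h c hc]
  simpa using this.symm

end OneVariablePolynomials

/-! ### Subfunctors generated by vectors, and eigenvectors of endomorphisms. -/

section Generated

variable {k : Type u} [Field k] {A : Type v} [Category.{w'} A]

/-- The subspaces generated by a family of elements of the values of a functor. -/
def generated (L : A ⥤ FGModuleCat.{u} k) {I : Type*} (V : I → A) (x : ∀ i, L.obj (V i)) (U : A) :
    Submodule k (L.obj U) :=
  Submodule.span k {y | ∃ (i : I) (g : V i ⟶ U), y = (L.map g).hom.hom (x i)}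

theorem generated_le (L : A ⥤ FGModuleCat.{u} k) {I : Type*} (V : I → A) (x : ∀ i, L.obj (V i))
    {U U' : A} (f : U ⟶ U') :
    generated L V x U ≤ (generated L V x U').comap (L.map f).hom.hom := by
  refine Submodule.span_le.mpr ?_
  rintro _ ⟨i, g, rfl⟩
  refine Submodule.subset_span ⟨i, g ≫ f, ?_⟩
  rw [L.map_comp]
  rfl

theorem mem_generated (L : A ⥤ FGModuleCat.{u} k) {I : Type*} (V : I → A) (x : ∀ i, L.obj (V i))
    (i : I) : x i ∈ generated L V x (V i) := by
  refine Submodule.subset_span ⟨i, 𝟙 _, ?_⟩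
  rw [L.map_id]
  rfl

variable [CharZero k] {n : ℕ} {L : FGModuleCat.{u} k ⥤ FGModuleCat.{u} k}
  (hL : IsHomogeneousFunctor k n L) (hI : IsIndec L)

include hL hI

/-- A quasi-inverse `σ` of the inclusion `ι` of the generated subfunctor makes `σ ≫ ι` an idempotent
of `L`. It is not zero, since otherwise `ι = 0`, against `x i ≠ 0`; hence it is the identity and `ι`
is onto. -/
theorem generated_eq_top {I : Type*} (V : I → FGModuleCat.{u} k) (x : ∀ i, L.obj (V i)) {i : I}
    (hi : x i ≠ 0) (U : FGModuleCat.{u} k) : generated L V x U = ⊤ := by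
  let ι := subFunctorι L (generated L V x) (generated_le L V x)
  obtain ⟨σ, hσ⟩ := exists_quasiInverse
    (subFunctor_homogeneous hL (generated L V x) (generated_le L V x)) hL ι
  rcases hI.2 (σ ≫ ι) (by rw [Category.assoc, hσ]) with h | h
  · rw [h, comp_zero] at hσ
    have := LinearMap.congr_fun (congrArg (fun t => (t.app (V i)).hom.hom) hσ)
      ⟨x i, mem_generated L V x i⟩
    exact (hi this.symm).elim
  · rw [eq_top_iff]
    intro y _
    have := LinearMap.congr_fun (congrArg (fun t => (t.app U).hom.hom) h) y
    have h2 : y = ((σ.app U).hom.hom y).1 := this.symm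
    rw [h2]
    exact Subtype.property _

/-- The endomorphism `φ - c • 𝟙 L` kills `x`, so it is not invertible; by Schur's lemma it vanishes.
One eigenvector therefore determines `φ`. -/
theorem eq_smul_of_eigenvector (φ : L ⟶ L) (c : k) {V : FGModuleCat.{u} k} {x : L.obj V}
    (hx : x ≠ 0) (h : (φ.app V).hom.hom x = c • x) : φ = c • 𝟙 L := by
  by_contra hne
  have h0 : φ - c • 𝟙 L ≠ 0 := sub_ne_zero.mpr hne
  obtain ⟨g, hg⟩ := exists_quasiInverse hL hL (φ - c • 𝟙 L)
  have := hI.isIso hI h0 hg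
  have h1 := LinearMap.congr_fun (congrArg (fun t => (t.app V).hom.hom)
    (IsIso.hom_inv_id (φ - c • 𝟙 L))) x
  have h2 : ((φ - c • 𝟙 L).app V).hom.hom x = 0 := by
    change (φ.app V).hom.hom x - c • x = 0
    rw [h, sub_self]
  have h3 : ((inv (φ - c • 𝟙 L)).app V).hom.hom (((φ - c • 𝟙 L).app V).hom.hom x) = x := h1
  rw [h2, map_zero] at h3
  exact hx h3.symm

omit [CharZero k] hL in
theorem IsIndec.exists_ne_zero : ∃ (V : FGModuleCat.{u} k) (x : L.obj V), x ≠ 0 := by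
  by_contra! h
  apply hI.1
  ext V x
  exact h V x

end Generated

/-! ### Unipotent maps and weight spaces -/

section Weights

variable {k : Type u} [Field k] {A : Type v} [Category.{w'} A] [Preadditive A] [Linear k A]
  {n : ℕ} {L : A ⥤ FGModuleCat.{u} k} (hL : IsHomogeneousFunctor k n L)

include hL

theorem polynomial_line {V W : A} (f g : V ⟶ W) :
    IsPolynomialMap k n fun c : k => L.map (f + c • g) :=
  ((hL V W).isPolynomialMap le_rfl).comp_affine (LinearMap.toSpanSingleton k _ g) f

variable [Infinite k] {X : A} {D : k → (X ⟶ X)} {e : ℕ → (L.obj X ⟶ L.obj X)}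
  (h1 : ∀ i c, e i ≫ L.map (D c) = c ^ i • e i) (h2 : ∀ i c, L.map (D c) ≫ e i = c ^ i • e i)
  (h3 : ∀ i, e i ≫ e i = e i) {i j : ℕ} (hij : i ≤ j) {w : X ⟶ X}

include h1 h2 h3 hij

/-- Upper triangular unipotent maps act on weight spaces by the identity up to lower weights. -/
theorem component_upper (hw : ∀ c, D c ≫ (𝟙 X + w) = (𝟙 X + c • w) ≫ D c) :
    e i ≫ L.map (𝟙 X + w) ≫ e j = if i = j then e i else 0 := by
  -- Moving `L.map (D c)` across gives `c ^ i • (e i ≫ L.map (𝟙 X + w) ≫ e j) = c ^ j • (e i ≫ L.map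
  -- (𝟙 X + c • w) ≫ e j)`. The right factor is polynomial in `c`, so `shift` leaves only its value
  -- at `c = 0`, and this only if `i = j`.
  have h := ((polynomial_line hL (𝟙 X) w).linear_comp
    (Linear.leftComp k _ (e i) ∘ₗ Linear.rightComp k _ (e j))).shift (a := i) (b := j)
      (x := e i ≫ L.map (𝟙 X + w) ≫ e j) hij ?_
  · rw [h]
    split_ifs with h'
    · subst h'
      change e i ≫ L.map (𝟙 X + (0 : k) • w) ≫ e i = _
      rw [zero_smul, add_zero, L.map_id, Category.id_comp, h3]
    · rfl
  · intro c
    change _ = c ^ j • (e i ≫ L.map (𝟙 X + c • w) ≫ e j)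
    have h4 := congrArg L.map (hw c)
    rw [L.map_comp, L.map_comp] at h4
    rw [← Linear.smul_comp, ← h1, ← Linear.comp_smul, ← Linear.comp_smul, ← h2, Category.assoc,
      reassoc_of% h4]

/-- Lower triangular unipotent maps act on weight spaces by the identity up to higher weights. -/
theorem component_lower (hw : ∀ c, (𝟙 X + w) ≫ D c = D c ≫ (𝟙 X + c • w)) :
    e j ≫ L.map (𝟙 X + w) ≫ e i = if i = j then e i else 0 := by
  have h := ((polynomial_line hL (𝟙 X) w).linear_comp
    (Linear.leftComp k _ (e j) ∘ₗ Linear.rightComp k _ (e i))).shift (a := i) (b := j)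
      (x := e j ≫ L.map (𝟙 X + w) ≫ e i) hij ?_
  · rw [h]
    split_ifs with h'
    · subst h'
      change e i ≫ L.map (𝟙 X + (0 : k) • w) ≫ e i = _
      rw [zero_smul, add_zero, L.map_id, Category.id_comp, h3]
    · rfl
  · intro c
    change _ = c ^ j • (e j ≫ L.map (𝟙 X + c • w) ≫ e i)
    have h4 := congrArg L.map (hw c)
    rw [L.map_comp, L.map_comp] at h4
    rw [← Linear.smul_comp _ _ _ (c ^ j), ← h1, ← Linear.comp_smul, ← Linear.comp_smul, ← h2,
      reassoc_of% h4, Category.assoc]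

end Weights

/-! ### Adding a line -/

section AddLine

variable (k : Type u) [Field k]

/-- The functor `V ↦ k ⊕ V`. -/
def addLine : FGModuleCat.{u} k ⥤ FGModuleCat.{u} k where
  obj V := line k ⊞ V
  map f := biprod.map (𝟙 _) f
  map_id V := by
    apply biprod.hom_ext <;> simp
  map_comp f g := by
    apply biprod.hom_ext <;> simp

variable {k}

def lineι (V : FGModuleCat.{u} k) : line k ⟶ (addLine k).obj V := biprod.inl
def lineπ (V : FGModuleCat.{u} k) : (addLine k).obj V ⟶ line k := biprod.fst
def spaceι (V : FGModuleCat.{u} k) : V ⟶ (addLine k).obj V := biprod.inr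
def spaceπ (V : FGModuleCat.{u} k) : (addLine k).obj V ⟶ V := biprod.snd

variable (V W : FGModuleCat.{u} k)

theorem lineι_lineπ : lineι V ≫ lineπ V = 𝟙 _ := biprod.inl_fst
theorem lineι_spaceπ : lineι V ≫ spaceπ V = 0 := biprod.inl_snd
theorem spaceι_lineπ : spaceι V ≫ lineπ V = 0 := biprod.inr_fst
theorem spaceι_spaceπ : spaceι V ≫ spaceπ V = 𝟙 _ := biprod.inr_snd
theorem addLine_total : lineπ V ≫ lineι V + spaceπ V ≫ spaceι V = 𝟙 _ := biprod.total
theorem addLine_map {V W : FGModuleCat.{u} k} (f : V ⟶ W) :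
    (addLine k).map f = lineπ V ≫ lineι W + spaceπ V ≫ f ≫ spaceι W := by
  refine (biprod.map_eq (f := 𝟙 (line k)) (g := f)).trans ?_
  rw [Category.id_comp]
  rfl

/-- Supplies the hypothesis of `component_upper` for a block `V ⟶ k`, the one-parameter family being
the scaling of `V` inside `k ⊕ V`. The next lemma does the same for a block `k ⟶ V` and
`component_lower`. -/
theorem addLine_smul_comp_upper {V : FGModuleCat.{u} k} (q : V ⟶ line k) (c : k) :
    (addLine k).map (c • 𝟙 V) ≫ (𝟙 _ + spaceπ V ≫ q ≫ lineι V) =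
      (𝟙 _ + c • spaceπ V ≫ q ≫ lineι V) ≫ (addLine k).map (c • 𝟙 V) := by
  simp only [addLine_map, Preadditive.add_comp, Preadditive.comp_add, Category.comp_id,
    Category.id_comp, Category.assoc, Linear.smul_comp, Linear.comp_smul,
    reassoc_of% (lineι_lineπ V), reassoc_of% (lineι_spaceπ V),
    reassoc_of% (spaceι_spaceπ V), zero_comp, comp_zero, smul_zero]
  module

theorem lower_comp_addLine_smul {V : FGModuleCat.{u} k} (r : line k ⟶ V) (c : k) :
    (𝟙 _ + lineπ V ≫ r ≫ spaceι V) ≫ (addLine k).map (c • 𝟙 V) =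
      (addLine k).map (c • 𝟙 V) ≫ (𝟙 _ + c • lineπ V ≫ r ≫ spaceι V) := by
  simp only [addLine_map, Preadditive.add_comp, Preadditive.comp_add, Category.comp_id,
    Category.id_comp, Category.assoc, Linear.smul_comp, Linear.comp_smul,
    reassoc_of% (lineι_lineπ V), reassoc_of% (spaceι_lineπ V),
    reassoc_of% (spaceι_spaceπ V), zero_comp, comp_zero, smul_zero]
  module

/-- The factorization of a map with nonzero upper left entry into unipotent and diagonal maps. -/
theorem exists_ldu {V W : FGModuleCat.{u} k} (g : (addLine k).obj V ⟶ (addLine k).obj W) {a : k}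
    (ha : lineι V ≫ g ≫ lineπ W = a • 𝟙 _) (h0 : a ≠ 0) :
    ∃ (q : V ⟶ line k) (f : V ⟶ W) (r : line k ⟶ W),
      g = (𝟙 _ + spaceπ V ≫ q ≫ lineι V) ≫ (a • (addLine k).map f) ≫
        (𝟙 _ + lineπ W ≫ r ≫ spaceι W) := by
  -- Block elimination with pivot `a`. Since the middle factor is `a • addLine f`, with both blocks
  -- scaled, `f` is the Schur complement divided by `a`.
  refine ⟨a⁻¹ • spaceι V ≫ g ≫ lineπ W, a⁻¹ • (spaceι V ≫ g ≫ spaceπ W -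
    a⁻¹ • (spaceι V ≫ g ≫ lineπ W) ≫ (lineι V ≫ g ≫ spaceπ W)),
    a⁻¹ • lineι V ≫ g ≫ spaceπ W, ?_⟩
  have hg : g = (lineπ V ≫ lineι V + spaceπ V ≫ spaceι V) ≫ g ≫
      (lineπ W ≫ lineι W + spaceπ W ≫ spaceι W) := by
    rw [addLine_total, addLine_total, Category.id_comp, Category.comp_id]
  have ha' := ha
  simp only [← Category.assoc] at ha'
  conv_lhs => rw [hg]
  simp only [addLine_map, Preadditive.add_comp, Preadditive.comp_add, Category.comp_id,
    Preadditive.sub_comp, Preadditive.comp_sub, smul_add, smul_sub,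
    Category.id_comp, Category.assoc, Linear.smul_comp, Linear.comp_smul,
    reassoc_of% (lineι_lineπ V), reassoc_of% (lineι_spaceπ V), reassoc_of% (lineι_lineπ W),
    reassoc_of% (spaceι_lineπ W), zero_comp, comp_zero, smul_zero, smul_smul,
    mul_inv_cancel₀ h0, one_smul, reassoc_of% ha]
  match_scalars <;> field_simp
  ring

variable {n : ℕ} {L : FGModuleCat.{u} k ⥤ FGModuleCat.{u} k}
  (hL : IsHomogeneousFunctor k n L)

include hL in
-- On morphisms `addLine` is affine, not linear, because it fixes the line. Hence `L (k ⊕ V)` is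
-- polynomial in `V` but in general not homogeneous, and its homogeneous components are the weight
-- spaces for the scaling of `V`.
theorem addLine_comp_polynomial (V W : FGModuleCat.{u} k) :
    IsPolynomialMap k n fun f : V ⟶ W => (addLine k ⋙ L).map f := by
  have h := ((hL ((addLine k).obj V) ((addLine k).obj W)).isPolynomialMap le_rfl).comp_affine
    (Linear.leftComp k _ (spaceπ V) ∘ₗ Linear.rightComp k V (spaceι W))
    (lineπ V ≫ lineι W)
  have e : (fun f : V ⟶ W => (addLine k ⋙ L).map f) = fun f => L.map (lineπ V ≫ lineι W +
      (Linear.leftComp k _ (spaceπ V) ∘ₗ Linear.rightComp k V (spaceι W)) f) :=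
    funext fun f => congrArg L.map (addLine_map f)
  rw [e]
  exact h

end AddLine

/-! ### Endomorphisms of indecomposable homogeneous functors -/

section LowestWeight

variable {k : Type u} [Field k] [CharZero k] {n : ℕ}
  {L : FGModuleCat.{u} k ⥤ FGModuleCat.{u} k} (hL : IsHomogeneousFunctor k n L)
  {p : ℕ → ∀ {V W : FGModuleCat.{u} k}, (V ⟶ W) →
    ((addLine k ⋙ L).obj V ⟶ (addLine k ⋙ L).obj W)} (hp : IsComponents (addLine k ⋙ L) n p)

include hL hp

/-- Guarantees that the lowest weight part has smaller degree than `L`, which drives the induction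
in `IsIndec.end_scalar`. Let `m + 1` be the smallest dimension on which `L` is nonzero. If only
weight `n` occurred at `k ⊕ k^m`, rescaling the line by `c ≠ 0` would act by a map independent of
`c`; in the limit `c = 0` this map factors through `L (k^m) = 0`. So `L (k ⊕ k^m)` would vanish too.
-/
theorem exists_component_ne_zero (hn : n ≠ 0) (h0 : 𝟙 L ≠ 0) :
    ∃ j, j < n ∧ ∃ V, p j (𝟙 V) ≠ 0 := by
  classical
  have h1 : ∃ m, 𝟙 (L.obj (std k m)) ≠ 0 :=
    ⟨n, fun h => h0 (eq_zero_of_app_std hL h)⟩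
  obtain ⟨m, hm, hmin⟩ : ∃ m, 𝟙 (L.obj (std k m)) ≠ 0 ∧
      ∀ m' < m, 𝟙 (L.obj (std k m')) = 0 :=
    ⟨Nat.find h1, Nat.find_spec h1, fun m' h => not_not.mp (Nat.find_min h1 h)⟩
  obtain _ | m := m
  · refine (hm ?_).elim
    -- On the zero space the identity is `0 • 𝟙`, so `L` acts on it by `0 ^ n = 0`; here `n ≠ 0` is
    -- needed.
    have h2 : 𝟙 (std k 0) = (0 : k) • 𝟙 (std k 0) := by
      apply FGModuleCat.hom_ext
      ext x i
      exact i.elim0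
    rw [← L.map_id, h2, (hL _ _).map_smul, zero_pow hn, zero_smul]
  · by_contra! hc
    have hz := hmin m (Nat.lt_succ_self m)
    -- Scaling the line by `c` is scaling `V` by `c⁻¹` followed by the scalar `c`. The scalar
    -- contributes `c ^ n`, which cancels the weight `n` of `c⁻¹`.
    have h3 : ∀ c : k, c ≠ 0 → L.map (spaceπ (std k m) ≫ spaceι _ +
        c • (lineπ (std k m) ≫ lineι _)) = p n (𝟙 (std k m)) := by
      intro c hc0
      have h4 : spaceπ (std k m) ≫ spaceι _ + c • (lineπ (std k m) ≫ lineι _) =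
          c • (addLine k).map (c⁻¹ • 𝟙 _) := by
        rw [addLine_map]
        simp only [Linear.smul_comp, Linear.comp_smul, Category.id_comp, smul_add, smul_smul,
          mul_inv_cancel₀ hc0, one_smul]
        abel
      rw [h4, (hL _ _).map_smul]
      refine (congrArg (c ^ n • ·) (hp.map_smul c⁻¹ (𝟙 _))).trans ?_
      rw [Finset.sum_eq_single_of_mem n (Finset.mem_range.mpr (Nat.lt_succ_self n)), smul_smul,
        ← mul_pow, mul_inv_cancel₀ hc0, one_pow, one_smul]
      intro j hj hjn
      rw [hc j (by simp only [Finset.mem_range] at hj; omega), smul_zero]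
    have h5 := ((polynomial_line hL (spaceπ (std k m) ≫ spaceι _)
      (lineπ (std k m) ≫ lineι _)).add (IsPolynomialMap.const n (-p n (𝟙 (std k m))))).eq_zero_of_ne
      fun c hc0 => by rw [h3 c hc0]; exact add_neg_cancel _
    have h6 : p n (𝟙 (std k m)) = 0 := by
      have h7 : L.map (spaceπ (std k m) ≫ spaceι (std k m) +
          (0 : k) • (lineπ (std k m) ≫ lineι _)) = 0 := by
        rw [zero_smul, add_zero, L.map_comp, ← Category.id_comp (L.map (spaceι _)), hz, zero_comp,
          comp_zero]
      rw [h7] at h5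
      exact neg_eq_zero.mp ((zero_add _).symm.trans h5)
    have h8 : 𝟙 (L.obj ((addLine k).obj (std k m))) = 0 := by
      refine ((addLine k ⋙ L).map_id (std k m)).symm.trans ((hp.map_eq _).trans ?_)
      refine Finset.sum_eq_zero fun j hj => ?_
      by_cases hjn : j = n
      · rw [hjn, h6]
      · exact hc j (by simp only [Finset.mem_range] at hj; omega) _
    apply hm
    -- Deleting the first coordinate, and inserting a zero there. Together with that coordinate they
    -- exhibit `k^(m+1)` as a retract of `k ⊕ k^m`.
    let t : std k (m + 1) ⟶ std k m := FGModuleCat.ofHom (LinearMap.funLeft k k Fin.succ)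
    let s : std k m ⟶ std k (m + 1) := FGModuleCat.ofHom (LinearMap.pi fun i =>
      Fin.cases (motive := fun _ => (Fin m → k) →ₗ[k] k) 0 (fun i => LinearMap.proj i) i)
    have h9 : 𝟙 (std k (m + 1)) = (stdπ (m + 1) 0 ≫ lineι _ + t ≫ spaceι _) ≫
        (lineπ (std k m) ≫ stdι (m + 1) 0 + spaceπ _ ≫ s) := by
      simp only [Preadditive.add_comp, Preadditive.comp_add, Category.assoc,
        reassoc_of% (lineι_lineπ (std k m)), reassoc_of% (lineι_spaceπ (std k m)),
        reassoc_of% (spaceι_lineπ (std k m)), reassoc_of% (spaceι_spaceπ (std k m)),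
        zero_comp, comp_zero, add_zero, zero_add]
      apply FGModuleCat.hom_ext
      refine LinearMap.ext fun (x : Fin (m + 1) → k) => funext fun i => ?_
      change x i = Pi.single (M := fun _ => k) 0 (x 0) i +
        (Fin.cases (motive := fun _ => (Fin m → k) →ₗ[k] k) 0
          (fun i => LinearMap.proj i) i : (Fin m → k) →ₗ[k] k) (fun j => x j.succ)
      refine Fin.cases ?_ (fun i => ?_) i
      · simp
      · simp
    rw [← L.map_id, h9, L.map_comp,
      ← Category.id_comp (L.map (lineπ (std k m) ≫ stdι (m + 1) 0 + _)), h8, zero_comp, comp_zero]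

variable {j : ℕ} (hj : ∀ i < j, ∀ V, p i (𝟙 V) = 0)

include hj

/-- Here `j` is the lowest weight. With a nonzero upper left entry `a`, the map `g` has a triangular
factorization. The projections to weight `j` absorb the unipotent factors, and the diagonal factor
contributes `a ^ n • p j f`. The case `a = 0` follows by perturbing the entry. -/
theorem compress_mem_span (V W : FGModuleCat.{u} k)
    (g : (addLine k).obj V ⟶ (addLine k).obj W) :
    p j (𝟙 V) ≫ L.map g ≫ p j (𝟙 W) ∈
      Submodule.span k (Set.range fun f : V ⟶ W => p j f) := by
  have h1 : ∀ V i (c : k), p i (𝟙 V) ≫ L.map ((addLine k).map (c • 𝟙 V)) = c ^ i • p i (𝟙 V) :=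
    fun V i c => (hp.comp_map i (𝟙 V) (c • 𝟙 V)).trans (by rw [Category.id_comp, hp.smul])
  have h2 : ∀ V i (c : k), L.map ((addLine k).map (c • 𝟙 V)) ≫ p i (𝟙 V) = c ^ i • p i (𝟙 V) :=
    fun V i c => (hp.map_comp i (c • 𝟙 V) (𝟙 V)).trans (by rw [Category.comp_id, hp.smul])
  have h3 : ∀ V i, p i (𝟙 V) ≫ p i (𝟙 V) = p i (𝟙 V) := fun V i => by
    rw [hp.comp, if_pos rfl, Category.id_comp]
  have hsum : ∀ V, 𝟙 _ = ∑ i ∈ Finset.range (n + 1), p i (𝟙 V) := fun V =>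
    ((addLine k ⋙ L).map_id V).symm.trans (hp.map_eq _)
  -- No bound on `j` is assumed: if `j > n` the sum has no term of index `j`, but then `p j` is zero
  -- anyway.
  have hjj : ∀ V, (if j ∈ Finset.range (n + 1) then p j (𝟙 V) else 0) = p j (𝟙 V) := by
    intro V
    split_ifs with h
    · rfl
    · exact (hp.vanish j (by simpa using h) _).symm
  -- Insert the sum of all weight projections on the right: the terms above `j` vanish by
  -- `component_upper` and those below `j` by minimality. The dual computation for lower triangular
  -- maps inserts it on the left.
  have hu : ∀ (q : V ⟶ line k), p j (𝟙 V) ≫ L.map (𝟙 _ + spaceπ V ≫ q ≫ lineι V) = p j (𝟙 V) := by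
    intro q
    have : p j (𝟙 V) ≫ L.map (𝟙 _ + spaceπ V ≫ q ≫ lineι V) ≫ 𝟙 _ = p j (𝟙 V) := by
      refine (congrArg (fun t => p j (𝟙 V) ≫ L.map (𝟙 _ + spaceπ V ≫ q ≫ lineι V) ≫ t)
        (hsum V)).trans ?_
      rw [Preadditive.comp_sum, Preadditive.comp_sum]
      refine Eq.trans (Finset.sum_congr rfl fun i hi => ?_)
        ((Finset.sum_ite_eq _ j fun _ => p j (𝟙 V)).trans (hjj V))
      by_cases hij : j ≤ i
      · exact component_upper hL (h1 V) (h2 V) (h3 V) hij (addLine_smul_comp_upper q)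
      · rw [hj i (by omega), if_neg (by omega)]
        exact (congrArg (p j (𝟙 V) ≫ ·) comp_zero).trans comp_zero
    rwa [Category.comp_id] at this
  have hl : ∀ (r : line k ⟶ W), L.map (𝟙 _ + lineπ W ≫ r ≫ spaceι W) ≫ p j (𝟙 W) = p j (𝟙 W) := by
    intro r
    have : 𝟙 _ ≫ L.map (𝟙 _ + lineπ W ≫ r ≫ spaceι W) ≫ p j (𝟙 W) = p j (𝟙 W) := by
      refine (congrArg (fun t => t ≫ L.map (𝟙 _ + lineπ W ≫ r ≫ spaceι W) ≫ p j (𝟙 W))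
        (hsum W)).trans ?_
      rw [Preadditive.sum_comp]
      refine Eq.trans (Finset.sum_congr rfl fun i hi => ?_)
        ((Finset.sum_ite_eq _ j fun _ => p j (𝟙 W)).trans (hjj W))
      by_cases hij : j ≤ i
      · exact component_lower hL (h1 W) (h2 W) (h3 W) hij (lower_comp_addLine_smul r)
      · rw [hj i (by omega), if_neg (by omega)]
        exact zero_comp
    rwa [Category.id_comp] at this
  have key : ∀ (g : (addLine k).obj V ⟶ (addLine k).obj W) (a : k),
      lineι V ≫ g ≫ lineπ W = a • 𝟙 _ → a ≠ 0 → p j (𝟙 V) ≫ L.map g ≫ p j (𝟙 W) ∈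
      Submodule.span k (Set.range fun f : V ⟶ W => p j f) := by
    intro g a ha h0
    obtain ⟨q, f, r, rfl⟩ := exists_ldu g ha h0
    rw [L.map_comp, L.map_comp, (hL _ _).map_smul, Category.assoc, Category.assoc, hl,
      ← Category.assoc, hu, Linear.smul_comp, Linear.comp_smul]
    refine Submodule.smul_mem _ _ (Submodule.subset_span ⟨f, ?_⟩)
    have h4 := hp.map_comp j f (𝟙 W)
    have h5 := hp.comp j j (𝟙 V) f
    rw [Category.comp_id] at h4
    rw [Category.id_comp, if_pos rfl] at h5
    exact h5.symm.trans (congrArg (p j (𝟙 V) ≫ ·) h4.symm)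
  obtain ⟨a, ha⟩ := end_line (lineι V ≫ g ≫ lineπ W)
  by_cases h0 : a = 0
  -- Adding `c` times the projection to the line makes the corner entry equal to `c`. Modulo the
  -- span this gives a polynomial in `c` vanishing for `c ≠ 0`, hence also at `c = 0`.
  · rw [← Submodule.Quotient.mk_eq_zero]
    have h6 := (((polynomial_line hL g (lineπ V ≫ lineι W)).linear_comp
      (Linear.leftComp k _ (p j (𝟙 V)) ∘ₗ Linear.rightComp k _ (p j (𝟙 W)))).linear_comp
      (Submodule.mkQ (Submodule.span k (Set.range fun f : V ⟶ W => p j f)))).eq_zero_of_ne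
      fun c hc => (Submodule.Quotient.mk_eq_zero _).mpr (key _ c (by
        simp only [Preadditive.add_comp, Preadditive.comp_add, Linear.smul_comp, Linear.comp_smul,
          Category.assoc, ha, h0, zero_smul, zero_add, reassoc_of% (lineι_lineπ V),
          lineι_lineπ]) hc)
    rw [zero_smul, add_zero] at h6
    exact h6
  · exact key g a ha h0

end LowestWeight

section AbsolutelyIrreducible

variable {k : Type u} [Field k] [CharZero k]

omit [CharZero k] in
theorem IsHomogeneousFunctor.map_eq_id_of_zero {L : FGModuleCat.{u} k ⥤ FGModuleCat.{u} k}
    (hL : IsHomogeneousFunctor k 0 L) {V : FGModuleCat.{u} k} (g : V ⟶ V) : L.map g = 𝟙 _ := by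
  obtain ⟨M, hM⟩ := hL V V
  rw [← L.map_id]
  refine (hM g).trans (Eq.trans (congrArg M (funext fun i => i.elim0)) (hM (𝟙 V)).symm)

/-- Indecomposable homogeneous functors have only scalar endomorphisms. -/
theorem IsIndec.end_scalar (n : ℕ) : ∀ {L : FGModuleCat.{u} k ⥤ FGModuleCat.{u} k},
    IsHomogeneousFunctor k n L → IsIndec L → ∀ φ : L ⟶ L, ∃ c : k, φ = c • 𝟙 L := by
  classical
  induction n using Nat.strong_induction_on with
  | _ n ih =>
  intro L hL hI φ
  by_cases hn : n = 0
  · subst hn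
    obtain ⟨V, x, hx⟩ := hI.exists_ne_zero
    -- In degree `0` every morphism acts as the identity, so what `x` generates is just its span; as
    -- this is everything, `x` is an eigenvector.
    have h1 := generated_eq_top hL hI (fun _ : Unit => V) (fun _ => x) (i := ()) hx V
    have h2 : (φ.app V).hom.hom x ∈ generated L (fun _ : Unit => V) (fun _ => x) V := by
      rw [h1]
      trivial
    have h3 : generated L (fun _ : Unit => V) (fun _ => x) V ≤ Submodule.span k {x} := by
      refine Submodule.span_le.mpr ?_
      rintro _ ⟨-, g, rfl⟩
      rw [hL.map_eq_id_of_zero g]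
      exact Submodule.mem_span_singleton_self x
    obtain ⟨c, hc⟩ := Submodule.mem_span_singleton.mp (h3 h2)
    exact ⟨c, eq_smul_of_eigenvector hL hI φ c hx hc.symm⟩
  obtain ⟨p, hp⟩ := IsPolynomialFunctor.exists_components (addLine_comp_polynomial hL)
  obtain ⟨j, hjn, ⟨V₀, hj0⟩, hmin⟩ : ∃ j, j < n ∧ (∃ V, p j (𝟙 V) ≠ 0) ∧
      ∀ i < j, ∀ V, p i (𝟙 V) = 0 := by
    have h := exists_component_ne_zero hL hp hn hI.1
    exact ⟨Nat.find h, (Nat.find_spec h).1, (Nat.find_spec h).2, fun i hi V => by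
      by_contra hc
      exact Nat.find_min h hi ⟨hi.trans (Nat.find_spec h).1, V, hc⟩⟩
  let G : Poly k (FGModuleCat.{u} k) := ⟨addLine k ⋙ L, n, addLine_comp_polynomial hL⟩
  let e : addLine k ⋙ L ⟶ addLine k ⋙ L :=
    { app := fun V => p j (𝟙 V)
      naturality := fun V W f => by
        rw [hp.map_comp, hp.comp_map, Category.id_comp, Category.comp_id] }
  obtain ⟨X, ι', π', h1, h2⟩ := exists_splitting G (ObjectProperty.homMk e) (by
    apply ObjectProperty.hom_ext
    ext V : 2
    change p j (𝟙 V) ≫ p j (𝟙 V) = p j (𝟙 V)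
    rw [hp.comp, if_pos rfl, Category.id_comp])
  obtain ⟨ι, rfl⟩ := ObjectProperty.homMk_surjective ι'
  obtain ⟨π, rfl⟩ := ObjectProperty.homMk_surjective π'
  have hιπ : ∀ V, ι.app V ≫ π.app V = 𝟙 _ := fun V =>
    congrArg (fun t : X ⟶ X => t.hom.app V) h1
  have hπι : ∀ V, π.app V ≫ ι.app V = p j (𝟙 V) := fun V =>
    congrArg (fun t : G ⟶ G => t.hom.app V) h2
  have hιe : ∀ V, ι.app V ≫ p j (𝟙 V) = ι.app V := fun V => by
    rw [← hπι, ← Category.assoc, hιπ, Category.id_comp]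
  have heπ : ∀ V, p j (𝟙 V) ≫ π.app V = π.app V := fun V => by
    rw [← hπι, Category.assoc, hιπ, Category.comp_id]
  -- The splitting `X` of the weight `j` projection acts through the component `p j f` alone, so it
  -- is homogeneous of degree `j`.
  have hXmap : ∀ {V W : FGModuleCat.{u} k} (f : V ⟶ W),
      X.obj.map f = ι.app V ≫ p j f ≫ π.app W := by
    intro V W f
    have h3 : p j f = (addLine k ⋙ L).map f ≫ p j (𝟙 W) := by rw [hp.map_comp, Category.comp_id]
    rw [h3, Category.assoc, heπ]
    refine Eq.trans ?_ (congrArg (ι.app V ≫ ·) (π.naturality f)).symm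
    rw [← Category.assoc, hιπ, Category.id_comp]
  have hX : IsHomogeneousFunctor k j X.obj := by
    intro V W
    have h := (hp.homogeneous j V W).linear_comp
      (Linear.leftComp k _ (ι.app V) ∘ₗ Linear.rightComp k _ (π.app W))
    have e1 : (fun f : V ⟶ W => X.obj.map f) = fun f =>
      (Linear.leftComp k _ (ι.app V) ∘ₗ Linear.rightComp k _ (π.app W)) (p j f) :=
      funext fun f => hXmap f
    rw [e1]
    exact h
  have hιinj : ∀ V (x : X.obj.obj V), (π.app V).hom.hom ((ι.app V).hom.hom x) = x := fun V x =>
    LinearMap.congr_fun (congrArg (fun t => t.hom.hom) (hιπ V)) x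
  -- Indecomposability descends to the lowest weight part. The image of a nonzero idempotent `ε`
  -- generates all of `L`; compressing a generated element back to weight `j` involves only maps
  -- `X.map f`, by `compress_mem_span`, and these preserve the image of `ε`. So `ε` is onto, hence
  -- the identity.
  have hXI : IsIndec X.obj := by
    refine ⟨fun h => hj0 ?_, fun ε hε => ?_⟩
    · rw [← hπι, ← Category.id_comp (ι.app V₀)]
      have : 𝟙 (X.obj.obj V₀) = 0 := congrArg (fun t : X.obj ⟶ X.obj => t.app V₀) h
      rw [this, zero_comp, comp_zero]
    · by_cases h0 : ε = 0
      · exact Or.inl h0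
      right
      obtain ⟨V₁, x₁, hx₁⟩ : ∃ (V : FGModuleCat.{u} k) (x : X.obj.obj V),
          (ε.app V).hom.hom x ≠ 0 := by
        by_contra! h
        apply h0
        ext V x
        exact h V x
      have hε' : ∀ V x, (ε.app V).hom.hom ((ε.app V).hom.hom x) = (ε.app V).hom.hom x :=
        fun V x => LinearMap.congr_fun (congrArg (fun t : X.obj ⟶ X.obj => (t.app V).hom.hom) hε) x
      let gen := generated L (I := Σ V, X.obj.obj V) (fun i => (addLine k).obj i.1)
        (fun i => (ι.app i.1).hom.hom ((ε.app i.1).hom.hom i.2))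
      have htop : ∀ U, gen U = ⊤ := fun U => generated_eq_top hL hI _ _ (i := ⟨V₁, x₁⟩) (by
        intro h
        apply hx₁
        rw [← hιinj V₁ ((ε.app V₁).hom.hom x₁), h, map_zero]) U
      have hrange : ∀ W (y : X.obj.obj W), y ∈ LinearMap.range (ε.app W).hom.hom := by
        intro W y
        have h3 : gen ((addLine k).obj W) ≤
            (LinearMap.range (ε.app W).hom.hom).comap (π.app W).hom.hom := by
          refine Submodule.span_le.mpr ?_
          rintro _ ⟨⟨V, x⟩, g, rfl⟩
          have h4 := compress_mem_span hL hp hmin V W g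
          have h5 : (ι.app V) ≫ L.map g ≫ π.app W =
              ι.app V ≫ (p j (𝟙 V) ≫ L.map g ≫ p j (𝟙 W)) ≫ π.app W := by
            conv_lhs => rw [← hιe V, ← heπ W]
            simp only [Category.assoc]
          -- Evaluation at `ε x` of the compression of a map; membership in the image of `ε` is a
          -- linear condition on the map, so it can be checked on the spanning maps `p j f`.
          let Φ : ((addLine k ⋙ L).obj V ⟶ (addLine k ⋙ L).obj W) →ₗ[k] X.obj.obj W :=
            LinearMap.applyₗ ((ε.app V).hom.hom x) ∘ₗ (fgHom _ _).toLinearMap ∘ₗ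
              Linear.leftComp k _ (ι.app V) ∘ₗ Linear.rightComp k _ (π.app W)
          have h6 : Submodule.span k (Set.range fun f : V ⟶ W => p j f) ≤
              (LinearMap.range (ε.app W).hom.hom).comap Φ := by
            refine Submodule.span_le.mpr ?_
            rintro _ ⟨f, rfl⟩
            change (ι.app V ≫ p j f ≫ π.app W).hom.hom ((ε.app V).hom.hom x) ∈
              LinearMap.range (ε.app W).hom.hom
            rw [← hXmap]
            exact ⟨(X.obj.map f).hom.hom x, LinearMap.congr_fun
              (congrArg (fun t => t.hom.hom) (ε.naturality f)) x⟩
          have h7 := h6 h4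
          change (ι.app V ≫ (p j (𝟙 V) ≫ L.map g ≫ p j (𝟙 W)) ≫ π.app W).hom.hom
            ((ε.app V).hom.hom x) ∈ LinearMap.range (ε.app W).hom.hom at h7
          rw [← h5] at h7
          exact h7
        have h8 : (ι.app W).hom.hom y ∈ gen ((addLine k).obj W) := by
          rw [htop]
          trivial
        have h9 := h3 h8
        rw [Submodule.mem_comap, hιinj] at h9
        exact h9
      ext W y
      obtain ⟨z, hz⟩ := hrange W y
      change (ε.app W).hom.hom y = y
      rw [← hz, hε']
  -- By naturality of components `φ` commutes with the weight projection, so its compression to `X`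
  -- is its restriction. Any nonzero vector of `X` then becomes an eigenvector of `φ`.
  obtain ⟨c, hc⟩ := ih j hjn hX hXI (ι ≫ Functor.whiskerLeft (addLine k) φ ≫ π)
  obtain ⟨V, x, hx⟩ := hXI.exists_ne_zero
  refine ⟨c, eq_smul_of_eigenvector hL hI φ c (V := (addLine k).obj V)
    (x := (ι.app V).hom.hom x) (fun h => hx ?_) ?_⟩
  · rw [← hιinj V x, h, map_zero]
  · have h3 : ι.app V ≫ φ.app ((addLine k).obj V) = c • ι.app V := by
      have h4 : ι.app V ≫ φ.app ((addLine k).obj V) ≫ π.app V = c • 𝟙 _ :=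
        congrArg (fun t : X.obj ⟶ X.obj => t.app V) hc
      have h5 : p j (𝟙 V) ≫ φ.app ((addLine k).obj V) =
          φ.app ((addLine k).obj V) ≫ p j (𝟙 V) :=
        hp.naturality hp (Functor.whiskerLeft (addLine k) φ) j (𝟙 V)
      calc ι.app V ≫ φ.app ((addLine k).obj V)
          = (ι.app V ≫ p j (𝟙 V)) ≫ φ.app ((addLine k).obj V) := by rw [hιe]
        _ = ι.app V ≫ φ.app ((addLine k).obj V) ≫ p j (𝟙 V) := by
            rw [Category.assoc]
            exact congrArg (ι.app V ≫ ·) h5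
        _ = (ι.app V ≫ φ.app ((addLine k).obj V) ≫ π.app V) ≫ ι.app V := by
            rw [← hπι]
            simp only [Category.assoc]
        _ = c • ι.app V := by rw [h4, Linear.smul_comp, Category.id_comp]
    exact LinearMap.congr_fun (congrArg (fun t => t.hom.hom) h3) x

end AbsolutelyIrreducible

/-! ### Direct sums -/

section DirectSums

variable {C : Type v} [Category.{w'} C] [Preadditive C]

theorem IsDirectSum.sigma {X : C} {J : Type} [Fintype J] {Y : J → C} (hX : IsDirectSum X Y)
    {K : J → Type} [∀ a, Fintype (K a)] {Z : ∀ a, K a → C} (hY : ∀ a, IsDirectSum (Y a) (Z a)) :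
    IsDirectSum X fun p : Σ a, K a => Z p.1 p.2 := by
  classical
  obtain ⟨π, ι, h1, h2, h3⟩ := hX
  choose π' ι' h1' h2' h3' using hY
  refine ⟨fun p => π p.1 ≫ π' p.1 p.2, fun p => ι' p.1 p.2 ≫ ι p.1, ?_, ?_, ?_⟩
  · rintro ⟨a, b⟩
    simp only [Category.assoc]
    rw [reassoc_of% (h1 a), h1']
  · rintro ⟨a, b⟩ ⟨a', b'⟩ hne
    simp only [Category.assoc]
    by_cases haa' : a = a'
    · subst haa'
      rw [reassoc_of% (h1 a), h2']
      rintro rfl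
      exact hne rfl
    · rw [reassoc_of% (h2 a a' haa')]
      simp
  · rw [Fintype.sum_sigma, ← h3]
    refine Finset.sum_congr rfl fun a _ => ?_
    calc ∑ b, (π a ≫ π' a b) ≫ ι' a b ≫ ι a = π a ≫ (∑ b, π' a b ≫ ι' a b) ≫ ι a := by
          simp only [Preadditive.sum_comp, Preadditive.comp_sum, Category.assoc]
      _ = π a ≫ ι a := by rw [h3']; simp

theorem IsDirectSum.congr {X : C} {J : Type} [Fintype J] {Y Y' : J → C} (hX : IsDirectSum X Y)
    (e : ∀ a, Y a ≅ Y' a) : IsDirectSum X Y' := by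
  obtain ⟨π, ι, h1, h2, h3⟩ := hX
  refine ⟨fun a => π a ≫ (e a).hom, fun a => (e a).inv ≫ ι a, fun a => ?_, fun a b hab => ?_, ?_⟩
  · simp [reassoc_of% (h1 a)]
  · simp [reassoc_of% (h2 a b hab)]
  · simp [h3]

theorem IsDirectSum.of_iso {X X' : C} {J : Type} [Fintype J] {Y : J → C} (hX : IsDirectSum X Y)
    (e : X ≅ X') : IsDirectSum X' Y := by
  obtain ⟨π, ι, h1, h2, h3⟩ := hX
  refine ⟨fun a => e.inv ≫ π a, fun a => ι a ≫ e.hom, fun a => ?_, fun a b hab => ?_, ?_⟩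
  · simp [h1]
  · simp [h2 a b hab]
  · calc ∑ a, (e.inv ≫ π a) ≫ ι a ≫ e.hom = e.inv ≫ (∑ a, π a ≫ ι a) ≫ e.hom := by
          simp only [Preadditive.sum_comp, Preadditive.comp_sum, Category.assoc]
      _ = 𝟙 X' := by rw [h3]; simp

theorem IsDirectSum.map_additive {D : Type*} [Category D] [Preadditive D] (F : C ⥤ D) [F.Additive]
    {X : C} {J : Type} [Fintype J] {Y : J → C} (hX : IsDirectSum X Y) :
    IsDirectSum (F.obj X) fun a => F.obj (Y a) := by
  obtain ⟨π, ι, h1, h2, h3⟩ := hX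
  refine ⟨fun a => F.map (π a), fun a => F.map (ι a), fun a => ?_, fun a b hab => ?_, ?_⟩
  · rw [← F.map_comp, h1, F.map_id]
  · rw [← F.map_comp, h2 a b hab, F.map_zero]
  · simp only [← F.map_comp, ← F.map_sum, h3, F.map_id]

theorem IsDirectSum.unit (X : C) : IsDirectSum X fun _ : Unit => X :=
  ⟨fun _ => 𝟙 X, fun _ => 𝟙 X, by simp, fun a b h => (h rfl).elim, by simp⟩

theorem IsDirectSum.empty {X : C} (h : 𝟙 X = 0) (Y : Empty → C) : IsDirectSum X Y :=
  ⟨fun a => a.elim, fun a => a.elim, fun a => a.elim, fun a => a.elim, by simp [h]⟩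

/-- A complete family of split orthogonal idempotents gives a direct sum decomposition. -/
theorem IsDirectSum.of_idempotents {X : C} {J : Type} [Fintype J] {Y : J → C} (e : J → (X ⟶ X))
    (π : ∀ a, X ⟶ Y a) (ι : ∀ a, Y a ⟶ X) (h1 : ∀ a, ι a ≫ π a = 𝟙 _)
    (h2 : ∀ a, π a ≫ ι a = e a) (h3 : ∀ a b, a ≠ b → e a ≫ e b = 0) (h4 : ∑ a, e a = 𝟙 X) :
    IsDirectSum X Y := by
  refine ⟨π, ι, h1, fun a b hab => ?_, by simp only [h2, h4]⟩
  calc ι a ≫ π b = ((ι a ≫ π a) ≫ ι a) ≫ π b ≫ (ι b ≫ π b) := by simp [h1]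
    _ = ι a ≫ (e a ≫ e b) ≫ π b := by simp only [← h2, Category.assoc]
    _ = 0 := by simp [h3 a b hab]

end DirectSums

/-! ### Bases of semisimple categories -/

section Bases

/-- A family of pairwise non-isomorphic objects whose endomorphisms are scalars, such that every
object is a finite direct sum of members of the family. -/
structure IsBasis (k : Type u) [Field k] {C : Type v} [Category.{w'} C] [Preadditive C]
    [Linear k C] {B : Type} (E : B → C) : Prop where
  scalar : ∀ b (f : E b ⟶ E b), ∃ c : k, f = c • 𝟙 _
  id_ne_zero : ∀ b, 𝟙 (E b) ≠ 0
  orthogonal : ∀ a b, a ≠ b → ∀ f : E a ⟶ E b, f = 0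
  decomposition : ∀ X : C, ∃ (J : Type) (_ : Fintype J) (q : J → B), IsDirectSum X fun a => E (q a)

variable {k : Type u} [Field k] {C : Type v} [Category.{w'} C] [Preadditive C]
    [Linear k C] {B : Type} {E : B → C}

theorem IsBasis.congr (hE : IsBasis k E) {E' : B → C} (e : ∀ b, E b ≅ E' b) : IsBasis k E' where
  scalar b f := by
    obtain ⟨c, hc⟩ := hE.scalar b ((e b).hom ≫ f ≫ (e b).inv)
    refine ⟨c, ?_⟩
    calc f = (e b).inv ≫ ((e b).hom ≫ f ≫ (e b).inv) ≫ (e b).hom := by simp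
      _ = c • 𝟙 _ := by rw [hc]; simp
  id_ne_zero b h := hE.id_ne_zero b (by
    rw [← (e b).hom_inv_id, ← Category.id_comp (e b).inv, h]
    simp)
  orthogonal a b hab f := by
    have := hE.orthogonal a b hab ((e a).hom ≫ f ≫ (e b).inv)
    calc f = (e a).inv ≫ ((e a).hom ≫ f ≫ (e b).inv) ≫ (e b).hom := by simp
      _ = 0 := by rw [this]; simp
  decomposition X := by
    obtain ⟨J, _, q, h⟩ := hE.decomposition X
    exact ⟨J, _, q, h.congr fun a => e (q a)⟩

theorem IsBasis.reindex (hE : IsBasis k E) {B' : Type} (σ : B' ≃ B) :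
    IsBasis k fun b => E (σ b) where
  scalar b := hE.scalar _
  id_ne_zero b := hE.id_ne_zero _
  orthogonal a b hab := hE.orthogonal _ _ (σ.injective.ne hab)
  decomposition X := by
    obtain ⟨J, fJ, q, h⟩ := hE.decomposition X
    refine ⟨J, fJ, fun a => σ.symm (q a), ?_⟩
    simp only [Equiv.apply_symm_apply]
    exact h

theorem IsBasis.map_equivalence (hE : IsBasis k E) {D : Type*} [Category D] [Preadditive D]
    [Linear k D] (F : C ⥤ D) [F.Additive] [F.Linear k] [F.IsEquivalence] :
    IsBasis k fun b => F.obj (E b) where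
  scalar b f := by
    obtain ⟨g, rfl⟩ := F.map_surjective f
    obtain ⟨c, rfl⟩ := hE.scalar b g
    exact ⟨c, by rw [F.map_smul, F.map_id]⟩
  id_ne_zero b h := hE.id_ne_zero b (F.map_injective (by rw [F.map_id, h, F.map_zero]))
  orthogonal a b hab f := by
    obtain ⟨g, rfl⟩ := F.map_surjective f
    rw [hE.orthogonal a b hab g, F.map_zero]
  decomposition X := by
    obtain ⟨J, _, q, h⟩ := hE.decomposition (F.objPreimage X)
    exact ⟨J, _, q, (h.map_additive F).of_iso (F.objObjPreimageIso X)⟩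

end Bases

/-! ### Decomposition of polynomial functors -/

section Decomposition

variable {k : Type u} [Field k]

theorem IsIndec.obj {A : Type v} [Category.{w'} A] [Preadditive A] [Linear k A] {X : Poly k A}
    (h : IsIndec X) : IsIndec X.obj := by
  refine ⟨fun h0 => h.1 (ObjectProperty.hom_ext _ h0), fun ε hε => ?_⟩
  rcases h.2 (ObjectProperty.homMk ε) (ObjectProperty.hom_ext _ hε) with h1 | h1
  · exact Or.inl (congrArg (fun t : X ⟶ X => t.hom) h1)
  · exact Or.inr (congrArg (fun t : X ⟶ X => t.hom) h1)

/-- The `n`-th tensor power functor. -/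
def tensorPower (k : Type u) [Field k] (n : ℕ) : FGModuleCat.{u} k ⥤ FGModuleCat.{u} k :=
  tensorFunctor fun _ : Fin n => 𝟭 _

theorem tensorPower_homogeneous (n : ℕ) : IsHomogeneousFunctor k n (tensorPower k n) := by
  have := tensorFunctor_homogeneous (G := fun _ : Fin n => 𝟭 (FGModuleCat.{u} k)) (n := fun _ => 1)
    fun _ V W => IsHomogeneousMap.linear LinearMap.id
  rw [finsum_eq_sum_of_fintype] at this
  simp only [Finset.sum_const, Finset.card_univ, Fintype.card_fin, smul_eq_mul, mul_one] at this
  exact this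

variable [CharZero k]

section

variable {A : Type v} [Category.{w'} A] [Preadditive A] [Linear k A]

/-- The components `p n (𝟙 V)` are natural orthogonal idempotents with sum `𝟙`. The image of the
`n`-th one acts through `p n f`, so it is homogeneous of degree `n`. -/
theorem exists_homogeneous_decomposition (F : Poly k A) :
    ∃ (d : ℕ) (Y : Fin (d + 1) → Poly k A), IsDirectSum F Y ∧
      ∀ n : Fin (d + 1), polyDeg k A n (Y n) := by
  obtain ⟨d, hd⟩ := F.property
  obtain ⟨p, hp⟩ := IsPolynomialFunctor.exists_components hd
  let e : ℕ → (F ⟶ F) := fun n => ObjectProperty.homMk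
    { app := fun V => p n (𝟙 V)
      naturality := fun V W f => by
        rw [hp.map_comp, hp.comp_map, Category.id_comp, Category.comp_id] }
  have he : ∀ m n, e m ≫ e n = if m = n then e m else 0 := by
    intro m n
    apply ObjectProperty.hom_ext
    ext V : 2
    change p m (𝟙 V) ≫ p n (𝟙 V) = _
    rw [hp.comp]
    split_ifs
    · rw [Category.id_comp]
      rfl
    · rfl
  choose Y ι π h1 h2 using fun n => exists_splitting F (e n) (by rw [he, if_pos rfl])
  refine ⟨d, fun n => Y n, IsDirectSum.of_idempotents (fun n : Fin (d + 1) => e n)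
    (fun n => π n) (fun n => ι n) (fun n => h1 n) (fun n => h2 n) (fun m n hmn => ?_) ?_,
    fun n => ?_⟩
  · rw [he, if_neg (Fin.val_ne_of_ne hmn)]
  · have h3 : (∑ n : Fin (d + 1), e n).hom = 𝟙 F.obj := by
      rw [Finset.sum_fin_eq_sum_range]
      change ((ObjectProperty.ι _).mapAddHom _) = _
      rw [map_sum]
      ext V : 2
      rw [NatTrans.app_sum, NatTrans.id_app, ← F.obj.map_id, hp.map_eq]
      refine Finset.sum_congr rfl fun n hn => ?_
      rw [dif_pos (Finset.mem_range.mp hn)]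
      rfl
    exact ObjectProperty.hom_ext _ h3
  · intro V W
    have h := (hp.homogeneous n V W).linear_comp
      (Linear.leftComp k _ ((ι n).hom.app V) ∘ₗ Linear.rightComp k _ ((π n).hom.app W))
    have h4 : ∀ f : V ⟶ W, (Y n).obj.map f =
        (Linear.leftComp k _ ((ι n).hom.app V) ∘ₗ Linear.rightComp k _ ((π n).hom.app W))
          (p n f) := by
      intro f
      change _ = (ι n).hom.app V ≫ p n f ≫ (π n).hom.app W
      have h5 : p n f = p n (𝟙 V) ≫ F.obj.map f := by rw [hp.comp_map, Category.id_comp]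
      have h6 : (ι n).hom.app V ≫ p n (𝟙 V) = (ι n).hom.app V := by
        have : ι n ≫ e n = ι n := by rw [← h2, ← Category.assoc, h1, Category.id_comp]
        exact congrArg (fun t : Y n ⟶ F => t.hom.app V) this
      rw [h5, Category.assoc, reassoc_of% h6, (π n).hom.naturality, ← Category.assoc]
      have h7 : (ι n).hom.app V ≫ (π n).hom.app V = 𝟙 _ :=
        congrArg (fun t : Y n ⟶ Y n => t.hom.app V) (h1 n)
      rw [h7, Category.id_comp]
    have h8 := funext h4
    change IsHomogeneousMap k n fun f : V ⟶ W => (Y n).obj.map f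
    rw [h8]
    exact h

/-- Naturality at the scalar `2` gives `2 ^ m • f = 2 ^ n • f`, and powers of `2` with different
exponents differ in characteristic `0`. -/
theorem polyDeg_orthogonal {m n : ℕ} (hmn : m ≠ n) {X Y : Poly k A} (hX : polyDeg k A m X)
    (hY : polyDeg k A n Y) (f : X ⟶ Y) : f = 0 := by
  apply ObjectProperty.hom_ext
  ext V : 2
  have h := f.hom.naturality ((2 : k) • 𝟙 V)
  rw [(hX V V).map_smul, (hY V V).map_smul, X.obj.map_id, Y.obj.map_id, Linear.smul_comp,
    Linear.comp_smul, Category.id_comp, Category.comp_id] at h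
  have h2 : ((2 : k) ^ m - 2 ^ n) ≠ 0 := by
    rw [sub_ne_zero]
    intro h3
    have h4 : (2 : ℕ) ^ m = 2 ^ n := by exact_mod_cast h3
    exact hmn (Nat.pow_right_injective le_rfl h4)
  have h5 : ((2 : k) ^ m - 2 ^ n) • f.hom.app V = 0 := by rw [sub_smul, h, sub_self]
  exact (smul_eq_zero_iff_right h2).mp h5

end

variable {n : ℕ}

/-- Transformations out of a functor of degree `n` are detected at `k^n`, so a proper summand
already has smaller dimension there. This dimension is the induction parameter of
`exists_indec_decomposition`. -/
theorem finrank_lt_of_splitting {F X : Poly k (FGModuleCat.{u} k)} (hF : polyDeg k (FGModuleCat.{u} k) n F) {ε : F ⟶ F}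
    (hε : ε ≠ 𝟙 F) {ι : X ⟶ F} {π : F ⟶ X} (h1 : ι ≫ π = 𝟙 X) (h2 : π ≫ ι = ε) :
    Module.finrank k (X.obj.obj (std k n)) < Module.finrank k (F.obj.obj (std k n)) := by
  have h3 : ∀ x, ((π.hom.app (std k n)).hom.hom) ((ι.hom.app (std k n)).hom.hom x) = x := fun x =>
    LinearMap.congr_fun (congrArg (fun t : X ⟶ X => (t.hom.app (std k n)).hom.hom) h1) x
  have hinj : Function.Injective (ι.hom.app (std k n)).hom.hom :=
    Function.LeftInverse.injective h3
  by_contra hlt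
  have hsurj := (LinearMap.injective_iff_surjective_of_finrank_eq_finrank
    (le_antisymm (LinearMap.finrank_le_finrank_of_injective hinj) (not_lt.mp hlt))).mp hinj
  apply hε
  have h4 : (ε - 𝟙 F).hom = 0 := by
    refine eq_zero_of_app_std (n := n) hF ?_
    apply FGModuleCat.hom_ext
    ext y
    obtain ⟨x, rfl⟩ := hsurj y
    change (ε.hom.app (std k n)).hom.hom _ - _ = 0
    rw [← h2, sub_eq_zero]
    exact congrArg (ι.hom.app (std k n)).hom.hom (h3 x)
  exact sub_eq_zero.mp (ObjectProperty.hom_ext _ h4)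

theorem exists_indec_decomposition (N : ℕ) : ∀ (F : Poly k (FGModuleCat.{u} k)), polyDeg k (FGModuleCat.{u} k) n F →
    Module.finrank k (F.obj.obj (std k n)) ≤ N →
    ∃ (J : Type) (_ : Fintype J) (Y : J → Poly k (FGModuleCat.{u} k)), IsDirectSum F Y ∧
      ∀ a, IsIndec (Y a) ∧ polyDeg k (FGModuleCat.{u} k) n (Y a) := by
  induction N using Nat.strong_induction_on with
  | _ N ih =>
  intro F hF hN
  by_cases h0 : 𝟙 F = 0
  · exact ⟨Empty, inferInstance, fun a => a.elim, IsDirectSum.empty h0 _, fun a => a.elim⟩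
  by_cases hI : IsIndec F
  · exact ⟨Unit, inferInstance, fun _ => F, IsDirectSum.unit F, fun _ => ⟨hI, hF⟩⟩
  obtain ⟨ε, hε, hε0, hε1⟩ : ∃ ε : F ⟶ F, ε ≫ ε = ε ∧ ε ≠ 0 ∧ ε ≠ 𝟙 F := by
    by_contra! hc
    exact hI ⟨h0, fun ε h => or_iff_not_imp_left.mpr fun hne => hc ε h hne⟩
  have hε' : (𝟙 F - ε) ≫ (𝟙 F - ε) = 𝟙 F - ε := by
    simp [Preadditive.sub_comp, Preadditive.comp_sub, hε]
  have hε1' : 𝟙 F - ε ≠ 𝟙 F := fun h => hε0 (sub_eq_self.mp h)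
  obtain ⟨X, ι, π, h1, h2⟩ := exists_splitting F ε hε
  obtain ⟨X', ι', π', h1', h2'⟩ := exists_splitting F (𝟙 F - ε) hε'
  have hX : polyDeg k (FGModuleCat.{u} k) n X := IsHomogeneousFunctor.of_retract hF ι.hom π.hom
    (congrArg (fun t : X ⟶ X => t.hom) h1)
  have hX' : polyDeg k (FGModuleCat.{u} k) n X' := IsHomogeneousFunctor.of_retract hF ι'.hom π'.hom
    (congrArg (fun t : X' ⟶ X' => t.hom) h1')
  obtain ⟨J, _, Y, hY, hYI⟩ := ih _ (lt_of_lt_of_le (finrank_lt_of_splitting hF hε1 h1 h2) hN) X hX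
    le_rfl
  obtain ⟨J', _, Y', hY', hYI'⟩ := ih _ (lt_of_lt_of_le
    (finrank_lt_of_splitting hF hε1' h1' h2') hN) X' hX' le_rfl
  have hsum : IsDirectSum F fun b : Bool => cond b X X' := by
    refine IsDirectSum.of_idempotents (fun b : Bool => cond b ε (𝟙 F - ε))
      (Bool.rec π' π) (Bool.rec ι' ι) ?_ ?_ ?_ ?_
    · rintro (_ | _)
      exacts [h1', h1]
    · rintro (_ | _)
      exacts [h2', h2]
    · rintro (_ | _) (_ | _) h <;> simp_all [Preadditive.sub_comp, Preadditive.comp_sub]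
    · simp
  have : ∀ b : Bool, ∃ (J : Type) (_ : Fintype J) (Y : J → Poly k (FGModuleCat.{u} k)), IsDirectSum (cond b X X') Y ∧
      ∀ a, IsIndec (Y a) ∧ polyDeg k (FGModuleCat.{u} k) n (Y a) := by
    rintro (_ | _)
    exacts [⟨J', _, Y', hY', hYI'⟩, ⟨J, _, Y, hY, hYI⟩]
  choose J fJ Y hY hYI using this
  exact ⟨_, inferInstance, _, hsum.sigma hY, fun p => hYI p.1 p.2⟩

/-- For fixed `x` in `F (k^n)`, sending `v` to the polarization of `F` at the maps `k^n → k → V`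
given by the vectors `v i`, applied to `x`, is multilinear in `v` and natural in `V`. By
`sum_polar_comp_polar` these polarizations cannot all vanish if `F ≠ 0`. -/
theorem exists_tensorPower_map {F : (FGModuleCat.{u} k) ⥤ (FGModuleCat.{u} k)} (hF : IsHomogeneousFunctor k n F) (h0 : 𝟙 F ≠ 0) :
    ∃ τ : tensorPower k n ⟶ F, τ ≠ 0 := by
  obtain ⟨V, hV⟩ : ∃ V, 𝟙 (F.obj V) ≠ 0 := by
    by_contra! h
    apply h0
    ext V : 2
    exact h V
  obtain ⟨m, a, c, hac⟩ := exists_coordinates V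
  obtain ⟨b, hb⟩ : ∃ b : Fin n → Fin m, polar F n (fun i => stdπ n i ≫ a (b i)) ≠ 0 := by
    by_contra! h
    have h1 := sum_polar_comp_polar hF (stdι n) (stdπ n) (stdι_stdπ n) (stdι_stdπ_ne n) a c hac
    simp only [h, comp_zero, Finset.sum_const_zero] at h1
    exact hV ((smul_eq_zero_iff_right (Nat.cast_ne_zero.mpr n.factorial_ne_zero)).mp h1.symm)
  obtain ⟨x, hx⟩ : ∃ x, (polar F n (fun i => stdπ n i ≫ a (b i))).hom.hom x ≠ 0 := by
    by_contra! h
    apply hb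
    apply FGModuleCat.hom_ext
    exact LinearMap.ext h
  choose Q hQ _ using fun V => (hF (std k n) V).exists_polarize
  let vec : ∀ V : (FGModuleCat.{u} k), V →ₗ[k] (line k ⟶ V) := fun V =>
    (fgHom _ _).symm.toLinearMap ∘ₗ (LinearMap.ringLmapEquivSelf k k V).symm.toLinearMap
  have hvec : ∀ (V W : FGModuleCat.{u} k) (f : V ⟶ W) (x : V), vec V x ≫ f = vec W (f.hom.hom x) := by
    intro V W f x
    apply FGModuleCat.hom_ext
    ext
    change f.hom.hom ((1 : k) • x) = (1 : k) • f.hom.hom x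
    rw [one_smul, one_smul]
  let M : ∀ V : (FGModuleCat.{u} k), MultilinearMap k (fun _ : Fin n => V) (F.obj V) := fun V =>
    (LinearMap.applyₗ x ∘ₗ (fgHom _ _).toLinearMap).compMultilinearMap
      ((Q V).compLinearMap fun i => Linear.leftComp k _ (stdπ n i) ∘ₗ vec V)
  have hM : ∀ V v, M V v = (polar F n (fun i => stdπ n i ≫ vec V (v i))).hom.hom x := by
    intro V v
    exact congrArg (fun t => t.hom.hom x) (hQ V fun i => stdπ n i ≫ vec V (v i)).symm
  let τ : tensorPower k n ⟶ F :=
    { app := fun V => FGModuleCat.ofHom (PiTensorProduct.lift (M V))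
      naturality := fun V W f => by
        apply FGModuleCat.hom_ext
        apply PiTensorProduct.ext
        ext v
        change PiTensorProduct.lift (M W) (PiTensorProduct.map _ (PiTensorProduct.tprod k v)) =
          (F.map f).hom.hom (PiTensorProduct.lift (M V) (PiTensorProduct.tprod k v))
        rw [PiTensorProduct.map_tprod, PiTensorProduct.lift.tprod, PiTensorProduct.lift.tprod,
          hM, hM]
        have h2 := polar_comp_map F n (fun i => stdπ n i ≫ vec V (v i)) f
        simp only [Category.assoc, hvec] at h2
        exact (congrArg (fun t => t.hom.hom x) h2).symm }
  refine ⟨τ, fun h => hx ?_⟩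
  have h3 := LinearMap.congr_fun (congrArg (fun t => (t.app V).hom.hom) h)
    (PiTensorProduct.tprod k fun i => (a (b i)).hom.hom (1 : k))
  have h4 : ∀ j, vec V ((a j).hom.hom (1 : k)) = a j := by
    intro j
    apply FGModuleCat.hom_ext
    ext
    exact one_smul _ _
  have h5 : PiTensorProduct.lift (M V)
    (PiTensorProduct.tprod k fun i => (a (b i)).hom.hom (1 : k)) = 0 := h3
  rw [PiTensorProduct.lift.tprod, hM] at h5
  simpa only [h4] using h5

end Decomposition

/-! ### Simple polynomial functors of one variable -/

section BasisVect

variable {k : Type u} [Field k] [CharZero k]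

theorem isIso_of_ne_zero {n : ℕ} {X Y : Poly k (FGModuleCat.{u} k)} (hX : polyDeg k _ n X)
    (hY : polyDeg k _ n Y) (hX' : IsIndec X) (hY' : IsIndec Y) {f : X ⟶ Y} (hf : f ≠ 0) :
    IsIso f := by
  obtain ⟨σ, hσ⟩ := exists_quasiInverse hX hY f.hom
  exact IsIndec.isIso hX' hY' hf (g := ObjectProperty.homMk σ) (ObjectProperty.hom_ext _ hσ)

/-- The basis consists of one representative from each isomorphism class of indecomposable summands
of the `n`-th tensor power. An indecomposable `X` of degree `n` receives a nonzero map from the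
tensor power, hence from one of its summands, and by Schur's lemma this is an isomorphism. -/
theorem exists_basis_of_degree (n : ℕ) :
    ∃ (B : Type) (_ : Finite B) (E : B → Poly k (FGModuleCat.{u} k)),
      (∀ b, IsIndec (E b) ∧ polyDeg k _ n (E b)) ∧ (∀ a b, a ≠ b → IsEmpty (E a ≅ E b)) ∧
      ∀ X, IsIndec X → polyDeg k _ n X → ∃ b, Nonempty (X ≅ E b) := by
  let T : Poly k (FGModuleCat.{u} k) := ⟨tensorPower k n, n, fun V W =>
    (tensorPower_homogeneous n V W).isPolynomialMap le_rfl⟩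
  obtain ⟨J, _, Y, ⟨π, ι, h1, h2, h3⟩, hYI⟩ := exists_indec_decomposition (n := n) _ T
    (tensorPower_homogeneous n) le_rfl
  let r : Setoid J := ⟨fun a b => Nonempty (Y a ≅ Y b), fun a => ⟨Iso.refl _⟩,
    fun ⟨e⟩ => ⟨e.symm⟩, fun ⟨e⟩ ⟨e'⟩ => ⟨e ≪≫ e'⟩⟩
  refine ⟨Quotient r, inferInstance, fun q => Y q.out, fun b => hYI _, fun a b hab => ?_,
    fun X hX hXn => ?_⟩
  · refine ⟨fun e => hab ?_⟩
    rw [← Quotient.out_eq a, ← Quotient.out_eq b]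
    exact Quotient.sound ⟨e⟩
  · obtain ⟨τ, hτ⟩ := exists_tensorPower_map hXn hX.obj.1
    let τ' : T ⟶ X := ObjectProperty.homMk τ
    have hτ' : τ' ≠ 0 := fun h => hτ (congrArg (fun t : T ⟶ X => t.hom) h)
    obtain ⟨a, ha⟩ : ∃ a, ι a ≫ τ' ≠ 0 := by
      by_contra! h
      apply hτ'
      rw [← Category.id_comp τ', ← h3, Preadditive.sum_comp]
      exact Finset.sum_eq_zero fun a _ => by rw [Category.assoc, h a, comp_zero]
    have := isIso_of_ne_zero (hYI a).2 hXn (hYI a).1 hX ha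
    obtain ⟨e⟩ := Quotient.mk_out (s := r) a
    exact ⟨⟦a⟧, ⟨(asIso (ι a ≫ τ')).symm ≪≫ e.symm⟩⟩

variable (k) in
/-- The category of polynomial functors of one variable has a basis of homogeneous functors,
finite in every degree. -/
theorem exists_basis_vect :
    ∃ (B : Type) (deg : B → ℕ) (E : B → Poly k (FGModuleCat.{u} k)), IsBasis k E ∧
      (∀ b, polyDeg k _ (deg b) (E b)) ∧ ∀ n, Finite {b // deg b = n} := by
  choose B fB E hE hE' hE'' using fun n : ℕ => exists_basis_of_degree (k := k) n
  refine ⟨Σ n, B n, Sigma.fst, fun b => E b.1 b.2, ⟨fun b f => ?_, fun b => (hE b.1 b.2).1.1,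
    fun a b hab f => ?_, fun X => ?_⟩, fun b => (hE b.1 b.2).2, fun n => ?_⟩
  · obtain ⟨c, hc⟩ := (hE b.1 b.2).1.obj.end_scalar b.1 (hE b.1 b.2).2 f.hom
    exact ⟨c, ObjectProperty.hom_ext _ hc⟩
  · obtain ⟨m, a⟩ := a
    obtain ⟨n, b⟩ := b
    by_cases hmn : m = n
    · subst hmn
      by_contra hf
      have := isIso_of_ne_zero (hE m a).2 (hE m b).2 (hE m a).1 (hE m b).1 hf
      exact (hE' m a b fun h => hab (by rw [h])).false (asIso f)
    · exact polyDeg_orthogonal hmn (hE m a).2 (hE n b).2 f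
  · obtain ⟨d, Y, hY, hYn⟩ := exists_homogeneous_decomposition X
    have h1 : ∀ n : Fin (d + 1), ∃ (J : Type) (_ : Fintype J) (q : J → B n),
        IsDirectSum (Y n) fun a => E n (q a) := by
      intro n
      obtain ⟨J, fJ, Z, hZ, hZI⟩ := exists_indec_decomposition (n := n) _ (Y n) (hYn n) le_rfl
      choose q hq using fun a => hE'' n (Z a) (hZI a).1 (hZI a).2
      exact ⟨J, fJ, q, hZ.congr fun a => (hq a).some⟩
    choose J fJ q hq using h1
    exact ⟨Σ n, J n, inferInstance, fun p => ⟨p.1, q p.1 p.2⟩, hY.sigma hq⟩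
  · refine Finite.of_injective (fun b : {b : Σ n, B n // b.1 = n} => b.2 ▸ b.1.2) ?_
    rintro ⟨⟨m, a⟩, rfl⟩ ⟨⟨m', a'⟩, h⟩ hab
    simp only at h
    subst h
    simp only at hab
    subst hab
    rfl

end BasisVect

/-! ### Tensor products of polynomial functors in separate variables -/

section Bilinear

variable {k : Type u} [Field k] {U U₁ U₂ W : Type*} [AddCommGroup U] [Module k U] [AddCommGroup U₁]
  [Module k U₁] [AddCommGroup U₂] [Module k U₂] [AddCommGroup W] [Module k W]

theorem IsHomogeneousMap.bilinear (β : U₁ →ₗ[k] U₂ →ₗ[k] W) {m n : ℕ} {f : U → U₁} {g : U → U₂}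
    (hf : IsHomogeneousMap k m f) (hg : IsHomogeneousMap k n g) :
    IsHomogeneousMap k (m + n) fun x => β (f x) (g x) := by
  obtain ⟨M, hM⟩ := hf
  obtain ⟨N, hN⟩ := hg
  refine IsHomogeneousMap.of_multilinear (ι := Fin m ⊕ Fin n) (by simp)
    ((TensorProduct.lift β).compMultilinearMap (M.domCoprod N)) fun x => ?_
  simp [hM, hN]

theorem IsPolynomialMap.bilinear (β : U₁ →ₗ[k] U₂ →ₗ[k] W) {d e : ℕ} {f : U → U₁} {g : U → U₂}
    (hf : IsPolynomialMap k d f) (hg : IsPolynomialMap k e g) :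
    IsPolynomialMap k (d + e) fun x => β (f x) (g x) := by
  obtain ⟨p, hp, hf⟩ := hf
  obtain ⟨q, hq, hg⟩ := hg
  have : (fun x => β (f x) (g x)) = fun x => ∑ i, ∑ j, β (p i x) (q j x) := by
    funext x
    simp [hf, hg, map_sum, LinearMap.sum_apply]
    rw [Finset.sum_comm]
  rw [this]
  exact IsPolynomialMap.sum _ fun i _ => IsPolynomialMap.sum _ fun j _ =>
    ((hp i).bilinear β (hq j)).isPolynomialMap (by omega)

end Bilinear

section ProductCategories

variable (C : Type v) [Category.{w'} C] [Preadditive C] (D : Type v) [Category.{w'} D]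
  [Preadditive D]

instance prodPreadditive : Preadditive (C × D) where
  homGroup X Y := inferInstanceAs (AddCommGroup ((X.1 ⟶ Y.1) × (X.2 ⟶ Y.2)))
  add_comp _ _ _ f f' g := Prod.ext (Preadditive.add_comp _ _ _ f.1 f'.1 g.1)
    (Preadditive.add_comp _ _ _ f.2 f'.2 g.2)
  comp_add _ _ _ f g g' := Prod.ext (Preadditive.comp_add _ _ _ f.1 g.1 g'.1)
    (Preadditive.comp_add _ _ _ f.2 g.2 g'.2)

instance prodLinear (k : Type u) [Field k] [Linear k C] [Linear k D] : Linear k (C × D) where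
  homModule X Y := inferInstanceAs (Module k ((X.1 ⟶ Y.1) × (X.2 ⟶ Y.2)))
  smul_comp _ _ _ r f g := Prod.ext (Linear.smul_comp _ _ _ r f.1 g.1)
    (Linear.smul_comp _ _ _ r f.2 g.2)
  comp_smul _ _ _ f r g := Prod.ext (Linear.comp_smul _ _ _ f.1 r g.1)
    (Linear.comp_smul _ _ _ f.2 r g.2)

end ProductCategories

section Box

variable {k : Type u} [Field k] {C : Type v} [Category.{w'} C] [Preadditive C] [Linear k C]
  {D : Type v} [Category.{w'} D] [Preadditive D] [Linear k D]

/-- The functor `(V, W) ↦ M(V) ⊗ N(W)`. -/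
def boxFunctor (M : C ⥤ FGModuleCat.{u} k) (N : D ⥤ FGModuleCat.{u} k) :
    C × D ⥤ FGModuleCat.{u} k where
  obj X := FGModuleCat.of k (M.obj X.1 ⊗[k] N.obj X.2)
  map f := FGModuleCat.ofHom (TensorProduct.map (M.map f.1).hom.hom (N.map f.2).hom.hom)
  map_id X := by
    ext : 1
    refine Eq.trans ?_ TensorProduct.map_id
    exact congrArg₂ TensorProduct.map (congrArg (fun t => t.hom.hom) (M.map_id X.1))
      (congrArg (fun t => t.hom.hom) (N.map_id X.2))
  map_comp f g := by
    ext : 1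
    refine Eq.trans ?_ (TensorProduct.map_comp _ _ _ _)
    exact congrArg₂ TensorProduct.map (congrArg (fun t => t.hom.hom) (M.map_comp f.1 g.1))
      (congrArg (fun t => t.hom.hom) (N.map_comp f.2 g.2))

/-- The tensor product of morphisms of vector spaces, as a bilinear map. -/
def boxHom (V V' W W' : FGModuleCat.{u} k) : (V ⟶ V') →ₗ[k] (W ⟶ W') →ₗ[k]
    (FGModuleCat.of k (V ⊗[k] W) ⟶ FGModuleCat.of k (V' ⊗[k] W')) :=
  ((TensorProduct.mapBilinear (RingHom.id k) V W V' W').compl₁₂ (fgHom V V').toLinearMap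
    (fgHom W W').toLinearMap).compr₂
    (fgHom (FGModuleCat.of k (V ⊗[k] W)) (FGModuleCat.of k (V' ⊗[k] W'))).symm.toLinearMap

theorem boxFunctor_polynomial {M : C ⥤ FGModuleCat.{u} k} {N : D ⥤ FGModuleCat.{u} k}
    (hM : IsPolynomialFunctor k M) (hN : IsPolynomialFunctor k N) :
    IsPolynomialFunctor k (boxFunctor M N) := by
  obtain ⟨d, hd⟩ := hM
  obtain ⟨e, he⟩ := hN
  exact ⟨d + e, fun V W => IsPolynomialMap.bilinear
    (boxHom (M.obj V.1) (M.obj W.1) (N.obj V.2) (N.obj W.2))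
    ((hd V.1 W.1).comp_linear (LinearMap.fst k (V.1 ⟶ W.1) (V.2 ⟶ W.2)))
    ((he V.2 W.2).comp_linear (LinearMap.snd k (V.1 ⟶ W.1) (V.2 ⟶ W.2)))⟩

/-- The functor `M ↦ ((V, W) ↦ M(V) ⊗ N(W))`. -/
def box (N : Poly k D) : Poly k C ⥤ Poly k (C × D) where
  obj M := ⟨boxFunctor M.obj N.obj, boxFunctor_polynomial M.property N.property⟩
  map τ := ObjectProperty.homMk
    { app := fun X => FGModuleCat.ofHom ((τ.hom.app X.1).hom.hom.rTensor (N.obj.obj X.2))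
      naturality := fun X Y f => by
        apply FGModuleCat.hom_ext
        apply TensorProduct.ext'
        intro x y
        have h := LinearMap.congr_fun (congrArg (fun t => t.hom.hom) (τ.hom.naturality f.1)) x
        exact congrArg (fun z => z ⊗ₜ[k] (N.obj.map f.2).hom.hom y) h }
  map_id M := by
    apply ObjectProperty.hom_ext
    ext X : 3
    exact LinearMap.rTensor_id _ _
  map_comp σ τ := by
    apply ObjectProperty.hom_ext
    ext X : 3
    exact LinearMap.rTensor_comp _ _ _

instance box_additive (N : Poly k D) : (box (C := C) N).Additive where
  map_add {X Y f g} := by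
    apply ObjectProperty.hom_ext
    ext X : 3
    exact LinearMap.rTensor_add _ _ _

instance box_linear (N : Poly k D) : (box (C := C) N).Linear k where
  map_smul f c := by
    apply ObjectProperty.hom_ext
    ext X : 3
    exact LinearMap.rTensor_smul _ _ _

end Box

/-! ### Partial functors of a functor of two variables -/

section Fubini

variable {k : Type u} [Field k] {C : Type v} [Category.{w'} C] [Preadditive C] [Linear k C]
  {D : Type v} [Category.{w'} D] [Preadditive D] [Linear k D]

/-- Fixing an identity in one variable is an affine substitution on morphism spaces. The bound `d`
does not depend on `V`, which later confines the members of the basis that can occur to a finite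
set. -/
theorem partialRight_polynomial {d : ℕ} {F : C × D ⥤ FGModuleCat.{u} k}
    (hF : ∀ V W, IsPolynomialMap k d fun f : V ⟶ W => F.map f) (V : C) (W W' : D) :
    IsPolynomialMap k d fun g : W ⟶ W' =>
      F.map ((𝟙 V, g) : ((V, W) : C × D) ⟶ (V, W')) := by
  have h := (hF (V, W) (V, W')).comp_affine (LinearMap.inr k (V ⟶ V) (W ⟶ W')) (𝟙 V, 0)
  convert h using 3 with g
  exact Prod.ext (add_zero _).symm (zero_add _).symm

theorem partialLeft_polynomial {d : ℕ} {F : C × D ⥤ FGModuleCat.{u} k}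
    (hF : ∀ V W, IsPolynomialMap k d fun f : V ⟶ W => F.map f) (W : D) (V V' : C) :
    IsPolynomialMap k d fun f : V ⟶ V' =>
      F.map ((f, 𝟙 W) : ((V, W) : C × D) ⟶ (V', W)) := by
  have h := (hF (V, W) (V', W)).comp_affine (LinearMap.inl k (V ⟶ V') (W ⟶ W)) (0, 𝟙 W)
  convert h using 3 with g
  exact Prod.ext (zero_add _).symm (add_zero _).symm

/-- The functor `F(V, -)`. -/
def partialRight (F : Poly k (C × D)) (V : C) : Poly k D :=
  ⟨Prod.sectR V D ⋙ F.obj, by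
    obtain ⟨d, hd⟩ := F.property
    exact ⟨d, partialRight_polynomial hd V⟩⟩

/-- The functor `F(-, W)`. -/
def partialLeft (F : Poly k (C × D)) (W : D) : Poly k C :=
  ⟨Prod.sectL C W ⋙ F.obj, by
    obtain ⟨d, hd⟩ := F.property
    exact ⟨d, partialLeft_polynomial hd W⟩⟩

/-- The transformation `F(V, -) ⟶ F(V', -)` induced by a morphism `V ⟶ V'`. -/
def partialRightMap (F : Poly k (C × D)) {V V' : C} (f : V ⟶ V') :
    partialRight F V ⟶ partialRight F V' :=
  ObjectProperty.homMk
    { app := fun W => F.obj.map ((f, 𝟙 W) : ((V, W) : C × D) ⟶ (V', W))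
      naturality := fun W W' g => by
        refine (F.obj.map_comp _ _).symm.trans (Eq.trans ?_ (F.obj.map_comp _ _))
        congr 1
        exact Prod.ext ((Category.id_comp _).trans (Category.comp_id _).symm)
          ((Category.comp_id _).trans (Category.id_comp _).symm) }

end Fubini

/-! ### Dual systems of projections and inclusions for a basis. -/

section DualSystem

variable {k : Type u} [Field k] {C : Type v} [Category.{w'} C] [Preadditive C]
    [Linear k C] {B : Type} {E : B → C}

/-- The projections and inclusions of a decomposition are padded by zero at the labels `b ≠ q a`, so
that every label has the same index set `J`. The sum may run over any finite `s` outside of which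
nothing maps to `X`. -/
theorem IsBasis.exists_dual (hE : IsBasis k E) (X : C) :
    ∃ (J : Type) (_ : Fintype J) (π : J → ∀ b, X ⟶ E b) (ι : J → ∀ b, E b ⟶ X),
      ∀ s : Finset B, (∀ b ∉ s, ∀ φ : E b ⟶ X, φ = 0) →
        ∑ a, ∑ b ∈ s, π a b ≫ ι a b = 𝟙 X := by
  classical
  obtain ⟨J, fJ, q, π, ι, h1, h2, h3⟩ := hE.decomposition X
  refine ⟨J, fJ, fun a b => if h : q a = b then π a ≫ eqToHom (congrArg E h) else 0,
    fun a b => if h : q a = b then eqToHom (congrArg E h).symm ≫ ι a else 0, fun s hs => ?_⟩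
  rw [← h3]
  refine Finset.sum_congr rfl fun a _ => ?_
  rw [Finset.sum_eq_single (q a)]
  · simp
  · intro b _ hb
    simp only [dif_neg (Ne.symm hb), zero_comp]
  · intro ha
    refine (hE.id_ne_zero (q a) ?_).elim
    rw [← h1 a, hs _ ha (ι a), zero_comp]

/-- Some component of `φ` in a decomposition of `X` is nonzero. By orthogonality that summand is `E
b` itself, and the component is then an invertible scalar. -/
theorem IsBasis.exists_retraction (hE : IsBasis k E) {X : C} {b : B} {φ : E b ⟶ X} (hφ : φ ≠ 0) :
    ∃ r : X ⟶ E b, φ ≫ r = 𝟙 _ := by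
  obtain ⟨J, fJ, q, π, ι, h1, h2, h3⟩ := hE.decomposition X
  obtain ⟨a, ha⟩ : ∃ a, φ ≫ π a ≠ 0 := by
    by_contra! h
    apply hφ
    rw [← Category.comp_id φ, ← h3, Preadditive.comp_sum]
    exact Finset.sum_eq_zero fun a _ => by rw [← Category.assoc, h a, zero_comp]
  obtain rfl : b = q a := by
    by_contra hb
    exact ha (hE.orthogonal _ _ hb _)
  obtain ⟨c, hc⟩ := hE.scalar _ (φ ≫ π a)
  have hc0 : c ≠ 0 := by
    rintro rfl
    exact ha (by rw [hc, zero_smul])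
  exact ⟨c⁻¹ • π a, by rw [Linear.comp_smul, hc, inv_smul_smul₀ hc0]⟩

end DualSystem

/-! ### Direct sums of polynomial functors from pointwise data. -/

section Pointwise

variable {k : Type u} [Field k] {A : Type v} [Category.{w'} A] [Preadditive A] [Linear k A]

/-- Naturality of the projections is not assumed: projections onto a direct sum are determined by
the inclusions, which are natural. -/
theorem IsDirectSum.of_pointwise {F : Poly k A} {J : Type} [Fintype J] {Y : J → Poly k A}
    (ι : ∀ b, Y b ⟶ F) (p : ∀ b V, F.obj.obj V →ₗ[k] (Y b).obj.obj V)
    (h1 : ∀ b V y, p b V (((ι b).hom.app V).hom.hom y) = y)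
    (h2 : ∀ b c, b ≠ c → ∀ V y, p c V (((ι b).hom.app V).hom.hom y) = 0)
    (h3 : ∀ V y, ∑ b, ((ι b).hom.app V).hom.hom (p b V y) = y) : IsDirectSum F Y := by
  have hnat : ∀ b {V W : A} (f : V ⟶ W) y, p b W ((F.obj.map f).hom.hom y) =
      ((Y b).obj.map f).hom.hom (p b V y) := by
    intro b V W f y
    conv_lhs => rw [← h3 V y]
    rw [map_sum, map_sum, Finset.sum_eq_single b]
    · have h := LinearMap.congr_fun (congrArg (fun t => t.hom.hom) ((ι b).hom.naturality f))
        (p b V y)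
      exact (congrArg (p b W) h.symm).trans (h1 _ _ _)
    · intro c _ hc
      have h := LinearMap.congr_fun (congrArg (fun t => t.hom.hom) ((ι c).hom.naturality f))
        (p c V y)
      exact (congrArg (p b W) h.symm).trans (h2 _ _ hc _ _)
    · simp
  let π : ∀ b, F ⟶ Y b := fun b => ObjectProperty.homMk
    { app := fun V => FGModuleCat.ofHom (p b V)
      naturality := fun V W f => by
        apply FGModuleCat.hom_ext
        exact LinearMap.ext (hnat b f) }
  refine ⟨π, ι, fun b => ?_, fun b c hbc => ?_, ?_⟩
  · apply ObjectProperty.hom_ext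
    ext V : 3
    exact LinearMap.ext (h1 b V)
  · apply ObjectProperty.hom_ext
    ext V : 3
    exact LinearMap.ext (h2 b c hbc V)
  · apply ObjectProperty.hom_ext
    change (ObjectProperty.ι _).mapAddHom _ = _
    rw [map_sum]
    ext V : 2
    rw [NatTrans.app_sum]
    apply FGModuleCat.hom_ext
    apply LinearMap.ext
    intro y
    refine Eq.trans ?_ (h3 V y)
    change fgHom _ _ (∑ b, _) y = _
    rw [map_sum, LinearMap.sum_apply]
    rfl

end Pointwise

/-! ### Decomposition of a functor of two variables along a basis in the second variable. -/

section FubiniBasis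

variable {k : Type u} [Field k] {C : Type v} [Category.{w'} C] [Preadditive C] [Linear k C]
  {D : Type v} [Category.{w'} D] [Preadditive D] [Linear k D]

theorem Poly.exists_vector_ne_zero {E : Poly k C} (h : 𝟙 E ≠ 0) :
    ∃ (W : C) (e : E.obj.obj W), e ≠ 0 := by
  by_contra! h0
  apply h
  apply ObjectProperty.hom_ext
  ext V x
  exact h0 V x

/-- On the scalars `c • 𝟙 V` the functor `E` acts by `c ^ n`. Being a retract of `F`, it acts there
by a polynomial of degree at most `d` in `c`. -/
theorem degree_le_of_retract [Infinite k] {n d : ℕ} {E F : Poly k C} (hE : polyDeg k C n E)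
    (h0 : 𝟙 E ≠ 0) (hF : ∀ V W, IsPolynomialMap k d fun f : V ⟶ W => F.obj.map f) {φ : E ⟶ F}
    {r : F ⟶ E} (h : φ ≫ r = 𝟙 E) : n ≤ d := by
  obtain ⟨V, e, he⟩ := Poly.exists_vector_ne_zero h0
  by_contra! hlt
  have h1 := IsPolynomialMap.of_retract φ.hom r.hom (congrArg (fun t : E ⟶ E => t.hom) h) (hF V V)
  obtain ⟨p, hp, hp0, hsum⟩ := h1.exists_components
  have h2 := coeff_unique (k := k) (Finset.range (n + 1)) (fun m => p m (𝟙 V))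
    (fun m => if m = n then 𝟙 (E.obj.obj V) else 0) (fun c => ?_) n (by simp)
  · simp only [if_true] at h2
    rw [hp0 n hlt] at h2
    exact he (LinearMap.congr_fun (congrArg (fun t => t.hom.hom) h2) e).symm
  · have h3 := hsum (c • 𝟙 V)
    rw [(hE V V).map_smul, E.obj.map_id] at h3
    simp only [smul_ite, smul_zero]
    rw [Finset.sum_ite_eq', if_pos (by simp), h3]
    refine Eq.trans ?_ (Finset.sum_subset (Finset.range_mono (by omega : d + 1 ≤ n + 1)) ?_).symm
    · exact Finset.sum_congr rfl fun m _ => ((hp m).map_smul c _).symm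
    · intro m _ hm
      rw [hp0 m (by simpa using hm)]
      simp

variable {B₂ : Type} {E₂ : B₂ → Poly k D}

theorem IsBasis.injective_of_ne_zero (h₂ : IsBasis k E₂) {G : Poly k D} {b : B₂} {φ : E₂ b ⟶ G}
    (hφ : φ ≠ 0) (W : D) : Function.Injective (φ.hom.app W).hom.hom := by
  obtain ⟨r, hr⟩ := h₂.exists_retraction hφ
  exact Function.LeftInverse.injective (g := (r.hom.app W).hom.hom) fun x =>
    LinearMap.congr_fun (congrArg (fun t : E₂ b ⟶ E₂ b => (t.hom.app W).hom.hom) hr) x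

/-- A polynomial functor of two variables is a sum of tensor products `M b ⊗ E₂ b`. -/
theorem IsBasis.exists_box_decomposition [Infinite k] (h₂ : IsBasis k E₂) {deg : B₂ → ℕ}
    (hdeg : ∀ b, polyDeg k D (deg b) (E₂ b)) (hfin : ∀ n, Finite {b // deg b = n})
    (F : Poly k (C × D)) : ∃ (s : Finset B₂) (M : s → Poly k C),
      IsDirectSum F fun b => (box (E₂ b.1)).obj (M b) := by
  classical
  obtain ⟨d, hd⟩ := F.property
  have hfin' : Set.Finite {b | deg b ≤ d} := by
    have : {b | deg b ≤ d} = ⋃ n ∈ Set.Iic d, {b | deg b = n} := by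
      ext b
      simp
    rw [this]
    refine (Set.finite_Iic d).biUnion fun n _ => ?_
    exact @Set.toFinite _ {b | deg b = n} (hfin n)
  -- The labels of degree at most `d`: one finite set serves for all the functors `F (V, -)`, whose
  -- degrees are bounded uniformly in `V`.
  let s := hfin'.toFinset
  have hs : ∀ b ∉ s, ∀ V (φ : E₂ b ⟶ partialRight F V), φ = 0 := by
    intro b hb V φ
    by_contra hφ
    obtain ⟨r, hr⟩ := h₂.exists_retraction hφ
    exact hb (by
      simp only [s, Set.Finite.mem_toFinset, Set.mem_ofPred_eq]
      exact degree_le_of_retract (hdeg b) (h₂.id_ne_zero b) (partialRight_polynomial hd V) hr)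
  choose W e he using fun b => Poly.exists_vector_ne_zero (h₂.id_ne_zero b)
  -- The multiplicity space of `E₂ b` in `F (V, -)` is embedded into `F (V, W b)` by evaluation at a
  -- fixed nonzero vector. Its image is a subfunctor of `F (-, W b)`, hence finite-dimensional and
  -- polynomial in `V`.
  let ev : ∀ b V, (E₂ b ⟶ partialRight F V) →ₗ[k] F.obj.obj (V, W b) := fun b V =>
    { toFun := fun φ => (φ.hom.app (W b)).hom.hom (e b)
      map_add' := fun _ _ => rfl
      map_smul' := fun _ _ => rfl }
  have hev : ∀ b V, Function.Injective (ev b V) := by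
    intro b V
    rw [injective_iff_map_eq_zero]
    intro φ h
    by_contra hφ
    exact he b (h₂.injective_of_ne_zero hφ (W b) (h.trans (map_zero _).symm))
  let M : B₂ → Poly k C := fun b => polySub (partialLeft F (W b)) (fun V => LinearMap.range (ev b V))
    (by
      rintro V V' f _ ⟨φ, rfl⟩
      exact ⟨φ ≫ partialRightMap F f, rfl⟩)
  let θ : ∀ b V, (M b).obj.obj V ≃ₗ[k] (E₂ b ⟶ partialRight F V) := fun b V =>
    (LinearEquiv.ofInjective (ev b V) (hev b V)).symm
  have hθ : ∀ b {V V'} (f : V ⟶ V') m, θ b V' (((M b).obj.map f).hom.hom m) =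
      θ b V m ≫ partialRightMap F f := by
    intro b V V' f m
    obtain ⟨φ, rfl⟩ := (θ b V).symm.surjective m
    rw [LinearEquiv.apply_symm_apply, ← LinearEquiv.eq_symm_apply]
    rfl
  let j : ∀ b V X, (M b).obj.obj V →ₗ[k] (E₂ b).obj.obj X →ₗ[k] F.obj.obj (V, X) := fun b V X =>
    LinearMap.mk₂ k (fun m x => ((θ b V m).hom.app X).hom.hom x)
      (fun m m' x => by rw [map_add]; rfl) (fun c m x => by rw [map_smul]; rfl)
      (fun m x x' => map_add _ _ _) (fun c m x => map_smul _ _ _)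
  let ι : ∀ b, (box (E₂ b)).obj (M b) ⟶ F := fun b => ObjectProperty.homMk
    { app := fun X => FGModuleCat.ofHom (TensorProduct.lift (j b X.1 X.2))
      naturality := fun X Y f => by
        apply FGModuleCat.hom_ext
        apply TensorProduct.ext'
        intro m x
        change ((θ b Y.1 (((M b).obj.map f.1).hom.hom m)).hom.app Y.2).hom.hom
          (((E₂ b).obj.map f.2).hom.hom x) =
          (F.obj.map f).hom.hom (((θ b X.1 m).hom.app X.2).hom.hom x)
        rw [hθ]
        have h := LinearMap.congr_fun (congrArg (fun t => t.hom.hom)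
          ((θ b X.1 m).hom.naturality f.2)) x
        refine (congrArg ((F.obj.map ((f.1, 𝟙 Y.2) : ((X.1, Y.2) : C × D) ⟶ (Y.1, Y.2))).hom.hom)
          h).trans ?_
        have h' : F.obj.map f = F.obj.map ((𝟙 X.1, f.2) : X ⟶ ((X.1, Y.2) : C × D)) ≫
            F.obj.map ((f.1, 𝟙 Y.2) : ((X.1, Y.2) : C × D) ⟶ Y) := by
          rw [← F.obj.map_comp]
          congr 1
          exact Prod.ext (Category.id_comp _).symm (Category.comp_id _).symm
        rw [h']
        rfl }
  choose J fJ P I hPI using fun V => h₂.exists_dual (partialRight F V)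
  -- The inverse of the evaluation map: `y` goes to the sum of `I a b ⊗ P a b y` over a dual system
  -- of `F (V, -)`. The dual systems are chosen separately for each `V`, which
  -- `IsDirectSum.of_pointwise` permits.
  let p : ∀ b (X : C × D), F.obj.obj X →ₗ[k] ((box (E₂ b)).obj (M b)).obj.obj X := fun b X =>
    ∑ a, TensorProduct.mk k ((M b).obj.obj X.1) ((E₂ b).obj.obj X.2)
      ((θ b X.1).symm (I X.1 a b)) ∘ₗ ((P X.1 a b).hom.app X.2).hom.hom
  have hp : ∀ b X y, p b X y = ∑ a, (θ b X.1).symm (I X.1 a b) ⊗ₜ[k]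
      ((P X.1 a b).hom.app X.2).hom.hom y := by
    intro b X y
    simp only [p, LinearMap.sum_apply]
    rfl
  refine ⟨s, fun b => M b, IsDirectSum.of_pointwise (fun b => ι b) (fun b => p b) ?_ ?_ ?_⟩
  · rintro ⟨b, hb⟩ X y
    change (p b X ∘ₗ TensorProduct.lift (j b X.1 X.2)) y = LinearMap.id (R := k) y
    congr 1
    apply TensorProduct.ext'
    intro m x
    obtain ⟨φ, rfl⟩ := (θ b X.1).symm.surjective m
    change p b X (((θ b X.1 ((θ b X.1).symm φ)).hom.app X.2).hom.hom x) = _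
    rw [LinearEquiv.apply_symm_apply]
    choose c hc using fun a => h₂.scalar b (φ ≫ P X.1 a b)
    have h1 : ∀ a, ((P X.1 a b).hom.app X.2).hom.hom ((φ.hom.app X.2).hom.hom x) = c a • x :=
      fun a => LinearMap.congr_fun
        (congrArg (fun t : E₂ b ⟶ E₂ b => (t.hom.app X.2).hom.hom) (hc a)) x
    have h2 : ∀ a, (θ b X.1).symm (I X.1 a b) ⊗ₜ[k]
        ((P X.1 a b).hom.app X.2).hom.hom ((φ.hom.app X.2).hom.hom x) =
        (θ b X.1).symm (c a • I X.1 a b) ⊗ₜ[k] x := by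
      intro a
      rw [map_smul, TensorProduct.smul_tmul]
      exact congrArg _ (h1 a)
    refine (hp b X _).trans ((Finset.sum_congr rfl fun a _ => h2 a).trans ?_)
    rw [← TensorProduct.sum_tmul, ← map_sum]
    change _ = (θ b X.1).symm φ ⊗ₜ[k] x
    congr 2
    calc ∑ a, c a • I X.1 a b = ∑ a, φ ≫ P X.1 a b ≫ I X.1 a b := by
          refine Finset.sum_congr rfl fun a _ => ?_
          rw [← Category.assoc, hc a, Linear.smul_comp, Category.id_comp]
      _ = φ ≫ ∑ a, ∑ b' ∈ s, P X.1 a b' ≫ I X.1 a b' := by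
          rw [Preadditive.comp_sum]
          refine Finset.sum_congr rfl fun a _ => ?_
          rw [Preadditive.comp_sum, Finset.sum_eq_single_of_mem b hb]
          intro b' _ hb'
          rw [← Category.assoc, h₂.orthogonal b b' hb'.symm (φ ≫ P X.1 a b'), zero_comp]
      _ = φ := by rw [hPI X.1 s fun b' hb' => hs b' hb' X.1, Category.comp_id]
  · rintro ⟨b, hb⟩ ⟨c, hc⟩ hbc X y
    change (p c X ∘ₗ TensorProduct.lift (j b X.1 X.2)) y = (0 : _ →ₗ[k] _) y
    congr 1
    apply TensorProduct.ext'
    intro m x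
    have h0 := fun a => h₂.orthogonal b c (fun h => hbc (Subtype.ext h)) (θ b X.1 m ≫ P X.1 a c)
    have h1 : ∀ a, ((P X.1 a c).hom.app X.2).hom.hom (((θ b X.1 m).hom.app X.2).hom.hom x) = 0 :=
      fun a => LinearMap.congr_fun
        (congrArg (fun t : E₂ b ⟶ E₂ c => (t.hom.app X.2).hom.hom) (h0 a)) x
    have h2 : ∀ a, (θ c X.1).symm (I X.1 a c) ⊗ₜ[k]
        ((P X.1 a c).hom.app X.2).hom.hom (((θ b X.1 m).hom.app X.2).hom.hom x) = 0 := fun a =>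
      (congrArg _ (h1 a)).trans (TensorProduct.tmul_zero _ _)
    exact (hp c X _).trans (Finset.sum_eq_zero fun a _ => h2 a)
  · intro X y
    have h1 : ∀ b : s, ((ι b).hom.app X).hom.hom (p b X y) = ∑ a,
        ((I X.1 a b).hom.app X.2).hom.hom (((P X.1 a b).hom.app X.2).hom.hom y) := by
      intro b
      refine (congrArg ((ι b).hom.app X).hom.hom (hp b X y)).trans
        ((map_sum ((ι b).hom.app X).hom.hom _ _).trans (Finset.sum_congr rfl fun a _ => ?_))
      change ((θ b X.1 ((θ b X.1).symm (I X.1 a b))).hom.app X.2).hom.hom _ = _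
      rw [LinearEquiv.apply_symm_apply]
    refine (Finset.sum_congr rfl fun b _ => h1 b).trans (Finset.sum_comm.trans ?_)
    let ev' : (partialRight F X.1 ⟶ partialRight F X.1) →+ F.obj.obj X :=
      { toFun := fun φ => (φ.hom.app X.2).hom.hom y
        map_zero' := rfl
        map_add' := fun _ _ => rfl }
    have h2 := congrArg ev' (hPI X.1 s fun b' hb' => hs b' hb' X.1)
    rw [map_sum] at h2
    refine Eq.trans (Finset.sum_congr rfl fun a _ => ?_) h2
    rw [map_sum, ← Finset.sum_coe_sort s]
    rfl

end FubiniBasis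

/-! ### Contraction of tensors with functionals. -/

section Contraction

variable {k : Type u} [Field k] {M N : Type*} [AddCommGroup M] [Module k M] [AddCommGroup N]
  [Module k N]

/-- Contraction of the first factor of a tensor product with a functional. -/
def contract (N : Type*) [AddCommGroup N] [Module k N] (ξ : Module.Dual k M) : M ⊗[k] N →ₗ[k] N :=
  (TensorProduct.lid k N).toLinearMap ∘ₗ ξ.rTensor N

theorem contract_tmul (ξ : Module.Dual k M) (x : M) (y : N) :
    contract N ξ (x ⊗ₜ y) = ξ x • y := by
  simp [contract]

theorem eq_of_contract_eq [FiniteDimensional k M] {y y' : M ⊗[k] N}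
    (h : ∀ ξ, contract N ξ y = contract N ξ y') : y = y' := by
  let b := Module.finBasis k M
  have key : ∀ z : M ⊗[k] N, ∑ i, b i ⊗ₜ[k] contract N (b.coord i) z = z := by
    have : (∑ i, TensorProduct.mk k M N (b i) ∘ₗ contract N (b.coord i)) = LinearMap.id := by
      apply TensorProduct.ext'
      intro x y
      simp only [LinearMap.sum_apply, LinearMap.comp_apply, contract_tmul, TensorProduct.mk_apply,
        LinearMap.id_apply, ← TensorProduct.smul_tmul, ← TensorProduct.sum_tmul]
      congr 1
      exact b.sum_repr x
    intro z
    simpa using LinearMap.congr_fun this z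
  rw [← key y, ← key y']
  simp only [h]

theorem apply_contract (ξ : Module.Dual k M) (ε : Module.Dual k N) (y : M ⊗[k] N) :
    ξ (TensorProduct.rid k M (ε.lTensor M y)) = ε (contract N ξ y) := by
  have : ξ ∘ₗ (TensorProduct.rid k M).toLinearMap ∘ₗ ε.lTensor M = ε ∘ₗ contract N ξ := by
    apply TensorProduct.ext'
    intro x y
    simp [contract_tmul, mul_comm]
  exact LinearMap.congr_fun this y

theorem exists_dual_eq_one {x : N} (hx : x ≠ 0) : ∃ ε : Module.Dual k N, ε x = 1 := by
  obtain ⟨ε, hε⟩ : ∃ ε : Module.Dual k N, ε x ≠ 0 := by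
    by_contra! h
    exact hx ((Module.forall_dual_apply_eq_zero_iff k x).mp h)
  exact ⟨(ε x)⁻¹ • ε, by simp [hε]⟩

end Contraction

/-! ### Morphisms between tensor products in separate variables. -/

section FubiniBasis

variable {k : Type u} [Field k] {C : Type v} [Category.{w'} C] [Preadditive C] [Linear k C]
  {D : Type v} [Category.{w'} D] [Preadditive D] [Linear k D]

/-- The transformation of functors on `D` obtained from a transformation of tensor products by
fixing a vector and a functional in the first factor. -/
def slice {M M' : Poly k C} {N N' : Poly k D} (τ : (box N).obj M ⟶ (box N').obj M') (V : C)
    (m : M.obj.obj V) (ξ : Module.Dual k (M'.obj.obj V)) : N ⟶ N' :=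
  ObjectProperty.homMk
    { app := fun W => FGModuleCat.ofHom (contract _ ξ ∘ₗ (τ.hom.app (V, W)).hom.hom ∘ₗ
        TensorProduct.mk k (M.obj.obj V) (N.obj.obj W) m)
      naturality := fun W W' g => by
        apply FGModuleCat.hom_ext
        apply LinearMap.ext
        intro x
        have h1 := LinearMap.congr_fun (congrArg (fun t => t.hom.hom)
          (τ.hom.naturality ((𝟙 V, g) : ((V, W) : C × D) ⟶ (V, W')))) (m ⊗ₜ[k] x)
        have h2 : ((M.obj.map (𝟙 V)).hom.hom m) ⊗ₜ[k] (N.obj.map g).hom.hom x =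
            m ⊗ₜ[k] (N.obj.map g).hom.hom x := by
          rw [M.obj.map_id]
          rfl
        have h3 : ∀ y : M'.obj.obj V ⊗[k] N'.obj.obj W, contract (N'.obj.obj W') ξ
            (TensorProduct.map (M'.obj.map (𝟙 V)).hom.hom (N'.obj.map g).hom.hom y) =
            (N'.obj.map g).hom.hom (contract _ ξ y) := by
          intro y
          rw [M'.obj.map_id]
          have : contract (N'.obj.obj W') ξ ∘ₗ TensorProduct.map LinearMap.id
              (N'.obj.map g).hom.hom = (N'.obj.map g).hom.hom ∘ₗ contract (N'.obj.obj W) ξ := by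
            apply TensorProduct.ext'
            intro a b
            simp only [LinearMap.comp_apply, TensorProduct.map_tmul, contract_tmul, map_smul]
            rfl
          exact LinearMap.congr_fun this y
        refine Eq.trans ?_ (h3 _)
        refine congrArg (contract (N'.obj.obj W') ξ) (Eq.trans ?_ h1)
        exact congrArg (τ.hom.app (V, W')).hom.hom h2.symm }

variable {B₂ : Type} {E₂ : B₂ → Poly k D}

/-- Each slice is a map from `E₂ b` to `E₂ c`, hence zero, and a tensor is determined by its
contractions. -/
theorem IsBasis.box_hom_eq_zero (h₂ : IsBasis k E₂) {M M' : Poly k C} {b c : B₂} (hbc : b ≠ c)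
    (τ : (box (E₂ b)).obj M ⟶ (box (E₂ c)).obj M') : τ = 0 := by
  apply ObjectProperty.hom_ext
  ext X : 2
  apply FGModuleCat.hom_ext
  apply TensorProduct.ext'
  intro m x
  refine eq_of_contract_eq fun ξ => ?_
  have h := h₂.orthogonal b c hbc (slice τ X.1 m ξ)
  refine (LinearMap.congr_fun (congrArg (fun t : E₂ b ⟶ E₂ c => (t.hom.app X.2).hom.hom) h)
    x).trans ?_
  exact (map_zero (contract _ ξ)).symm

/-- Each slice is a scalar, and this scalar is `ξ (t m)` for a linear map `t` that is read off at
one vector `e`, with a functional `ε` normalized by `ε e = 1`. -/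
theorem IsBasis.box_hom_eq_map (h₂ : IsBasis k E₂) {M M' : Poly k C} {b : B₂}
    (τ : (box (E₂ b)).obj M ⟶ (box (E₂ b)).obj M') : ∃ t : M ⟶ M', τ = (box (E₂ b)).map t := by
  obtain ⟨W, e, he⟩ := Poly.exists_vector_ne_zero (h₂.id_ne_zero b)
  obtain ⟨ε, hε⟩ := exists_dual_eq_one (k := k) he
  let t : ∀ V, M.obj.obj V →ₗ[k] M'.obj.obj V := fun V =>
    (TensorProduct.rid k _).toLinearMap ∘ₗ ε.lTensor (M'.obj.obj V) ∘ₗ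
      (τ.hom.app (V, W)).hom.hom ∘ₗ (TensorProduct.mk k (M.obj.obj V) ((E₂ b).obj.obj W)).flip e
  have ht : ∀ V X m x, (τ.hom.app (V, X)).hom.hom (m ⊗ₜ[k] x) = t V m ⊗ₜ[k] x := by
    intro V X m x
    refine eq_of_contract_eq fun ξ => ?_
    obtain ⟨c, hc⟩ := h₂.scalar b (slice τ V m ξ)
    have h1 : ∀ X x, contract _ ξ ((τ.hom.app (V, X)).hom.hom (m ⊗ₜ[k] x)) = c • x := fun X x =>
      LinearMap.congr_fun (congrArg (fun t : E₂ b ⟶ E₂ b => (t.hom.app X).hom.hom) hc) x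
    refine (h1 X x).trans (Eq.trans ?_ (contract_tmul _ _ _).symm)
    congr 1
    refine Eq.trans ?_ (apply_contract ξ ε _).symm
    refine Eq.trans ?_ (congrArg ε (h1 W e)).symm
    rw [map_smul, hε, smul_eq_mul, mul_one]
  refine ⟨ObjectProperty.homMk
    { app := fun V => FGModuleCat.ofHom (t V)
      naturality := fun V V' f => ?_ }, ?_⟩
  · apply FGModuleCat.hom_ext
    apply LinearMap.ext
    intro m
    have h1 := LinearMap.congr_fun (congrArg (fun t => t.hom.hom)
      (τ.hom.naturality ((f, 𝟙 W) : ((V, W) : C × D) ⟶ (V', W)))) (m ⊗ₜ[k] e)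
    have h2 : ((E₂ b).obj.map (𝟙 W)).hom.hom e = e := by
      rw [(E₂ b).obj.map_id]
      rfl
    have h3 : (M.obj.map f).hom.hom m ⊗ₜ[k] ((E₂ b).obj.map (𝟙 W)).hom.hom e =
      (M.obj.map f).hom.hom m ⊗ₜ[k] e := congrArg _ h2
    have h4 : t V' ((M.obj.map f).hom.hom m) ⊗ₜ[k] e = (M'.obj.map f).hom.hom (t V m) ⊗ₜ[k] e := by
      refine (ht V' W _ e).symm.trans ((congrArg _ h3).symm.trans (h1.trans ?_))
      refine (congrArg (TensorProduct.map (M'.obj.map f).hom.hom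
        ((E₂ b).obj.map (𝟙 W)).hom.hom) (ht V W m e)).trans ?_
      exact congrArg (fun y => (M'.obj.map f).hom.hom (t V m) ⊗ₜ[k] y) h2
    have h5 := congrArg (fun y => TensorProduct.rid k _ (ε.lTensor (M'.obj.obj V') y)) h4
    simp only [LinearMap.lTensor_tmul, hε, TensorProduct.rid_tmul, one_smul] at h5
    exact h5
  · apply ObjectProperty.hom_ext
    ext X : 2
    apply FGModuleCat.hom_ext
    apply TensorProduct.ext'
    intro m x
    exact ht X.1 X.2 m x

/-- Tensor products of members of bases of categories of polynomial functors form a basis of the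
category of polynomial functors of two variables. -/
theorem IsBasis.box [Infinite k] {B₁ : Type} {E₁ : B₁ → Poly k C} (h₁ : IsBasis k E₁)
    (h₂ : IsBasis k E₂) {deg : B₂ → ℕ} (hdeg : ∀ b, polyDeg k D (deg b) (E₂ b))
    (hfin : ∀ n, Finite {b // deg b = n}) :
    IsBasis k fun b : B₁ × B₂ => (SSH.box (E₂ b.2)).obj (E₁ b.1) where
  scalar b f := by
    obtain ⟨t, rfl⟩ := h₂.box_hom_eq_map f
    obtain ⟨c, rfl⟩ := h₁.scalar _ t
    exact ⟨c, by rw [Functor.map_smul, CategoryTheory.Functor.map_id]⟩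
  id_ne_zero b h := by
    obtain ⟨V, x, hx⟩ := Poly.exists_vector_ne_zero (h₁.id_ne_zero b.1)
    obtain ⟨W, y, hy⟩ := Poly.exists_vector_ne_zero (h₂.id_ne_zero b.2)
    obtain ⟨ξ, hξ⟩ := exists_dual_eq_one (k := k) hx
    have h0 : x ⊗ₜ[k] y = 0 := LinearMap.congr_fun (congrArg (fun t :
      (SSH.box (E₂ b.2)).obj (E₁ b.1) ⟶ (SSH.box (E₂ b.2)).obj (E₁ b.1) =>
      (t.hom.app (V, W)).hom.hom) h) (x ⊗ₜ[k] y)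
    apply hy
    have := congrArg (contract _ ξ) h0
    rwa [contract_tmul, hξ, one_smul, map_zero] at this
  orthogonal := by
    rintro ⟨a, a'⟩ ⟨b, b'⟩ hab f
    by_cases h : a' = b'
    · subst h
      obtain ⟨t, rfl⟩ := h₂.box_hom_eq_map f
      rw [h₁.orthogonal a b (fun h => hab (by rw [h])) t, Functor.map_zero]
    · exact h₂.box_hom_eq_zero h f
  decomposition F := by
    obtain ⟨s, M, hM⟩ := h₂.exists_box_decomposition hdeg hfin F
    choose J fJ q hq using fun b => h₁.decomposition (M b)
    exact ⟨Σ b : s, J b, inferInstance, fun p => (q p.1 p.2, p.1.1),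
      hM.sigma fun b => (hq b).map_additive (SSH.box (E₂ b.1))⟩

end FubiniBasis

/-! ### Precomposition with linear equivalences. -/

section PrecompEquivalence

variable {k : Type u} [Field k] {A : Type v} [Category.{w'} A] [Preadditive A] [Linear k A]
    {B : Type v} [Category.{w'} B] [Preadditive B] [Linear k B]

instance precomp_additive (L : B ⥤ A) [L.Additive] [L.Linear k] :
    (precomp (k := k) L).Additive where
  map_add := rfl

instance precomp_linear (L : B ⥤ A) [L.Additive] [L.Linear k] : (precomp (k := k) L).Linear k where
  map_smul _ _ := rfl

/-- An isomorphism of polynomial functors from its components. -/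
def polyIso {F G : Poly k A} (e : ∀ V, F.obj.obj V ≃ₗ[k] G.obj.obj V)
    (h : ∀ {V W : A} (f : V ⟶ W) x,
      e W ((F.obj.map f).hom.hom x) = (G.obj.map f).hom.hom (e V x)) : F ≅ G :=
  ObjectProperty.isoMk _ (NatIso.ofComponents (fun V => (e V).toFGModuleCatIso) fun f => by
    apply FGModuleCat.hom_ext
    exact LinearMap.ext (h f))

instance precomp_isEquivalence (L : B ⥤ A) [L.Additive] [L.Linear k] [L.IsEquivalence] :
    (precomp (k := k) L).IsEquivalence where
  faithful := ⟨fun {F G f g} h => ObjectProperty.hom_ext _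
    (((Functor.whiskeringLeft B A (FGModuleCat.{u} k)).obj L).map_injective
      (congrArg (fun t => t.hom) h))⟩
  full := ⟨fun {F G} f => by
    obtain ⟨g, hg⟩ := ((Functor.whiskeringLeft B A (FGModuleCat.{u} k)).obj L).map_surjective f.hom
    exact ⟨ObjectProperty.homMk g, ObjectProperty.hom_ext _ hg⟩⟩
  essSurj := ⟨fun G => by
    have h1 : L.asEquivalence.inverse.Additive :=
      haveI : L.asEquivalence.functor.Additive := inferInstanceAs L.Additive
      inferInstance
    have h2 : L.asEquivalence.inverse.Linear k :=
      haveI : L.asEquivalence.functor.Additive := inferInstanceAs L.Additive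
      haveI : L.asEquivalence.functor.Linear k := inferInstanceAs (L.Linear k)
      inferInstance
    refine ⟨⟨L.asEquivalence.inverse ⋙ G.obj, G.property.precomp h1 h2⟩,
      ⟨ObjectProperty.isoMk _ ?_⟩⟩
    exact (Functor.associator _ _ _).symm ≪≫
      Functor.isoWhiskerRight L.asEquivalence.unitIso.symm G.obj ≪≫ Functor.leftUnitor _⟩

end PrecompEquivalence

/-! ### Sheaves on one point, along bijections, and on a set with one point added. -/

section SheafEquivalences

variable {k : Type u} [Field k]

instance stalk_isEquivalence : (stalk k).IsEquivalence where
  faithful := ⟨fun h => funext fun _ => h⟩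
  full := ⟨fun f => ⟨fun _ => f, rfl⟩⟩
  essSurj := ⟨fun V => ⟨fun _ => V, ⟨Iso.refl _⟩⟩⟩

/-- Inverse image along a bijection is an equivalence. -/
instance shPull_isEquivalence {S T : Type} (σ : S ≃ T) : (shPull k σ).IsEquivalence :=
  Functor.IsEquivalence.mk' (shPull k σ.symm)
    (NatIso.ofComponents (fun V => Pi.isoMk fun t => eqToIso (by simp [shPull])) fun {V W} f => by
      funext t
      have h := pullCongr_naturality (φ := id) (ψ := fun t => σ (σ.symm t)) (fun t => by simp) f
      exact (congrFun h t).symm)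
    (NatIso.ofComponents (fun V => Pi.isoMk fun t => eqToIso (by simp [shPull])) fun {V W} f => by
      funext t
      have h := pullCongr_naturality (φ := fun s => σ.symm (σ s)) (ψ := id) (fun t => by simp) f
      exact (congrFun h t).symm)

/-- Splitting off one stalk. -/
def shOption (k : Type u) [Field k] (S : Type) : Sh k (Option S) ⥤ Sh k S × FGModuleCat.{u} k :=
  (shPull k some).prod' (Pi.eval _ none)

instance (S : Type) : (shOption k S).Additive where
  map_add := rfl

instance (S : Type) : (shOption k S).Linear k where
  map_smul _ _ := rfl

instance (S : Type) : (shOption k S).IsEquivalence where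
  faithful := ⟨fun {V W f g} h => by
    funext o
    cases o with
    | none => exact congrArg Prod.snd h
    | some s => exact congrFun (congrArg Prod.fst h) s⟩
  full := ⟨fun {V W} f => ⟨fun o => match o with
    | none => f.2
    | some s => f.1 s, rfl⟩⟩
  essSurj := ⟨fun V => ⟨fun o => match o with
    | none => V.2
    | some s => V.1 s, ⟨Iso.refl _⟩⟩⟩

end SheafEquivalences

section OptionTensor

variable (k : Type u) [Field k] {S : Type} (M : Option S → Type u) [∀ o, AddCommGroup (M o)]
  [∀ o, Module k (M o)]

/-- Splitting off one factor of a tensor product. -/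
def optionTensor : ((⨂[k] s, M (some s)) ⊗[k] M none) ≃ₗ[k] ⨂[k] o, M o :=
  (TensorProduct.congr (LinearEquiv.refl k _) (PiTensorProduct.subsingletonEquiv (R := k)
    (s := fun _ : PUnit.{1} => M none) PUnit.unit).symm).trans
  ((PiTensorProduct.tmulEquivDep k
    fun x : S ⊕ PUnit.{1} => M ((Equiv.optionEquivSumPUnit S).symm x)).trans
    (PiTensorProduct.reindex k M (Equiv.optionEquivSumPUnit S)).symm)

theorem optionTensor_tmul (x : ∀ o, M o) :
    optionTensor k M ((PiTensorProduct.tprod k fun s => x (some s)) ⊗ₜ x none) =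
      PiTensorProduct.tprod k x := by
  have h : (PiTensorProduct.subsingletonEquiv (R := k)
      (s := fun _ : PUnit.{1} => M none) PUnit.unit).symm (x none) =
      PiTensorProduct.tprod k fun _ => x none := by
    rw [LinearEquiv.symm_apply_eq, PiTensorProduct.subsingletonEquiv_apply_tprod]
  refine (LinearEquiv.symm_apply_eq (PiTensorProduct.reindex k M (Equiv.optionEquivSumPUnit S))).mpr
    (Eq.trans ?_ (PiTensorProduct.reindex_tprod (Equiv.optionEquivSumPUnit S) x).symm)
  refine (congrArg (fun z => PiTensorProduct.tmulEquivDep k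
    (fun x : S ⊕ PUnit.{1} => M ((Equiv.optionEquivSumPUnit S).symm x))
    ((PiTensorProduct.tprod k fun s => x (some s)) ⊗ₜ z)) h).trans ?_
  refine (PiTensorProduct.tmulEquivDep_apply k
    (fun x : S ⊕ PUnit.{1} => M ((Equiv.optionEquivSumPUnit S).symm x)) _ _).trans ?_
  congr 1
  funext i
  rcases i with s | _ <;> rfl

end OptionTensor

/-! ### External tensor products of functors of one variable. -/

section ExternalTensor

variable {k : Type u} [Field k]

instance evalAdditive {S : Type} (s : S) :
    (Pi.eval (fun _ : S => FGModuleCat.{u} k) s).Additive where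
  map_add := rfl

instance evalLinear {S : Type} (s : S) :
    (Pi.eval (fun _ : S => FGModuleCat.{u} k) s).Linear k where
  map_smul _ _ := rfl

/-- The external tensor product `V ↦ ⨂ F s (V s)`. -/
def ext {S : Type} [Finite S] (F : S → Poly k (FGModuleCat.{u} k)) : Poly k (Sh k S) :=
  ⟨tensorFunctor fun s => Pi.eval _ s ⋙ (F s).obj, tensorFunctor_polynomial fun s =>
    (F s).property.precomp inferInstance inferInstance⟩

theorem ext_homogeneous {S : Type} [Finite S] {F : S → Poly k (FGModuleCat.{u} k)} {n : S → ℕ}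
    (h : ∀ s, polyDeg k _ (n s) (F s)) : polyDeg k _ (∑ᶠ s, n s) (ext F) :=
  tensorFunctor_homogeneous fun s => IsHomogeneousFunctor.precomp (h s) inferInstance inferInstance

/-- External tensor products are compatible with bijections of index sets. -/
def extReindex {S T : Type} [Finite S] [Finite T] (σ : S ≃ T)
    (F : T → Poly k (FGModuleCat.{u} k)) :
    ext F ≅ (precomp (shPull k σ)).obj (ext fun s => F (σ s)) :=
  let e : ∀ V : Sh k T, (⨂[k] t, (F t).obj.obj (V t)) ≃ₗ[k] ⨂[k] s, (F (σ s)).obj.obj (V (σ s)) :=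
    fun V => PiTensorProduct.reindex k (fun t => (F t).obj.obj (V t)) σ.symm
  polyIso e (by
    intro V W f x
    have key : (e W).toLinearMap ∘ₗ (PiTensorProduct.map fun t => ((F t).obj.map (f t)).hom.hom) =
        (PiTensorProduct.map fun s => ((F (σ s)).obj.map (f (σ s))).hom.hom) ∘ₗ
          (e V).toLinearMap := by
      apply PiTensorProduct.ext
      ext x
      refine (congrArg (e W) (PiTensorProduct.map_tprod _ _)).trans ?_
      refine (PiTensorProduct.reindex_tprod σ.symm _).trans ?_
      refine Eq.trans ?_ (congrArg (PiTensorProduct.map _)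
        (PiTensorProduct.reindex_tprod σ.symm x)).symm
      exact (PiTensorProduct.map_tprod _ _).symm
    exact LinearMap.congr_fun key x)

/-- An external tensor product over `Option S` is a tensor product of an external tensor product
over `S` and a functor of one variable. -/
def extOption {S : Type} [Finite S] (F : Option S → Poly k (FGModuleCat.{u} k)) :
    (precomp (shOption k S)).obj ((box (F none)).obj (ext fun s => F (some s))) ≅ ext F :=
  let e : ∀ V : Sh k (Option S), ((⨂[k] s, (F (some s)).obj.obj (V (some s))) ⊗[k]
      (F none).obj.obj (V none)) ≃ₗ[k] ⨂[k] o, (F o).obj.obj (V o) :=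
    fun V => optionTensor k fun o => (F o).obj.obj (V o)
  polyIso e (by
    intro V W f x
    have key : (e W).toLinearMap ∘ₗ TensorProduct.map
          (PiTensorProduct.map fun s : S => ((F (some s)).obj.map (f (some s))).hom.hom)
          ((F none).obj.map (f none)).hom.hom =
        (PiTensorProduct.map fun o => ((F o).obj.map (f o)).hom.hom) ∘ₗ (e V).toLinearMap := by
      apply TensorProduct.ext
      apply PiTensorProduct.ext
      ext x y
      let z : ∀ o, (F o).obj.obj (V o) := fun o => match o with
        | none => y
        | some s => x s
      have h1 := optionTensor_tmul k (fun o => (F o).obj.obj (V o)) z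
      have h2 := optionTensor_tmul k (fun o => (F o).obj.obj (W o))
        fun o => ((F o).obj.map (f o)).hom.hom (z o)
      have h3 : PiTensorProduct.map (fun s : S => ((F (some s)).obj.map (f (some s))).hom.hom)
          (PiTensorProduct.tprod k x) = PiTensorProduct.tprod k fun s =>
            ((F (some s)).obj.map (f (some s))).hom.hom (x s) := PiTensorProduct.map_tprod _ _
      have h4 := congrArg (PiTensorProduct.map fun o => ((F o).obj.map (f o)).hom.hom) h1
      rw [PiTensorProduct.map_tprod] at h4
      exact (congrArg (fun t => e W (t ⊗ₜ[k] ((F none).obj.map (f none)).hom.hom y)) h3).trans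
        (h2.trans h4.symm)
    exact LinearMap.congr_fun key x)

end ExternalTensor

/-! ### External tensor products of a basis form a basis. -/

section ExtBasis

variable {k : Type u} [Field k]

/-- Sheaves on the empty set form a category with one object and one morphism. A functor on it is a
vector space, and the empty tensor product is the line. -/
theorem isBasis_ext_empty {S : Type} [IsEmpty S] {B : Type} (E : B → Poly k (FGModuleCat.{u} k)) :
    IsBasis k fun b : S → B => ext fun s => E (b s) := by
  let V₀ : Sh k S := fun s => isEmptyElim s
  let e : ∀ (F : S → Poly k (FGModuleCat.{u} k)) (V : Sh k S),
      (⨂[k] s, (F s).obj.obj (V s)) ≃ₗ[k] k := fun F V => PiTensorProduct.isEmptyEquiv S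
  have hnat : ∀ (F G : Poly k (Sh k S)) (t : ∀ V, F.obj.obj V →ₗ[k] G.obj.obj V) {V W : Sh k S}
      (f : V ⟶ W), F.obj.map f ≫ FGModuleCat.ofHom (t W) =
        FGModuleCat.ofHom (t V) ≫ G.obj.map f := by
    intro F G t V W f
    obtain rfl := Subsingleton.elim V W
    obtain rfl : f = 𝟙 V := funext fun s => isEmptyElim s
    rw [F.obj.map_id, G.obj.map_id, Category.id_comp, Category.comp_id]
  refine ⟨fun b f => ?_, fun b h => ?_, fun a b hab => (hab (Subsingleton.elim _ _)).elim,
    fun X => ?_⟩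
  · let F := fun s => E (b s)
    let t : (⨂[k] s, (F s).obj.obj (V₀ s)) →ₗ[k] ⨂[k] s, (F s).obj.obj (V₀ s) :=
      (f.hom.app V₀).hom.hom
    let v := (e F V₀).symm 1
    refine ⟨e F V₀ (t v), ?_⟩
    apply ObjectProperty.hom_ext
    ext V : 2
    obtain rfl := Subsingleton.elim V₀ V
    apply FGModuleCat.hom_ext
    apply LinearMap.ext
    intro z
    have hz : ∀ z, z = e F V₀ z • v := by
      intro z
      rw [← map_smul, smul_eq_mul, mul_one, LinearEquiv.symm_apply_apply]
    have h1 : ∀ z, t z = e F V₀ (t v) • z := by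
      intro z
      calc t z = t (e F V₀ z • v) := by rw [← hz z]
        _ = e F V₀ z • e F V₀ (t v) • v := by rw [map_smul, ← hz (t v)]
        _ = e F V₀ (t v) • z := by rw [smul_comm, ← hz z]
    exact h1 z
  · let F := fun s => E (b s)
    have h1 : (e F V₀).symm 1 = 0 := LinearMap.congr_fun (congrArg
      (fun t : ext F ⟶ ext F => (t.hom.app V₀).hom.hom) h) ((e F V₀).symm 1)
    exact one_ne_zero ((LinearEquiv.map_eq_zero_iff _).mp h1)
  · have hd : ∀ V, Module.finrank k (X.obj.obj V) = Module.finrank k (X.obj.obj V₀) := fun V => by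
      rw [Subsingleton.elim V V₀]
    let b : ∀ V, Module.Basis (Fin (Module.finrank k (X.obj.obj V₀))) k (X.obj.obj V) := fun V =>
      (Module.finBasis k (X.obj.obj V)).reindex (finCongr (hd V))
    refine ⟨Fin (Module.finrank k (X.obj.obj V₀)), inferInstance, fun _ s => isEmptyElim s, ?_⟩
    let F : S → Poly k (FGModuleCat.{u} k) := fun s => E (isEmptyElim s)
    change IsDirectSum X fun _ => ext F
    let i : ∀ a V, (⨂[k] s, (F s).obj.obj (V s)) →ₗ[k] X.obj.obj V := fun a V =>
      LinearMap.toSpanSingleton k _ (b V a) ∘ₗ (e F V).toLinearMap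
    refine IsDirectSum.of_pointwise (fun a => ObjectProperty.homMk
      { app := fun V => FGModuleCat.ofHom (i a V)
        naturality := fun V W f => hnat (ext F) X (i a) f })
      (fun a V => (e F V).symm.toLinearMap ∘ₗ (b V).coord a) ?_ ?_ ?_
    · intro a V y
      change (e F V).symm ((b V).coord a (e F V y • b V a)) = y
      rw [map_smul, Module.Basis.coord_apply, Module.Basis.repr_self, Finsupp.single_eq_same,
        smul_eq_mul, mul_one]
      exact LinearEquiv.symm_apply_apply (e F V) y
    · intro a c hac V y
      change (e F V).symm ((b V).coord c (e F V y • b V a)) = 0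
      rw [map_smul, Module.Basis.coord_apply, Module.Basis.repr_self,
        Finsupp.single_eq_of_ne hac.symm, smul_zero, map_zero]
    · intro V y
      refine Eq.trans (Finset.sum_congr rfl fun a _ => ?_) ((b V).sum_repr y)
      change e F V ((e F V).symm ((b V).coord a y)) • b V a = _
      rw [LinearEquiv.apply_symm_apply]
      rfl

/-- External tensor products of the members of a basis of the category of polynomial functors of one
variable form a basis of the category of polynomial functors on sheaves. -/
theorem isBasis_ext [Infinite k] {B : Type} {E : B → Poly k (FGModuleCat.{u} k)}
    (hE : IsBasis k E) {deg : B → ℕ} (hdeg : ∀ b, polyDeg k _ (deg b) (E b))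
    (hfin : ∀ n, Finite {b // deg b = n}) (S : Type) [Finite S] :
    IsBasis k fun b : S → B => ext fun s => E (b s) := by
  -- Induction over finite sets: invariance under bijections, the empty set, and the addition of a
  -- point, where `IsBasis.box` supplies one more variable.
  refine Finite.induction_empty_option
    (P := fun S => ∀ [Finite S], IsBasis k fun b : S → B => ext fun s => E (b s))
    (fun {α β} σ ih _ => ?_) ?_ (fun {α} _ ih _ => ?_) S
  · have : Finite α := Finite.of_equiv β σ.symm
    have h := (ih.map_equivalence (precomp (shPull k σ))).reindex
      (σ.arrowCongr (Equiv.refl B)).symm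
    exact h.congr fun b => (extReindex σ fun t => E (b t)).symm
  · intro _
    exact isBasis_ext_empty E
  · have h := ((ih.box hE hdeg hfin).map_equivalence (precomp (shOption k _))).reindex
      ((Equiv.piOptionEquivProd (β := fun _ => B)).trans (Equiv.prodComm _ _))
    exact h.congr fun b => extOption fun o => E (b o)

end ExtBasis

/-! ### Multilinear functors on products of semisimple categories -/

universe v' w''

section MultiBasis

variable (k : Type u) [Field k] {J : Type} {C : J → Type v} [∀ j, Category.{w'} (C j)]
  [∀ j, Preadditive (C j)] [∀ j, Linear k (C j)]

/-- Multilinearity of a functor on a product of categories, for arbitrary universe levels. -/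
def IsMultilinear {D : Type v'} [Category.{w''} D] [Preadditive D] [Linear k D]
    (F : (∀ j, C j) ⥤ D) : Prop :=
  ∀ X Y : ∀ j, C j, ∃ M : MultilinearMap k (fun j => X j ⟶ Y j) (F.obj X ⟶ F.obj Y),
    ∀ f : X ⟶ Y, M f = F.map f

/-- A decomposition of an object of a product of categories which is turned into a direct sum
decomposition by every multilinear functor. -/
def IsMultiSum {P : Type} [Fintype P] (X : ∀ j, C j) (Y : P → ∀ j, C j) : Prop :=
  ∃ (π : ∀ p, X ⟶ Y p) (ι : ∀ p, Y p ⟶ X), (∀ p j, ι p j ≫ π p j = 𝟙 _) ∧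
    (∀ p r, p ≠ r → ∃ j, ι p j ≫ π r j = 0) ∧
    ∑ p, PiTensorProduct.tprod k (fun j => π p j ≫ ι p j) =
      PiTensorProduct.tprod k fun j => 𝟙 (X j)

/-- A family of objects of a product of categories, consisting of all combinations of members of
bases of the factors. -/
structure IsMultiBasis {K : Type} (E : K → ∀ j, C j) : Prop where
  scalar : ∀ κ j (f : E κ j ⟶ E κ j), ∃ c : k, f = c • 𝟙 _
  id_ne_zero : ∀ κ j, 𝟙 (E κ j) ≠ 0
  orthogonal : ∀ κ κ', κ ≠ κ' → ∀ f : ∀ j, E κ j ⟶ E κ' j, ∃ j, f j = 0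
  decomposition : ∀ X, ∃ (P : Type) (_ : Fintype P) (q : P → K), IsMultiSum k X fun p => E (q p)

variable {k}

theorem IsMultiBasis.reindex {K K' : Type} {E : K → ∀ j, C j} (hE : IsMultiBasis k E)
    (σ : K' ≃ K) : IsMultiBasis k fun κ => E (σ κ) where
  scalar κ := hE.scalar _
  id_ne_zero κ := hE.id_ne_zero _
  orthogonal a b hab := hE.orthogonal _ _ (σ.injective.ne hab)
  decomposition X := by
    obtain ⟨P, fP, q, h⟩ := hE.decomposition X
    refine ⟨P, fP, fun a => σ.symm (q a), ?_⟩
    simp only [Equiv.apply_symm_apply]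
    exact h

theorem IsMultiSum.of_isDirectSum [Finite J] {X : ∀ j, C j} {P : J → Type} [∀ j, Fintype (P j)]
    [Fintype (∀ j, P j)] {Y : ∀ j, P j → C j} (h : ∀ j, IsDirectSum (X j) (Y j)) :
    IsMultiSum k X fun (p : ∀ j, P j) j => Y j (p j) := by
  classical
  have := Fintype.ofFinite J
  choose π ι h1 h2 h3 using h
  refine ⟨fun p j => π j (p j), fun p j => ι j (p j), fun p j => h1 j (p j), fun p r hpr => ?_, ?_⟩
  · obtain ⟨j, hj⟩ := Function.ne_iff.mp hpr
    exact ⟨j, h2 j _ _ hj⟩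
  · have key := (PiTensorProduct.tprod k (s := fun j => X j ⟶ X j)).map_sum
      (fun j a => π j a ≫ ι j a)
    simp only [h3] at key
    rw [key]
    exact Finset.sum_congr (by ext; simp) fun p _ => rfl

theorem IsBasis.multi [Finite J] {B : J → Type} {E : ∀ j, B j → C j}
    (hE : ∀ j, IsBasis k (E j)) : IsMultiBasis k fun (b : ∀ j, B j) j => E j (b j) where
  scalar b j := (hE j).scalar _
  id_ne_zero b j := (hE j).id_ne_zero _
  orthogonal a b hab f := by
    obtain ⟨j, hj⟩ := Function.ne_iff.mp hab
    exact ⟨j, (hE j).orthogonal _ _ hj _⟩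
  decomposition X := by
    classical
    have := Fintype.ofFinite J
    choose P fP q h using fun j => (hE j).decomposition (X j)
    exact ⟨∀ j, P j, inferInstance, fun p j => q j (p j), IsMultiSum.of_isDirectSum h⟩

section

variable {D : Type v'} [Category.{w''} D] [Preadditive D] [Linear k D] {K : Type}
  {E : K → ∀ j, C j}

/-- The resolution of the identity in `IsMultiSum` is stated in a tensor product exactly so that it
can be evaluated by an arbitrary multilinear map. -/
theorem sum_apply_of_tprod {P : Type} [Fintype P] {X : ∀ j, C j} {f : P → ∀ j, X j ⟶ X j}
    (h : ∑ p, PiTensorProduct.tprod k (f p) = PiTensorProduct.tprod k fun j => 𝟙 (X j))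
    {W : Type*} [AddCommGroup W] [Module k W] (M : MultilinearMap k (fun j => X j ⟶ X j) W) :
    ∑ p, M (f p) = M fun j => 𝟙 (X j) := by
  have := congrArg (PiTensorProduct.lift M) h
  simpa only [map_sum, PiTensorProduct.lift.tprod] using this

theorem IsMultilinear.sum_map {Φ : (∀ j, C j) ⥤ D} (hΦ : IsMultilinear k Φ) {P : Type} [Fintype P]
    {X : ∀ j, C j} {Y : P → ∀ j, C j} {π : ∀ p, X ⟶ Y p} {ι : ∀ p, Y p ⟶ X}
    (h : ∑ p, PiTensorProduct.tprod k (fun j => π p j ≫ ι p j) =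
      PiTensorProduct.tprod k fun j => 𝟙 (X j)) :
    ∑ p, Φ.map (π p) ≫ Φ.map (ι p) = 𝟙 (Φ.obj X) := by
  obtain ⟨M, hM⟩ := hΦ X X
  rw [← Φ.map_id, ← hM]
  refine Eq.trans (Finset.sum_congr rfl fun p _ => ?_) (sum_apply_of_tprod h M)
  rw [← Φ.map_comp, ← hM]
  rfl

theorem IsMultilinear.isDirectSum {Φ : (∀ j, C j) ⥤ D} (hΦ : IsMultilinear k Φ) {P : Type}
    [Fintype P] {X : ∀ j, C j} {Y : P → ∀ j, C j} (h : IsMultiSum k X Y) :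
    IsDirectSum (Φ.obj X) fun p => Φ.obj (Y p) := by
  obtain ⟨π, ι, h1, h2, h3⟩ := h
  refine ⟨fun p => Φ.map (π p), fun p => Φ.map (ι p), fun p => ?_, fun p r hpr => ?_,
    hΦ.sum_map h3⟩
  · rw [← Φ.map_comp, ← Φ.map_id]
    congr 1
    funext j
    exact h1 p j
  · obtain ⟨j, hj⟩ := h2 p r hpr
    rw [← Φ.map_comp]
    obtain ⟨M, hM⟩ := hΦ (Y p) (Y r)
    rw [← hM]
    exact M.map_coord_zero j hj

/-- Between two members of the basis either some component of `g` is zero, or the members agree and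
all components are scalars. Multilinear functors treat both cases alike, so any family `ζ` is
natural on the basis. -/
theorem IsMultiBasis.commutes [Finite J] (hE : IsMultiBasis k E) {Φ Ψ : (∀ j, C j) ⥤ D}
    (hΦ : IsMultilinear k Φ) (hΨ : IsMultilinear k Ψ) (ζ : ∀ κ, Φ.obj (E κ) ⟶ Ψ.obj (E κ))
    {κ κ' : K} (g : E κ ⟶ E κ') : ζ κ ≫ Ψ.map g = Φ.map g ≫ ζ κ' := by
  classical
  have := Fintype.ofFinite J
  obtain ⟨M, hM⟩ := hΦ (E κ) (E κ')
  obtain ⟨N, hN⟩ := hΨ (E κ) (E κ')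
  rw [← hM, ← hN]
  by_cases h : κ = κ'
  · subst h
    choose c hc using fun j => hE.scalar κ j (g j)
    have hg : g = fun j => c j • 𝟙 (E κ j) := funext hc
    rw [hg, MultilinearMap.map_smul_univ, MultilinearMap.map_smul_univ, Linear.comp_smul,
      Linear.smul_comp]
    congr 1
    have h1 := hM (𝟙 (E κ))
    have h2 := hN (𝟙 (E κ))
    rw [CategoryTheory.Functor.map_id] at h1 h2
    refine (congrArg (ζ κ ≫ ·) h2).trans (Eq.trans ?_ (congrArg (· ≫ ζ κ) h1).symm)
    simp
  · obtain ⟨j, hj⟩ := hE.orthogonal κ κ' h g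
    rw [M.map_coord_zero j hj, N.map_coord_zero j hj]
    simp

theorem IsMultiBasis.nat_ext (hE : IsMultiBasis k E) {Φ Ψ : (∀ j, C j) ⥤ D}
    (hΦ : IsMultilinear k Φ) {η θ : Φ ⟶ Ψ} (h : ∀ κ, η.app (E κ) = θ.app (E κ)) : η = θ := by
  ext X : 2
  obtain ⟨P, _, q, π, ι, h1, h2, h3⟩ := hE.decomposition X
  have key : ∀ η : Φ ⟶ Ψ, η.app X = ∑ p, Φ.map (π p) ≫ η.app (E (q p)) ≫ Ψ.map (ι p) := by
    intro η
    rw [← Category.id_comp (η.app X), ← hΦ.sum_map h3, Preadditive.sum_comp]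
    refine Finset.sum_congr rfl fun p _ => ?_
    rw [Category.assoc, η.naturality]
  rw [key η, key θ]
  simp only [h]

/-- The component at `X` is the sum of `ζ` over the pieces of a decomposition. Naturality follows by
resolving the identities of `X` and of `Y`, so that only morphisms between members of the basis
remain in the middle. -/
theorem IsMultiBasis.exists_nat [Finite J] (hE : IsMultiBasis k E) {Φ Ψ : (∀ j, C j) ⥤ D}
    (hΦ : IsMultilinear k Φ) (hΨ : IsMultilinear k Ψ) (ζ : ∀ κ, Φ.obj (E κ) ⟶ Ψ.obj (E κ)) :
    ∃ η : Φ ⟶ Ψ, ∀ κ, η.app (E κ) = ζ κ := by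
  choose P fP q π ι h1 h2 h3 using hE.decomposition
  refine ⟨{ app := fun X => ∑ p, Φ.map (π X p) ≫ ζ (q X p) ≫ Ψ.map (ι X p)
            naturality := fun X Y f => ?_ }, fun κ => ?_⟩
  · calc Φ.map f ≫ ∑ r, Φ.map (π Y r) ≫ ζ (q Y r) ≫ Ψ.map (ι Y r)
        = (∑ p, Φ.map (π X p) ≫ Φ.map (ι X p)) ≫ Φ.map f ≫
            ∑ r, Φ.map (π Y r) ≫ ζ (q Y r) ≫ Ψ.map (ι Y r) := by
          rw [hΦ.sum_map (h3 X), Category.id_comp]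
      _ = ∑ p, ∑ r, Φ.map (π X p) ≫ Φ.map (ι X p ≫ f ≫ π Y r) ≫ ζ (q Y r) ≫ Ψ.map (ι Y r) := by
          simp only [Preadditive.sum_comp, Preadditive.comp_sum, Φ.map_comp, Category.assoc]
          exact Finset.sum_comm
      _ = ∑ p, ∑ r, Φ.map (π X p) ≫ ζ (q X p) ≫ Ψ.map (ι X p ≫ f ≫ π Y r) ≫ Ψ.map (ι Y r) := by
          refine Finset.sum_congr rfl fun p _ => Finset.sum_congr rfl fun r _ => ?_
          rw [← reassoc_of% (hE.commutes hΦ hΨ ζ (ι X p ≫ f ≫ π Y r))]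
      _ = (∑ p, Φ.map (π X p) ≫ ζ (q X p) ≫ Ψ.map (ι X p)) ≫ Ψ.map f ≫
            ∑ r, Ψ.map (π Y r) ≫ Ψ.map (ι Y r) := by
          simp only [Preadditive.sum_comp, Preadditive.comp_sum, Ψ.map_comp, Category.assoc]
          exact Finset.sum_comm
      _ = _ := by rw [hΨ.sum_map (h3 Y), Category.comp_id]
  · change ∑ p, Φ.map (π (E κ) p) ≫ ζ (q (E κ) p) ≫ Ψ.map (ι (E κ) p) = ζ κ
    calc _ = ∑ p, (Φ.map (π (E κ) p) ≫ Φ.map (ι (E κ) p)) ≫ ζ κ := by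
          refine Finset.sum_congr rfl fun p _ => ?_
          rw [hE.commutes hΦ hΨ ζ (ι (E κ) p), Category.assoc]
      _ = ζ κ := by rw [← Preadditive.sum_comp, hΦ.sum_map (h3 (E κ)), Category.id_comp]

theorem IsMultiBasis.nonempty_iso [Finite J] (hE : IsMultiBasis k E) {Φ Ψ : (∀ j, C j) ⥤ D}
    (hΦ : IsMultilinear k Φ) (hΨ : IsMultilinear k Ψ)
    (e : ∀ κ, Nonempty (Φ.obj (E κ) ≅ Ψ.obj (E κ))) : Nonempty (Φ ≅ Ψ) := by
  obtain ⟨η, hη⟩ := hE.exists_nat hΦ hΨ fun κ => (e κ).some.hom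
  obtain ⟨θ, hθ⟩ := hE.exists_nat hΨ hΦ fun κ => (e κ).some.inv
  exact ⟨⟨η, θ, hE.nat_ext hΦ fun κ => by simp [hη, hθ], hE.nat_ext hΨ fun κ => by simp [hη, hθ]⟩⟩

/-- The required functor on the full subcategory of basis objects: a family of scalars goes to their
product times `𝟙 (z κ)`, and everything between different members goes to zero. It respects a
composite through a different member, because there some component of `f` is zero. -/
theorem IsMultiBasis.exists_coef [Finite J] (hE : IsMultiBasis k E) (z : K → D) :
    ∃ coef : ∀ κ κ', MultilinearMap k (fun j => E κ j ⟶ E κ' j) (z κ ⟶ z κ'),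
      (∀ κ, coef κ κ (fun j => 𝟙 _) = 𝟙 _) ∧
      ∀ κ κ' κ'' f g, coef κ κ' f ≫ coef κ' κ'' g = coef κ κ'' fun j => f j ≫ g j := by
  classical
  have := Fintype.ofFinite J
  choose χ hχ using fun κ j => exists_dual_eq_one (k := k) (hE.id_ne_zero κ j)
  have hχ' : ∀ κ j f, f = χ κ j f • 𝟙 _ := by
    intro κ j f
    obtain ⟨c, rfl⟩ := hE.scalar κ j f
    rw [map_smul, hχ, smul_eq_mul, mul_one]
  let M : ∀ κ, MultilinearMap k (fun j => E κ j ⟶ E κ j) (z κ ⟶ z κ) := fun κ =>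
    (LinearMap.toSpanSingleton k _ (𝟙 (z κ))).compMultilinearMap
      ((MultilinearMap.mkPiAlgebra k J k).compLinearMap fun j => χ κ j)
  have hM : ∀ κ f, M κ f = (∏ j, χ κ j (f j)) • 𝟙 _ := fun κ f => rfl
  let coef : ∀ κ κ', MultilinearMap k (fun j => E κ j ⟶ E κ' j) (z κ ⟶ z κ') := fun κ κ' =>
    if h : κ = κ' then h ▸ M κ else 0
  have hself : ∀ κ, coef κ κ = M κ := fun κ => dif_pos rfl
  have hne : ∀ κ κ', κ ≠ κ' → coef κ κ' = 0 := fun κ κ' h => dif_neg h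
  refine ⟨coef, fun κ => ?_, fun κ κ' κ'' f g => ?_⟩
  · simp [hself, hM, hχ]
  · by_cases h : κ = κ'
    · subst h
      by_cases h' : κ = κ''
      · subst h'
        rw [hself, hM, hM, hM, Linear.smul_comp, Linear.comp_smul, smul_smul, Category.id_comp,
          ← Finset.prod_mul_distrib]
        congr 1
        refine Finset.prod_congr rfl fun j _ => ?_
        conv_rhs => rw [hχ' κ j (f j), Linear.smul_comp, Category.id_comp, map_smul, smul_eq_mul]
      · rw [hne κ κ'' h']
        simp
    · obtain ⟨j, hj⟩ := hE.orthogonal κ κ' h f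
      rw [hne κ κ' h, (coef κ κ'').map_coord_zero j (by rw [hj, zero_comp])]
      simp

/-- Multilinear functors can be prescribed on a basis. -/
theorem IsMultiBasis.exists_functor [Finite J] (hE : IsMultiBasis k E)
    (hD : ∀ (P : Type) [Fintype P] (Y : P → D), ∃ X, IsDirectSum X Y) (z : K → D) :
    ∃ G : (∀ j, C j) ⥤ D, IsMultilinear k G ∧ ∀ κ, Nonempty (G.obj (E κ) ≅ z κ) := by
  classical
  obtain ⟨coef, hid, hcomp⟩ := hE.exists_coef z
  choose P fP q π ι h1 h2 h3 using hE.decomposition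
  -- The value at `X` is the direct sum of the prescribed objects over a fixed decomposition of `X`.
  -- A morphism acts by the matrix of its coefficients.
  choose O πO ιO hO1 hO2 hO3 using fun X => hD (P X) fun p => z (q X p)
  have hdiag : ∀ X p, coef _ _ (fun j => ι X p j ≫ π X p j) = 𝟙 _ := fun X p => by
    simp only [h1]
    exact hid _
  have hoff : ∀ X p r, p ≠ r → coef _ _ (fun j => ι X p j ≫ π X r j) = 0 := fun X p r hpr => by
    obtain ⟨j, hj⟩ := h2 X p r hpr
    exact MultilinearMap.map_coord_zero _ j hj
  -- Matrix multiplication: the middle index is summed out by the resolution of the identity of `X`.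
  have hsum : ∀ {X : ∀ j, C j} {κ κ' : K} (a : E κ ⟶ X) (b : X ⟶ E κ'),
      ∑ r, coef _ _ (fun j => a j ≫ π X r j) ≫ coef _ _ (fun j => ι X r j ≫ b j) =
        coef _ _ fun j => a j ≫ b j := by
    intro X κ κ' a b
    simp only [hcomp, Category.assoc]
    have := sum_apply_of_tprod (h3 X) ((coef κ κ').compLinearMap fun j =>
      Linear.leftComp k _ (a j) ∘ₗ Linear.rightComp k _ (b j))
    simpa using this
  let m : ∀ {X Y : ∀ j, C j} (f : X ⟶ Y), O X ⟶ O Y := fun {X Y} f =>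
    ∑ p, ∑ r, πO X p ≫ coef _ _ (fun j => ι X p j ≫ f j ≫ π Y r j) ≫ ιO Y r
  have hm : ∀ {X Y : ∀ j, C j} (f : X ⟶ Y) p, ιO X p ≫ m f =
      ∑ r, coef _ _ (fun j => ι X p j ≫ f j ≫ π Y r j) ≫ ιO Y r := by
    intro X Y f p
    simp only [m, Preadditive.comp_sum]
    rw [Finset.sum_eq_single p]
    · simp [reassoc_of% (hO1 X p)]
    · intro p' _ hp'
      simp [reassoc_of% (hO2 X p p' hp'.symm)]
    · simp
  have hext : ∀ {X : ∀ j, C j} {Y : D} (f g : O X ⟶ Y), (∀ p, ιO X p ≫ f = ιO X p ≫ g) →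
      f = g := by
    intro X Y f g h
    rw [← Category.id_comp f, ← Category.id_comp g, ← hO3 X]
    simp only [Preadditive.sum_comp, Category.assoc, h]
  let G : (∀ j, C j) ⥤ D :=
    { obj := O
      map := m
      map_id := fun X => by
        apply hext
        intro p
        rw [hm, Category.comp_id]
        have : ∀ r, coef _ _ (fun j => ι X p j ≫ (𝟙 X : X ⟶ X) j ≫ π X r j) =
            coef _ _ (fun j => ι X p j ≫ π X r j) := fun r => by
          congr 1
          funext j
          exact congrArg _ (Category.id_comp _)
        simp only [this]
        rw [Finset.sum_eq_single p]
        · rw [hdiag, Category.id_comp]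
        · intro r _ hr
          rw [hoff X p r hr.symm, zero_comp]
        · simp
      map_comp := fun {X Y W} f g => by
        apply hext
        intro p
        rw [hm, ← Category.assoc, hm, Preadditive.sum_comp]
        simp only [Category.assoc, hm, Preadditive.comp_sum]
        rw [Finset.sum_comm]
        refine Finset.sum_congr rfl fun s _ => ?_
        simp only [← Category.assoc]
        rw [← Preadditive.sum_comp]
        congr 1
        have h := hsum (X := Y) (ι X p ≫ f) (g ≫ π W s)
        refine Eq.trans ?_ (Eq.trans h.symm ?_)
        · congr 1
          funext j
          simp
        · refine Finset.sum_congr rfl fun r _ => ?_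
          simp }
  refine ⟨G, fun X Y => ?_, fun κ => ?_⟩
  · let N : MultilinearMap k (fun j => X j ⟶ Y j) (O X ⟶ O Y) :=
      ∑ p, ∑ r, (Linear.leftComp k _ (πO X p) ∘ₗ Linear.rightComp k _ (ιO Y r)).compMultilinearMap
        ((coef _ _).compLinearMap fun j =>
          Linear.leftComp k _ (ι X p j) ∘ₗ Linear.rightComp k _ (π Y r j))
    refine ⟨N, fun f => ?_⟩
    change N f = m f
    simp [N, m]
  -- The decomposition chosen for `E κ` need not be the tautological one, so the comparison with `z
  -- κ` passes through the coefficients of its projections and inclusions.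
  · refine ⟨⟨∑ p, πO (E κ) p ≫ coef _ _ (ι (E κ) p), ∑ p, coef _ _ (π (E κ) p) ≫ ιO (E κ) p,
      ?_, ?_⟩⟩
    · apply hext
      intro p
      have h4 : ιO (E κ) p ≫ ∑ r, πO (E κ) r ≫ coef _ _ (ι (E κ) r) = coef _ _ (ι (E κ) p) := by
        rw [Preadditive.comp_sum, Finset.sum_eq_single p]
        · rw [reassoc_of% (hO1 (E κ) p)]
        · intro r _ hr
          rw [reassoc_of% (hO2 (E κ) p r hr.symm), zero_comp]
        · simp
      rw [← Category.assoc, h4, Preadditive.comp_sum, Finset.sum_eq_single p]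
      · rw [← Category.assoc, hcomp, hdiag, Category.id_comp]
        exact (Category.comp_id _).symm
      · intro r _ hr
        rw [← Category.assoc, hcomp, hoff _ _ _ hr.symm, zero_comp]
      · simp
    · rw [Preadditive.sum_comp, ← hid κ, ← sum_apply_of_tprod (h3 (E κ)) (coef κ κ)]
      refine Finset.sum_congr rfl fun p _ => ?_
      rw [Category.assoc, Preadditive.comp_sum, Finset.sum_eq_single p]
      · rw [reassoc_of% (hO1 (E κ) p), hcomp]
      · intro r _ hr
        rw [reassoc_of% (hO2 (E κ) p r hr.symm), zero_comp]
      · simp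

end

end MultiBasis

/-! ### Equivalences of semisimple categories -/

section Equivalences

variable {k : Type u} [Field k] {C : Type v} [Category.{w'} C] [Preadditive C] [Linear k C]
  {D : Type v'} [Category.{w''} D] [Preadditive D] [Linear k D]

/-- Finite direct sums exist in `C`. -/
def HasDirectSums (C : Type v) [Category.{w'} C] [Preadditive C] : Prop :=
  ∀ (P : Type) [Fintype P] (Y : P → C), ∃ X, IsDirectSum X Y

theorem HasDirectSums.hasFiniteBiproducts (h : HasDirectSums C) : HasFiniteBiproducts C := by
  classical
  refine ⟨fun n => ⟨fun Y => ?_⟩⟩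
  obtain ⟨X, π, ι, h1, h2, h3⟩ := h (Fin n) Y
  let b : Bicone Y :=
    { pt := X, π := π, ι := ι
      ι_π := by
        intro a a'
        by_cases haa' : a = a'
        · subst haa'
          simp [h1]
        · simp [haa', h2 a a' haa'] }
  exact HasBiproduct.mk ⟨b, isBilimitOfTotal b h3⟩

theorem HasDirectSums.of_hasFiniteBiproducts [HasFiniteBiproducts C] : HasDirectSums C := by
  classical
  intro P _ Y
  refine ⟨⨁ Y, fun a => biproduct.π Y a, fun a => biproduct.ι Y a, fun a => by simp,
    fun a b hab => biproduct.ι_π_ne Y hab, biproduct.total⟩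

/-- Direct sums of isomorphic families are isomorphic. -/
theorem IsDirectSum.nonempty_iso {X X' : C} {J : Type} [Fintype J] {Y Y' : J → C}
    (h : IsDirectSum X Y) (h' : IsDirectSum X' Y') (e : ∀ a, Y a ≅ Y' a) : Nonempty (X ≅ X') := by
  classical
  obtain ⟨π, ι, h1, h2, h3⟩ := h.congr e
  obtain ⟨π', ι', h1', h2', h3'⟩ := h'
  have key : ∀ {X X' : C} (π : ∀ a, X ⟶ Y' a) (ι : ∀ a, Y' a ⟶ X) (π' : ∀ a, X' ⟶ Y' a)
      (ι' : ∀ a, Y' a ⟶ X'), (∀ a, ι' a ≫ π' a = 𝟙 _) → (∀ a b, a ≠ b → ι' a ≫ π' b = 0) →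
      ∑ a, π a ≫ ι a = 𝟙 X → (∑ a, π a ≫ ι' a) ≫ ∑ a, π' a ≫ ι a = 𝟙 X := by
    intro X X' π ι π' ι' h1' h2' h3
    rw [Preadditive.sum_comp, ← h3]
    refine Finset.sum_congr rfl fun a _ => ?_
    rw [Category.assoc, Preadditive.comp_sum, Finset.sum_eq_single a]
    · rw [reassoc_of% (h1' a)]
    · intro b _ hb
      rw [reassoc_of% (h2' a b hb.symm), zero_comp]
    · simp
  exact ⟨⟨∑ a, π a ≫ ι' a, ∑ a, π' a ≫ ι a, key π ι π' ι' h1' h2' h3, key π' ι' π ι h1 h2 h3'⟩⟩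

/-- A linear functor taking a basis to a basis is an equivalence. -/
theorem IsBasis.isEquivalence {B : Type} {E : B → C} (hE : IsBasis k E) (hC : HasDirectSums C)
    (F : C ⥤ D) [F.Additive] [F.Linear k] (hF : IsBasis k fun b => F.obj (E b)) :
    F.IsEquivalence where
  faithful := ⟨fun {X Y f g} h => by
    rw [← sub_eq_zero] at h ⊢
    rw [← F.map_sub] at h
    generalize f - g = f at h
    obtain ⟨J, _, q, π, ι, h1, h2, h3⟩ := hE.decomposition X
    obtain ⟨J', _, q', π', ι', h1', h2', h3'⟩ := hE.decomposition Y
    have key : ∀ a b, ι a ≫ f ≫ π' b = 0 := by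
      intro a b
      have h4 : F.map (ι a ≫ f ≫ π' b) = 0 := by simp [h]
      by_cases hab : q a = q' b
      · have : ∀ (c : B) (t : E (q a) ⟶ E c), q a = c → F.map t = 0 → t = 0 := by
          rintro _ t rfl ht
          obtain ⟨c, rfl⟩ := hE.scalar _ t
          rw [F.map_smul, F.map_id] at ht
          by_cases hc : c = 0
          · simp [hc]
          · exact (hF.id_ne_zero _ ((smul_eq_zero_iff_right hc).mp ht)).elim
        exact this _ _ hab h4
      · exact hE.orthogonal _ _ hab _
    calc f = (∑ a, π a ≫ ι a) ≫ f ≫ ∑ b, π' b ≫ ι' b := by rw [h3, h3']; simp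
      _ = ∑ a, ∑ b, π a ≫ (ι a ≫ f ≫ π' b) ≫ ι' b := by
        simp only [Preadditive.sum_comp, Preadditive.comp_sum, Category.assoc]
        exact Finset.sum_comm
      _ = 0 := by simp [key]⟩
  full := ⟨fun {X Y} f => by
    obtain ⟨J, _, q, π, ι, h1, h2, h3⟩ := hE.decomposition X
    obtain ⟨J', _, q', π', ι', h1', h2', h3'⟩ := hE.decomposition Y
    have key : ∀ a b, ∃ t, F.map t = F.map (ι a) ≫ f ≫ F.map (π' b) := by
      intro a b
      by_cases hab : q a = q' b
      · have : ∀ (c : B) (s : F.obj (E (q a)) ⟶ F.obj (E c)), q a = c → ∃ t, F.map t = s := by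
          rintro _ s rfl
          obtain ⟨c, rfl⟩ := hF.scalar _ s
          exact ⟨c • 𝟙 _, by rw [F.map_smul, F.map_id]⟩
        exact this _ _ hab
      · exact ⟨0, by rw [F.map_zero]; exact (hF.orthogonal _ _ hab _).symm⟩
    choose t ht using key
    refine ⟨∑ a, ∑ b, π a ≫ t a b ≫ ι' b, ?_⟩
    simp only [F.map_sum, F.map_comp, ht]
    calc _ = (∑ a, F.map (π a) ≫ F.map (ι a)) ≫ f ≫ ∑ b, F.map (π' b) ≫ F.map (ι' b) := by
          simp only [Preadditive.sum_comp, Preadditive.comp_sum, Category.assoc]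
          exact Finset.sum_comm
      _ = f := by simp only [← F.map_comp, ← F.map_sum, h3, h3', F.map_id]; simp⟩
  essSurj := ⟨fun Y => by
    obtain ⟨J, _, q, h⟩ := hF.decomposition Y
    obtain ⟨X, hX⟩ := hC J fun a => E (q a)
    exact ⟨X, (hX.map_additive F).nonempty_iso h fun a => Iso.refl _⟩⟩

/-- Categories with finite direct sums and bases indexed by the same set are equivalent. -/
theorem IsBasis.exists_equivalence {B : Type} {E : B → C} (hE : IsBasis k E)
    (hC : HasDirectSums C) {E' : B → D} (hE' : IsBasis k E') (hD : HasDirectSums D) :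
    ∃ e : C ≌ D, e.functor.Additive ∧ e.functor.Linear k := by
  classical
  -- Functors of one variable are handled as multilinear functors on a product over `Unit`.
  let δ : C ⥤ (Unit → C) := { obj := fun X _ => X, map := fun f _ => f }
  obtain ⟨G, hG, hGE⟩ := (IsBasis.multi (J := Unit) fun _ => hE).exists_functor hD
    fun b => E' (b ())
  choose M hM using hG
  let F : C ⥤ D := δ ⋙ G
  have hF : ∀ X Y (f : X ⟶ Y), F.map f = M (fun _ => X) (fun _ => Y) (fun _ => f) := fun X Y f =>
    (hM _ _ (fun _ => f)).symm
  have hup : ∀ {X Y : C} (f g : X ⟶ Y),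
      (fun _ : Unit => g) = Function.update (fun _ : Unit => f) () g := fun f g => by
    funext a
    simp
  have h1 : F.Additive := ⟨fun {X Y f g} => by
    rw [hF, hF, hF, hup f (f + g), MultilinearMap.map_update_add, ← hup, ← hup]⟩
  have h2 : F.Linear k := ⟨fun {X Y} f c => by
    rw [hF, hF, hup f (c • f), MultilinearMap.map_update_smul, ← hup]⟩
  have h3 : F.IsEquivalence := hE.isEquivalence hC F
    (hE'.congr fun b => (hGE fun _ => b).some.symm)
  exact ⟨F.asEquivalence, h1, h2⟩

end Equivalences

/-! ### The standard basis of a finite sum of copies of the category of vector spaces. -/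

section VectorSpaces

variable {k : Type u} [Field k]

theorem isBasis_line : IsBasis k fun _ : Unit => line k where
  scalar _ f := end_line f
  id_ne_zero _ h := one_ne_zero (α := k) (LinearMap.congr_fun
    (congrArg (fun t : line k ⟶ line k => t.hom.hom) h) (1 : k))
  orthogonal a b hab := (hab rfl).elim
  decomposition V := by
    let b := Module.finBasis k V
    refine ⟨Fin (Module.finrank k V), inferInstance, fun _ => (),
      fun a => FGModuleCat.ofHom (b.coord a),
      fun a => FGModuleCat.ofHom (LinearMap.toSpanSingleton k V (b a)), fun a => ?_,
      fun a c hac => ?_, ?_⟩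
    · apply FGModuleCat.hom_ext
      apply LinearMap.ext_ring
      change b.coord a ((1 : k) • b a) = 1
      simp
    · apply FGModuleCat.hom_ext
      apply LinearMap.ext_ring
      change b.coord c ((1 : k) • b a) = 0
      simp [Finsupp.single_eq_of_ne hac.symm]
    · apply (fgHom V V).injective
      rw [map_sum]
      apply LinearMap.ext
      intro x
      rw [LinearMap.sum_apply]
      exact b.sum_repr x

theorem isZero_punit : IsZero (FGModuleCat.of.{u} k PUnit.{u + 1}) := by
  rw [IsZero.iff_id_eq_zero]
  apply FGModuleCat.hom_ext
  apply LinearMap.ext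
  intro x
  exact Subsingleton.elim (α := PUnit) _ _

/-- The inclusion of the `j`-th summand. -/
def incl (k : Type u) [Field k] {m : ℕ} (j : Fin m) :
    FGModuleCat.{u} k ⥤ (Fin m → FGModuleCat.{u} k) where
  obj V i := if i = j then V else FGModuleCat.of k PUnit
  map f i := if h : i = j then eqToHom (if_pos h) ≫ f ≫ eqToHom (if_pos h).symm else 0
  map_id V := by
    funext i
    by_cases h : i = j
    · simp [h]
    · rw [dif_neg h]
      have h0 : IsZero (if i = j then V else FGModuleCat.of k PUnit) := by
        rw [if_neg h]
        exact isZero_punit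
      exact h0.eq_of_src _ _
  map_comp f g := by
    funext i
    by_cases h : i = j
    · simp [h]
    · simp [h]

variable {m : ℕ}

theorem incl_isZero {i j : Fin m} (h : i ≠ j) (V : FGModuleCat.{u} k) :
    IsZero ((incl k j).obj V i) := by
  change IsZero (if i = j then V else FGModuleCat.of k PUnit)
  rw [if_neg h]
  exact isZero_punit

instance incl_additive (j : Fin m) : (incl k j).Additive where
  map_add {V W f g} := by
    funext i
    by_cases h : i = j
    · subst h
      change (incl k i).map (f + g) i = (incl k i).map f i + (incl k i).map g i
      simp [incl]
      rfl
    · exact (incl_isZero h V).eq_of_src _ _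

/-- The only nonzero component of the inclusion of the `j`-th summand. -/
def inclIso (j : Fin m) (V : FGModuleCat.{u} k) : (incl k j).obj V j ≅ V :=
  eqToIso (if_pos rfl)

theorem incl_hom_ext {j : Fin m} {V W : FGModuleCat.{u} k}
    {f g : (incl k j).obj V ⟶ (incl k j).obj W} (h : f j = g j) : f = g := by
  funext i
  by_cases hij : i = j
  · subst hij
    exact h
  · exact (incl_isZero hij V).eq_of_src _ _

theorem isDirectSum_incl (X : Fin m → FGModuleCat.{u} k) :
    IsDirectSum X fun j => (incl k j).obj (X j) := by
  have key : ∀ i j, ∃ (p : X i ⟶ (incl k j).obj (X j) i) (q : (incl k j).obj (X j) i ⟶ X i),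
      q ≫ p = 𝟙 _ ∧ p ≫ q = if i = j then 𝟙 _ else 0 := by
    intro i j
    by_cases h : i = j
    · subst h
      exact ⟨(inclIso i (X i)).inv, (inclIso i (X i)).hom, by simp, by simp⟩
    · exact ⟨0, 0, (incl_isZero h _).eq_of_src _ _, by simp [h]⟩
  choose p q h1 h2 using key
  refine ⟨fun j i => p i j, fun j i => q i j, fun j => funext fun i => h1 i j,
    fun j j' hjj => funext fun i => ?_, funext fun i => ?_⟩
  · by_cases h : i = j
    · subst h
      exact (incl_isZero hjj _).eq_of_tgt _ _
    · exact (incl_isZero h _).eq_of_src _ _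
  · have : (∑ j, (show X ⟶ X from fun i => p i j ≫ q i j)) i = ∑ j, p i j ≫ q i j :=
      Finset.sum_apply (M := fun i => X i ⟶ X i) i _ _
    refine this.trans ?_
    simp only [h2]
    simp

theorem isBasis_incl : IsBasis k fun j : Fin m => (incl k j).obj (line k) where
  scalar j f := by
    obtain ⟨c, hc⟩ := end_line ((inclIso j (line k)).inv ≫ f j ≫ (inclIso j (line k)).hom)
    refine ⟨c, incl_hom_ext ?_⟩
    have := congrArg (fun t => (inclIso j (line k)).hom ≫ t ≫ (inclIso j (line k)).inv) hc
    simp only [Category.assoc, Iso.hom_inv_id, Category.comp_id, Iso.hom_inv_id_assoc,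
      Linear.smul_comp, Linear.comp_smul, Category.id_comp] at this
    exact this
  id_ne_zero j h := by
    refine isBasis_line.id_ne_zero (k := k) () ?_
    have : 𝟙 ((incl k j).obj (line k) j) = 0 := congrFun h j
    calc 𝟙 (line k) = (inclIso j (line k)).inv ≫ 𝟙 _ ≫ (inclIso j (line k)).hom := by simp
      _ = 0 := by rw [this]; simp
  orthogonal j j' h f := by
    funext i
    by_cases hij : i = j
    · subst hij
      exact (incl_isZero h _).eq_of_tgt _ _
    · exact (incl_isZero hij _).eq_of_src _ _
  decomposition X := by
    choose J hJ q h using fun j => isBasis_line.decomposition (k := k) (X j)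
    refine ⟨Σ j, J j, inferInstance, fun p => p.1, ?_⟩
    exact (isDirectSum_incl X).sigma fun j => (h j).map_additive (incl k j)

theorem hasDirectSums_pi : HasDirectSums (Fin m → FGModuleCat.{u} k) := by
  intro P _ Y
  have : HasFiniteBiproducts (FGModuleCat.{u} k) := HasFiniteBiproducts.of_hasFiniteProducts
  choose X π ι h1 h2 h3 using fun i => HasDirectSums.of_hasFiniteBiproducts P fun a => Y a i
  refine ⟨X, fun a i => π i a, fun a i => ι i a, fun a => funext fun i => h1 i a,
    fun a b hab => funext fun i => h2 i a b hab, funext fun i => ?_⟩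
  exact (Finset.sum_apply (M := fun i => X i ⟶ X i) i _ _).trans (h3 i)

end VectorSpaces

/-! ### Polynomial functors on sheaves form a graded 2-vector space -/

section DirectSums

variable {k : Type u} [Field k] {A : Type v} [Category.{w'} A] [Preadditive A] [Linear k A]

theorem IsHomogeneousMap.sum {U W : Type*} [AddCommGroup U] [Module k U] [AddCommGroup W]
    [Module k W] {n : ℕ} {α : Type*} (s : Finset α) {f : α → U → W}
    (hf : ∀ a ∈ s, IsHomogeneousMap k n (f a)) :
    IsHomogeneousMap k n (fun x => ∑ a ∈ s, f a x) := by
  classical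
  induction s using Finset.induction_on with
  | empty => simpa using IsHomogeneousMap.zero n
  | insert a s ha ih =>
    simp only [Finset.sum_insert ha]
    exact (hf a (Finset.mem_insert_self a s)).add
      (ih fun b hb => hf b (Finset.mem_insert_of_mem hb))

/-- The action on a direct sum is a sum of linear functions of the actions on the summands, so
polynomiality and homogeneity pass to direct sums. -/
theorem IsDirectSum.map_eq_sum {F : A ⥤ FGModuleCat.{u} k} {P : Type} [Fintype P]
    {Y : P → (A ⥤ FGModuleCat.{u} k)} (h : IsDirectSum F Y) (V W : A) :
    ∃ L : ∀ a, ((Y a).obj V ⟶ (Y a).obj W) →ₗ[k] (F.obj V ⟶ F.obj W),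
      ∀ f : V ⟶ W, F.map f = ∑ a, L a ((Y a).map f) := by
  obtain ⟨π, ι, h1, h2, h3⟩ := h
  refine ⟨fun a => Linear.leftComp k _ ((π a).app V) ∘ₗ Linear.rightComp k _ ((ι a).app W),
    fun f => ?_⟩
  calc F.map f = F.map f ≫ (𝟙 F : F ⟶ F).app W := by simp
    _ = F.map f ≫ ∑ a, (π a).app W ≫ (ι a).app W := by
      rw [← h3, NatTrans.app_sum]
      rfl
    _ = ∑ a, F.map f ≫ (π a).app W ≫ (ι a).app W := by rw [Preadditive.comp_sum]
    _ = _ := Finset.sum_congr rfl fun a _ => (by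
      rw [← Category.assoc, (π a).naturality, Category.assoc]
      rfl)

theorem IsDirectSum.homogeneous {F : A ⥤ FGModuleCat.{u} k} {P : Type} [Fintype P]
    {Y : P → (A ⥤ FGModuleCat.{u} k)} (h : IsDirectSum F Y) {n : ℕ}
    (hY : ∀ a, IsHomogeneousFunctor k n (Y a)) : IsHomogeneousFunctor k n F := by
  intro V W
  obtain ⟨L, hL⟩ := h.map_eq_sum V W
  simp only [hL]
  exact IsHomogeneousMap.sum _ fun a _ => (hY a V W).linear_comp _

theorem IsDirectSum.polynomial {F : A ⥤ FGModuleCat.{u} k} {P : Type} [Fintype P]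
    {Y : P → (A ⥤ FGModuleCat.{u} k)} (h : IsDirectSum F Y)
    (hY : ∀ a, IsPolynomialFunctor k (Y a)) : IsPolynomialFunctor k F := by
  choose d hd using hY
  refine ⟨∑ a, d a, fun V W => ?_⟩
  obtain ⟨L, hL⟩ := h.map_eq_sum V W
  simp only [hL]
  exact IsPolynomialMap.sum _ fun a _ => ((hd a V W).mono
    (Finset.single_le_sum (f := d) (fun _ _ => Nat.zero_le _) (Finset.mem_univ a))).linear_comp _

/-- A direct sum in a full subcategory, from one in the ambient category. -/
theorem IsDirectSum.fullSubcategory {C : Type*} [Category C] [Preadditive C]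
    {Q : ObjectProperty C} {X : Q.FullSubcategory} {P : Type} [Fintype P]
    {Y : P → Q.FullSubcategory} (h : IsDirectSum X.obj fun a => (Y a).obj) : IsDirectSum X Y := by
  obtain ⟨π, ι, h1, h2, h3⟩ := h
  refine ⟨fun a => ObjectProperty.homMk (π a), fun a => ObjectProperty.homMk (ι a),
    fun a => ObjectProperty.hom_ext _ (h1 a), fun a b hab => ObjectProperty.hom_ext _ (h2 a b hab),
    ?_⟩
  apply ObjectProperty.hom_ext
  refine Eq.trans ?_ h3
  exact Q.ι.map_sum _ _

theorem hasDirectSums_functor : HasDirectSums (A ⥤ FGModuleCat.{u} k) := by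
  have : HasFiniteBiproducts (FGModuleCat.{u} k) := HasFiniteBiproducts.of_hasFiniteProducts
  have : HasFiniteBiproducts (A ⥤ FGModuleCat.{u} k) := HasFiniteBiproducts.of_hasFiniteProducts
  exact .of_hasFiniteBiproducts

theorem hasDirectSums_poly : HasDirectSums (Poly k A) := by
  intro P _ Y
  obtain ⟨F, hF⟩ := hasDirectSums_functor P fun a => (Y a).obj
  exact ⟨⟨F, hF.polynomial fun a => (Y a).property⟩, IsDirectSum.fullSubcategory hF⟩

theorem hasDirectSums_degree (n : ℕ) : HasDirectSums (polyDeg k A n).FullSubcategory := by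
  intro P _ Y
  obtain ⟨F, hF⟩ := hasDirectSums_poly P fun a => (Y a).obj
  exact ⟨⟨F, IsDirectSum.homogeneous (hF.map_additive (IsPolynomialFunctor k (A := A)).ι)
    fun a => (Y a).property⟩, IsDirectSum.fullSubcategory hF⟩

/-- The part of degree `n` of a homogeneous basis. -/
theorem IsBasis.degree [CharZero k] {B : Type} {E : B → Poly k A} (hE : IsBasis k E) {deg : B → ℕ}
    (hdeg : ∀ b, polyDeg k A (deg b) (E b)) (n : ℕ) :
    IsBasis k (fun b : {b // deg b = n} =>
      (⟨E b.1, by simpa only [b.2] using hdeg b.1⟩ : (polyDeg k A n).FullSubcategory)) where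
  scalar b f := by
    obtain ⟨c, hc⟩ := hE.scalar b.1 f.hom
    exact ⟨c, ObjectProperty.hom_ext _ hc⟩
  id_ne_zero b h := hE.id_ne_zero b.1 (congrArg (fun t => t.hom) h)
  orthogonal a b hab f := ObjectProperty.hom_ext _
    (hE.orthogonal a.1 b.1 (fun h => hab (Subtype.ext h)) f.hom)
  decomposition X := by
    obtain ⟨J, _, q, h⟩ := hE.decomposition X.obj
    -- A summand of another degree has no nonzero map to `X`, so its inclusion, and then its
    -- identity, would vanish.
    have hq : ∀ a, deg (q a) = n := by
      obtain ⟨π, ι, h1, h2, h3⟩ := h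
      intro a
      by_contra hne
      refine hE.id_ne_zero (q a) ?_
      rw [← h1 a, polyDeg_orthogonal hne (hdeg _) X.property (ι a), zero_comp]
    exact ⟨J, inferInstance, fun a => ⟨q a, hq a⟩, IsDirectSum.fullSubcategory h⟩

/-- A category of polynomial functors with a homogeneous basis that is finite in each degree is a
graded 2-vector space. -/
theorem IsBasis.isGradedTwoVect [CharZero k] {A : Type (u + 1)} [Category.{u} A] [Preadditive A]
    [Linear k A] {B : Type} {E : B → Poly k A}
    (hE : IsBasis k E) {deg : B → ℕ} (hdeg : ∀ b, polyDeg k A (deg b) (E b))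
    (hfin : ∀ n, Finite {b // deg b = n}) : IsGradedTwoVect k (Poly k A) (polyDeg k A) where
  closed_iso n := ⟨fun {X Y} e hX => IsHomogeneousFunctor.of_retract hX e.inv.hom e.hom.hom
    (congrArg (fun t => t.hom) e.inv_hom_id)⟩
  twoVect n := by
    have := hfin n
    refine ⟨Nat.card {b // deg b = n}, ?_⟩
    exact ((hE.degree hdeg n).reindex (Finite.equivFin _).symm).exists_equivalence
      (hasDirectSums_degree n) isBasis_incl hasDirectSums_pi
  orthogonal m n hmn X Y hX hY f := polyDeg_orthogonal hmn hX hY f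
  biproducts := hasDirectSums_poly.hasFiniteBiproducts
  decomposition F := by
    rw [isSumOfDegrees_iff]
    obtain ⟨d, Y, hY, h⟩ := exists_homogeneous_decomposition F
    exact ⟨Fin (d + 1), inferInstance, Y, hY, fun a => ⟨a, trivial, h a⟩⟩

end DirectSums

/-! ### Polynomial functors on sheaves form graded 2-vector spaces. -/

section Sheaves

variable {k : Type u} [Field k]

/-- Degrees are natural numbers, so each `deg (b s)` is at most `n`, and only finitely many labels
are available at each point. -/
theorem finite_sum_eq {B S : Type} [Finite S] {deg : B → ℕ} (hfin : ∀ n, Finite {b // deg b = n})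
    (n : ℕ) : Finite {b : S → B // ∑ᶠ s, deg (b s) = n} := by
  have := Fintype.ofFinite S
  have h : {b : B | deg b ≤ n}.Finite := by
    have : {b : B | deg b ≤ n} = ⋃ m : Fin (n + 1), {b | deg b = m} := by
      ext b
      simp only [Set.mem_ofPred_eq, Set.mem_iUnion]
      exact ⟨fun hb => ⟨⟨deg b, by omega⟩, rfl⟩, fun ⟨m, hm⟩ => by omega⟩
    rw [this]
    exact Set.finite_iUnion fun m => @Set.toFinite _ {b | deg b = m} (hfin m)
  have := h.to_subtype
  refine Finite.of_injective
    (fun b s => (⟨b.1 s, ?_⟩ : {b : B | deg b ≤ n}) : {b : S → B // ∑ᶠ s, deg (b s) = n} → _) ?_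
  · have h2 := b.2
    rw [finsum_eq_sum_of_fintype] at h2
    exact (Finset.single_le_sum (f := fun s => deg (b.1 s)) (fun _ _ => Nat.zero_le _)
      (Finset.mem_univ s)).trans h2.le
  · intro b b' h
    exact Subtype.ext (funext fun s => congrArg Subtype.val (congrFun h s))

theorem polyIsGradedTwoVect (k : Type u) [Field k] [CharZero k] : PolyIsGradedTwoVect k := by
  intro S
  obtain ⟨B, deg, E, hE, hdeg, hfin⟩ := exists_basis_vect k
  exact (isBasis_ext hE hdeg hfin S).isGradedTwoVect (deg := fun b => ∑ᶠ s, deg (b s))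
    (fun b => ext_homogeneous fun s => hdeg (b s)) (finite_sum_eq hfin)

end Sheaves

/-! ### Composition with multilinear functors taking bases to bases -/

section Substitution

variable {k : Type u} [Field k] {I J : Type} [Finite I] [Finite J] {fib : J → Type}
  (e : ∀ j, fib j → I)
  {B : I → GradedTwoVect k} {C : J → GradedTwoVect k} {D : GradedTwoVect k}
  (F : ∀ j, (∀ i : fib j, B (e j i)) ⥤ C j) {K : I → Type} {U : ∀ i, K i → B i}

/-- The blocks partition `I`, so a choice of a basis label for every block amounts to a choice of
labels for all variables. -/
theorem isMultiBasis_blocks (he : Function.Bijective fun p : Σ j, fib j => e p.1 p.2)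
    (hF : ∀ j, IsBasis k fun β : ∀ i : fib j, K (e j i) =>
      (F j).obj fun i => U (e j i) (β i)) :
    IsMultiBasis k fun (b : ∀ i, K i) j => (F j).obj fun i => U (e j i) (b (e j i)) :=
  (IsBasis.multi hF).reindex
    ((Equiv.piCongrLeft K (Equiv.ofBijective _ he)).symm.trans
      (Equiv.piCurry fun j (i : fib j) => K (e j i)))

/-- Whiskering with the functors `F j`. -/
def substNat {G G' : (∀ j, C j) ⥤ D} (η : G ⟶ G') : composeFunctor e F G ⟶ composeFunctor e F G' where
  app X := η.app fun j => (F j).obj fun i => X (e j i)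
  naturality _ _ f := η.naturality fun j => (F j).map fun i => f (e j i)

/-- On both sides a natural transformation is the same as an arbitrary family on members of a basis,
and the basis of `∏ C j` consists of the images under the `F j` of the basis of `∏ B i`. -/
theorem substNat_bijective (he : Function.Bijective fun p : Σ j, fib j => e p.1 p.2)
    (hU : ∀ i, IsBasis k (U i))
    (hFm : ∀ j, IsMultilinearFunctor k (F j))
    (hF : ∀ j, IsBasis k fun β : ∀ i : fib j, K (e j i) =>
      (F j).obj fun i => U (e j i) (β i)) {G G' : (∀ j, C j) ⥤ D}
    (hG : IsMultilinearFunctor k G) (hG' : IsMultilinearFunctor k G') :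
    Function.Bijective (substNat e F : (G ⟶ G') → _) := by
  have hE := isMultiBasis_blocks e F he hF
  constructor
  · intro η θ h
    refine hE.nat_ext hG fun b => ?_
    exact congrArg (fun t : composeFunctor e F G ⟶ composeFunctor e F G' =>
      t.app fun i => U i (b i)) h
  · intro θ
    obtain ⟨η, hη⟩ := hE.exists_nat hG hG' fun b => θ.app fun i => U i (b i)
    exact ⟨η, (IsBasis.multi hU).nat_ext (composeFunctor_multilinear e he hFm hG) hη⟩

/-- The functor `G` is prescribed on the images of basis members by the values of `H`, so its
composite with the `F j` agrees with `H` on a basis. The bound on degrees is inherited with the same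
set `S`. -/
theorem exists_subst_lift (he : Function.Bijective fun p : Σ j, fib j => e p.1 p.2)
    {A : AddSubmonoid ℤ} (hU : ∀ i, IsBasis k (U i))
    {deg : ∀ i, K i → ℕ} (hdeg : ∀ i b, (B i).deg (deg i b) (U i b))
    (hFm : ∀ j, IsMultilinearFunctor k (F j)) (hF0 : ∀ j, IsDegreeZero (F j))
    (hF : ∀ j, IsBasis k fun β : ∀ i : fib j, K (e j i) =>
      (F j).obj fun i => U (e j i) (β i)) {H : (∀ i, B i) ⥤ D}
    (hH : IsMultilinearFunctor k H) (hHb : IsBounded A H) :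
    ∃ G : (∀ j, C j) ⥤ D, IsMultilinearFunctor k G ∧ IsBounded A G ∧
      Nonempty (composeFunctor e F G ≅ H) := by
  have hE := isMultiBasis_blocks e F he hF
  have := D.isGradedTwoVect.biproducts
  obtain ⟨G, hG, hGE⟩ := hE.exists_functor (D := D) HasDirectSums.of_hasFiniteBiproducts
    fun b => H.obj fun i => U i (b i)
  have hiso : Nonempty (composeFunctor e F G ≅ H) :=
    (IsBasis.multi hU).nonempty_iso (composeFunctor_multilinear e he hFm hG) hH hGE
  refine ⟨G, hG, ?_, hiso⟩
  obtain ⟨S, hS, hHS⟩ := hHb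
  refine ⟨S, hS, fun Y n hY => ?_⟩
  obtain ⟨P, _, q, hq⟩ := hE.decomposition Y
  refine IsSumOfDegrees.trans (hG.isDirectSum hq) fun p => ?_
  obtain ⟨π, ι, h1, -⟩ := hq
  -- Homogeneous objects of different degrees are orthogonal, so the basis members occurring in `Y`
  -- have the degrees of `Y`. That the `F j` have degree zero identifies these with sums over the
  -- blocks.
  have hn : ∀ j, ∑ᶠ i : fib j, deg (e j i) (q p (e j i)) = n j := by
    intro j
    by_contra hne
    refine hE.id_ne_zero (q p) j ?_
    rw [← h1 p j, (C j).isGradedTwoVect.orthogonal _ _ hne _ _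
      (hF0 j _ _ fun i => hdeg (e j i) (q p (e j i))) (hY j) (ι p j), zero_comp]
  have hsum : ∑ᶠ i, deg i (q p i) = ∑ᶠ j, n j := by
    have := Fintype.ofFinite J
    have hfib : ∀ j, Finite (fib j) := fun j =>
      Finite.of_injective (fun i => e j i) fun a b hab => by
        simpa using @he.1 ⟨_, a⟩ ⟨_, b⟩ hab
    have := fun j => Fintype.ofFinite (fib j)
    rw [← finsum_comp_equiv (Equiv.ofBijective _ he), finsum_eq_sum_of_fintype,
      Fintype.sum_sigma, finsum_eq_sum_of_fintype]
    refine Finset.sum_congr rfl fun j _ => ?_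
    rw [← hn j, finsum_eq_sum_of_fintype]
    rfl
  have h := hHS (fun i => U i (q p i)) (fun i => deg i (q p i)) fun i => hdeg i _
  rw [hsum] at h
  obtain ⟨K', fK, Z, b, hb, ⟨ψ⟩, hd⟩ := h
  exact ⟨K', fK, Z, b, hb, ⟨(hGE (q p)).some ≪≫ ψ⟩, hd⟩

end Substitution

/-! ### CoCartesian 1-morphisms -/

section CoCartesian

variable {k : Type u} [Field k] {A : AddSubmonoid ℤ}

/-- The criterion for coCartesian 1-morphisms: degree zero, and combinations of basis members go to
a basis. Over each index `c` of the target, existence of lifts is `exists_subst_lift` and full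
faithfulness is `substNat_bijective`. -/
theorem TwoVectTensor.Cell1.isCoCartesian {X Y : TwoVectTensor k A} (F : Cell1 X Y) {K : X.I → Type}
    {U : ∀ i, K i → X.C i} (hU : ∀ i, IsBasis k (U i))
    {deg : ∀ i, K i → ℕ} (hdeg : ∀ i b, (X.C i).deg (deg i b) (U i b))
    (hF0 : ∀ j, IsDegreeZero (F.func j))
    (hF : ∀ j, IsBasis k fun β : ∀ i : {i // F.base i = some j}, K i.1 =>
      (F.func j).obj fun i => U i.1 (β i)) :
    IsCoCartesian (TwoVectTensor.proj k A) (show X ⟶ Y from F) where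
  exists_lift Z g G hG := by
    obtain ⟨b, func, hm, hb⟩ := G
    obtain rfl : b = fun i => (F.base i).bind g := hG
    choose G' hG'm hG'b hG'i using fun c => exists_subst_lift
      (B := fun i : {i // (F.base i).bind g = some c} => X.C i.1)
      (C := fun j : {j // g j = some c} => Y.C j.1)
      (fib := fun j : {j // g j = some c} => {i // F.base i = some j.1})
      (fun (j : {j // g j = some c}) (i : {i // F.base i = some j.1}) =>
        (⟨i.1, by rw [i.2]; exact j.2⟩ : {i // (F.base i).bind g = some c}))
      (fun j : {j // g j = some c} => F.func j.1) (fiber_bijective F.base g c) (A := A) (D := Z.C c)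
      (fun i => hU i.1) (fun i => hdeg i.1) (fun j => F.multilinear j.1) (fun j => hF0 j.1)
      (fun j => hF j.1) (hm c) (hb c)
    let Φ : Cell1 Y Z := ⟨g, G', hG'm, hG'b⟩
    refine ⟨Φ, rfl, ⟨?_⟩⟩
    let θ := fun c => (hG'i c).some
    let Ψ : Cell1 X Z := ⟨fun i => (F.base i).bind g, func, hm, hb⟩
    exact
      { hom := ({ base_eq := rfl, app := fun c => (θ c).hom } : Cell2 (F.comp Φ) Ψ)
        inv := ({ base_eq := rfl, app := fun c => (θ c).inv } : Cell2 Ψ (F.comp Φ))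
        hom_inv_id := Cell2.ext (funext fun c => (θ c).hom_inv_id)
        inv_hom_id := Cell2.ext (funext fun c => (θ c).inv_hom_id) }
  bijective Z G G' h := by
    obtain ⟨b, func, hm, hb⟩ := G
    obtain ⟨b', func', hm', hb'⟩ := G'
    obtain rfl : b = b' := h
    have key := fun c => substNat_bijective
      (B := fun i : {i // (F.base i).bind b = some c} => X.C i.1)
      (C := fun j : {j // b j = some c} => Y.C j.1)
      (fib := fun j : {j // b j = some c} => {i // F.base i = some j.1})
      (fun (j : {j // b j = some c}) (i : {i // F.base i = some j.1}) =>
        (⟨i.1, by rw [i.2]; exact j.2⟩ : {i // (F.base i).bind b = some c}))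
      (fun j : {j // b j = some c} => F.func j.1) (fiber_bijective F.base b c) (D := Z.C c)
      (fun i => hU i.1) (fun j => F.multilinear j.1) (fun j => hF j.1) (hm c) (hm' c)
    constructor
    · intro η θ hηθ
      refine Cell2.ext (funext fun c => (key c).1 ?_)
      exact congrArg (fun t : Cell2 (F.comp ⟨b, func, hm, hb⟩) (F.comp ⟨b, func', hm', hb'⟩) =>
        show (F.comp ⟨b, func, hm, hb⟩).func c ⟶ (F.comp ⟨b, func', hm', hb'⟩).func c from
          t.app c) hηθ
    · intro ζ
      choose η hη using fun c => (key c).2 (Cell2.app ζ c)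
      exact ⟨({ base_eq := rfl, app := η } :
        Cell2 (Cell1.mk b func hm hb) (Cell1.mk b func' hm' hb')), Cell2.ext (funext hη)⟩

/-- The blocks of a coCartesian morphism of families of finite sets are bijections. -/
theorem FinSetSqcup.bijective_of_isCoCartesian {X Y : LocallyDiscrete FinSetSqcup} (f : X ⟶ Y)
    (hf : IsCoCartesian FinSetSqcup.proj f) (j : Y.as.I) :
    Function.Bijective fun p : Σ i : {i // FinSetSqcup.Hom.base f.as i = some j}, X.as.S i.1 =>
      FinSetSqcup.Hom.fn f.as p.1.1 j p.1.2 p.2 := by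
  classical
  let Z : LocallyDiscrete FinSetSqcup := ⟨single (FintypeCat.of Bool)⟩
  constructor
  · rintro ⟨⟨i, hi⟩, s⟩ ⟨⟨i', hi'⟩, s'⟩ h
    -- The indicator function of the point `s` of the set with index `i`, on all of the family. It
    -- factors through `f`, so points with the same image in `Y.S j` have the same value.
    let G : Hom X.as Z.as :=
      { base := fun i => (Hom.base f.as i).bind fun _ => some PUnit.unit
        fn := fun a _ _ t => decide ((⟨a, t⟩ : Σ a, X.as.S a) = ⟨i, s⟩) }
    obtain ⟨G', hG', ⟨e⟩⟩ := hf.exists_lift Z (fun _ => some PUnit.unit) ⟨G⟩ rfl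
    have h1 : f.as ≫ G'.as = G := congrArg (·.as) (LocallyDiscrete.eq_of_hom e.hom)
    have h2 : ∀ (a : X.as.I) (ha : Hom.base f.as a = some j) (t : X.as.S a),
        Hom.fn G'.as j PUnit.unit (congrFun hG' j) (Hom.fn f.as a j ha t) =
          decide ((⟨a, t⟩ : Σ a, X.as.S a) = ⟨i, s⟩) := by
      intro a ha t
      have hb : Hom.base G a = some PUnit.unit := by
        change (Hom.base f.as a).bind _ = _
        rw [ha]
        rfl
      exact (Hom.comp_fn f.as G'.as ha (congrFun hG' j) (hom_base_eq h1 hb) t).symm.trans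
        (hom_fn_eq h1 hb t)
    have h3 := (h2 i hi s).symm.trans ((congrArg _ h).trans (h2 i' hi' s'))
    have h4 : (⟨i', s'⟩ : Σ a, X.as.S a) = ⟨i, s⟩ := 
      of_decide_eq_true (h3.symm.trans (decide_eq_true rfl))
    cases h4
    rfl
  · intro t₀
    by_contra hne
    push Not at hne
    -- If `t₀` is not in the image, its indicator function and the constant `false` agree after
    -- composition with `f`. Fullness lifts this equality to a 2-cell between them, that is, to
    -- their equality, which fails at `t₀`.
    let G : Bool → Hom Y.as Z.as := fun v =>
      { base := fun _ => some PUnit.unit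
        fn := fun a _ _ t => v && decide ((⟨a, t⟩ : Σ a, Y.as.S a) = ⟨j, t₀⟩) }
    have h1 : f.as ≫ (show Y.as ⟶ Z.as from G true) = f.as ≫ (show Y.as ⟶ Z.as from G false) := by
      refine Hom.ext' rfl fun i c hi hi' s => ?_
      obtain ⟨a, ha, -⟩ := Option.bind_eq_some_iff.mp hi
      refine (Hom.comp_fn f.as (G true) ha rfl _ s).trans
        (Eq.trans ?_ (Hom.comp_fn f.as (G false) ha rfl _ s).symm)
      change (true && decide ((⟨a, Hom.fn f.as i a ha s⟩ : Σ a, Y.as.S a) = ⟨j, t₀⟩)) =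
        (false && decide ((⟨a, Hom.fn f.as i a ha s⟩ : Σ a, Y.as.S a) = ⟨j, t₀⟩))
      simp only [Bool.true_and, Bool.false_and, decide_eq_false_iff_not]
      intro h
      cases h
      exact hne ⟨⟨i, ha⟩, s⟩ rfl
    obtain ⟨η, -⟩ := (hf.bijective Z ⟨G true⟩ ⟨G false⟩ rfl).2
      (eqToHom (congrArg Quiver.Hom.toLoc h1))
    have h2 : G true = G false := congrArg (·.as) (LocallyDiscrete.eq_of_hom η)
    have h3 := hom_fn_eq (X := Y.as) (Y := Z.as) h2 (i := j) (j := PUnit.unit) rfl t₀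
    change (true && decide ((⟨j, t₀⟩ : Σ a, Y.as.S a) = ⟨j, t₀⟩)) =
      (false && decide ((⟨j, t₀⟩ : Σ a, Y.as.S a) = ⟨j, t₀⟩)) at h3
    simp at h3

end CoCartesian

/-! ### The functors `m` of bijective families take bases to bases. -/

section Polynomial

variable {k : Type u} [Field k]

theorem nestTensor_naturality {ι κ : Type*} {fib : κ → Type*} (e : ∀ j, fib j → ι)
    (he : Function.Bijective fun p : Σ j, fib j => e p.1 p.2) {M N : ι → Type*}
    [∀ i, AddCommGroup (M i)] [∀ i, Module k (M i)] [∀ i, AddCommGroup (N i)] [∀ i, Module k (N i)]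
    (L : ∀ i, M i →ₗ[k] N i) :
    nestTensor e he N ∘ₗ PiTensorProduct.map L =
      (PiTensorProduct.map fun j => PiTensorProduct.map fun i => L (e j i)) ∘ₗ
        nestTensor e he M := by
  apply PiTensorProduct.ext
  ext x
  simp only [LinearMap.compMultilinearMap_apply, LinearMap.comp_apply, PiTensorProduct.map_tprod,
    nestTensor_tprod]

/-- If the sets `S i` partition `T`, regrouping an external tensor product over `T` by blocks gives
the tensor product of external tensor products over the `S i`. So this is the basis of `isBasis_ext`
for `T`, relabelled. -/
theorem isBasis_mTensor [Infinite k] {B : Type} {E : B → Poly k (FGModuleCat.{u} k)}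
    (hE : IsBasis k E) {deg : B → ℕ} (hdeg : ∀ b, polyDeg k _ (deg b) (E b))
    (hfin : ∀ n, Finite {b // deg b = n}) {ι : Type} [Finite ι] {S : ι → Type} [∀ i, Finite (S i)]
    {T : Type} [Finite T] (φ : ∀ i, S i → T)
    (hφ : Function.Bijective fun p : Σ i, S i => φ p.1 p.2) :
    IsBasis k fun β : ∀ i, S i → B => (mTensor φ).obj fun i => ext fun s => E (β i s) := by
  let σ : (T → B) ≃ ∀ i, S i → B :=
    (Equiv.arrowCongr (Equiv.ofBijective _ hφ) (Equiv.refl B)).symm.trans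
      (Equiv.piCurry fun _ _ => B)
  have h : IsBasis k fun b : T → B => (mTensor φ).obj fun i => ext fun s => E (σ b i s) := by
    refine (isBasis_ext hE hdeg hfin T).congr fun b => polyIso
      (fun V => LinearEquiv.ofBijective _ (nestTensor_bijective φ hφ fun t => (E (b t)).obj.obj (V t)))
      fun f x => ?_
    exact LinearMap.congr_fun (nestTensor_naturality φ hφ fun t => ((E (b t)).obj.map (f t)).hom.hom) x
  have h' := h.reindex σ.symm
  simp only [Equiv.apply_symm_apply] at h'
  exact h'

end Polynomial

section Structure

variable {k : Type u} [Field k] {A : AddSubmonoid ℤ} {hk : PolyIsGradedTwoVect k}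

theorem polyH_degreeZero {X Y : LocallyDiscrete FinSetSqcup} (f : X ⟶ Y)
    (j : ((polyH A hk).obj Y).I) :
    IsDegreeZero (TwoVectTensor.Cell1.func ((polyH A hk).map f) j) :=
  mTensor_degreeZero hk (S := fun i : {i // FinSetSqcup.Hom.base f.as i = some j} => X.as.S i.1)
    (T := Y.as.S j) _

theorem polyH_isCoCartesian [CharZero k] {X Y : LocallyDiscrete FinSetSqcup} (f : X ⟶ Y)
    (hf : IsCoCartesian FinSetSqcup.proj f) :
    IsCoCartesian (TwoVectTensor.proj k A) ((polyH A hk).map f) := by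
  obtain ⟨B, deg, E, hE, hdeg, hfin⟩ := exists_basis_vect k
  refine TwoVectTensor.Cell1.isCoCartesian (polyMap A hk f.as) (K := fun i => X.as.S i → B)
    (U := fun i b => ext fun s => E (b s)) (fun i => isBasis_ext hE hdeg hfin _)
    (deg := fun i b => ∑ᶠ s, deg (b s))
    (fun i b => ext_homogeneous fun s => hdeg (b s)) (polyH_degreeZero f) fun j => ?_
  exact isBasis_mTensor hE hdeg hfin
    (fun (i : {i // FinSetSqcup.Hom.base f.as i = some j}) => FinSetSqcup.Hom.fn f.as i.1 j i.2)
    (FinSetSqcup.bijective_of_isCoCartesian f hf j)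

theorem polyH_base :
    (polyH A hk).toPrefunctor ⋙q TwoVectTensor.proj k A = FinSetSqcup.proj :=
  rfl

end Structure

/-! ### The category of polynomial functors on the one-point set -/

section Point

variable (k : Type u) [Field k]

instance fromP_isEquivalence : (fromP k).IsEquivalence :=
  precomp_isEquivalence (stalk k)

variable {k}

theorem polyDeg_fromP (n : ℕ) (F : Poly k (FGModuleCat.{u} k)) :
    polyDeg k (FGModuleCat.{u} k) n F ↔ polyDeg k (Sh k PUnit) n ((fromP k).obj F) := by
  refine ⟨fun h => IsHomogeneousFunctor.precomp h inferInstance inferInstance, fun h V W => ?_⟩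
  exact (h (fun _ => V) (fun _ => W)).comp_linear
    ({ toFun := fun f _ => f, map_add' := fun _ _ => rfl, map_smul' := fun _ _ => rfl } :
      (V ⟶ W) →ₗ[k] ((fun _ => V : Sh k PUnit) ⟶ fun _ => W))

end Point

/-! ### Invariance of the Beck–Chevalley condition under isomorphisms of 1-morphisms -/

section Transport

open Bicategory

variable {B : Type*} [Bicategory B] {a b c d : B}

/-- Replacement of a left adjoint by an isomorphic 1-morphism. -/
def adjOfIsoLeft {l l' : a ⟶ b} {r : b ⟶ a} (θ : l ≅ l') (adj : l' ⊣ r) : l ⊣ r where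
  unit := adj.unit ≫ θ.inv ▷ r
  counit := r ◁ θ.hom ≫ adj.counit
  left_triangle := by
    have h := adj.left_triangle
    calc leftZigzag (adj.unit ≫ θ.inv ▷ r) (r ◁ θ.hom ≫ adj.counit)
        = 𝟙 _ ⊗≫ adj.unit ▷ l ⊗≫ (θ.inv ▷ (r ≫ l) ≫ l ◁ (r ◁ θ.hom ≫ adj.counit)) ⊗≫ 𝟙 _ := by
          bicategory
      _ = 𝟙 _ ⊗≫ (adj.unit ▷ l ≫ (l' ≫ r) ◁ θ.hom) ⊗≫ l' ◁ adj.counit ⊗≫ θ.inv ⊗≫ 𝟙 _ := by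
          rw [← whisker_exchange]
          bicategory
      _ = 𝟙 _ ⊗≫ θ.hom ⊗≫ leftZigzag adj.unit adj.counit ⊗≫ θ.inv ⊗≫ 𝟙 _ := by
          rw [← whisker_exchange]
          bicategory
      _ = 𝟙 _ ⊗≫ (θ.hom ≫ θ.inv) ⊗≫ 𝟙 _ := by
          rw [h]
          bicategory
      _ = _ := by
          rw [Iso.hom_inv_id]
          bicategory
  right_triangle := by
    have h := adj.right_triangle
    calc rightZigzag (adj.unit ≫ θ.inv ▷ r) (r ◁ θ.hom ≫ adj.counit)
        = 𝟙 _ ⊗≫ r ◁ adj.unit ⊗≫ r ◁ (θ.inv ≫ θ.hom) ▷ r ⊗≫ adj.counit ▷ r ⊗≫ 𝟙 _ := by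
          bicategory
      _ = rightZigzag adj.unit adj.counit := by
          rw [Iso.inv_hom_id]
          bicategory
      _ = _ := h

/-- Replacement of a right adjoint by an isomorphic 1-morphism. -/
def adjOfIsoRight {l : a ⟶ b} {r r' : b ⟶ a} (θ : r ≅ r') (adj : l ⊣ r') : l ⊣ r where
  unit := adj.unit ≫ l ◁ θ.inv
  counit := θ.hom ▷ l ≫ adj.counit
  left_triangle := by
    have h := adj.left_triangle
    calc leftZigzag (adj.unit ≫ l ◁ θ.inv) (θ.hom ▷ l ≫ adj.counit)
        = 𝟙 _ ⊗≫ adj.unit ▷ l ⊗≫ l ◁ (θ.inv ≫ θ.hom) ▷ l ⊗≫ l ◁ adj.counit ⊗≫ 𝟙 _ := by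
          bicategory
      _ = leftZigzag adj.unit adj.counit := by
          rw [Iso.inv_hom_id]
          bicategory
      _ = _ := h
  right_triangle := by
    have h := adj.right_triangle
    calc rightZigzag (adj.unit ≫ l ◁ θ.inv) (θ.hom ▷ l ≫ adj.counit)
        = 𝟙 _ ⊗≫ r ◁ adj.unit ⊗≫ ((r ≫ l) ◁ θ.inv ≫ (θ.hom ▷ l ≫ adj.counit) ▷ r) ⊗≫ 𝟙 _ := by
          bicategory
      _ = 𝟙 _ ⊗≫ (r ◁ adj.unit ≫ θ.hom ▷ (l ≫ r')) ⊗≫ adj.counit ▷ r' ⊗≫ θ.inv ⊗≫ 𝟙 _ := by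
          rw [whisker_exchange]
          bicategory
      _ = 𝟙 _ ⊗≫ θ.hom ⊗≫ rightZigzag adj.unit adj.counit ⊗≫ θ.inv ⊗≫ 𝟙 _ := by
          rw [whisker_exchange]
          bicategory
      _ = 𝟙 _ ⊗≫ (θ.hom ≫ θ.inv) ⊗≫ 𝟙 _ := by
          rw [h]
          bicategory
      _ = _ := by
          rw [Iso.hom_inv_id]
          bicategory

variable {g g' : a ⟶ b} {f f' : a ⟶ c} {h h' : b ⟶ d} {i i' : c ⟶ d}
  (θg : g ≅ g') (θf : f ≅ f') (θh : h ≅ h') (θi : i ≅ i')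
  {α : g ≫ h ⟶ f ≫ i} {α' : g' ≫ h' ⟶ f' ≫ i'}

/-- The hypothesis `w` says that `α` and `α'` correspond under the given isomorphisms. With the
adjunctions transported along `θf` and `θh`, the mates correspond too, by the interchange law. The
next lemma is the dual for left adjoints. -/
theorem mateEquiv_of_iso_left {fR : c ⟶ a} {hR : d ⟶ b} (adjf : f' ⊣ fR) (adjh : h' ⊣ hR)
    (w : α ≫ f ◁ θi.hom ≫ θf.hom ▷ i' = g ◁ θh.hom ≫ θg.hom ▷ h' ≫ α') :
    mateEquiv (adjOfIsoLeft θf adjf) (adjOfIsoLeft θh adjh) α ≫ θi.hom ▷ hR =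
      fR ◁ θg.hom ≫ mateEquiv adjf adjh α' := by
  have w' : g ◁ θh.inv ≫ α ≫ f ◁ θi.hom ≫ θf.hom ▷ i' = θg.hom ▷ h' ≫ α' := by
    rw [w, ← Category.assoc, ← Bicategory.whiskerLeft_comp]
    simp
  rw [mateEquiv_apply', mateEquiv_apply']
  simp only [adjOfIsoLeft]
  calc _ = 𝟙 _ ⊗≫ fR ◁ g ◁ adjh.unit ⊗≫ fR ◁ (g ◁ θh.inv ≫ α ≫ θf.hom ▷ i) ▷ hR ⊗≫
        (adjf.counit ▷ i ≫ 𝟙 c ◁ θi.hom) ▷ hR ⊗≫ 𝟙 _ := by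
        bicategory
    _ = 𝟙 _ ⊗≫ fR ◁ g ◁ adjh.unit ⊗≫ fR ◁ (g ◁ θh.inv ≫ α ≫ f ◁ θi.hom ≫ θf.hom ▷ i') ▷ hR ⊗≫
        adjf.counit ▷ i' ▷ hR ⊗≫ 𝟙 _ := by
        rw [← whisker_exchange, whisker_exchange θf.hom θi.hom]
        bicategory
    _ = 𝟙 _ ⊗≫ fR ◁ (g ◁ adjh.unit ≫ θg.hom ▷ (h' ≫ hR)) ⊗≫ fR ◁ α' ▷ hR ⊗≫
        adjf.counit ▷ i' ▷ hR ⊗≫ 𝟙 _ := by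
        rw [w']
        bicategory
    _ = _ := by
        rw [whisker_exchange]
        bicategory

theorem mateEquiv_of_iso_right {gL : b ⟶ a} {iL : d ⟶ c} (adjg : gL ⊣ g') (adji : iL ⊣ i')
    (w : α ≫ f ◁ θi.hom ≫ θf.hom ▷ i' = g ◁ θh.hom ≫ θg.hom ▷ h' ≫ α') :
    (mateEquiv (adjOfIsoRight θg adjg) (adjOfIsoRight θi adji)).symm α ≫ gL ◁ θf.hom =
      θh.hom ▷ iL ≫ (mateEquiv adjg adji).symm α' := by
  have w' : θg.inv ▷ h ≫ α ≫ f ◁ θi.hom ≫ θf.hom ▷ i' = g' ◁ θh.hom ≫ α' := by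
    rw [w, ← Category.assoc, ← Category.assoc, Category.assoc (θg.inv ▷ h), whisker_exchange]
    simp
  rw [mateEquiv_symm_apply', mateEquiv_symm_apply']
  simp only [adjOfIsoRight]
  calc _ = 𝟙 _ ⊗≫ adjg.unit ▷ h ▷ iL ⊗≫ gL ◁ (θg.inv ▷ h ≫ α ≫ f ◁ θi.hom) ▷ iL ⊗≫
        gL ◁ (f ◁ adji.counit ≫ θf.hom ▷ 𝟙 c) ⊗≫ 𝟙 _ := by
        bicategory
    _ = 𝟙 _ ⊗≫ adjg.unit ▷ h ▷ iL ⊗≫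
        gL ◁ (θg.inv ▷ h ≫ α ≫ f ◁ θi.hom ≫ θf.hom ▷ i') ▷ iL ⊗≫
        gL ◁ f' ◁ adji.counit ⊗≫ 𝟙 _ := by
        rw [whisker_exchange]
        bicategory
    _ = 𝟙 _ ⊗≫ (adjg.unit ▷ (h ≫ iL) ≫ (gL ≫ g') ◁ (θh.hom ▷ iL)) ⊗≫ gL ◁ α' ▷ iL ⊗≫
        gL ◁ f' ◁ adji.counit ⊗≫ 𝟙 _ := by
        rw [w']
        bicategory
    _ = _ := by
        rw [← whisker_exchange]
        bicategory

theorem RightBeckChevalley.of_iso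
    (w : α ≫ f ◁ θi.hom ≫ θf.hom ▷ i' = g ◁ θh.hom ≫ θg.hom ▷ h' ≫ α')
    (hα : RightBeckChevalley α') : RightBeckChevalley α := by
  obtain ⟨fR, hR, adjf, adjh, hm⟩ := hα
  refine ⟨fR, hR, adjOfIsoLeft θf adjf, adjOfIsoLeft θh adjh, ?_⟩
  have := mateEquiv_of_iso_left θg θf θh θi adjf adjh w
  have h2 : IsIso (mateEquiv (adjOfIsoLeft θf adjf) (adjOfIsoLeft θh adjh) α ≫ θi.hom ▷ hR) := by
    rw [this]
    infer_instance
  exact IsIso.of_isIso_comp_right _ (θi.hom ▷ hR)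

theorem LeftBeckChevalley.of_iso
    (w : α ≫ f ◁ θi.hom ≫ θf.hom ▷ i' = g ◁ θh.hom ≫ θg.hom ▷ h' ≫ α')
    (hα : LeftBeckChevalley α') : LeftBeckChevalley α := by
  obtain ⟨gL, iL, adjg, adji, hm⟩ := hα
  refine ⟨gL, iL, adjOfIsoRight θg adjg, adjOfIsoRight θi adji, ?_⟩
  have := mateEquiv_of_iso_right θg θf θh θi adjg adji w
  have h2 : IsIso ((mateEquiv (adjOfIsoRight θg adjg) (adjOfIsoRight θi adji)).symm α ≫
      gL ◁ θf.hom) := by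
    rw [this]
    infer_instance
  exact IsIso.of_isIso_comp_right _ (gL ◁ θf.hom)

end Transport

/-! ### The two adjunctions between inverse and direct images -/

section Sheaves

variable {k : Type u} [Field k] {S T : Type}

/-- The identification of the stalks of `V` at equal points. -/
def castLin (V : Sh k T) {t t' : T} (h : t = t') : V t →ₗ[k] V t' :=
  (eqToHom (congrArg V h)).hom.hom

theorem castLin_naturality {V W : Sh k T} (f : V ⟶ W) {t t' : T} (h : t = t') (x : V t) :
    (f t').hom.hom (castLin V h x) = castLin W h ((f t).hom.hom x) := by
  subst h
  rfl

theorem sh_hom_ext {V W : Sh k T} {f g : V ⟶ W} (h : ∀ t x, (f t).hom.hom x = (g t).hom.hom x) :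
    f = g := by
  funext t
  apply FGModuleCat.hom_ext
  exact LinearMap.ext (h t)

variable [Finite S] (φ : S → T)

def pullPushUnit (V : Sh k T) : V ⟶ (shPush k φ).obj ((shPull k φ).obj V) :=
  fun t => FGModuleCat.ofHom (LinearMap.pi fun s : {s // φ s = t} => castLin V s.2.symm)

def pullPushCounit (W : Sh k S) : (shPull k φ).obj ((shPush k φ).obj W) ⟶ W :=
  fun s => FGModuleCat.ofHom (LinearMap.proj (⟨s, rfl⟩ : {s' // φ s' = φ s}))

/-- The inverse image functor is left adjoint to the direct image functor. -/
def pullPush : shPull k φ ⊣ shPush k φ where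
  unit :=
    { app := pullPushUnit φ
      naturality := fun V W f => sh_hom_ext fun t x => funext fun s =>
        (castLin_naturality f s.2.symm x).symm }
  counit :=
    { app := pullPushCounit φ
      naturality := fun V W f => rfl }
  left_triangle_components V := sh_hom_ext fun s x => rfl
  right_triangle_components W := sh_hom_ext fun t x => funext fun s => by
    obtain ⟨s, rfl⟩ := s
    rfl

section

open Classical

/-- Fibres are finite, so the product over a fibre is also the direct sum: the unit is the inclusion
of one summand, and the counit adds up the components. -/
def pushPullUnit (W : Sh k S) : W ⟶ (shPull k φ).obj ((shPush k φ).obj W) :=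
  fun s => FGModuleCat.ofHom (LinearMap.single k (fun s' : {s' // φ s' = φ s} => W s'.1) ⟨s, rfl⟩)

/-- The sum of the components of an element of a stalk of `φ_* φ^* V`. -/
def sumLin (V : Sh k T) (t : T) : (∀ s : {s // φ s = t}, V (φ s.1)) →ₗ[k] V t :=
  haveI := Fintype.ofFinite S
  ∑ s : {s // φ s = t}, castLin V s.2 ∘ₗ LinearMap.proj s

theorem sumLin_apply [Fintype S] (V : Sh k T) (t : T) (x : ∀ s : {s // φ s = t}, V (φ s.1)) :
    sumLin φ V t x = ∑ s : {s // φ s = t}, castLin V s.2 (x s) := by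
  rw [sumLin, LinearMap.sum_apply]
  exact Finset.sum_congr (by ext; simp) fun _ _ => rfl

def pushPullCounit (V : Sh k T) : (shPush k φ).obj ((shPull k φ).obj V) ⟶ V :=
  fun t => FGModuleCat.ofHom (sumLin φ V t)

theorem castLin_single (W : Sh k S) {s : S} {t : T} (h : φ s = t) (y : W s) :
    castLin ((shPush k φ).obj W) h
        (Pi.single (M := fun s' : {s' // φ s' = φ s} => W s'.1) ⟨s, rfl⟩ y) =
      Pi.single (M := fun s' : {s' // φ s' = t} => W s'.1) ⟨s, h⟩ y := by
  subst h
  rfl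

/-- The direct image functor is left adjoint to the inverse image functor. -/
def pushPull : shPush k φ ⊣ shPull k φ where
  unit :=
    { app := pushPullUnit φ
      naturality := fun V W f => sh_hom_ext fun s x => funext fun s' => by
        by_cases h : s' = ⟨s, rfl⟩
        · subst h
          refine (Pi.single_eq_same _ _).trans (congrArg (f s).hom.hom ?_)
          exact (Pi.single_eq_same (M := fun s' : {s' // φ s' = φ s} => V s'.1) (⟨s, rfl⟩ : {s' // φ s' = φ s}) x).symm
        · refine (Pi.single_eq_of_ne h _).trans ?_
          refine Eq.trans ?_ (congrArg (f s').hom.hom (Pi.single_eq_of_ne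
            (M := fun s' : {s' // φ s' = φ s} => V s'.1) h x).symm)
          exact (map_zero _).symm }
  counit :=
    { app := pushPullCounit φ
      naturality := fun V W f => sh_hom_ext fun t x => by
        have := Fintype.ofFinite S
        refine (sumLin_apply φ W t _).trans ?_
        refine Eq.trans ?_ (congrArg (f t).hom.hom (sumLin_apply φ V t x)).symm
        refine Eq.trans ?_ (map_sum _ _ _).symm
        exact Finset.sum_congr rfl fun s _ => (castLin_naturality f s.2 (x s)).symm }
  left_triangle_components W := sh_hom_ext fun t x => by
    have := Fintype.ofFinite S
    refine (sumLin_apply φ ((shPush k φ).obj W) t _).trans ?_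
    refine Eq.trans (Finset.sum_congr rfl fun s _ => castLin_single φ W s.2 (x s)) ?_
    exact Finset.univ_sum_single x
  right_triangle_components V := sh_hom_ext fun s x => by
    have := Fintype.ofFinite S
    refine (sumLin_apply φ V (φ s) _).trans ?_
    refine (Finset.sum_eq_single (⟨s, rfl⟩ : {s' // φ s' = φ s}) (fun s' _ h => ?_) (by simp)).trans ?_
    · refine (congrArg (castLin V s'.2) (Pi.single_eq_of_ne
        (M := fun s' : {s' // φ s' = φ s} => V (φ s'.1)) h x)).trans (map_zero _)
    · exact Pi.single_eq_same (M := fun s' : {s' // φ s' = φ s} => V (φ s'.1)) (⟨s, rfl⟩ : {s' // φ s' = φ s}) x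

end

end Sheaves

/-! ### Adjunctions between precomposition functors -/

section Precomposition

variable {k : Type u} [Field k]

variable {A : AddSubmonoid ℤ} {hk : PolyIsGradedTwoVect k} {S T : FintypeCat.{0}}
  {L : Sh k T ⥤ Sh k S} [L.Additive] [L.Linear k] {R : Sh k S ⥤ Sh k T} [R.Additive] [R.Linear k]

theorem map_map_eq {C : Type*} [Category C] (F : C ⥤ FGModuleCat.{u} k) {U V W : C} {f : U ⟶ V}
    {g : V ⟶ W} {h : U ⟶ W} (w : f ≫ g = h) (x : F.obj U) :
    (F.map g).hom.hom ((F.map f).hom.hom x) = (F.map h).hom.hom x := by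
  rw [← w, F.map_comp]
  rfl

theorem map_map_id {C : Type*} [Category C] (F : C ⥤ FGModuleCat.{u} k) {U V : C} {f : U ⟶ V}
    {g : V ⟶ U} (w : f ≫ g = 𝟙 U) (x : F.obj U) :
    (F.map g).hom.hom ((F.map f).hom.hom x) = x := by
  rw [map_map_eq F w, F.map_id]
  rfl

def unitNat (adj : L ⊣ R) (F : Poly k (Sh k T)) : F ⟶ (precomp L).obj ((precomp R).obj F) :=
  ObjectProperty.homMk (Functor.whiskerRight adj.unit F.obj)

def counitNat (adj : L ⊣ R) (F : Poly k (Sh k S)) : (precomp R).obj ((precomp L).obj F) ⟶ F :=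
  ObjectProperty.homMk (Functor.whiskerRight adj.counit F.obj)

def precompUnit (adj : L ⊣ R) : 𝟙 (polyObj A hk (FinSetSqcup.single T)) ⟶
    precompCell A hk R ≫ precompCell A hk L :=
  ({  base_eq := rfl
      app := fun j =>
        { app := fun F => unitNat adj (F ⟨j, rfl⟩ : Poly k (Sh k T))
          naturality := fun F G τ => by
            apply ObjectProperty.hom_ext
            ext V : 2
            exact ((τ ⟨j, rfl⟩ : (F ⟨j, rfl⟩ : Poly k (Sh k T)) ⟶ G ⟨j, rfl⟩).hom.naturality (adj.unit.app V)).symm } } :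
    TwoVectTensor.Cell2 (TwoVectTensor.Cell1.id (polyObj A hk (FinSetSqcup.single T)))
      ((precompCell A hk R : TwoVectTensor.Cell1 _ _).comp (precompCell A hk L)))

def precompCounit (adj : L ⊣ R) : precompCell A hk L ≫ precompCell A hk R ⟶
    𝟙 (polyObj A hk (FinSetSqcup.single S)) :=
  ({  base_eq := rfl
      app := fun j =>
        { app := fun F => counitNat adj (F ⟨j, rfl⟩ : Poly k (Sh k S))
          naturality := fun F G τ => by
            apply ObjectProperty.hom_ext
            ext V : 2
            exact ((τ ⟨j, rfl⟩ : (F ⟨j, rfl⟩ : Poly k (Sh k S)) ⟶ G ⟨j, rfl⟩).hom.naturality (adj.counit.app V)).symm } } :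
    TwoVectTensor.Cell2 ((precompCell A hk L : TwoVectTensor.Cell1 _ _).comp (precompCell A hk R))
      (TwoVectTensor.Cell1.id (polyObj A hk (FinSetSqcup.single S))))

open Bicategory in
/-- Precomposition turns an adjunction `L ⊣ R` into an adjunction `R^* ⊣ L^*`. -/
def precompAdj (adj : L ⊣ R) :
    Bicategory.Adjunction (precompCell A hk R) (precompCell A hk L) where
  unit := precompUnit adj
  counit := precompCounit adj
  left_triangle := by
    dsimp only [leftZigzag, bicategoricalComp]
    refine cellLin_ext (X := polyObj A hk (FinSetSqcup.single T)) fun j P V => LinearMap.ext fun x => ?_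
    -- Precomposition is contravariant in the functor, so the two triangle identities of `adj`
    -- change places.
    exact map_map_id (P ⟨j, rfl⟩ : Poly k (Sh k T)).obj (adj.right_triangle_components V) x
  right_triangle := by
    refine cellLin_ext (X := polyObj A hk (FinSetSqcup.single S)) fun j P V => LinearMap.ext fun x => ?_
    exact map_map_id (P ⟨j, rfl⟩ : Poly k (Sh k S)).obj (adj.left_triangle_components V) x

end Precomposition

/-! ### Base change for sheaves on finite sets -/

section BaseChange

variable {k : Type u} [Field k] {S T R U : Type} [Finite S] [Finite T] [Finite R]
  {a : S → T} {c : S → R} {b : T → U} {d : R → U} (w : ∀ s, b (a s) = d (c s))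

theorem sh_isIso {V W : Sh k S} (f : V ⟶ W) (h : ∀ s, Function.Bijective (f s).hom.hom) :
    IsIso f := by
  have h1 : ∀ s, IsIso (f s) := fun s => by
    let e := (LinearEquiv.ofBijective (f s).hom.hom (h s)).toFGModuleCatIso
    exact inferInstanceAs (IsIso e.hom)
  exact ⟨⟨fun s => inv (f s), funext fun s => IsIso.hom_inv_id (f s),
    funext fun s => IsIso.inv_hom_id (f s)⟩⟩

theorem map_bijective_of_isIso {C : Type*} [Category C] (F : C ⥤ FGModuleCat.{u} k) {V W : C}
    (f : V ⟶ W) [IsIso f] : Function.Bijective (F.map f).hom.hom := by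
  constructor
  · exact Function.LeftInverse.injective (g := (F.map (inv f)).hom.hom) fun x =>
      map_map_id F (IsIso.hom_inv_id f) x
  · exact Function.RightInverse.surjective (g := (F.map (inv f)).hom.hom) fun x =>
      map_map_id F (IsIso.inv_hom_id f) x

/-- The comparison map `c_* a^* ⟶ d^* b_*`. -/
def baseChangeRight (V : Sh k T) :
    (shPush k c).obj ((shPull k a).obj V) ⟶ (shPull k d).obj ((shPush k b).obj V) :=
  (shPush k c).map ((shPull k a).map (pushPullUnit b V)) ≫
    (shPush k c).map (pullCongr w ((shPush k b).obj V)) ≫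
      pushPullCounit c ((shPull k d).obj ((shPush k b).obj V))

/-- The comparison map `b^* d_* ⟶ a_* c^*`. -/
def baseChangeLeft (V : Sh k R) :
    (shPull k b).obj ((shPush k d).obj V) ⟶ (shPush k a).obj ((shPull k c).obj V) :=
  pullPushUnit a ((shPull k b).obj ((shPush k d).obj V)) ≫
    (shPush k a).map (pullCongr w ((shPush k d).obj V)) ≫
      (shPush k a).map ((shPull k c).map (pullPushCounit d V))

theorem castLin_shPush (V : Sh k R) {u u' : U} (h : u = u') (x : ((shPush k d).obj V) u)
    (r : {r // d r = u'}) :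
    (show ∀ r : {r // d r = u'}, V r.1 from castLin ((shPush k d).obj V) h x) r =
      (show ∀ r : {r // d r = u}, V r.1 from x) ⟨r.1, r.2.trans h.symm⟩ := by
  subst h
  rfl

/-- The map restricts a function on the fibre of `d` over `b t` along `c`, from the fibre of `a`
over `t`. For a fibre product `c` is a bijection between these fibres. -/
theorem baseChangeLeft_apply (V : Sh k R) (t : T) (x : ∀ r : {r // d r = b t}, V r.1)
    (s : {s // a s = t}) :
    (show ∀ s : {s // a s = t}, V (c s.1) from (baseChangeLeft w V t).hom.hom x) s =
      x ⟨c s.1, (w s.1).symm.trans (congrArg b s.2)⟩ := by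
  obtain ⟨s, rfl⟩ := s
  exact castLin_shPush V (w s) x ⟨c s, rfl⟩

open Classical in
-- The map pushes a function on the fibre of `c` over `r` forward along `a`, to the fibre of `b`
-- over `d r`; again this is a bijection of fibres for a fibre product.
theorem baseChangeRight_apply [Fintype S] (V : Sh k T) (r : R) (x : ∀ s : {s // c s = r}, V (a s.1)) :
    (baseChangeRight w V r).hom.hom x = ∑ s : {s // c s = r},
      Pi.single (M := fun t : {t // b t = d r} => V t.1)
        ⟨a s.1, (w s.1).trans (congrArg d s.2)⟩ (x s) := by
  refine (sumLin_apply c ((shPull k d).obj ((shPush k b).obj V)) r _).trans ?_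
  refine Finset.sum_congr rfl fun s _ => ?_
  obtain ⟨s, rfl⟩ := s
  exact castLin_single b V (w s) (x ⟨s, rfl⟩)

theorem baseChangeLeft_isIso (hinj : ∀ s s', a s = a s' → c s = c s' → s = s')
    (hsurj : ∀ t r, b t = d r → ∃ s, a s = t ∧ c s = r)
    (V : Sh k R) : IsIso (baseChangeLeft w V) := by
  refine sh_isIso _ fun t => ⟨fun x y hxy => ?_, fun y => ?_⟩
  · funext r
    obtain ⟨s, rfl, hs⟩ := hsurj t r.1 r.2.symm
    obtain ⟨r, hr⟩ := r
    obtain rfl : c s = r := hs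
    exact (baseChangeLeft_apply w V _ x ⟨s, rfl⟩).symm.trans ((congrFun hxy ⟨s, rfl⟩).trans
      (baseChangeLeft_apply w V _ y ⟨s, rfl⟩))
  · choose σ hσ hσ' using fun r : {r // d r = b t} => hsurj t r.1 r.2.symm
    refine ⟨fun r => castLin V (hσ' r) ((show ∀ s : {s // a s = t}, V (c s.1) from y)
      ⟨σ r, hσ r⟩), funext fun s => ?_⟩
    refine (baseChangeLeft_apply w V t _ s).trans ?_
    have key : ∀ (s' : {s // a s = t}) (h : s' = s), castLin V (congrArg (fun s => c s.1) h)
        ((show ∀ s : {s // a s = t}, V (c s.1) from y) s') = y s := by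
      rintro _ rfl
      rfl
    exact key ⟨σ ⟨c s.1, _⟩, hσ _⟩ (Subtype.ext (hinj _ _ ((hσ _).trans s.2.symm) (hσ' _)))

theorem baseChangeRight_isIso (hinj : ∀ s s', a s = a s' → c s = c s' → s = s')
    (hsurj : ∀ t r, b t = d r → ∃ s, a s = t ∧ c s = r)
    (V : Sh k T) : IsIso (baseChangeRight w V) := by
  classical
  have := Fintype.ofFinite S
  have key : ∀ r (x : ∀ s : {s // c s = r}, V (a s.1)) (s : {s // c s = r}),
      (show ∀ t : {t // b t = d r}, V t.1 from (baseChangeRight w V r).hom.hom x)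
        ⟨a s.1, (w s.1).trans (congrArg d s.2)⟩ = x s := by
    intro r x s
    refine (congrFun (baseChangeRight_apply w V r x) _).trans ?_
    refine (Finset.sum_apply _ _ _).trans ?_
    refine (Finset.sum_eq_single s (fun s' _ hne => ?_) (by simp)).trans ?_
    · refine Pi.single_eq_of_ne (fun h => hne (Subtype.ext (hinj _ _ ?_ (s'.2.trans s.2.symm)))) _
      exact (congrArg Subtype.val h).symm
    · exact Pi.single_eq_same (M := fun t : {t // b t = d r} => V t.1) _ _
  refine sh_isIso _ fun r => ⟨fun x y hxy => ?_, fun y => ?_⟩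
  · funext s
    exact (key r x s).symm.trans ((congrFun hxy _).trans (key r y s))
  · refine ⟨fun s => (show ∀ t : {t // b t = d r}, V t.1 from y)
      ⟨a s.1, (w s.1).trans (congrArg d s.2)⟩, funext fun t => ?_⟩
    obtain ⟨t, ht⟩ := t
    obtain ⟨s, rfl, hs⟩ := hsurj t r ht
    exact key r _ ⟨s, hs⟩

end BaseChange

/-! ### The Beck–Chevalley condition for precomposition functors -/

section StrictSquare

variable {k : Type u} [Field k] {A : AddSubmonoid ℤ} {hk : PolyIsGradedTwoVect k}
  {S T R U : FintypeCat.{0}}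

variable (A hk) in
/-- `m_φ` is left adjoint to `Δ_φ`. -/
def mDelta (φ : S → T) : Bicategory.Adjunction (mCell A hk φ) (deltaCell A hk φ) :=
  precompAdj (pushPull φ)

variable (A hk) in
/-- `Δ_φ` is left adjoint to `m_φ`. -/
def deltaM (φ : S → T) : Bicategory.Adjunction (deltaCell A hk φ) (mCell A hk φ) :=
  precompAdj (pullPush φ)

variable {a : S → T} {c : S → R} {b : T → U} {d : R → U} (w : ∀ s, b (a s) = d (c s))

def squareNat (F : Poly k (Sh k S)) :
    (precomp (shPull k b)).obj ((precomp (shPull k a)).obj F) ⟶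
      (precomp (shPull k d)).obj ((precomp (shPull k c)).obj F) :=
  ObjectProperty.homMk
    { app := fun V => F.obj.map (pullCongr w V)
      naturality := fun V W f => by
        have h := congrArg F.obj.map (pullCongr_naturality w f)
        rw [F.obj.map_comp, F.obj.map_comp] at h
        exact h.symm }

/-- The canonical 2-cell `m_b m_a ⟶ m_d m_c` of a commutative square. -/
def squareCell : mCell A hk a ≫ mCell A hk b ⟶ mCell A hk c ≫ mCell A hk d :=
  ({  base_eq := rfl
      app := fun j =>
        { app := fun F => squareNat w (F ⟨j, rfl⟩ : Poly k (Sh k S))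
          naturality := fun F G τ => by
            apply ObjectProperty.hom_ext
            ext V : 2
            exact ((τ ⟨j, rfl⟩ : (F ⟨j, rfl⟩ : Poly k (Sh k S)) ⟶ G ⟨j, rfl⟩).hom.naturality
              (pullCongr w V)).symm } } :
    TwoVectTensor.Cell2 ((mCell A hk a : TwoVectTensor.Cell1 _ _).comp (mCell A hk b))
      ((mCell A hk c : TwoVectTensor.Cell1 _ _).comp (mCell A hk d)))

theorem map_map_map_bijective {C : Type*} [Category C] (F : C ⥤ FGModuleCat.{u} k)
    {V₁ V₂ V₃ V₄ : C} (f : V₁ ⟶ V₂) (g : V₂ ⟶ V₃) (h : V₃ ⟶ V₄) (hi : IsIso (f ≫ g ≫ h)) :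
    Function.Bijective fun x => (F.map h).hom.hom ((F.map g).hom.hom ((F.map f).hom.hom x)) := by
  have := map_bijective_of_isIso F (f ≫ g ≫ h)
  rw [F.map_comp, F.map_comp] at this
  exact this

/-- At a functor `P` and a sheaf `V` the mate is `P` applied in turn to a unit, the commutation of
the square, and a counit. Their composite is `baseChangeRight`; for the left condition it is
`baseChangeLeft`. -/
theorem squareCell_rightBeckChevalley (hinj : ∀ s s', a s = a s' → c s = c s' → s = s')
    (hsurj : ∀ t r, b t = d r → ∃ s, a s = t ∧ c s = r) :
    RightBeckChevalley (squareCell (A := A) (hk := hk) w) := by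
  refine ⟨deltaCell A hk c, deltaCell A hk b, mDelta A hk c, mDelta A hk b, ?_⟩
  refine cell_isIso (X := polyObj A hk (FinSetSqcup.single R)) (Y := FinSetSqcup.single T) _
    fun j P V => ?_
  exact map_map_map_bijective (P ⟨j, rfl⟩ : Poly k (Sh k R)).obj _ _ _
    (baseChangeRight_isIso w hinj hsurj V)

theorem squareCell_leftBeckChevalley (hinj : ∀ s s', a s = a s' → c s = c s' → s = s')
    (hsurj : ∀ t r, b t = d r → ∃ s, a s = t ∧ c s = r) :
    LeftBeckChevalley (squareCell (A := A) (hk := hk) w) := by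
  refine ⟨deltaCell A hk a, deltaCell A hk d, deltaM A hk a, deltaM A hk d, ?_⟩
  refine cell_isIso (X := polyObj A hk (FinSetSqcup.single T)) (Y := FinSetSqcup.single R) _
    fun j P V => ?_
  exact map_map_map_bijective (P ⟨j, rfl⟩ : Poly k (Sh k T)).obj _ _ _
    (baseChangeLeft_isIso w hinj hsurj V)

end StrictSquare

/-! ### Pullbacks of finite sets in terms of elements. -/

section Pullbacks

/-- Elements are maps from a one-point set, so this is the uniqueness part of the universal
property; the next lemma is the existence part. -/
theorem FintypeCat.isPullback_injective {S T R U : FintypeCat.{0}} {a : S ⟶ T} {c : S ⟶ R}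
    {b : T ⟶ U} {d : R ⟶ U} (sq : IsPullback a c b d) (s s' : S) (h1 : a s = a s')
    (h2 : c s = c s') : s = s' := by
  let f : FintypeCat.of PUnit ⟶ S := FintypeCat.homMk fun _ => s
  let f' : FintypeCat.of PUnit ⟶ S := FintypeCat.homMk fun _ => s'
  have h : f = f' := sq.hom_ext (FintypeCat.hom_ext _ _ fun _ => h1)
    (FintypeCat.hom_ext _ _ fun _ => h2)
  exact congrArg (fun t : FintypeCat.of PUnit ⟶ S => t PUnit.unit) h

theorem FintypeCat.isPullback_surjective {S T R U : FintypeCat.{0}} {a : S ⟶ T} {c : S ⟶ R}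
    {b : T ⟶ U} {d : R ⟶ U} (sq : IsPullback a c b d) (t : T) (r : R) (h : b t = d r) :
    ∃ s, a s = t ∧ c s = r := by
  let f : FintypeCat.of PUnit ⟶ T := FintypeCat.homMk fun _ => t
  let g : FintypeCat.of PUnit ⟶ R := FintypeCat.homMk fun _ => r
  have hfg : f ≫ b = g ≫ d := FintypeCat.hom_ext _ _ fun _ => h
  refine ⟨sq.lift f g hfg PUnit.unit, ?_, ?_⟩
  · exact congrArg (fun t : FintypeCat.of PUnit ⟶ T => t PUnit.unit) (sq.lift_fst f g hfg)
  · exact congrArg (fun t : FintypeCat.of PUnit ⟶ R => t PUnit.unit) (sq.lift_snd f g hfg)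

end Pullbacks

/-! ### Comparison of the one-fold tensor product with composition -/

section Comparison

open FinSetSqcup Bicategory

variable {k : Type u} [Field k] {A : AddSubmonoid ℤ} {hk : PolyIsGradedTwoVect k}

/-- The canonical identification of the one-fold tensor product `⨂ F ∘ φ^*` with `F ∘ φ^*`. -/
def singleNat {S T : Type} (φ : S → T) (j : PUnit)
    (F : ∀ i : {i : PUnit // some i = some j}, Poly k (Sh k S)) :
    (mTensor fun _ : {i : PUnit // some i = some j} => φ).obj F ⟶ (precomp (shPull k φ)).obj (F ⟨j, rfl⟩) :=
  ObjectProperty.homMk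
    { app := fun V => FGModuleCat.ofHom (PiTensorProduct.subsingletonEquiv
        (s := fun i : {i : PUnit // some i = some j} => (F i).obj.obj ((shPull k φ).obj V))
        (⟨j, rfl⟩ : {i : PUnit // some i = some j})).toLinearMap
      naturality := fun V W f => by
        apply FGModuleCat.hom_ext
        apply PiTensorProduct.ext
        ext x
        exact subsingletonEquiv_map (⟨j, rfl⟩ : {i : PUnit // some i = some j})
          (fun i => ((F i).obj.map ((shPull k φ).map f)).hom.hom) x }

variable (A hk) in
def singleCell {S T : FintypeCat.{0}} (φ : S ⟶ T) :
    polyMap A hk (singleMap φ) ⟶ mCell A hk φ :=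
  ({  base_eq := rfl
      app := fun j =>
        { app := fun F => singleNat φ j F
          naturality := fun F G τ => by
            apply ObjectProperty.hom_ext
            apply NatTrans.ext
            funext V
            apply FGModuleCat.hom_ext
            apply PiTensorProduct.ext
            ext x
            exact subsingletonEquiv_map (⟨j, rfl⟩ : {i : PUnit // some i = some j})
              (fun i => ((τ i).hom.app ((shPull k φ).obj V)).hom.hom) x } } :
    TwoVectTensor.Cell2 (polyMap A hk (singleMap φ)) (mCell A hk φ))

instance singleCell_isIso {S T : FintypeCat.{0}} (φ : S ⟶ T) : IsIso (singleCell A hk φ) :=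
  cell_isIso (X := polyObj A hk (single S)) (Y := single T) _ fun j P V =>
    (PiTensorProduct.subsingletonEquiv (R := k)
      (s := fun i : {i : PUnit // some i = some j} =>
        (P i : Poly k (Sh k S)).obj.obj ((shPull k φ).obj V))
      (⟨j, rfl⟩ : {i : PUnit // some i = some j})).bijective

variable (A hk) in
/-- The isomorphism of `m_φ`, as a value of the SSH structure, with `F ↦ F ∘ φ^*`. -/
def singleIso {S T : FintypeCat.{0}} (φ : S ⟶ T) :
    (polyH A hk).map (singleMap φ).toLoc ≅ mCell A hk φ :=
  show polyMap A hk (singleMap φ) ≅ mCell A hk φ from asIso (singleCell A hk φ)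

variable {S T R U : FintypeCat.{0}} {a : S ⟶ T} {c : S ⟶ R} {b : T ⟶ U} {d : R ⟶ U}

variable (A hk) in
/-- The canonical map `m_(b a) ⟶ m_b m_a`, as a value of the SSH structure, followed by the
identification of `m_a` and `m_b` with precomposition functors. -/
def compSingle (a : S ⟶ T) (b : T ⟶ U) :
    polyMap A hk (singleMap a ≫ singleMap b) ⟶ mCell A hk a ≫ mCell A hk b :=
  polyMapComp (singleMap a) (singleMap b) ≫ polyMap A hk (singleMap a) ◁ singleCell A hk b ≫
    singleCell A hk a ▷ mCell A hk b

/-- With one variable the nested tensor products have a single factor, and for a strictly composed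
pair of maps the transport of stalks is the identity; on pure tensors nothing remains but the only
component. -/
theorem compSingle_tprod (a : S ⟶ T) (b : T ⟶ U) (j : PUnit)
    (P : ∀ i : {i // Hom.base (singleMap a ≫ singleMap b) i = some j}, Poly k (Sh k S))
    (V : Sh k U)
    (x : ∀ i, (P i).obj.obj ((shPull k (Hom.fn (singleMap a ≫ singleMap b) i.1 j i.2)).obj V)) :
    cellLin (X := polyObj A hk (single S)) (Y := single U) (compSingle A hk a b) j P V
        (PiTensorProduct.tprod k x) = x ⟨j, rfl⟩ := by
  refine (congrArg (fun t => PiTensorProduct.subsingletonEquiv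
    (⟨j, rfl⟩ : {i : PUnit // some i = some j}) (PiTensorProduct.subsingletonEquiv
      (⟨j, rfl⟩ : {i : PUnit // some i = some j}) t))
    (compLin_tprod (singleMap a) (singleMap b) j P V x)).trans ?_
  refine (congrArg (PiTensorProduct.subsingletonEquiv
    (⟨j, rfl⟩ : {i : PUnit // some i = some j}))
    (PiTensorProduct.subsingletonEquiv_apply_tprod
      (⟨j, rfl⟩ : {i : PUnit // some i = some j}) _)).trans ?_
  refine (PiTensorProduct.subsingletonEquiv_apply_tprod
    (⟨j, rfl⟩ : {i : PUnit // some i = some j}) _).trans ?_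
  let F : Poly k (Sh k S) := P ⟨j, rfl⟩
  let W : Sh k S := (shPull k fun s => b (a s)).obj V
  have h0 : F.obj.map (𝟙 W) = 𝟙 (F.obj.obj W) := F.obj.map_id W
  exact LinearMap.congr_fun (congrArg (fun t : F.obj.obj W ⟶ F.obj.obj W => t.hom.hom) h0)
    (x ⟨j, rfl⟩)

/-- Both sides take a pure tensor to its only component, transported along `b ∘ a = d ∘ c`. Thus
`squareCell` is the commutativity isomorphism of the SSH structure, seen through the one-fold tensor
products. -/
theorem singleCell_square (w : a ≫ b = c ≫ d) (h : ∀ s, b (a s) = d (c s))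
    (e : polyMap A hk (singleMap a ≫ singleMap b) = polyMap A hk (singleMap c ≫ singleMap d)) :
    compSingle A hk a b ≫ squareCell h = eqToHom e ≫ compSingle A hk c d := by
  refine cellLin_ext (X := polyObj A hk (single S)) (Y := single U) fun j P V => ?_
  apply PiTensorProduct.ext
  ext x
  have w' : singleMap a ≫ singleMap b = singleMap c ≫ singleMap d := congrArg singleMap w
  refine (congrArg ((P ⟨j, rfl⟩ : Poly k (Sh k S)).obj.map (pullCongr h V)).hom.hom
    (compSingle_tprod a b j P V x)).trans ?_
  have h1 : cellLin (X := polyObj A hk (single S)) (Y := single U) (eqToHom e) j P V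
      (PiTensorProduct.tprod k x) = _ :=
    (congrArg (fun t => (t.hom.app V).hom.hom (PiTensorProduct.tprod k x))
      (app_eqToHom w' e j P)).trans (eqNat_tprod w' j P V x)
  refine Eq.symm ((congrArg (cellLin (X := polyObj A hk (single S)) (Y := single U)
    (compSingle A hk c d) j (fun i => P ⟨i.1, hom_base_eq w' i.2⟩) V) h1).trans ?_)
  exact compSingle_tprod c d j (fun i => P ⟨i.1, hom_base_eq w' i.2⟩) V _

end Comparison

/-! ### The Beck–Chevalley condition for the SSH structure. -/

section BeckChevalley

open FinSetSqcup Bicategory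

variable {k : Type u} [Field k] {A : AddSubmonoid ℤ} {hk : PolyIsGradedTwoVect k}
  {S T R U : FintypeCat.{0}} {a : S ⟶ T} {c : S ⟶ R} {b : T ⟶ U} {d : R ⟶ U}

/-- The image square begins with the inverse of `H.mapComp`, so an identity between 2-cells out of
the image of the composite becomes one about the square after cancelling it. -/
theorem imageSquare_comp_eq {E : Type*} [Category E] {B : Type*} [Bicategory B]
    (H : LocallyDiscrete E ⥤ᵖ B) {s t r u : E} {p : s ⟶ t} {p' : s ⟶ r} {q : t ⟶ u} {q' : r ⟶ u}
    (w : p ≫ q = p' ≫ q') {X : H.obj ⟨s⟩ ⟶ H.obj ⟨u⟩}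
    (β : H.map p.toLoc ≫ H.map q.toLoc ⟶ X) (β' : H.map p'.toLoc ≫ H.map q'.toLoc ⟶ X)
    (h : (H.mapComp p.toLoc q.toLoc).hom ≫ β =
      eqToHom (congrArg (fun t => H.map (Quiver.Hom.toLoc t)) w) ≫
        (H.mapComp p'.toLoc q'.toLoc).hom ≫ β') : (imageSquare H w).hom ≫ β' = β := by
  have h2 : H.map₂ (eqToHom (congrArg Quiver.Hom.toLoc w)) =
      eqToHom (congrArg (fun t => H.map (Quiver.Hom.toLoc t)) w) :=
    PrelaxFunctor.map₂_eqToHom _ _ _ _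
  have h3 : (imageSquare H w).hom = (H.mapComp p.toLoc q.toLoc).inv ≫
      eqToHom (congrArg (fun t => H.map (Quiver.Hom.toLoc t)) w) ≫
        (H.mapComp p'.toLoc q'.toLoc).hom :=
    congrArg (fun t => (H.mapComp p.toLoc q.toLoc).inv ≫ t ≫ (H.mapComp p'.toLoc q'.toLoc).hom) h2
  refine (congrArg (· ≫ β') h3).trans ?_
  refine (Category.assoc _ _ _).trans ((congrArg _ ((Category.assoc _ _ _).trans h.symm)).trans ?_)
  exact Iso.inv_hom_id_assoc _ _

theorem imageSquare_singleIso (w : a ≫ b = c ≫ d) (h : ∀ s, b (a s) = d (c s)) :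
    (imageSquare (polyH A hk) (s := single S) (a := singleMap a) (c := singleMap c)
        (b := singleMap b) (d := singleMap d) (congrArg singleMap w)).hom ≫
      (polyH A hk).map (singleMap c).toLoc ◁ (singleIso A hk d).hom ≫
        (singleIso A hk c).hom ▷ mCell A hk d =
    (polyH A hk).map (singleMap a).toLoc ◁ (singleIso A hk b).hom ≫
      (singleIso A hk a).hom ▷ mCell A hk b ≫ squareCell h := by
  have w' : singleMap a ≫ singleMap b = singleMap c ≫ singleMap d := congrArg singleMap w
  have key := singleCell_square (A := A) (hk := hk) w h (congrArg (polyMap A hk) w')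
  simp only [compSingle, Category.assoc] at key
  exact imageSquare_comp_eq (polyH A hk) w' _ _ key

theorem polyH_beckChevalley (sq : IsPullback a c b d) :
    BeckChevalley (imageSquare (polyH A hk) (s := single S) (a := singleMap a) (c := singleMap c)
      (b := singleMap b) (d := singleMap d) (congrArg singleMap sq.w)).hom := by
  have h : ∀ s, b (a s) = d (c s) := fun s => congrArg (fun t : S ⟶ U => t s) sq.w
  have hinj := FintypeCat.isPullback_injective sq
  have hsurj := FintypeCat.isPullback_surjective sq
  exact ⟨RightBeckChevalley.of_iso _ _ _ _ (imageSquare_singleIso sq.w h)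
      (squareCell_rightBeckChevalley h hinj hsurj),
    LeftBeckChevalley.of_iso _ _ _ _ (imageSquare_singleIso sq.w h)
      (squareCell_leftBeckChevalley h hinj hsurj)⟩

end BeckChevalley

variable {k : Type u} [Field k]

/-- The polynomial functors on sheaves form a symmetric self-adjoint Hopf structure. -/
theorem polyH_isSSH [CharZero k] (A : AddSubmonoid ℤ) (hk : PolyIsGradedTwoVect k) :
    IsSSH (polyH A hk) where
  base := polyH_base
  degreeZero := polyH_degreeZero
  coCartesian := polyH_isCoCartesian
  beckChevalley := polyH_beckChevalley

end

end SSH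

theorem mainTheorem4 (k : Type u) [Field k] [CharZero k] (A : AddSubmonoid ℤ) :
    ∃ hk : SSH.PolyIsGradedTwoVect k,
      SSH.IsSSH (SSH.polyH A hk) ∧
      (∀ (S T : FintypeCat.{0}) (φ : S ⟶ T),
        Nonempty ((SSH.polyH A hk).map (SSH.FinSetSqcup.singleMap φ).toLoc ≅
          SSH.mCell A hk φ) ∧
        Nonempty (Bicategory.Adjunction (SSH.mCell A hk φ) (SSH.deltaCell A hk φ)) ∧
        Nonempty (Bicategory.Adjunction (SSH.deltaCell A hk φ) (SSH.mCell A hk φ))) ∧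
      (SSH.fromP k).IsEquivalence ∧
      (∀ (n : ℕ) (F : SSH.Poly k (FGModuleCat.{u} k)),
        SSH.polyDeg k (FGModuleCat.{u} k) n F ↔
          SSH.polyDeg k (SSH.Sh k PUnit) n ((SSH.fromP k).obj F)) := by
  exact ⟨SSH.polyIsGradedTwoVect k, SSH.polyH_isSSH A _, fun S T φ =>
    ⟨⟨SSH.singleIso A _ φ⟩, ⟨SSH.mDelta A _ φ⟩, ⟨SSH.deltaM A _ φ⟩⟩,
    SSH.fromP_isEquivalence k, SSH.polyDeg_fromP⟩
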